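/- **Setting.** Let $k$ be a perfect field of characteristic $p\ge 3$, $W=W(k)$, $W_n=W/p^n$, and let $\lambda\in W$ with $\lambda\not\equiv 0,1 \pmod p$. Work on $(\mathbb P^1_{W_n},D)$ with $D=\{0,1,\lambda,\infty\}$. Consider graded semistable logarithmic Higgs bundles $(E,\theta)$ over $W_n$ with $E=\mathcal O\oplus\mathcal O(1)$ and $\theta:\mathcal O(1)\to\mathcal O\otimes\Omega^1(\log D)$ nonzero modulo $p$; up to isomorphism such a bundle is determined by the zero $(\theta)_0\in\mathbb P^1(W_n)$ of $\theta$. A *filtered de Rham bundle* over $W_n$ is a rank two bundle $V$ with logarithmic connection $\nabla$ and a line subbundle $\mathrm{Fil}$ such that $\mathrm{Gr}(V,\nabla,\mathrm{Fil})$ is such a Higgs bundle. Given $n\ge 0$, a filtered de Rham bundle $V_{-1}$ over $W_n$ and a Higgs bundle $(E,\theta)$ over $W_{n+1}$ lifting $\mathrm{Gr}(V_{-1})$, the Higgs–de Rham flow produces a filtered de Rham bundle $V_0$ over $W_{n+1}$: $V_0=C^{-1}(E,\theta,V_{-1})\otimes(\mathcal O(-\tfrac{p-1}{2}\infty),d)$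 with its Hodge line subbundle $\mathcal O(1)$, where $C^{-1}$ is the inverse Cartier functor (the functor $\mathcal T$ to $p$-connections, followed by Frobenius pullback along local log Frobenius lifts and Taylor gluing). The next Higgs bundle is $\mathrm{Gr}(V_0)$, and one continues with $\mathrm{Gr}(V_0)$ and $V_0 \bmod p^n$. (Equivalently: the parabolic flow with parabolic weights $1/2$ at $\infty$ and $0$ at $0,1,\lambda$.) A filtered de Rham bundle over $W_n$, $n\ge1$, together with its graded Higgs bundle, is called *$f$-periodic* ($f\ge 1$) if $f$ steps of the flow over $W_n$, started with its graded Higgs bundle and its reduction modulo $p^{n-1}$, return it up to isomorphism. **Theorem.** (0) There is a unique rational function $\widetilde\varphi_{\lambda,p}$ over $k$ such that, over every perfect extension field $K$ of $k$, the flow modulo $p$ sends the Higgs bundle with zero $x\in K$ to the Higgs bundle with zero $\varphi_{\lambda,p}(x)=\widetilde\varphi_{\lambda,p}(x^p)\in\mathbb P^1(K)$. Let $n\ge1$. For $a\in W$ and $\delta\in k$ write $a+p^n\delta$ for $a+p^n[\delta]$, where $[\delta]$ is the Teichmüller lift; modulo $p^{n+1}$ these are all the lifts of $a\bmod p^n$,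 so $\delta$ is a coordinate on the torsor of lifts to $W_{n+1}$ of the Higgs bundle with zero $a\bmod p^n$. Write $\bar a=a\bmod p$. (1) Let $V$ be a filtered de Rham bundle over $W_n$, let $V'$ be the result of one step of the flow over $W_n$ started with $\mathrm{Gr}(V)$ and $V\bmod p^{n-1}$, and suppose the zeros of the Higgs bundles $\mathrm{Gr}(V)$, $\mathrm{Gr}(V')$ are $a,b\bmod p^n$ with $a,b\in W$ (so not $\infty$). The flow over $W_{n+1}$ (with $V_{-1}=V$) induces a well-defined map from the lifts of $\mathrm{Gr}(V)$ to the lifts of $\mathrm{Gr}(V')$, and for some $\gamma\in k$ it is $$a+p^n\delta\ \longmapsto\ b+p^n\big(\widetilde\varphi_{\lambda,p}'(\bar a^p)\cdot t+\gamma\big),\qquad t=\delta^p .$$ (2) Let $V$ be $f$-periodic over $W_n$ and let the zero of the Higgs bundle $\mathrm{Gr}(V)$ be $a\bmod p^n$ with $a\in W$. The $f$-fold flow over $W_{n+1}$ induces a well-defined self-map of the torsor of lifts of $\mathrm{Gr}(V)$ to $W_{n+1}$, and for some $\gamma\in k$ it is $$a+p^n\delta\ \longmapsto\ a+p^n\Big(\prod_{i=0}^{f-1}\widetilde\varphi_{\lambda,p}'(\bar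 a_i^{\,p})^{p^{f-1-i}}\cdot\delta^{p^f}+\gamma\Big),\qquad \bar a_0=\bar a,\quad \bar a_{i+1}=\varphi_{\lambda,p}(\bar a_i).$$ In particular, for $f=1$ the self-map is $\widetilde\varphi_{\lambda,p}'(\bar a^p)\cdot t+\gamma$ with $t=\delta^p$. -/

import Mathlib

open Polynomial

noncomputable section

namespace HiggsDeRham

universe u

/-- A Witt vector `lam` over `k` which is neither `0` nor `1` modulo `p`.  It defines the relative
divisor `D = {0, 1, lam, ∞}` on the projective line over `W(k)`. -/
structure Puncture (p : ℕ) [Fact p.Prime] (k : Type u) [Field k] [CharP k p] where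
  lam : WittVector p k
  ne_zero : lam.coeff 0 ≠ 0
  ne_one : lam.coeff 0 ≠ 1

/-- Base change of the four-punctured line along an extension of fields. -/
def Puncture.baseChange {p : ℕ} [Fact p.Prime] {k : Type u} [Field k] [CharP k p]
    (P : Puncture p k) (K : Type u) [Field K] [CharP K p] [Algebra k K] : Puncture p K where
  lam := WittVector.map (algebraMap k K) P.lam
  ne_zero := by
    rw [WittVector.map_coeff]
    intro h
    exact P.ne_zero ((map_eq_zero (algebraMap k K)).1 h)
  ne_one := by
    rw [WittVector.map_coeff]
    intro h
    exact P.ne_one ((algebraMap k K).injective (by rw [h, map_one]))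

section Rings

variable {p : ℕ} [Fact p.Prime] {k : Type u} [Field k] [CharP k p]

variable (p k) in
/-- The truncated Witt vectors `W_N(k) = W(k) / p ^ N`. -/
abbrev WN (N : ℕ) : Type u := WittVector p k ⧸ Ideal.span {(p : WittVector p k) ^ N}

variable (p k) in
/-- The projection `W(k) → W_N(k)`. -/
abbrev mkW (N : ℕ) : WittVector p k →+* WN p k N := Ideal.Quotient.mk _

variable (p k) in
/-- The Frobenius `σ` of `W_N(k)`. -/
def sigma (N : ℕ) : WN p k N →+* WN p k N :=
  Ideal.quotientMap _ (WittVector.frobenius : WittVector p k →+* WittVector p k) (by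
    rw [Ideal.span_le, Set.singleton_subset_iff, SetLike.mem_coe, Ideal.mem_comap]
    rw [map_pow, map_natCast]
    exact Ideal.mem_span_singleton_self ((p : WittVector p k) ^ N))

variable (p k) in
/-- The projection `W_{N+1}(k) → W_N(k)`. -/
def redW (N : ℕ) : WN p k (N + 1) →+* WN p k N :=
  Ideal.Quotient.factor (by
    rw [Ideal.span_singleton_le_span_singleton]
    exact pow_dvd_pow _ (Nat.le_succ N))

/-- The polynomial `X (X - 1) (X - lam)` cutting out the finite punctures. -/
def Puncture.poly (P : Puncture p k) (N : ℕ) : (WN p k N)[X] :=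
  X * (X - 1) * (X - C (mkW p k N P.lam))

/-- The coordinate ring `R₁₂ = W_N[t, 1/t, 1/(t-1), 1/(t-lam)]` of `U₁₂ = ℙ¹ ∖ {0, 1, lam, ∞}`
over `W_N(k)`. -/
def Puncture.R (P : Puncture p k) (N : ℕ) : Type u := Localization.Away (P.poly N)

variable (P : Puncture p k) (N : ℕ)

instance : CommRing (P.R N) := inferInstanceAs (CommRing (Localization.Away (P.poly N)))

instance : Algebra (WN p k N)[X] (P.R N) :=
  inferInstanceAs (Algebra (WN p k N)[X] (Localization.Away (P.poly N)))

instance : Algebra (WN p k N) (P.R N) :=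
  inferInstanceAs (Algebra (WN p k N) (Localization.Away (P.poly N)))

instance : IsScalarTower (WN p k N) (WN p k N)[X] (P.R N) :=
  inferInstanceAs (IsScalarTower (WN p k N) (WN p k N)[X] (Localization.Away (P.poly N)))

instance : IsLocalization.Away (P.poly N) (P.R N) :=
  inferInstanceAs (IsLocalization.Away (P.poly N) (Localization.Away (P.poly N)))

attribute [irreducible] Puncture.R

/-- Constants: the structure map `W(k) → R₁₂`. -/
def Puncture.const : WittVector p k →+* P.R N := (algebraMap (WN p k N) (P.R N)).comp (mkW p k N)

/-- The affine coordinate `t`. -/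
def Puncture.t : P.R N := algebraMap (WN p k N)[X] (P.R N) X

/-- `1 / (t - 1)` -/
def Puncture.invT1 : P.R N := Ring.inverse (P.t N - 1)

/-- `1 / (t - lam)` -/
def Puncture.invTlam : P.R N := Ring.inverse (P.t N - P.const N P.lam)

/-- The coordinate `s = (t - lam) / (t - 1)`. -/
def Puncture.s : P.R N := (P.t N - P.const N P.lam) * P.invT1 N

/-- `R₁ = W_N[t, 1/t]`, the coordinate ring of `U₁ = ℙ¹ ∖ {0, ∞}`, inside `R₁₂`. -/
def Puncture.chart1 : Subalgebra (WN p k N) (P.R N) :=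
  Algebra.adjoin (WN p k N) {P.t N, Ring.inverse (P.t N)}

/-- `R₂ = W_N[s, 1/s]`, the coordinate ring of `U₂ = ℙ¹ ∖ {1, lam}`, inside `R₁₂`. -/
def Puncture.chart2 : Subalgebra (WN p k N) (P.R N) :=
  Algebra.adjoin (WN p k N) {P.s N, Ring.inverse (P.s N)}

theorem isUnit_prod : IsUnit (P.t N * (P.t N - 1) * (P.t N - P.const N P.lam)) := by
  have h := IsLocalization.Away.algebraMap_isUnit (S := P.R N) (P.poly N)
  have e : algebraMap (WN p k N)[X] (P.R N) (P.poly N)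
      = P.t N * (P.t N - 1) * (P.t N - P.const N P.lam) := by
    simp only [Puncture.poly, Puncture.t, Puncture.const, map_mul, map_sub, map_one,
      RingHom.comp_apply]
    rw [IsScalarTower.algebraMap_apply (WN p k N) (WN p k N)[X] (P.R N)]
    rfl
  rwa [e] at h

theorem isUnit_t : IsUnit (P.t N) :=
  isUnit_of_mul_isUnit_left (isUnit_of_mul_isUnit_left (isUnit_prod P N))

theorem isUnit_t1 : IsUnit (P.t N - 1) :=
  isUnit_of_mul_isUnit_right (isUnit_of_mul_isUnit_left (isUnit_prod P N))

theorem isUnit_tlam : IsUnit (P.t N - P.const N P.lam) :=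
  isUnit_of_mul_isUnit_right (isUnit_prod P N)

end Rings

section Frobenius

variable {p : ℕ} [Fact p.Prime] {k : Type u} [Field k] [CharP k p]

theorem natCast_p_nilpotent (P : Puncture p k) (N : ℕ) : (p : P.R N) ^ N = 0 := by
  have h : P.const N ((p : WittVector p k) ^ N) = 0 := by
    rw [Puncture.const, RingHom.comp_apply, Ideal.Quotient.eq_zero_iff_mem.2
      (Ideal.mem_span_singleton_self _), map_zero]
  simpa using h

theorem one_sub_isUnit (P : Puncture p k) : IsUnit (1 - P.lam) := by
  apply WittVector.isUnit_of_coeff_zero_ne_zero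
  intro h
  have h2 : WittVector.constantCoeff (1 - P.lam) = 0 := h
  rw [map_sub, map_one, sub_eq_zero] at h2
  exact P.ne_one h2.symm

section

variable (P : Puncture p k) (N : ℕ)

theorem s_mul (x : P.R N) (h : x = P.s N) : x * (P.t N - 1) = P.t N - P.const N P.lam := by
  rw [h, Puncture.s, Puncture.invT1, mul_assoc, Ring.inverse_mul_cancel _ (isUnit_t1 P N), mul_one]

theorem isUnit_s : IsUnit (P.s N) := by
  have h := isUnit_tlam P N
  rw [← s_mul P N _ rfl] at h
  exact isUnit_of_mul_isUnit_left h

theorem isUnit_s1 : IsUnit (P.s N - 1) := by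
  have h : IsUnit ((P.s N - 1) * (P.t N - 1)) := by
    have e : (P.s N - 1) * (P.t N - 1) = P.const N (1 - P.lam) := by
      rw [sub_mul, s_mul P N _ rfl, map_sub, map_one]; ring
    rw [e]
    exact (one_sub_isUnit P).map _
  exact isUnit_of_mul_isUnit_left h

theorem isUnit_slam : IsUnit (P.s N - P.const N P.lam) := by
  have h : IsUnit ((P.s N - P.const N P.lam) * (P.t N - 1)) := by
    have e : (P.s N - P.const N P.lam) * (P.t N - 1) = P.const N (1 - P.lam) * P.t N := by
      rw [sub_mul, s_mul P N _ rfl, map_sub, map_one]; ring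
    rw [e]
    exact ((one_sub_isUnit P).map _).mul (isUnit_t P N)
  exact isUnit_of_mul_isUnit_left h

/-- The value of `t` under the Frobenius lift with `s ↦ s ^ p`; since `t = (s - lam) / (s - 1)`
this is `(s ^ p - σ(lam)) / (s ^ p - 1)`. -/
def Puncture.frobT1 : P.R N :=
  (P.s N ^ p - P.const N (WittVector.frobenius P.lam)) * Ring.inverse (P.s N ^ p - 1)

theorem one_sub_frobenius_isUnit : IsUnit (P.const N (1 - WittVector.frobenius P.lam)) := by
  have h := ((one_sub_isUnit P).map
    (WittVector.frobenius : WittVector p k →+* WittVector p k)).map (P.const N)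
  rwa [map_sub, map_one] at h

/-- The substitution `t ↦ x` which is `σ` on constants, as a map out of `W_N[t]`. -/
def Puncture.subst (x : P.R N) : (WN p k N)[X] →+* P.R N :=
  eval₂RingHom ((algebraMap (WN p k N) (P.R N)).comp (sigma p k N)) x

theorem subst_poly (x : P.R N) : P.subst N x (P.poly N)
    = x * (x - 1) * (x - P.const N (WittVector.frobenius P.lam)) := by
  simp [Puncture.subst, Puncture.poly, Puncture.const, sigma]

end

variable [PerfectRing k p]

/-- `σ(x) ≡ x ^ p` modulo `p`. -/
theorem exists_frobenius_eq (x : WittVector p k) :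
    ∃ d, WittVector.frobenius x = x ^ p + (p : WittVector p k) * d := by
  have h : WittVector.frobenius x - x ^ p ∈ Ideal.span {(p : WittVector p k)} := by
    rw [WittVector.mem_span_p_iff_coeff_zero_eq_zero]
    change WittVector.constantCoeff (WittVector.frobenius x - x ^ p) = 0
    rw [map_sub, map_pow, sub_eq_zero]
    exact WittVector.coeff_frobenius_charP p x 0
  obtain ⟨d, hd⟩ := Ideal.mem_span_singleton.1 h
  exact ⟨d, by rw [← hd]; ring⟩

theorem exists_sub_pow {A : Type*} [CommRing A] (hp : Odd p) (x y : A) :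
    ∃ r, (x - y) ^ p = x ^ p - y ^ p + (p : A) * r := by
  obtain ⟨r, hr⟩ := exists_add_pow_prime_eq (Fact.out : p.Prime) x (-y)
  refine ⟨x * (-y) * r, ?_⟩
  rw [sub_eq_add_neg, hr, hp.neg_pow]
  ring

theorem isUnit_pow_sub (P : Puncture p k) (N : ℕ) (hp : Odd p) (x : P.R N)
    (c : WittVector p k) (h : IsUnit (x - P.const N c)) :
    IsUnit (x ^ p - P.const N (WittVector.frobenius c)) := by
  obtain ⟨d, hd⟩ := exists_frobenius_eq c
  obtain ⟨r, hr⟩ := exists_sub_pow hp x (P.const N c)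
  have e : x ^ p - P.const N (WittVector.frobenius c)
      = (x - P.const N c) ^ p + (p : P.R N) * (-r - P.const N d) := by
    rw [hr, hd]
    simp only [map_add, map_mul, map_pow, map_natCast]
    ring
  rw [e]
  refine IsNilpotent.isUnit_add_left_of_commute ?_ (h.pow p) (Commute.all _ _)
  exact ⟨N, by rw [mul_pow, natCast_p_nilpotent, zero_mul]⟩

variable (P : Puncture p k) (N : ℕ)

theorem isUnit_sp1 (hp : Odd p) : IsUnit (P.s N ^ p - 1) := by
  have h := isUnit_pow_sub P N hp (P.s N) 1 (by simpa using isUnit_s1 P N)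
  simpa using h

theorem isUnit_splam (hp : Odd p) :
    IsUnit (P.s N ^ p - P.const N (WittVector.frobenius P.lam)) :=
  isUnit_pow_sub P N hp (P.s N) P.lam (isUnit_slam P N)

theorem isUnit_subst_frobT1 (hp : Odd p) : IsUnit (P.subst N (P.frobT1 N) (P.poly N)) := by
  rw [subst_poly]
  have h1 := isUnit_sp1 P N hp
  have h2 := isUnit_splam P N hp
  have hi : (P.s N ^ p - 1) * Ring.inverse (P.s N ^ p - 1) = 1 := Ring.mul_inverse_cancel _ h1
  have hu : IsUnit (Ring.inverse (P.s N ^ p - 1)) := h1.ringInverse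
  have hc := one_sub_frobenius_isUnit P N
  rw [map_sub, map_one] at hc
  refine IsUnit.mul (IsUnit.mul (h2.mul hu) ?_) ?_
  · have e : P.frobT1 N - 1
        = (1 - P.const N (WittVector.frobenius P.lam)) * Ring.inverse (P.s N ^ p - 1) := by
      rw [Puncture.frobT1]; linear_combination hi
    rw [e]
    exact hc.mul hu
  · have e : P.frobT1 N - P.const N (WittVector.frobenius P.lam)
        = (1 - P.const N (WittVector.frobenius P.lam)) * P.s N ^ p
          * Ring.inverse (P.s N ^ p - 1) := by
      rw [Puncture.frobT1]
      linear_combination (P.const N (WittVector.frobenius P.lam)) * hi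
    rw [e]
    exact (hc.mul ((isUnit_s P N).pow p)).mul hu

theorem isUnit_subst_pow (hp : Odd p) : IsUnit (P.subst N (P.t N ^ p) (P.poly N)) := by
  rw [subst_poly]
  refine IsUnit.mul (IsUnit.mul ((isUnit_t P N).pow p) ?_) ?_
  · have h := isUnit_pow_sub P N hp (P.t N) 1 (by simpa using isUnit_t1 P N)
    simpa using h
  · exact isUnit_pow_sub P N hp (P.t N) P.lam (isUnit_tlam P N)

/-- The log Frobenius lift `Φ₁` of the chart `U₁`: `σ`-semilinear with `s ↦ s ^ p`. -/
def Puncture.Phi1 (hp : Odd p) : P.R N →+* P.R N :=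
  IsLocalization.Away.lift (P.poly N) (isUnit_subst_frobT1 P N hp)

/-- The log Frobenius lift `Φ₂` of the chart `U₂`: `σ`-semilinear with `t ↦ t ^ p`. -/
def Puncture.Phi2 (hp : Odd p) : P.R N →+* P.R N :=
  IsLocalization.Away.lift (P.poly N) (isUnit_subst_pow P N hp)

theorem Phi1_t (hp : Odd p) : P.Phi1 N hp (P.t N) = P.frobT1 N := by
  refine (IsLocalization.Away.lift_eq (P.poly N) (isUnit_subst_frobT1 P N hp) X).trans ?_
  simp [Puncture.subst]

theorem Phi2_t (hp : Odd p) : P.Phi2 N hp (P.t N) = P.t N ^ p := by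
  refine (IsLocalization.Away.lift_eq (P.poly N) (isUnit_subst_pow P N hp) X).trans ?_
  simp [Puncture.subst]

/-- The numerator of `Φ₁(t) - Φ₂(t)`, the denominator being `(t - lam) ^ p - (t - 1) ^ p`. -/
def Puncture.num : (WittVector p k)[X] :=
  ((X - C P.lam) ^ p - C (WittVector.frobenius P.lam) * (X - 1) ^ p)
    - X ^ p * ((X - C P.lam) ^ p - (X - 1) ^ p)

theorem exists_num (hp : Odd p) : ∃ Q, P.num = (p : (WittVector p k)[X]) * Q := by
  obtain ⟨d, hd⟩ := exists_frobenius_eq P.lam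
  obtain ⟨r1, h1⟩ := exists_sub_pow hp (X : (WittVector p k)[X]) (C P.lam)
  obtain ⟨r2, h2⟩ := exists_sub_pow hp (X : (WittVector p k)[X]) 1
  refine ⟨r1 - C (P.lam ^ p) * r2 - C d * (X - 1) ^ p - X ^ p * (r1 - r2), ?_⟩
  rw [Puncture.num, h1, hd, map_add, map_mul, map_pow, map_natCast, h2]
  ring

/-- The element `(Φ₁(t) - Φ₂(t)) / p` of `R₁₂` (the division by `p` is carried out over the
`p`-torsion free ring `W(k)[X]`). -/
def Puncture.z (hp : Odd p) : P.R N :=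
  eval₂ (P.const N) (P.t N) (exists_num P hp).choose
    * Ring.inverse ((P.t N - P.const N P.lam) ^ p - (P.t N - 1) ^ p)

theorem p_mul_z (hp : Odd p) :
    (p : P.R N) * P.z N hp = P.Phi1 N hp (P.t N) - P.Phi2 N hp (P.t N) := by
  have hQ := congrArg (eval₂ (P.const N) (P.t N)) (exists_num P hp).choose_spec
  set Q := (exists_num P hp).choose
  have hs := isUnit_sp1 P N hp
  have hT := (isUnit_t1 P N).pow p
  have hst : (P.s N ^ p - 1) * (P.t N - 1) ^ p
      = (P.t N - P.const N P.lam) ^ p - (P.t N - 1) ^ p := by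
    rw [sub_mul, ← mul_pow, s_mul P N _ rfl, one_mul]
  have hu := hs.mul hT
  rw [hst] at hu
  have hi := Ring.mul_inverse_cancel _ hu
  have hj := Ring.mul_inverse_cancel _ hs
  have hsp : P.s N ^ p * (P.t N - 1) ^ p = (P.t N - P.const N P.lam) ^ p := by
    rw [← mul_pow, s_mul P N _ rfl]
  simp only [Puncture.num, eval₂_sub, eval₂_mul, eval₂_pow, eval₂_X, eval₂_C, eval₂_one,
    eval₂_natCast] at hQ
  rw [Phi1_t, Phi2_t, Puncture.frobT1]
  apply hu.mul_left_cancel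
  have hz : P.z N hp = eval₂ (P.const N) (P.t N) Q
    * Ring.inverse ((P.t N - P.const N P.lam) ^ p - (P.t N - 1) ^ p) := rfl
  rw [hz]
  generalize Ring.inverse ((P.t N - P.const N P.lam) ^ p - (P.t N - 1) ^ p) = v at *
  generalize Ring.inverse (P.s N ^ p - 1) = w at *
  generalize eval₂ (P.const N) (P.t N) Q = q at *
  generalize (P.t N - P.const N P.lam) ^ p = a at *
  generalize (P.t N - 1) ^ p = b at *
  generalize P.s N ^ p = s at *
  generalize P.t N ^ p = t at *
  generalize P.const N (WittVector.frobenius P.lam) = l at *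
  linear_combination (p : P.R N) * q * hi - hQ + (s - l) * w * hst - b * (s - l) * hj - hsp

end Frobenius

section Calculus

variable {p : ℕ} [Fact p.Prime] {k : Type u} [Field k] [CharP k p] (P : Puncture p k) (N : ℕ)

/-- The homomorphism `f ↦ f + f' ε` on polynomials. -/
def Puncture.dualPoly : (WN p k N)[X] →+* DualNumber (P.R N) :=
  eval₂RingHom ((TrivSqZeroExt.inlHom (P.R N) (P.R N)).comp (algebraMap (WN p k N) (P.R N)))
    (TrivSqZeroExt.inl (P.t N) + TrivSqZeroExt.inr 1)

theorem fst_dualPoly (f : (WN p k N)[X]) :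
    TrivSqZeroExt.fst (P.dualPoly N f) = algebraMap (WN p k N)[X] (P.R N) f := by
  have h : (TrivSqZeroExt.fstHom (P.R N) (P.R N) (P.R N) : _ →+* P.R N).comp (P.dualPoly N)
      = algebraMap (WN p k N)[X] (P.R N) := by
    refine Polynomial.ringHom_ext (fun a => ?_) ?_
    · have e : algebraMap (WN p k N)[X] (P.R N) (C a) = algebraMap (WN p k N) (P.R N) a :=
        (IsScalarTower.algebraMap_apply (WN p k N) (WN p k N)[X] (P.R N) a).symm
      rw [e]
      simp [Puncture.dualPoly]
    · simp [Puncture.dualPoly, Puncture.t]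
  exact congrArg (fun g : (WN p k N)[X] →+* P.R N => g f) h

/-- The homomorphism `f ↦ f + (∂f/∂t) ε` on `R₁₂`. -/
def Puncture.dual : P.R N →+* DualNumber (P.R N) :=
  IsLocalization.Away.lift (P.poly N) (g := P.dualPoly N) (by
    rw [TrivSqZeroExt.isUnit_iff_isUnit_fst, fst_dualPoly]
    exact IsLocalization.Away.algebraMap_isUnit (S := P.R N) (P.poly N))

/-- The derivation `∂ = ∂/∂t` of `R₁₂` over `W_N(k)`. -/
def Puncture.del (f : P.R N) : P.R N := TrivSqZeroExt.snd (P.dual N f)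

theorem dual_algebraMap (f : (WN p k N)[X]) :
    P.dual N (algebraMap (WN p k N)[X] (P.R N) f) = P.dualPoly N f :=
  IsLocalization.Away.lift_eq (P.poly N) _ f

theorem fst_dual (f : P.R N) : TrivSqZeroExt.fst (P.dual N f) = f := by
  have h : (TrivSqZeroExt.fstHom (P.R N) (P.R N) (P.R N) : _ →+* P.R N).comp (P.dual N)
      = RingHom.id _ := by
    refine IsLocalization.ringHom_ext (Submonoid.powers (P.poly N)) (RingHom.ext fun f => ?_)
    simp only [RingHom.comp_apply, dual_algebraMap, RingHom.id_apply]
    exact fst_dualPoly P N f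
  exact congrArg (fun g : P.R N →+* P.R N => g f) h

theorem del_add (f g : P.R N) : P.del N (f + g) = P.del N f + P.del N g := by
  simp [Puncture.del]

theorem del_mul (f g : P.R N) : P.del N (f * g) = f * P.del N g + P.del N f * g := by
  simp [Puncture.del, fst_dual, mul_comm]

theorem del_t : P.del N (P.t N) = 1 := by
  rw [Puncture.del, Puncture.t, dual_algebraMap]
  simp [Puncture.dualPoly]

theorem del_algebraMap (a : WN p k N) : P.del N (algebraMap (WN p k N) (P.R N) a) = 0 := by
  rw [IsScalarTower.algebraMap_apply (WN p k N) (WN p k N)[X] (P.R N), Puncture.del,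
    dual_algebraMap]
  simp [Puncture.dualPoly]

/-- `ω₁ = dlog s / dt = (lam - 1) / ((t - lam) (t - 1))`, where `dlog s` generates the log
differentials on `U₁`. -/
def Puncture.omega1 : P.R N := P.const N (P.lam - 1) * P.invTlam N * P.invT1 N

/-- `ω₂ = dlog t / dt = 1 / t`, where `dlog t` generates the log differentials on `U₂`. -/
def Puncture.omega2 : P.R N := Ring.inverse (P.t N)

theorem map_poly : (P.poly (N + 1)).map (redW p k N) = P.poly N := by
  have h : redW p k N (mkW p k (N + 1) P.lam) = mkW p k N P.lam := rfl
  simp [Puncture.poly, h]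

/-- Reduction `R₁₂ / p ^ (N+1) → R₁₂ / p ^ N`. -/
def Puncture.red : P.R (N + 1) →+* P.R N :=
  IsLocalization.Away.lift (P.poly (N + 1))
    (g := (algebraMap (WN p k N)[X] (P.R N)).comp (mapRingHom (redW p k N))) (by
      rw [RingHom.comp_apply, coe_mapRingHom, map_poly]
      exact IsLocalization.Away.algebraMap_isUnit (S := P.R N) (P.poly N))

theorem red_algebraMap (f : (WN p k (N + 1))[X]) :
    P.red N (algebraMap (WN p k (N + 1))[X] (P.R (N + 1)) f)
      = algebraMap (WN p k N)[X] (P.R N) (f.map (redW p k N)) :=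
  IsLocalization.Away.lift_eq (P.poly (N + 1)) _ f

theorem red_surjective : Function.Surjective (P.red N) := by
  intro y
  obtain ⟨m, a, h⟩ := IsLocalization.Away.surj (P.poly N) y
  have hs : Function.Surjective (redW p k N) := Ideal.Quotient.factor_surjective _
  obtain ⟨b, rfl⟩ := Polynomial.map_surjective _ hs a
  have hu := IsLocalization.Away.algebraMap_isUnit (S := P.R (N + 1)) (P.poly (N + 1))
  have hv := IsLocalization.Away.algebraMap_isUnit (S := P.R N) (P.poly N)
  refine ⟨algebraMap _ _ b * Ring.inverse (algebraMap _ (P.R (N + 1)) (P.poly (N + 1)) ^ m), ?_⟩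
  apply (hv.pow m).mul_right_cancel
  rw [h]
  have e : algebraMap (WN p k N)[X] (P.R N) (P.poly N) ^ m
      = P.red N (algebraMap _ (P.R (N + 1)) (P.poly (N + 1)) ^ m) := by
    rw [map_pow, red_algebraMap, map_poly]
  rw [e, ← map_mul, mul_assoc, Ring.inverse_mul_cancel _ (hu.pow m), mul_one, red_algebraMap]

/-- A lift of an element of `R₁₂ / p ^ N` to `R₁₂ / p ^ (N+1)`.  It is only ever used multiplied
by a multiple of `p`, so that the choice is irrelevant. -/
def Puncture.lift (x : P.R N) : P.R (N + 1) := Function.surjInv (red_surjective P N) x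

/-- The number `p ^ (J-1) / J!` (for `J ≥ 1`), which is a `p`-adic integer. -/
def Puncture.divPow (J : ℕ) : P.R N :=
  (p : P.R N) ^ (J - 1 - padicValNat p J.factorial)
    * Ring.inverse ((J.factorial / p ^ padicValNat p J.factorial : ℕ) : P.R N)

theorem padicValNat_factorial_le (J : ℕ) (hJ : J ≠ 0) :
    padicValNat p J.factorial ≤ J - 1 := by
  have h := sub_one_mul_padicValNat_factorial_lt_of_ne_zero (p := p) hJ
  have h2 : 1 ≤ p - 1 := by have := (Fact.out : p.Prime).two_le; omega
  have h3 := Nat.mul_le_mul_right (padicValNat p J.factorial) h2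
  omega

theorem factorial_mul_divPow (J : ℕ) (hJ : J ≠ 0) :
    (J.factorial : P.R N) * P.divPow N J = (p : P.R N) ^ (J - 1) := by
  set v := padicValNat p J.factorial with hv
  set w := J.factorial / p ^ v with hw
  have hd : p ^ v * w = J.factorial := Nat.mul_div_cancel' pow_padicValNat_dvd
  have hcop : ¬ p ∣ w := by
    intro ⟨c, hc⟩
    apply pow_succ_padicValNat_not_dvd (p := p) (Nat.factorial_ne_zero J)
    exact ⟨c, by rw [← hv, ← hd, hc, pow_succ, mul_assoc]⟩
  have hu : IsUnit (w : P.R N) := by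
    have h : IsUnit (w : WittVector p k) := by
      apply WittVector.isUnit_of_coeff_zero_ne_zero
      intro h
      have h2 : WittVector.constantCoeff (w : WittVector p k) = 0 := h
      rw [map_natCast, CharP.cast_eq_zero_iff k p] at h2
      exact hcop h2
    simpa using h.map (P.const N)
  have hle : v + (J - 1 - v) = J - 1 := by
    have := padicValNat_factorial_le (p := p) J hJ
    omega
  have e : P.divPow N J = (p : P.R N) ^ (J - 1 - v) * Ring.inverse (w : P.R N) := rfl
  rw [e, ← hd, Nat.cast_mul, Nat.cast_pow]
  calc (p : P.R N) ^ v * w * ((p : P.R N) ^ (J - 1 - v) * Ring.inverse (w : P.R N))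
      = (p : P.R N) ^ (v + (J - 1 - v)) * (w * Ring.inverse (w : P.R N)) := by ring
    _ = _ := by rw [Ring.mul_inverse_cancel _ hu, mul_one, hle]

/-- The coefficients `p ^ (J-1) / J!` vanish modulo `p ^ N` for `J > 2 N`. -/
theorem divPow_eq_zero (hp : Odd p) (J : ℕ) (hJ : 2 * N < J) : P.divPow N J = 0 := by
  have hJ0 : J ≠ 0 := by omega
  have h := sub_one_mul_padicValNat_factorial_lt_of_ne_zero (p := p) hJ0
  have h2 : 2 ≤ p - 1 := by
    have h2 := (Fact.out : p.Prime).two_le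
    obtain ⟨m, hm⟩ := hp
    omega
  have h3 := Nat.mul_le_mul_right (padicValNat p J.factorial) h2
  obtain ⟨c, hc⟩ : ∃ c, J - 1 - padicValNat p J.factorial = N + c :=
    Nat.exists_eq_add_of_le (by omega)
  rw [Puncture.divPow, hc, pow_add, natCast_p_nilpotent, zero_mul, zero_mul]

end Calculus

section Bundles

variable {p : ℕ} [Fact p.Prime] {k : Type u} [Field k] [CharP k p]

/-- Descent data of a rank two bundle with a log connection, in bases `v₁` over `U₁` and `v₂` over
`U₂`:  `v₁ = v₂ G` over `U₁₂`, `∇ v₁ = v₁ A₁ dlog s` and `∇ v₂ = v₂ A₂ dlog t`.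
(Every bundle over `W_N(k)` is free over `U₁` and over `U₂`.) -/
structure Conn (P : Puncture p k) (N : ℕ) where
  G : Matrix (Fin 2) (Fin 2) (P.R N)
  A1 : Matrix (Fin 2) (Fin 2) (P.R N)
  A2 : Matrix (Fin 2) (Fin 2) (P.R N)

/-- The data define a vector bundle with a logarithmic connection over `(ℙ¹, D)`. -/
structure Conn.IsLogConnection {P : Puncture p k} {N : ℕ} (c : Conn P N) : Prop where
  isUnit : IsUnit c.G
  mem1 : ∀ i j, c.A1 i j ∈ P.chart1 N
  mem2 : ∀ i j, c.A2 i j ∈ P.chart2 N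
  glue : c.G * (P.omega1 N • c.A1) = (P.omega2 N • c.A2) * c.G + c.G.map (P.del N)

/-- An isomorphism of bundles with connection: matrices `g₁` over `R₁` and `g₂` over `R₂`, which
express the bases of the target through those of the source. -/
structure Conn.IsIso {P : Puncture p k} {N : ℕ} (c c' : Conn P N)
    (g1 : GL (Fin 2) (P.chart1 N)) (g2 : GL (Fin 2) (P.chart2 N)) : Prop where
  glue : c.G * g1.val.map Subtype.val = g2.val.map Subtype.val * c'.G
  conn1 : g1.val.map Subtype.val * (P.omega1 N • c'.A1)
    = (P.omega1 N • c.A1) * g1.val.map Subtype.val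
      + (g1.val.map Subtype.val).map (P.del N)
  conn2 : g2.val.map Subtype.val * (P.omega2 N • c'.A2)
    = (P.omega2 N • c.A2) * g2.val.map Subtype.val
      + (g2.val.map Subtype.val).map (P.del N)

/-- Data of a filtered log de Rham bundle `0 ⊂ Fil¹ ⊂ V` of rank two with
`Gr⁰ = 𝒪`, `Gr¹ = 𝒪(1)`, in bases whose second vector spans `Fil¹`.  The transition matrix is
`[[1, 0], [F, t/(t-1)]]`; the cocycle `t/(t-1)` is that of `𝒪(1)`. -/
structure FilData (P : Puncture p k) (N : ℕ) where
  F : P.R N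
  A1 : Matrix (Fin 2) (Fin 2) (P.R N)
  A2 : Matrix (Fin 2) (Fin 2) (P.R N)

/-- The underlying bundle with connection. -/
def FilData.toConn {P : Puncture p k} {N : ℕ} (V : FilData P N) : Conn P N where
  G := !![1, 0; V.F, P.t N * P.invT1 N]
  A1 := V.A1
  A2 := V.A2

/-- Reduction modulo `p ^ N`. -/
def FilData.red {P : Puncture p k} {N : ℕ} (V : FilData P (N + 1)) : FilData P N where
  F := P.red N V.F
  A1 := V.A1.map (P.red N)
  A2 := V.A2.map (P.red N)

/-- The graded Higgs field of `Gr V = 𝒪 ⊕ 𝒪(1)`: the map `θ : 𝒪(1) → 𝒪 ⊗ Ω¹(log D)` induced by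
`∇`, as coefficient of `dlog s` over `U₁`. -/
def FilData.theta {P : Puncture p k} {N : ℕ} (V : FilData P N) : P.R N := V.A1 0 1

/-- The Higgs field on `𝒪 ⊕ 𝒪(1)` with coefficient `θ` over `U₁` has its zero at
`[x₀ : x₁] ∈ ℙ¹(W_N(k))`: up to a unit it is `x₁ t - x₀`.  (The global maps
`𝒪(1) → Ω¹(log D) = 𝒪(2)` are exactly those with coefficient `x₁ t - x₀` over `U₁`.) -/
def IsZeroOf (P : Puncture p k) (N : ℕ) (θ : P.R N) (x0 x1 : WittVector p k) : Prop :=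
  (¬ ((p : WittVector p k) ∣ x0 ∧ (p : WittVector p k) ∣ x1)) ∧
    ∃ w : WittVector p k, IsUnit w ∧
      θ = P.const N w * (P.const N x1 * P.t N - P.const N x0)

/-- A filtered log de Rham bundle of rank two over `(ℙ¹, D)` over `W_N(k)` whose grading is a
graded semistable Higgs bundle `(𝒪 ⊕ 𝒪(1), θ)` with `θ` nonzero modulo `p`.  (Every such bundle has
bases of the kind used in `FilData`.  After tensoring with `𝒪(-1/2 ∞)` these are the stable
parabolic de Rham bundles of degree `0` with weight `1/2` at `∞` and weights `0` at `0, 1, lam`,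
together with their parabolic Hodge line bundle.) -/
structure FilDR (P : Puncture p k) (N : ℕ) extends FilData P N where
  isLogConnection : toFilData.toConn.IsLogConnection
  exists_zero : ∃ x0 x1, IsZeroOf P N toFilData.theta x0 x1

/-- Isomorphism of filtered de Rham bundles: the isomorphism preserves `Fil¹`. -/
def FilDR.Iso {P : Puncture p k} {N : ℕ} (V V' : FilDR P N) : Prop :=
  ∃ g1 g2, V.toConn.IsIso V'.toConn g1 g2 ∧ g1.val 0 1 = 0 ∧ g2.val 0 1 = 0

end Bundles

section InverseCartier

variable {p : ℕ} [Fact p.Prime] {k : Type u} [Field k] [CharP k p] {P : Puncture p k} {n : ℕ}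

/-- Data of a bundle with a log `p`-connection, in the same format as `Conn`. -/
structure PConn (P : Puncture p k) (N : ℕ) where
  G : Matrix (Fin 2) (Fin 2) (P.R N)
  A1 : Matrix (Fin 2) (Fin 2) (P.R N)
  A2 : Matrix (Fin 2) (Fin 2) (P.R N)

/-- The functor `𝒯`.  Input: a filtered de Rham bundle `V` over `W_n` and a Higgs bundle
`(𝒪 ⊕ 𝒪(1), θ)` over `W_{n+1}` which lifts `Gr V`.  Output: the bundle over `W_{n+1}` with the
`p`-connection induced by `∇` on `(⊕ Filⁱ) / (x ∈ Filⁱ ∼ p x ∈ Filⁱ⁻¹)`, glued with `θ`.  In the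
bases `ṽ₁ = [v₁]₀`, `ṽ₂ = [v₂]₁` one has `[v₂]₀ = p [v₂]₁`, `∇̃ [x]ᵢ = [∇ x]ᵢ₋₁`, so that
`(a, θ; c, d)` becomes `(p a, θ; p² c, p d)`. -/
def functorT (V : FilData P n) (θ : P.R (n + 1)) : PConn P (n + 1) where
  G := !![1, 0; (p : P.R (n + 1)) * P.lift n V.F, P.t (n + 1) * P.invT1 (n + 1)]
  A1 := !![(p : P.R (n + 1)) * P.lift n (V.A1 0 0), θ;
    (p : P.R (n + 1)) ^ 2 * P.lift n (V.A1 1 0), (p : P.R (n + 1)) * P.lift n (V.A1 1 1)]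
  A2 := !![(p : P.R (n + 1)) * P.lift n (V.A2 0 0),
      P.const (n + 1) (P.lam - 1) * P.invTlam (n + 1) * θ;
    (p : P.R (n + 1)) ^ 2 * P.lift n (V.A2 1 0), (p : P.R (n + 1)) * P.lift n (V.A2 1 1)]

/-- The matrix of `∇(∂)` on lifts of the basis `v₁` of `V` over `U₁`, with `θ` in place of the
lift of its reduction. -/
def liftedConn (V : FilData P n) (θ : P.R (n + 1)) : Matrix (Fin 2) (Fin 2) (P.R (n + 1)) :=
  P.omega1 (n + 1) • !![P.lift n (V.A1 0 0), θ; P.lift n (V.A1 1 0), P.lift n (V.A1 1 1)]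

/-- The matrices of the powers `(∂ + B) ^ J`. -/
def iterConn {N : ℕ} (B : Matrix (Fin 2) (Fin 2) (P.R N)) : ℕ → Matrix (Fin 2) (Fin 2) (P.R N)
  | 0 => 1
  | J + 1 => (iterConn B J).map (P.del N) + B * iterConn B J

/-- The matrix of `∇̃(∂) ^ J / J!` over `U₁₂` in the basis `ṽ₁`, for `J ≥ 1`.  Since
`∇̃(∂) ^ J [x]ᵢ = [∇(∂) ^ J x]ᵢ₋_J`, its entries are those of `∇(∂) ^ J` times
`p ^ J / J!`, `p ^ (J-1) / J!`, `p ^ (J+1) / J!`, `p ^ J / J!`. -/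
def divIter (V : FilData P n) (θ : P.R (n + 1)) (J : ℕ) :
    Matrix (Fin 2) (Fin 2) (P.R (n + 1)) :=
  P.divPow (n + 1) J •
    !![(p : P.R (n + 1)) * iterConn (liftedConn V θ) J 0 0, iterConn (liftedConn V θ) J 0 1;
      (p : P.R (n + 1)) ^ 2 * iterConn (liftedConn V θ) J 1 0,
      (p : P.R (n + 1)) * iterConn (liftedConn V θ) J 1 1]

variable [PerfectRing k p]

/-- The inverse Cartier transform of `(V, θ)`: the Frobenius pullbacks `Φᵢ^* Ṽ` with connection
`d + (dΦᵢ/p)(∇̃ ⊗ 1)` over `Uᵢ`, where `dΦ₁/p (dlog s) = dlog s` and `dΦ₂/p (dlog t) = dlog t`,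
glued by the Taylor formula
`ṽ₁ ⊗_{Φ₁} 1 ↦ ∑_J ∇̃(∂) ^ J / J! (ṽ₁) ⊗_{Φ₂} ((Φ₁(t) - Φ₂(t)) / p) ^ J`.
All terms with `J > 2 (n + 1)` vanish, see `divPow_eq_zero`. -/
def inverseCartier (hp : Odd p) (V : FilData P n) (θ : P.R (n + 1)) : Conn P (n + 1) where
  G := (functorT V θ).G.map (P.Phi2 (n + 1) hp) *
    (1 + ∑ J ∈ Finset.Icc 1 (2 * (n + 1)),
      P.z (n + 1) hp ^ J • (divIter V θ J).map (P.Phi2 (n + 1) hp))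
  A1 := (functorT V θ).A1.map (P.Phi1 (n + 1) hp)
  A2 := (functorT V θ).A2.map (P.Phi2 (n + 1) hp)

/-- Tensor product with `(𝒪(-m ∞), d)`, in the bases `1` over `U₁` and `(t - 1) ^ (-m)` over `U₂`,
for which `d ((t-1) ^ (-m)) = (t-1) ^ (-m) (-m t / (t-1)) dlog t`. -/
def Conn.twist {N : ℕ} (c : Conn P N) (m : ℕ) : Conn P N where
  G := (P.t N - 1) ^ m • c.G
  A1 := c.A1
  A2 := c.A2 - ((m : P.R N) * (P.t N * P.invT1 N)) • (1 : Matrix (Fin 2) (Fin 2) (P.R N))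

/-- One step of the Higgs-de Rham flow: the filtered de Rham bundle `V'` over `W_{n+1}` is the
inverse Cartier transform of `(V, θ)`, which has degree `p`, brought back to degree `1` by the
twist with `𝒪(-(p-1)/2 ∞)`, together with its graded semistable Hodge filtration (the line
subbundle `𝒪(1)`, that is `𝒪((p+1)/2)` before the twist).  The next Higgs term is `Gr V'`.  (In
terms of the parabolic bundles `V ⊗ 𝒪(-1/2 ∞)` this is the parabolic inverse Cartier transform.) -/
def IsFlowStep (hp : Odd p) (V : FilData P n) (θ : P.R (n + 1)) (V' : FilDR P (n + 1)) : Prop :=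
  ∃ g1 g2, ((inverseCartier hp V θ).twist ((p - 1) / 2)).IsIso V'.toConn g1 g2

/-- A step of the flow within de Rham bundles over `W_{n+1}`: start with the Higgs bundle `Gr V`
over `W_{n+1}` and the reduction of `V` over `W_n`. -/
def FlowStep (hp : Odd p) (V V' : FilDR P (n + 1)) : Prop :=
  IsFlowStep hp V.toFilData.red V.theta V'

/-- The `f`-fold Higgs-de Rham flow over `W_{n+1}` on Higgs bundles lifting `Gr V`, where `V` is a
de Rham bundle over `W_n`, read off on zeros of Higgs fields: the Higgs bundle with zero `a` lifting
`Gr V` is sent to a Higgs bundle with zero `c`. -/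
def FlowMap (hp : Odd p) (V : FilDR P n) (f : ℕ) (a c : WittVector p k) : Prop :=
  ∃ (θ : P.R (n + 1)) (U : ℕ → FilDR P (n + 1)),
    P.red n θ = V.theta ∧ IsZeroOf P (n + 1) θ a 1 ∧
    IsFlowStep hp V.toFilData θ (U 0) ∧
    (∀ i, i + 1 < f → FlowStep hp (U i) (U (i + 1))) ∧
    IsZeroOf P (n + 1) (U (f - 1)).theta c 1

/-- The flow modulo `p`: `V'` is the de Rham bundle obtained from the Higgs bundle over the field
with zero `x`.  (There is no de Rham bundle to start from: it would live over `W₀ = 0`.) -/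
def ModPStep (hp : Odd p) (P : Puncture p k) (x : k) (V' : FilDR P 1) : Prop :=
  ∃ θ : P.R 1, IsZeroOf P 1 θ (WittVector.teichmuller p x) 1 ∧
    IsFlowStep hp (⟨0, 0, 0⟩ : FilData P 0) θ V'

/-- `φ` is the rational function `φ̃` over `k` with `φ_{lam,p}(a) = φ̃(a ^ p)`, where `φ_{lam,p}` is
the self-map of the projective line of zeros of Higgs fields induced by the flow modulo `p`, over
all perfect extension fields of `k`.  The value of `φ̃` is read as a point of the projective line. -/
def IsFlowFunction (hp : Odd p) (P : Puncture p k) (φ : RatFunc k) : Prop :=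
  ∀ (K : Type u) [Field K] [CharP K p] [PerfectRing K p] [Algebra k K] (x : K),
    (∃ V', ModPStep hp (P.baseChange K) x V') ∧
    ∀ V', ModPStep hp (P.baseChange K) x V' →
      IsZeroOf (P.baseChange K) 1 V'.theta
        (WittVector.teichmuller p (aeval (x ^ p) φ.num))
        (WittVector.teichmuller p (aeval (x ^ p) φ.denom))

end InverseCartier

section RationalFunctions

variable {k : Type u} [Field k]

/-- The value of a rational function at a point which is not a pole. -/
def ratEval (φ : RatFunc k) (y : k) : k := φ.num.eval y / φ.denom.eval y

/-- The value of the derivative of a rational function at a point which is not a pole. -/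
def ratDerivEval (φ : RatFunc k) (y : k) : k :=
  ((derivative φ.num).eval y * φ.denom.eval y - φ.num.eval y * (derivative φ.denom).eval y)
    / φ.denom.eval y ^ 2

end RationalFunctions

end HiggsDeRham

end

open HiggsDeRham

/-!
Over the four-punctured line everything is explicit: a bundle is a transition matrix over the ring
`R₁₂ = P.R N` of functions on `U₁ ∩ U₂`, and the Frobenius lifts `Φ₁`, `Φ₂`, which extend to `U₁`
and `U₂`, differ by `p z`, where `z = (Φ₁(t) - Φ₂(t)) / p`.

**The inverse Cartier transform.** The Taylor formula
`Φ₁(f) = ∑ z ^ J Φ₂(p ^ J / J! ∂ ^ J f)` (`Phi1_eq_sum`) holds because its right hand side is a ring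
homomorphism. It shows that the Taylor matrix `taylorMat` intertwines the two Frobenius pullbacks of a
`p`-connection (`DM_taylorMat_add`), so that the inverse Cartier transform is a bundle with a
logarithmic connection (`inverseCartier_glues`). For odd `p` the terms of degree `J ≥ 2` are divisible
by `p`. Hence the transform depends only on the filtered bundle over `W_n` and the lift of its Higgs
field, functorially (`inverseCartier_gauge`), and changing that lift by `p ^ n η` changes the
transition matrix and the connection only in one entry (`inverseCartier_add`).

**Hodge filtrations.** Since `H⁰(ℙ¹, 𝒪(-1)) = 0`, an extension of `𝒪` by `𝒪(1)`
has only one subbundle `𝒪(1)` up to constants (`Conn.Gauge.exists_const_mul`), so isomorphisms of de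
Rham bundles preserve the Hodge filtration, and the Higgs field is the Wronskian of the generator of
this subbundle (`Conn.Gauge.wronskian_eq`). Since `H¹(ℙ¹, 𝒪)` and `H¹(ℙ¹, 𝒪(-1))` vanish, a Hodge
filtration modulo `p ^ n` lifts (`Conn.Glues.exists_filData_of_red`). This gives the existence of the
steps of the flow over `W_{n+1}`.

**The flow modulo `p`.** For the Higgs field `t - x` the sections of `𝒪(1)` in the inverse Cartier
transform are the polynomial solutions of the linear equation in `IsSol`, with parameter `Y = x ^ p`.
There are more unknowns than equations, so there is a family of solutions over `k[Y]`, which can be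
taken without zero members (`exists_primitive_sol`). Its Wronskian is `X ^ (p-1) (D X - N)` with
`D, N ∈ k[Y]` by comparison of degrees over the two charts (`IsSol.exists_wronP_eq`), and it is nonzero
for every value of `Y` (`wronP_ne_zero`). A common factor of the components would divide it twice, so
the solution generates a subbundle, and the next Higgs field is `D(x ^ p) t - N(x ^ p)` up to a unit.
Thus the rational function is `N / D`.

**Lifts.** When the zero of the Higgs field moves by `p ^ n δ`, the generator of the Hodge line
subbundle varies by a multiple of `p ^ n`, so only the family modulo `p` matters. The derivative of the
family with respect to `Y`, multiplied by `δ ^ p`, solves the linearised equation, and by uniqueness it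
is the variation in question. The zero of the Wronskian therefore moves by `p ^ n (N / D)'(x ^ p) δ ^ p`
(`IsFamily.exists_compare`, `IsFamily.exists_step`). Composing `f` such affine maps in `δ ^ p` gives
the product of derivatives (`IsFamily.exists_flowMap_iff`). In a periodic flow no intermediate zero is
infinite, because infinity is fixed by the flow modulo `p`: there the Higgs field vanishes modulo `p`
at `∞` and the residue of the connection at `∞` is scalar (`exists_theta_eq_res_of_gauge`).
-/
open Polynomial HiggsDeRham
open Finset.HasAntidiagonal (antidiagonal)
noncomputable section
namespace HiggsDeRham
universe u

/-! ### The coordinate ring of the four-punctured line -/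

theorem ringHom_ringInverse {A B : Type*} [CommRing A] [CommRing B] (f : A →+* B) {a : A}
    (h : IsUnit a) : f (Ring.inverse a) = Ring.inverse (f a) := by
  apply (h.map f).mul_left_cancel
  rw [← map_mul, Ring.mul_inverse_cancel _ h, map_one, Ring.mul_inverse_cancel _ (h.map f)]

theorem mkW_surjective {p : ℕ} [Fact p.Prime] {k : Type u} [Field k] (N : ℕ) :
    Function.Surjective (mkW p k N) := Ideal.Quotient.mk_surjective

section Ring

variable {p : ℕ} [Fact p.Prime] {k : Type u} [Field k] [CharP k p] (P : Puncture p k) (N : ℕ)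

theorem algebraMap_C_mkW (x : WittVector p k) :
    algebraMap (WN p k N)[X] (P.R N) (C (mkW p k N x)) = P.const N x :=
  (IsScalarTower.algebraMap_apply (WN p k N) (WN p k N)[X] (P.R N) (mkW p k N x)).symm

theorem algebraMap_map_mkW (f : (WittVector p k)[X]) :
    algebraMap (WN p k N)[X] (P.R N) (f.map (mkW p k N)) = eval₂ (P.const N) (P.t N) f := by
  induction f using Polynomial.induction_on' with
  | add f g hf hg => rw [Polynomial.map_add, map_add, hf, hg, eval₂_add]
  | monomial n a =>
    rw [← C_mul_X_pow_eq_monomial, Polynomial.map_mul, map_mul, Polynomial.map_pow, map_X, map_C,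
      algebraMap_C_mkW, map_pow]
    simp [Puncture.t]

omit [CharP k p] in
theorem exists_poly_lift (f : (WN p k N)[X]) : ∃ g : (WittVector p k)[X], g.map (mkW p k N) = f :=
  Polynomial.map_surjective _ (mkW_surjective N) f

variable {P N} in
/-- Ring homomorphisms out of `R₁₂` are determined by the constants and by `t`. -/
theorem R_ringHom_ext {S : Type*} [CommRing S] {f g : P.R N →+* S}
    (hc : ∀ x, f (P.const N x) = g (P.const N x)) (ht : f (P.t N) = g (P.t N)) : f = g := by
  refine IsLocalization.ringHom_ext (Submonoid.powers (P.poly N)) ?_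
  refine Polynomial.ringHom_ext (fun a => ?_) ht
  obtain ⟨x, rfl⟩ := mkW_surjective N a
  simpa [algebraMap_C_mkW] using hc x

/-- A map which is a derivation along a ring homomorphism out of `R₁₂` vanishes as soon as it
kills the constants and `t`. -/
theorem R_derivation_ext {S : Type*} [CommRing S] (φ : P.R N →+* S) (d : P.R N → S)
    (hadd : ∀ f g, d (f + g) = d f + d g) (hmul : ∀ f g, d (f * g) = φ f * d g + d f * φ g)
    (hc : ∀ x, d (P.const N x) = 0) (ht : d (P.t N) = 0) (f : P.R N) : d f = 0 := by
  have hpoly : ∀ g : (WittVector p k)[X], d (eval₂ (P.const N) (P.t N) g) = 0 := by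
    intro g
    induction g using Polynomial.induction_on' with
    | add f g hf hg => rw [eval₂_add, hadd, hf, hg, add_zero]
    | monomial n a =>
      rw [eval₂_monomial, hmul, hc, zero_mul, add_zero]
      have : d (P.t N ^ n) = 0 := by
        induction n with
        | zero => simpa using hc 1
        | succ n ih => rw [pow_succ, hmul, ih, ht, zero_mul, mul_zero, add_zero]
      rw [this, mul_zero]
  obtain ⟨n, a, h⟩ := IsLocalization.Away.surj (P.poly N) f
  obtain ⟨g, rfl⟩ := exists_poly_lift N a
  obtain ⟨b, hb⟩ := exists_poly_lift N (P.poly N ^ n)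
  have hu : IsUnit (eval₂ (P.const N) (P.t N) b) := by
    rw [← algebraMap_map_mkW, hb, map_pow]
    exact (IsLocalization.Away.algebraMap_isUnit (S := P.R N) (P.poly N)).pow n
  rw [← map_pow, ← hb, algebraMap_map_mkW, algebraMap_map_mkW] at h
  have h2 := congrArg d h
  rw [hmul, hpoly, hpoly, mul_zero, zero_add] at h2
  exact (hu.map φ).mul_left_eq_zero.1 h2

/-- The derivation `∂/∂t` of `R₁₂` as a bundled derivation. -/
def Puncture.D : Derivation ℤ (P.R N) (P.R N) :=
  Derivation.mk' (AddMonoidHom.toIntLinearMap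
    { toFun := P.del N
      map_zero' := by simp [Puncture.del]
      map_add' := del_add P N }) (fun a b => by
        change P.del N (a * b) = _
        rw [del_mul, smul_eq_mul, smul_eq_mul, mul_comm (P.del N a)]; rfl)

theorem del_eq (f : P.R N) : P.del N f = P.D N f := rfl

theorem D_t : P.D N (P.t N) = 1 := del_t P N

theorem D_const (x : WittVector p k) : P.D N (P.const N x) = 0 := del_algebraMap P N _

theorem D_ringInverse {a : P.R N} (h : IsUnit a) :
    P.D N (Ring.inverse a) = - P.D N a * Ring.inverse a ^ 2 := by
  have e := congrArg (P.D N) (Ring.mul_inverse_cancel _ h)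
  rw [Derivation.leibniz, Derivation.map_one_eq_zero, smul_eq_mul, smul_eq_mul] at e
  have e2 := Ring.mul_inverse_cancel _ h
  linear_combination Ring.inverse a * e - P.D N (Ring.inverse a) * e2

theorem D_eval₂ (f : (WittVector p k)[X]) :
    P.D N (eval₂ (P.const N) (P.t N) f) = eval₂ (P.const N) (P.t N) (derivative f) := by
  induction f using Polynomial.induction_on' with
  | add f g hf hg => simp [hf, hg]
  | monomial n a =>
    rw [eval₂_monomial, Derivation.leibniz, D_const, smul_zero, add_zero, Derivation.leibniz_pow,
      D_t, derivative_monomial, eval₂_monomial, map_mul, map_natCast]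
    simp only [smul_eq_mul, nsmul_eq_mul]
    ring

/-- The derivation applied to the entries of a matrix satisfies the product rule. -/
theorem map_del_mul {l m n : Type*} [Fintype m] (A : Matrix l m (P.R N)) (B : Matrix m n (P.R N)) :
    (A * B).map (P.del N) = A.map (P.del N) * B + A * B.map (P.del N) := by
  ext i j
  simp only [Matrix.map_apply, Matrix.mul_apply, Matrix.add_apply, del_eq, map_sum,
    Derivation.leibniz, smul_eq_mul, ← Finset.sum_add_distrib]
  exact Finset.sum_congr rfl fun x _ => by ring

theorem map_del_one {n : Type*} [DecidableEq n] :
    (1 : Matrix n n (P.R N)).map (P.del N) = 0 := by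
  ext i j
  rw [Matrix.map_apply, Matrix.one_apply, del_eq]
  split_ifs <;> simp

theorem omega1_mul : P.omega1 N * ((P.t N - P.const N P.lam) * (P.t N - 1))
    = P.const N (P.lam - 1) := by
  have h1 := Ring.mul_inverse_cancel _ (isUnit_t1 P N)
  have h2 := Ring.mul_inverse_cancel _ (isUnit_tlam P N)
  rw [Puncture.omega1, Puncture.invT1, Puncture.invTlam]
  linear_combination P.const N (P.lam - 1) * (h1 * (P.t N - P.const N P.lam) *
    Ring.inverse (P.t N - P.const N P.lam) + h2)

theorem isUnit_const_lam_sub_one : IsUnit (P.const N (P.lam - 1)) := by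
  have h := ((one_sub_isUnit P).map (P.const N)).neg
  rwa [← map_neg, neg_sub] at h

theorem isUnit_omega1 : IsUnit (P.omega1 N) := by
  have h := isUnit_const_lam_sub_one P N
  rw [← omega1_mul] at h
  exact isUnit_of_mul_isUnit_left h

theorem omega2_mul : P.omega2 N * P.t N = 1 := Ring.inverse_mul_cancel _ (isUnit_t P N)

theorem isUnit_omega2 : IsUnit (P.omega2 N) := IsUnit.of_mul_eq_one _ (omega2_mul P N)

/-- The chain rule for a ring endomorphism which preserves constants. -/
theorem D_ringHom (Φ : P.R N →+* P.R N) (hc : ∀ x, ∃ y, Φ (P.const N x) = P.const N y)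
    (f : P.R N) : P.D N (Φ f) = Φ (P.D N f) * P.D N (Φ (P.t N)) := by
  rw [← sub_eq_zero]
  refine R_derivation_ext P N Φ (fun f => P.D N (Φ f) - Φ (P.D N f) * P.D N (Φ (P.t N)))
    ?_ ?_ ?_ ?_ f
  · intro f g; simp only [map_add]; ring
  · intro f g
    simp only [map_mul, Derivation.leibniz, smul_eq_mul, map_add]; ring
  · intro x
    obtain ⟨y, hy⟩ := hc x
    simp only [hy, D_const, map_zero]; ring
  · simp only [D_t, map_one]; ring

theorem p_mul_cancel {f g : (WittVector p k)[X]}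
    (h : (p : (WittVector p k)[X]) * f = (p : (WittVector p k)[X]) * g) : f = g := by
  have h0 : (p : (WittVector p k)[X]) ≠ 0 := by
    intro h0
    have h1 : (C (p : WittVector p k)) = 0 := by rw [map_natCast]; exact h0
    exact WittVector.p_nonzero p k (C_eq_zero.1 h1)
  exact mul_left_cancel₀ h0 h

end Ring

section Frobenius

variable {p : ℕ} [Fact p.Prime] {k : Type u} [Field k] [CharP k p] [PerfectRing k p]
  (P : Puncture p k) (N : ℕ) (hp : Odd p)

theorem Phi1_const (x : WittVector p k) :
    P.Phi1 N hp (P.const N x) = P.const N (WittVector.frobenius x) := by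
  rw [← algebraMap_C_mkW]
  refine (IsLocalization.Away.lift_eq (P.poly N) (isUnit_subst_frobT1 P N hp) _).trans ?_
  simp [Puncture.subst, sigma, Puncture.const]

theorem Phi2_const (x : WittVector p k) :
    P.Phi2 N hp (P.const N x) = P.const N (WittVector.frobenius x) := by
  rw [← algebraMap_C_mkW]
  refine (IsLocalization.Away.lift_eq (P.poly N) (isUnit_subst_pow P N hp) _).trans ?_
  simp [Puncture.subst, sigma, Puncture.const]

theorem D_Phi1 (f : P.R N) :
    P.D N (P.Phi1 N hp f) = P.Phi1 N hp (P.D N f) * P.D N (P.Phi1 N hp (P.t N)) :=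
  D_ringHom P N _ (fun x => ⟨_, Phi1_const P N hp x⟩) f

theorem D_Phi2 (f : P.R N) :
    P.D N (P.Phi2 N hp f) = P.Phi2 N hp (P.D N f) * ((p : P.R N) * P.t N ^ (p - 1)) := by
  rw [D_ringHom P N _ (fun x => ⟨_, Phi2_const P N hp x⟩) f, Phi2_t, Derivation.leibniz_pow, D_t]
  simp

/-- The denominator `(X - lam) ^ p - (X - 1) ^ p` of `Φ₁(t)`. -/
def Puncture.den : (WittVector p k)[X] := (X - C P.lam) ^ p - (X - 1) ^ p

/-- The numerator of `Φ₁(t)`. -/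
def Puncture.numT : (WittVector p k)[X] :=
  (X - C P.lam) ^ p - C (WittVector.frobenius P.lam) * (X - 1) ^ p

/-- The quotient of `num` by `p`. -/
def Puncture.Q : (WittVector p k)[X] := (exists_num P hp).choose

theorem num_eq_Q : P.num = (p : (WittVector p k)[X]) * P.Q hp := (exists_num P hp).choose_spec

omit [PerfectRing k p] in
theorem eval₂_den : eval₂ (P.const N) (P.t N) P.den
    = (P.t N - P.const N P.lam) ^ p - (P.t N - 1) ^ p := by
  simp only [Puncture.den, eval₂_sub, eval₂_pow, eval₂_X, eval₂_C, eval₂_one]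

include hp in
theorem isUnit_den : IsUnit (eval₂ (P.const N) (P.t N) P.den) := by
  have h := (isUnit_sp1 P N hp).mul ((isUnit_t1 P N).pow p)
  rwa [sub_mul, ← mul_pow, s_mul P N _ rfl, one_mul, ← eval₂_den] at h

theorem z_mul_den : P.z N hp * eval₂ (P.const N) (P.t N) P.den
    = eval₂ (P.const N) (P.t N) (P.Q hp) := by
  rw [Puncture.z, ← eval₂_den, mul_assoc, Ring.inverse_mul_cancel _ (isUnit_den P N hp), mul_one]
  rfl

theorem Phi1_t_mul_den : P.Phi1 N hp (P.t N) * eval₂ (P.const N) (P.t N) P.den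
    = eval₂ (P.const N) (P.t N) P.numT := by
  have h := p_mul_z P N hp
  have h2 := z_mul_den P N hp
  have h3 := congrArg (eval₂ (P.const N) (P.t N)) (num_eq_Q P hp)
  have h4 : P.num = P.numT - X ^ p * P.den := rfl
  rw [h4] at h3
  rw [Phi2_t] at h
  simp only [eval₂_sub, eval₂_mul, eval₂_pow, eval₂_X, eval₂_natCast] at h3
  linear_combination -(eval₂ (P.const N) (P.t N) P.den) * h + p * h2 - h3

/-- The derivative of `Q / den`, computed by dividing by `p` in `W(k)[X]`. -/
theorem derivative_Q_mul_den :
    derivative (P.Q hp) * P.den - P.Q hp * derivative P.den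
      = C ((1 - P.lam) * (1 - WittVector.frobenius P.lam))
          * ((X - C P.lam) * (X - 1)) ^ (p - 1) - X ^ (p - 1) * P.den ^ 2 := by
  apply p_mul_cancel
  have h := num_eq_Q P hp
  have hd : (p : (WittVector p k)[X]) * derivative (P.Q hp) = derivative P.num := by
    rw [h]; simp
  have hpp : ∀ f : (WittVector p k)[X], f ^ p = f ^ (p - 1) * f := fun f => by
    rw [← pow_succ, Nat.sub_add_cancel (Fact.out : p.Prime).one_le]
  have e1 : derivative P.den = (p : (WittVector p k)[X]) * ((X - C P.lam) ^ (p - 1)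
      - (X - 1) ^ (p - 1)) := by
    simp [Puncture.den, derivative_pow]; ring
  have e2 : derivative P.num = (p : (WittVector p k)[X]) * ((X - C P.lam) ^ (p - 1)
      - C (WittVector.frobenius P.lam) * (X - 1) ^ (p - 1))
      - (p : (WittVector p k)[X]) * X ^ (p - 1) * P.den - X ^ p * derivative P.den := by
    simp [Puncture.num, Puncture.den, derivative_pow]; ring
  have e3 : P.num = ((X - C P.lam) ^ p - C (WittVector.frobenius P.lam) * (X - 1) ^ p)
    - X ^ p * P.den := rfl
  have e4 : (p : (WittVector p k)[X]) * (derivative (P.Q hp) * P.den - P.Q hp * derivative P.den)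
      = derivative P.num * P.den - P.num * derivative P.den := by
    linear_combination P.den * hd + derivative P.den * h
  rw [e4, e2, e3, e1]
  simp only [Puncture.den, map_mul, map_sub, map_one]
  rw [hpp (X - C P.lam), hpp (X - 1), mul_pow]
  ring

/-- `∂((Φ₁(t) - Φ₂(t)) / p)`, expressed through `Φ₁^* (dlog s) = p dlog s` and
`Φ₂^* (dlog t) = p dlog t`. -/
theorem Phi1_omega1_mul_D_z :
    P.Phi1 N hp (P.omega1 N) * (P.D N (P.z N hp) + P.t N ^ (p - 1)) = P.omega1 N := by
  set d := eval₂ (P.const N) (P.t N) P.den with hd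
  have hu : IsUnit d := isUnit_den P N hp
  have hz := z_mul_den P N hp
  have hT := Phi1_t_mul_den P N hp
  have hQ := congrArg (eval₂ (P.const N) (P.t N)) (derivative_Q_mul_den P hp)
  have hz' := congrArg (P.D N) hz
  rw [Derivation.leibniz, D_eval₂, D_eval₂, smul_eq_mul, smul_eq_mul] at hz'
  have hw := congrArg (P.Phi1 N hp) (omega1_mul P N)
  have hw0 := omega1_mul P N
  simp only [map_mul, map_sub, map_one, Phi1_const] at hw hw0
  simp only [Puncture.numT, eval₂_sub, eval₂_mul, eval₂_pow, eval₂_X, eval₂_C, eval₂_one,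
    map_mul, map_sub, map_one] at hT hQ
  rw [← hd] at hz hT hQ hz'
  have hd2 : d = (P.t N - P.const N P.lam) ^ p - (P.t N - 1) ^ p := eval₂_den P N
  have ua := isUnit_tlam P N
  have ub := isUnit_t1 P N
  have hpp : ∀ f : P.R N, f ^ p = f ^ (p - 1) * f := fun f => by
    rw [← pow_succ, Nat.sub_add_cancel (Fact.out : p.Prime).one_le]
  have ul : IsUnit (1 - P.const N (WittVector.frobenius P.lam)) := by
    have := one_sub_frobenius_isUnit P N
    rwa [map_sub, map_one] at this
  generalize P.const N (WittVector.frobenius P.lam) = l at *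
  generalize P.const N P.lam = c at *
  generalize P.Phi1 N hp (P.t N) = T at *
  generalize P.Phi1 N hp (P.omega1 N) = w at *
  generalize P.omega1 N = v at *
  generalize P.D N (P.z N hp) = z' at *
  generalize P.z N hp = z at *
  generalize eval₂ (P.const N) (P.t N) (P.Q hp) = q at *
  generalize eval₂ (P.const N) (P.t N) (derivative (P.Q hp)) = q' at *
  generalize eval₂ (P.const N) (P.t N) (derivative P.den) = d' at *
  generalize P.t N = t at *
  generalize ha : t - c = a at *
  generalize hb : t - 1 = b at *
  have hcl : 1 - c = a - b := by rw [← ha, ← hb]; ring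
  have hz2 : (z' + t ^ (p - 1)) * d ^ 2 = (1 - c) * (1 - l) * (a * b) ^ (p - 1) := by
    linear_combination d * hz' + hQ - d' * hz
  have hT1 : (T - 1) * d = (1 - l) * b ^ p := by rw [sub_mul, hT, hd2]; ring
  have hT2 : (T - l) * d = (1 - l) * a ^ p := by rw [sub_mul, hT, hd2]; ring
  have hw2 : w * ((1 - l) * (a * b) ^ p) = - d ^ 2 := by
    apply ul.mul_left_cancel
    rw [mul_pow]
    linear_combination d ^ 2 * hw - w * (T - 1) * d * hT2 - w * (1 - l) * a ^ p * hT1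
  have hu2 := hu.pow 2
  apply (hu2.mul (ua.mul ub)).mul_right_cancel
  have e : (a * b) ^ p = (a * b) ^ (p - 1) * (a * b) := hpp _
  rw [e] at hw2
  linear_combination w * a * b * hz2 + (1 - c) * hw2 - d ^ 2 * hw0
end Frobenius

/-! ### The two charts and Čech cohomology of line bundles -/

section Charts

variable {p : ℕ} [Fact p.Prime] {k : Type u} [Field k] [CharP k p] (P : Puncture p k) (N : ℕ)

/-- The polynomial `(X - 1) (X - lam)`, which vanishes on the complement of the second chart. -/
def Puncture.kap : (WN p k N)[X] := (X - 1) * (X - C (mkW p k N P.lam))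

theorem algebraMap_kap : algebraMap (WN p k N)[X] (P.R N) (P.kap N)
    = (P.t N - 1) * (P.t N - P.const N P.lam) := by
  rw [Puncture.kap, map_mul, map_sub, map_sub, map_one, algebraMap_C_mkW]
  rfl

theorem isUnit_kap : IsUnit (algebraMap (WN p k N)[X] (P.R N) (P.kap N)) := by
  rw [algebraMap_kap]
  exact (isUnit_t1 P N).mul (isUnit_tlam P N)

theorem isUnit_mkW_lam : IsUnit (mkW p k N P.lam) :=
  (WittVector.isUnit_of_coeff_zero_ne_zero _ P.ne_zero).map (mkW p k N)

theorem isCoprime_X_kap : IsCoprime (X : (WN p k N)[X]) (P.kap N) := by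
  obtain ⟨c, hc⟩ := (isUnit_mkW_lam P N).exists_left_inv
  refine ⟨- C c * (X - 1 - C (mkW p k N P.lam)), C c, ?_⟩
  have h : C c * C (mkW p k N P.lam) = (1 : (WN p k N)[X]) := by rw [← C_mul, hc, C_1]
  rw [Puncture.kap]
  linear_combination h

theorem monic_kap : (P.kap N).Monic := by
  refine Monic.mul ?_ (monic_X_sub_C _)
  simpa using monic_X_sub_C (1 : WN p k N)

theorem monic_poly : (P.poly N).Monic := by
  refine Monic.mul (Monic.mul monic_X ?_) (monic_X_sub_C _)
  simpa using monic_X_sub_C (1 : WN p k N)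

theorem natDegree_kap_le : (P.kap N).natDegree ≤ 2 := by
  rw [Puncture.kap]; compute_degree

theorem natDegree_mul_kap_pow {g : (WN p k N)[X]} (hg : g ≠ 0) (i : ℕ) :
    (g * P.kap N ^ i).natDegree = g.natDegree + 2 * i := by
  have : Nontrivial (WN p k N) := by
    by_contra h
    rw [not_nontrivial_iff_subsingleton] at h
    exact hg (Subsingleton.elim _ _)
  have h2 : (P.kap N).natDegree = 2 := by
    have e : P.kap N = (X - C 1) * (X - C (mkW p k N P.lam)) := by simp [Puncture.kap]
    rw [e, (monic_X_sub_C _).natDegree_mul (monic_X_sub_C _), natDegree_X_sub_C, natDegree_X_sub_C]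
  rw [mul_comm, ((monic_kap P N).pow i).natDegree_mul' hg, (monic_kap P N).natDegree_pow, h2]
  ring

theorem algebraMap_injective : Function.Injective (algebraMap (WN p k N)[X] (P.R N)) := by
  refine IsLocalization.injective (M := Submonoid.powers (P.poly N)) (P.R N) ?_
  rw [Submonoid.powers_le]
  exact (monic_poly P N).mem_nonZeroDivisors

theorem const_eq_zero_iff {x : WittVector p k} :
    P.const N x = 0 ↔ (p : WittVector p k) ^ N ∣ x := by
  rw [← algebraMap_C_mkW, map_eq_zero_iff _ (algebraMap_injective P N), C_eq_zero,
    Ideal.Quotient.eq_zero_iff_mem, Ideal.mem_span_singleton]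

theorem mem_chart1_iff {x : P.R N} : x ∈ P.chart1 N ↔
    ∃ (f : (WN p k N)[X]) (e : ℕ), x * P.t N ^ e = algebraMap (WN p k N)[X] (P.R N) f := by
  have ht := Ring.mul_inverse_cancel _ (isUnit_t P N)
  have hX : algebraMap (WN p k N)[X] (P.R N) X = P.t N := rfl
  constructor
  · intro hx
    induction hx using Algebra.adjoin_induction with
    | mem x hx =>
      rcases hx with rfl | rfl
      · exact ⟨X, 0, by rw [pow_zero, mul_one]; rfl⟩
      · exact ⟨1, 1, by rw [pow_one, map_one, mul_comm, ht]⟩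
    | algebraMap r =>
      exact ⟨C r, 0, by rw [pow_zero, mul_one]
                        exact IsScalarTower.algebraMap_apply _ _ _ r⟩
    | add x y _ _ hx hy =>
      obtain ⟨f, e, hf⟩ := hx
      obtain ⟨g, d, hg⟩ := hy
      refine ⟨f * X ^ d + g * X ^ e, e + d, ?_⟩
      rw [map_add, map_mul, map_mul, map_pow, map_pow, hX, ← hf, ← hg]
      ring
    | mul x y _ _ hx hy =>
      obtain ⟨f, e, hf⟩ := hx
      obtain ⟨g, d, hg⟩ := hy
      refine ⟨f * g, e + d, ?_⟩
      rw [map_mul, ← hf, ← hg]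
      ring
  · rintro ⟨f, e, h⟩
    have hf : algebraMap (WN p k N)[X] (P.R N) f ∈ P.chart1 N := by
      induction f using Polynomial.induction_on' generalizing x with
      | add f g hf hg =>
        rw [map_add]
        exact add_mem (hf (x := algebraMap _ (P.R N) f * Ring.inverse (P.t N) ^ e) (by
          rw [mul_assoc, ← mul_pow, mul_comm (Ring.inverse _), ht, one_pow, mul_one]))
          (hg (x := algebraMap _ (P.R N) g * Ring.inverse (P.t N) ^ e) (by
          rw [mul_assoc, ← mul_pow, mul_comm (Ring.inverse _), ht, one_pow, mul_one]))
      | monomial n a =>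
        rw [← C_mul_X_pow_eq_monomial, map_mul, map_pow, hX,
          show algebraMap (WN p k N)[X] (P.R N) (C a) = algebraMap _ (P.R N) a
          from (IsScalarTower.algebraMap_apply _ _ _ _).symm]
        exact mul_mem (Subalgebra.algebraMap_mem _ _)
          (pow_mem (Algebra.subset_adjoin (by simp)) n)
    have hi : Ring.inverse (P.t N) ∈ P.chart1 N := Algebra.subset_adjoin (by simp)
    have : x = algebraMap (WN p k N)[X] (P.R N) f * Ring.inverse (P.t N) ^ e := by
      rw [← h, mul_assoc, ← mul_pow, ht, one_pow, mul_one]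
    rw [this]
    exact mul_mem hf (pow_mem hi e)

theorem algebraMap_mem_chart1 (f : (WN p k N)[X]) :
    algebraMap (WN p k N)[X] (P.R N) f ∈ P.chart1 N :=
  (mem_chart1_iff P N).2 ⟨f, 0, by simp⟩

theorem t_mem_chart1 : P.t N ∈ P.chart1 N := Algebra.subset_adjoin (by simp)

theorem invT_mem_chart1 : Ring.inverse (P.t N) ∈ P.chart1 N := Algebra.subset_adjoin (by simp)

theorem const_mem_chart1 (x : WittVector p k) : P.const N x ∈ P.chart1 N :=
  Subalgebra.algebraMap_mem _ _

theorem const_mem_chart2 (x : WittVector p k) : P.const N x ∈ P.chart2 N :=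
  Subalgebra.algebraMap_mem _ _

theorem s_mem_chart2 : P.s N ∈ P.chart2 N := Algebra.subset_adjoin (by simp)

theorem invS_mem_chart2 : Ring.inverse (P.s N) ∈ P.chart2 N := Algebra.subset_adjoin (by simp)

theorem t1_mul_invT1 : (P.t N - 1) * P.invT1 N = 1 := Ring.mul_inverse_cancel _ (isUnit_t1 P N)

theorem tlam_mul_invTlam : (P.t N - P.const N P.lam) * P.invTlam N = 1 :=
  Ring.mul_inverse_cancel _ (isUnit_tlam P N)

theorem invT1_mem_chart2 : P.invT1 N ∈ P.chart2 N := by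
  obtain ⟨c, hc⟩ := (one_sub_isUnit P).exists_left_inv
  have h := s_mul P N _ rfl
  have hc2 := congrArg (P.const N) hc
  have h1 := t1_mul_invT1 P N
  simp only [map_mul, map_sub, map_one] at hc2
  have e : P.invT1 N = P.const N c * (P.s N - 1) := by
    linear_combination (-P.invT1 N) * hc2 - P.const N c * P.invT1 N * h
      + P.const N c * (P.s N - 1) * h1
  rw [e]
  exact mul_mem (const_mem_chart2 P N c) (sub_mem (s_mem_chart2 P N) (one_mem _))

theorem invTlam_mem_chart2 : P.invTlam N ∈ P.chart2 N := by
  have h1 := t1_mul_invT1 P N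
  have h2 := tlam_mul_invTlam P N
  have h3 := Ring.mul_inverse_cancel _ (isUnit_s P N)
  have e : P.invTlam N = Ring.inverse (P.s N) * P.invT1 N := by
    have hs : P.s N = (P.t N - P.const N P.lam) * P.invT1 N := rfl
    have e : P.s N * P.invTlam N = P.invT1 N := by rw [hs]; linear_combination P.invT1 N * h2
    rw [← e, ← mul_assoc, mul_comm _ (P.s N), h3, one_mul]
  rw [e]
  exact mul_mem (invS_mem_chart2 P N) (invT1_mem_chart2 P N)

/-- The cocycle of `𝒪(1)`. -/
def Puncture.tau : P.R N := P.t N * P.invT1 N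

theorem tau_eq : P.tau N = 1 + P.invT1 N := by
  rw [Puncture.tau]; linear_combination t1_mul_invT1 P N

theorem tau_mem_chart2 : P.tau N ∈ P.chart2 N := by
  rw [tau_eq]; exact add_mem (one_mem _) (invT1_mem_chart2 P N)

theorem isUnit_tau : IsUnit (P.tau N) :=
  (isUnit_t P N).mul (isUnit_t1 P N).ringInverse

theorem t_mul_invTlam_mem_chart2 : P.t N * P.invTlam N ∈ P.chart2 N := by
  have e : P.t N * P.invTlam N = 1 + P.const N P.lam * P.invTlam N := by
    linear_combination tlam_mul_invTlam P N
  rw [e]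
  exact add_mem (one_mem _) (mul_mem (const_mem_chart2 P N _) (invTlam_mem_chart2 P N))

theorem mem_chart2_of_mul_kap_pow {x : P.R N} {f : (WN p k N)[X]} {i : ℕ}
    (hf : f.natDegree ≤ 2 * i)
    (h : x * algebraMap (WN p k N)[X] (P.R N) (P.kap N) ^ i = algebraMap _ (P.R N) f) :
    x ∈ P.chart2 N := by
  have h1 := t1_mul_invT1 P N
  have h2 := tlam_mul_invTlam P N
  rw [algebraMap_kap] at h
  have e : x = algebraMap _ (P.R N) f * (P.invT1 N * P.invTlam N) ^ i := by
    have : ((P.t N - 1) * (P.t N - P.const N P.lam)) * (P.invT1 N * P.invTlam N) = 1 := by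
      linear_combination (P.t N - P.const N P.lam) * P.invTlam N * h1 + h2
    rw [← h, mul_assoc, ← mul_pow, this, one_pow, mul_one]
  rw [e, f.as_sum_range_C_mul_X_pow' (n := 2 * i + 1) (by omega), map_sum, Finset.sum_mul]
  refine sum_mem fun j hj => ?_
  have hj2 : j ≤ 2 * i := by simpa [Nat.lt_succ_iff] using hj
  rw [map_mul, map_pow, mul_assoc]
  refine mul_mem ?_ ?_
  · rw [show algebraMap (WN p k N)[X] (P.R N) (C (f.coeff j)) = algebraMap _ (P.R N) (f.coeff j)
      from (IsScalarTower.algebraMap_apply _ _ _ _).symm]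
    exact Subalgebra.algebraMap_mem _ _
  · change P.t N ^ j * _ ∈ _
    have ha := invT1_mem_chart2 P N
    have hb := invTlam_mem_chart2 P N
    have hc := tau_mem_chart2 P N
    have hd := t_mul_invTlam_mem_chart2 P N
    rw [Puncture.tau] at hc
    rcases le_total j i with hji | hji
    · obtain ⟨l, rfl⟩ := Nat.exists_eq_add_of_le hji
      have : P.t N ^ j * (P.invT1 N * P.invTlam N) ^ (j + l)
          = (P.t N * P.invT1 N) ^ j * P.invT1 N ^ l * P.invTlam N ^ (j + l) := by ring
      rw [this]
      exact mul_mem (mul_mem (pow_mem hc _) (pow_mem ha _)) (pow_mem hb _)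
    · obtain ⟨l, rfl⟩ := Nat.exists_eq_add_of_le hji
      obtain ⟨q, rfl⟩ : ∃ q, i = l + q := ⟨i - l, by omega⟩
      have : P.t N ^ (l + q + l) * (P.invT1 N * P.invTlam N) ^ (l + q)
          = (P.t N * P.invT1 N) ^ (l + q) * (P.t N * P.invTlam N) ^ l * P.invTlam N ^ q := by ring
      rw [this]
      exact mul_mem (mul_mem (pow_mem hc _) (pow_mem hd _)) (pow_mem hb _)

theorem mem_chart2_iff {x : P.R N} : x ∈ P.chart2 N ↔
    ∃ (f : (WN p k N)[X]) (i : ℕ), f.natDegree ≤ 2 * i ∧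
      x * algebraMap (WN p k N)[X] (P.R N) (P.kap N) ^ i = algebraMap _ (P.R N) f := by
  refine ⟨fun hx => ?_, fun ⟨f, i, hf, h⟩ => mem_chart2_of_mul_kap_pow P N hf h⟩
  have hX : algebraMap (WN p k N)[X] (P.R N) X = P.t N := rfl
  have hs := s_mul P N _ rfl
  have hsi := Ring.mul_inverse_cancel _ (isUnit_s P N)
  have hk := natDegree_kap_le P N
  have hkp : ∀ (f : (WN p k N)[X]) (i j : ℕ), f.natDegree ≤ 2 * i →
      (f * P.kap N ^ j).natDegree ≤ 2 * (i + j) := fun f i j hf => by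
    refine natDegree_mul_le.trans ?_
    have := (natDegree_pow_le (p := P.kap N) (n := j)).trans (Nat.mul_le_mul_left j hk)
    omega
  induction hx using Algebra.adjoin_induction with
  | mem x hx =>
    rcases hx with rfl | rfl
    · refine ⟨(X - C (mkW p k N P.lam)) ^ 2, 1, by compute_degree, ?_⟩
      rw [pow_one, algebraMap_kap, map_pow, map_sub, algebraMap_C_mkW, hX]
      linear_combination (P.t N - P.const N P.lam) * hs
    · refine ⟨(X - C 1) ^ 2, 1, by compute_degree, ?_⟩
      rw [pow_one, algebraMap_kap, map_pow, map_sub, hX, C_1, map_one]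
      linear_combination (P.t N - 1) ^ 2 * hsi - (P.t N - 1) * Ring.inverse (P.s N) * hs
  | algebraMap r =>
    exact ⟨C r, 0, by simp, by rw [pow_zero, mul_one]
                               exact IsScalarTower.algebraMap_apply _ _ _ r⟩
  | add x y _ _ hx hy =>
    obtain ⟨f, i, hf, hx⟩ := hx
    obtain ⟨g, j, hg, hy⟩ := hy
    refine ⟨f * P.kap N ^ j + g * P.kap N ^ i, i + j, ?_, ?_⟩
    · refine (natDegree_add_le _ _).trans (max_le (hkp f i j hf) ?_)
      rw [add_comm i j]; exact hkp g j i hg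
    · rw [map_add, map_mul, map_mul, map_pow, map_pow, ← hx, ← hy]; ring
  | mul x y _ _ hx hy =>
    obtain ⟨f, i, hf, hx⟩ := hx
    obtain ⟨g, j, hg, hy⟩ := hy
    refine ⟨f * g, i + j, natDegree_mul_le.trans (by omega), ?_⟩
    rw [map_mul, ← hx, ← hy]; ring

/-- A function without poles outside `{0, ∞}` and without pole at `0` is a polynomial. -/
theorem exists_poly_of_mem_chart1 {x : P.R N} (hx : x ∈ P.chart1 N) {f : (WN p k N)[X]} {i : ℕ}
    (h : x * algebraMap (WN p k N)[X] (P.R N) (P.kap N) ^ i = algebraMap _ (P.R N) f) :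
    ∃ g : (WN p k N)[X], x = algebraMap _ (P.R N) g ∧ g * P.kap N ^ i = f := by
  have hX : algebraMap (WN p k N)[X] (P.R N) X = P.t N := rfl
  obtain ⟨g0, e, h0⟩ := (mem_chart1_iff P N).1 hx
  have e1 : g0 * P.kap N ^ i = X ^ e * f := by
    apply algebraMap_injective P N
    rw [map_mul, map_mul, ← h0, ← h, map_pow, map_pow, hX]; ring
  have e2 : X ^ e ∣ g0 :=
    ((isCoprime_X_kap P N).pow (m := e) (n := i)).dvd_of_dvd_mul_right (e1 ▸ dvd_mul_right _ _)
  obtain ⟨g, rfl⟩ := e2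
  have hg : x = algebraMap _ (P.R N) g := by
    apply ((isUnit_t P N).pow e).mul_right_cancel
    rw [h0, map_mul, map_pow, hX, mul_comm]
  refine ⟨g, hg, ?_⟩
  apply algebraMap_injective P N
  rw [map_mul, ← hg, map_pow, h]

/-- `H⁰(ℙ¹, 𝒪) = W_N`. -/
theorem exists_const_of_mem_charts {x : P.R N} (h1 : x ∈ P.chart1 N) (h2 : x ∈ P.chart2 N) :
    ∃ c, x = P.const N c := by
  obtain ⟨f, i, hf, h⟩ := (mem_chart2_iff P N).1 h2
  obtain ⟨g, hg, e⟩ := exists_poly_of_mem_chart1 P N h1 h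
  have hg0 : g.natDegree = 0 := by
    by_cases g0 : g = 0
    · simp [g0]
    · have := natDegree_mul_kap_pow P N g0 i
      rw [e] at this; omega
  obtain ⟨c, hc⟩ := mkW_surjective N (g.coeff 0)
  refine ⟨c, ?_⟩
  rw [hg, eq_C_of_natDegree_eq_zero hg0, ← hc, algebraMap_C_mkW]

/-- `H⁰(ℙ¹, 𝒪(-1)) = 0`. -/
theorem eq_zero_of_eq_tau_mul {x y : P.R N} (h1 : x ∈ P.chart1 N) (h2 : y ∈ P.chart2 N)
    (hxy : x = P.tau N * y) : x = 0 := by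
  have hX : algebraMap (WN p k N)[X] (P.R N) X = P.t N := rfl
  obtain ⟨f, i, hf, h⟩ := (mem_chart2_iff P N).1 h2
  have hl : algebraMap (WN p k N)[X] (P.R N) (X - C (mkW p k N P.lam))
      = P.t N - P.const N P.lam := by rw [map_sub, algebraMap_C_mkW, hX]
  have e0 : x * algebraMap (WN p k N)[X] (P.R N) (P.kap N) ^ (i + 1)
      = algebraMap _ (P.R N) (X * (X - C (mkW p k N P.lam)) * f) := by
    rw [map_mul, map_mul, ← h, hl, hX, hxy, Puncture.tau, pow_succ, algebraMap_kap]
    linear_combination P.t N * y * (P.t N - P.const N P.lam) *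
      ((P.t N - 1) * (P.t N - P.const N P.lam)) ^ i * t1_mul_invT1 P N
  obtain ⟨g, hg, e⟩ := exists_poly_of_mem_chart1 P N h1 e0
  -- `x` is regular on both charts, hence constant, and it vanishes at `t = 0`
  obtain ⟨c, hc⟩ := exists_const_of_mem_charts P N h1
    (hxy ▸ mul_mem (tau_mem_chart2 P N) h2)
  have hgc : g = C (mkW p k N c) := by
    apply algebraMap_injective P N
    rw [← hg, hc, algebraMap_C_mkW]
  have h0 := congrArg (eval 0) e
  rw [hgc] at h0
  simp only [Puncture.kap, eval_mul, eval_C, eval_pow, eval_sub, eval_X, eval_one, zero_sub,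
    zero_mul] at h0
  have hu : IsUnit ((-1 * -mkW p k N P.lam) ^ (i + 1)) := by
    rw [neg_one_mul, neg_neg]; exact (isUnit_mkW_lam P N).pow _
  have hc0 : mkW p k N c = 0 := hu.mul_left_eq_zero.1 h0
  rw [hg, hgc, hc0, C_0, map_zero]

/-- `H⁰(ℙ¹, 𝒪(1))` consists of the linear functions. -/
theorem exists_linear_of_mem_charts {x y : P.R N} (h1 : x ∈ P.chart1 N) (h2 : y ∈ P.chart2 N)
    (hxy : x = (P.t N - P.const N P.lam) * y) :
    ∃ a b, x = P.const N a * P.t N - P.const N b := by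
  have hX : algebraMap (WN p k N)[X] (P.R N) X = P.t N := rfl
  obtain ⟨f, i, hf, h⟩ := (mem_chart2_iff P N).1 h2
  have e0 : x * algebraMap (WN p k N)[X] (P.R N) (P.kap N) ^ i
      = algebraMap _ (P.R N) ((X - C (mkW p k N P.lam)) * f) := by
    rw [map_mul, ← h, hxy, map_sub, algebraMap_C_mkW, hX]; ring
  obtain ⟨g, hg, e⟩ := exists_poly_of_mem_chart1 P N h1 e0
  have hg0 : g.natDegree ≤ 1 := by
    by_cases g0 : g = 0
    · simp [g0]
    · have h3 := natDegree_mul_kap_pow P N g0 i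
      have h4 : ((X - C (mkW p k N P.lam)) * f).natDegree ≤ 1 + f.natDegree :=
        natDegree_mul_le.trans (Nat.add_le_add_right (natDegree_X_sub_C_le _) _)
      rw [e] at h3; omega
  obtain ⟨a, ha⟩ := mkW_surjective N (g.coeff 1)
  obtain ⟨b, hb⟩ := mkW_surjective N (g.coeff 0)
  refine ⟨a, -b, ?_⟩
  rw [hg, eq_X_add_C_of_natDegree_le_one hg0, ← ha, ← hb, map_add, map_mul, algebraMap_C_mkW,
    algebraMap_C_mkW, hX, map_neg, sub_neg_eq_add]

/-- `H¹(ℙ¹, 𝒪(-1)) = 0`. -/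
theorem exists_eq_add_tau_mul (x : P.R N) :
    ∃ y ∈ P.chart1 N, ∃ z ∈ P.chart2 N, x = y + P.tau N * z := by
  have hX : algebraMap (WN p k N)[X] (P.R N) X = P.t N := rfl
  obtain ⟨e, f, h⟩ := IsLocalization.Away.surj (P.poly N) x
  have hpoly : P.poly N = X * P.kap N := by rw [Puncture.poly, Puncture.kap, mul_assoc]
  rw [hpoly, ← map_pow, mul_pow, map_mul, map_pow, map_pow, hX] at h
  obtain ⟨α, β, hαβ⟩ := (isCoprime_X_kap P N).pow (m := e) (n := e)
  set K := algebraMap (WN p k N)[X] (P.R N) (P.kap N) with hK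
  have uK : IsUnit K := isUnit_kap P N
  have ut := isUnit_t P N
  have hm := (monic_kap P N).pow e
  -- the principal part at `0` and the polynomial part go to the first chart, the principal
  -- parts at `1` and `lam`, normalised to vanish at `0`, to the second
  set r := (f * α) %ₘ (P.kap N ^ e) with hr
  set q := (f * α) /ₘ (P.kap N ^ e) with hq
  have hdiv : r + P.kap N ^ e * q = f * α := modByMonic_add_div (f * α) (P.kap N ^ e)
  have hrdeg : r.natDegree ≤ 2 * e := by
    by_cases hs : Nontrivial (WN p k N)
    · have h3 := natDegree_mul_kap_pow P N (one_ne_zero) e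
      rw [one_mul, natDegree_one, zero_add] at h3
      have : r.natDegree ≤ _ := natDegree_modByMonic_le (f * α) hm
      omega
    · rw [not_nontrivial_iff_subsingleton] at hs
      rw [Subsingleton.elim r 0]; simp
  obtain ⟨d, hd⟩ := ((isUnit_mkW_lam P N).pow e).exists_left_inv
  have hk0 : (P.kap N ^ e).coeff 0 = mkW p k N P.lam ^ e := by
    rw [coeff_zero_eq_eval_zero]; simp [Puncture.kap]
  set c0 : WN p k N := r.coeff 0 * d with hc0
  obtain ⟨r', hr'⟩ : X ∣ r - C c0 * P.kap N ^ e := by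
    rw [X_dvd_iff, coeff_sub, coeff_C_mul, hk0, hc0, mul_assoc, hd, mul_one, sub_self]
  have hr'deg : (r' * (X - 1)).natDegree ≤ 2 * e := by
    by_cases h0 : r' = 0
    · simp [h0]
    have hs : Nontrivial (WN p k N) := by
      by_contra h
      rw [not_nontrivial_iff_subsingleton] at h
      exact h0 (Subsingleton.elim _ _)
    have h4 : (r - C c0 * P.kap N ^ e).natDegree ≤ 2 * e := by
      refine (natDegree_sub_le _ _).trans (max_le hrdeg ?_)
      refine (natDegree_C_mul_le _ _).trans ?_
      refine natDegree_pow_le.trans ?_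
      have := Nat.mul_le_mul_left e (natDegree_kap_le P N)
      omega
    rw [hr', natDegree_X_mul h0] at h4
    refine natDegree_mul_le.trans ?_
    have : (X - 1 : (WN p k N)[X]).natDegree ≤ 1 := by compute_degree
    omega
  have uKe := uK.pow e
  have ute := ut.pow e
  have iK := Ring.mul_inverse_cancel _ uKe
  have it := Ring.mul_inverse_cancel _ ute
  refine ⟨algebraMap _ _ (f * β) * Ring.inverse (P.t N ^ e) + algebraMap _ _ (q + C c0), ?_,
    algebraMap _ _ (r' * (X - 1)) * Ring.inverse (K ^ e), ?_, ?_⟩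
  · refine add_mem ((mem_chart1_iff P N).2 ⟨f * β, e, ?_⟩) (algebraMap_mem_chart1 P N _)
    rw [mul_assoc, mul_comm _ (P.t N ^ e), it, mul_one]
  · refine mem_chart2_of_mul_kap_pow P N hr'deg (i := e) ?_
    rw [← hK, mul_assoc, mul_comm _ (K ^ e), iK, mul_one]
  · apply (ute.mul uKe).mul_right_cancel
    rw [h]
    have e1 := congrArg (algebraMap (WN p k N)[X] (P.R N)) hαβ
    have e2 := congrArg (algebraMap (WN p k N)[X] (P.R N)) hdiv
    have e3 := congrArg (algebraMap (WN p k N)[X] (P.R N)) hr'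
    have ht1 := t1_mul_invT1 P N
    simp only [map_mul, map_add, map_sub, map_one, map_pow, ← hK, hX] at *
    rw [Puncture.tau]
    generalize algebraMap (WN p k N)[X] (P.R N) f = F at *
    generalize Ring.inverse (K ^ e) = iKe at *
    generalize Ring.inverse (P.t N ^ e) = ite at *
    generalize P.t N ^ e = te at *
    generalize K ^ e = Ke at *
    generalize P.invT1 N = v at *
    generalize P.t N = t at *
    linear_combination (-F) * e1 - te * e2 + te * e3 - F * algebraMap _ _ β * Ke * it
      - te * t * algebraMap _ _ r' * (v * (t - 1) * iK + ht1)

/-- `H¹(ℙ¹, 𝒪) = 0`. -/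
theorem exists_eq_add (x : P.R N) : ∃ y ∈ P.chart1 N, ∃ z ∈ P.chart2 N, x = y + z := by
  obtain ⟨y, hy, z, hz, h⟩ := exists_eq_add_tau_mul P N x
  exact ⟨y, hy, P.tau N * z, mul_mem (tau_mem_chart2 P N) hz, h⟩

theorem D_mem_chart1 {x : P.R N} (hx : x ∈ P.chart1 N) : P.D N x ∈ P.chart1 N := by
  induction hx using Algebra.adjoin_induction with
  | mem x hx =>
    rcases hx with rfl | rfl
    · rw [D_t]; exact one_mem _
    · rw [D_ringInverse _ _ (isUnit_t P N), D_t]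
      exact mul_mem (neg_mem (one_mem _)) (pow_mem (invT_mem_chart1 P N) 2)
  | algebraMap r => rw [← del_eq, del_algebraMap]; exact zero_mem _
  | add x y _ _ hx hy => rw [map_add]; exact add_mem hx hy
  | mul x y hx0 hy0 hx hy =>
    rw [Derivation.leibniz]; exact add_mem (mul_mem hx0 hy) (mul_mem hy0 hx)

/-- An ideal-like closure property: a log vector field maps the functions on the second chart to
multiples of the function `c` as soon as it does so for the generators. -/
theorem mul_D_mem_chart2 (c : P.R N)
    (h1 : c * P.D N (P.invT1 N) ∈ P.chart2 N)
    {x : P.R N} (hx : x ∈ P.chart2 N) : c * P.D N x ∈ P.chart2 N := by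
  have hs : P.D N (P.s N) = P.const N (1 - P.lam) * P.D N (P.invT1 N) := by
    have e : P.s N = 1 + P.const N (1 - P.lam) * P.invT1 N := by
      rw [Puncture.s, map_sub, map_one]; linear_combination t1_mul_invT1 P N
    rw [e, map_add, Derivation.map_one_eq_zero, Derivation.leibniz, D_const]; simp
  have hs2 : c * P.D N (P.s N) ∈ P.chart2 N := by
    rw [hs, mul_left_comm]; exact mul_mem (const_mem_chart2 P N _) h1
  induction hx using Algebra.adjoin_induction with
  | mem x hx =>
    rcases hx with rfl | rfl
    · exact hs2
    · rw [D_ringInverse _ _ (isUnit_s P N), ← mul_assoc, mul_neg]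
      exact mul_mem (neg_mem hs2) (pow_mem (invS_mem_chart2 P N) 2)
  | algebraMap r => rw [← del_eq, del_algebraMap, mul_zero]; exact zero_mem _
  | add x y _ _ hx hy => rw [map_add, mul_add]; exact add_mem hx hy
  | mul x y hx0 hy0 hx hy =>
    rw [Derivation.leibniz, mul_add, smul_eq_mul, smul_eq_mul, mul_left_comm, mul_left_comm c y]
    exact add_mem (mul_mem hx0 hy) (mul_mem hy0 hx)

theorem D_invT1 : P.D N (P.invT1 N) = - P.invT1 N ^ 2 := by
  rw [Puncture.invT1, D_ringInverse _ _ (isUnit_t1 P N), map_sub, D_t, Derivation.map_one_eq_zero]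
  ring

theorem t_mul_D_mem_chart2 {x : P.R N} (hx : x ∈ P.chart2 N) : P.t N * P.D N x ∈ P.chart2 N := by
  refine mul_D_mem_chart2 P N _ ?_ hx
  rw [D_invT1]
  have e : P.t N * -P.invT1 N ^ 2 = - (P.tau N * P.invT1 N) := by rw [Puncture.tau]; ring
  rw [e]
  exact neg_mem (mul_mem (tau_mem_chart2 P N) (invT1_mem_chart2 P N))

/-- `t ∂` maps the functions on the second chart to functions vanishing at `∞`. -/
theorem t_mul_D_mul_mem_chart2 {x : P.R N} (hx : x ∈ P.chart2 N) :
    (P.t N - 1) * (P.t N * P.D N x) ∈ P.chart2 N := by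
  rw [← mul_assoc]
  refine mul_D_mem_chart2 P N _ ?_ hx
  rw [D_invT1]
  have e : (P.t N - 1) * P.t N * -P.invT1 N ^ 2 = - P.tau N := by
    rw [Puncture.tau]; linear_combination (-P.t N * P.invT1 N) * t1_mul_invT1 P N
  rw [e]
  exact neg_mem (tau_mem_chart2 P N)

/-- Inverses of functions which are invertible up to multiples of `p` stay in a subalgebra. -/
theorem ringInverse_mem {S : Subalgebra (WN p k N) (P.R N)} {x y r : P.R N} (hx : x ∈ S)
    (hy : y ∈ S) (h : x * y = 1 + (p : P.R N) * r) : Ring.inverse x ∈ S := by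
  have hm : 1 - x * y ∈ S := sub_mem (one_mem _) (mul_mem hx hy)
  have h0 : (1 - x * y) ^ N = 0 := by
    rw [h]
    have : (1 - (1 + (p : P.R N) * r)) = (p : P.R N) * (-r) := by ring
    rw [this, mul_pow, natCast_p_nilpotent, zero_mul]
  have hg := mul_neg_geom_sum (1 - x * y) N
  rw [h0] at hg
  set g := ∑ i ∈ Finset.range N, (1 - x * y) ^ i with hgd
  have hgS : g ∈ S := sum_mem fun i _ => pow_mem hm i
  have hxu : x * (y * g) = 1 := by linear_combination hg
  have e : Ring.inverse x = y * g := by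
    have hu : IsUnit x := IsUnit.of_mul_eq_one _ hxu
    apply hu.mul_left_cancel
    rw [Ring.mul_inverse_cancel _ hu, hxu]
  rw [e]
  exact mul_mem hy hgS

end Charts

/-! ### Reduction modulo powers of `p` -/

section Reduction

variable {p : ℕ} [Fact p.Prime] {k : Type u} [Field k] [CharP k p] (P : Puncture p k) (N : ℕ)

theorem red_t : P.red N (P.t (N + 1)) = P.t N := by
  rw [Puncture.t, red_algebraMap, map_X]; rfl

theorem red_const (x : WittVector p k) : P.red N (P.const (N + 1) x) = P.const N x := by
  rw [← algebraMap_C_mkW, red_algebraMap, map_C, ← algebraMap_C_mkW]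
  rfl

theorem red_eval₂ (f : (WittVector p k)[X]) :
    P.red N (eval₂ (P.const (N + 1)) (P.t (N + 1)) f) = eval₂ (P.const N) (P.t N) f := by
  rw [hom_eval₂, red_t]
  congr 1
  exact RingHom.ext (red_const P N)

theorem red_D (f : P.R (N + 1)) : P.red N (P.D (N + 1) f) = P.D N (P.red N f) := by
  rw [← sub_eq_zero]
  refine R_derivation_ext P (N + 1) (P.red N)
    (fun f => P.red N (P.D (N + 1) f) - P.D N (P.red N f)) ?_ ?_ ?_ ?_ f
  · intro f g; simp only [map_add]; ring
  · intro f g; simp only [map_mul, Derivation.leibniz, smul_eq_mul, map_add]; ring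
  · intro x; simp only [D_const, red_const, map_zero, sub_zero]
  · simp only [D_t, red_t, map_one, sub_self]

theorem red_invT : P.red N (Ring.inverse (P.t (N + 1))) = Ring.inverse (P.t N) := by
  rw [ringHom_ringInverse _ (isUnit_t _ _), red_t]

theorem red_invT1 : P.red N (P.invT1 (N + 1)) = P.invT1 N := by
  rw [Puncture.invT1, ringHom_ringInverse _ (isUnit_t1 _ _), map_sub, red_t, map_one]; rfl

theorem red_invTlam : P.red N (P.invTlam (N + 1)) = P.invTlam N := by
  rw [Puncture.invTlam, ringHom_ringInverse _ (isUnit_tlam _ _), map_sub, red_t, red_const]; rfl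

theorem red_s : P.red N (P.s (N + 1)) = P.s N := by
  rw [Puncture.s, map_mul, map_sub, red_t, red_const, red_invT1]; rfl

theorem red_omega1 : P.red N (P.omega1 (N + 1)) = P.omega1 N := by
  rw [Puncture.omega1, map_mul, map_mul, red_const, red_invT1, red_invTlam]; rfl

theorem red_omega2 : P.red N (P.omega2 (N + 1)) = P.omega2 N := red_invT P N

theorem red_tau : P.red N (P.tau (N + 1)) = P.tau N := by
  rw [Puncture.tau, map_mul, red_t, red_invT1]; rfl

theorem red_algebraMap_W (a : WN p k (N + 1)) :
    P.red N (algebraMap _ (P.R (N + 1)) a) = algebraMap _ (P.R N) (redW p k N a) := by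
  obtain ⟨x, rfl⟩ := mkW_surjective (N + 1) a
  exact red_const P N x

theorem red_mem_chart1 {x : P.R (N + 1)} (hx : x ∈ P.chart1 (N + 1)) :
    P.red N x ∈ P.chart1 N := by
  induction hx using Algebra.adjoin_induction with
  | mem x hx =>
    rcases hx with rfl | rfl
    · rw [red_t]; exact t_mem_chart1 P N
    · rw [red_invT]; exact invT_mem_chart1 P N
  | algebraMap r => rw [red_algebraMap_W]; exact Subalgebra.algebraMap_mem _ _
  | add x y _ _ hx hy => rw [map_add]; exact add_mem hx hy
  | mul x y _ _ hx hy => rw [map_mul]; exact mul_mem hx hy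

theorem red_mem_chart2 {x : P.R (N + 1)} (hx : x ∈ P.chart2 (N + 1)) :
    P.red N x ∈ P.chart2 N := by
  induction hx using Algebra.adjoin_induction with
  | mem x hx =>
    rcases hx with rfl | rfl
    · rw [red_s]; exact s_mem_chart2 P N
    · rw [ringHom_ringInverse _ (isUnit_s _ _), red_s]; exact invS_mem_chart2 P N
  | algebraMap r => rw [red_algebraMap_W]; exact Subalgebra.algebraMap_mem _ _
  | add x y _ _ hx hy => rw [map_add]; exact add_mem hx hy
  | mul x y _ _ hx hy => rw [map_mul]; exact mul_mem hx hy

theorem exists_mem_chart1_red_eq {x : P.R N} (hx : x ∈ P.chart1 N) :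
    ∃ y ∈ P.chart1 (N + 1), P.red N y = x := by
  induction hx using Algebra.adjoin_induction with
  | mem x hx =>
    rcases hx with rfl | rfl
    · exact ⟨_, t_mem_chart1 P _, red_t P N⟩
    · exact ⟨_, invT_mem_chart1 P _, red_invT P N⟩
  | algebraMap r =>
    obtain ⟨x, rfl⟩ := mkW_surjective N r
    exact ⟨_, const_mem_chart1 P _ x, red_const P N x⟩
  | add x y _ _ hx hy =>
    obtain ⟨a, ha, rfl⟩ := hx
    obtain ⟨b, hb, rfl⟩ := hy
    exact ⟨a + b, add_mem ha hb, map_add _ _ _⟩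
  | mul x y _ _ hx hy =>
    obtain ⟨a, ha, rfl⟩ := hx
    obtain ⟨b, hb, rfl⟩ := hy
    exact ⟨a * b, mul_mem ha hb, map_mul _ _ _⟩

theorem exists_mem_chart2_red_eq {x : P.R N} (hx : x ∈ P.chart2 N) :
    ∃ y ∈ P.chart2 (N + 1), P.red N y = x := by
  induction hx using Algebra.adjoin_induction with
  | mem x hx =>
    rcases hx with rfl | rfl
    · exact ⟨_, s_mem_chart2 P _, red_s P N⟩
    · exact ⟨_, invS_mem_chart2 P _, by rw [ringHom_ringInverse _ (isUnit_s _ _), red_s]⟩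
  | algebraMap r =>
    obtain ⟨x, rfl⟩ := mkW_surjective N r
    exact ⟨_, const_mem_chart2 P _ x, red_const P N x⟩
  | add x y _ _ hx hy =>
    obtain ⟨a, ha, rfl⟩ := hx
    obtain ⟨b, hb, rfl⟩ := hy
    exact ⟨a + b, add_mem ha hb, map_add _ _ _⟩
  | mul x y _ _ hx hy =>
    obtain ⟨a, ha, rfl⟩ := hx
    obtain ⟨b, hb, rfl⟩ := hy
    exact ⟨a * b, mul_mem ha hb, map_mul _ _ _⟩

/-- The kernel of `R₁₂ / p ^ (N+1) → R₁₂ / p ^ N` is generated by `p ^ N`. -/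
theorem exists_eq_p_pow_mul_of_red_eq_zero {x : P.R (N + 1)} (h : P.red N x = 0) :
    ∃ y, x = (p : P.R (N + 1)) ^ N * y := by
  obtain ⟨n, f, hf⟩ := IsLocalization.Away.surj (P.poly (N + 1)) x
  obtain ⟨F, rfl⟩ := exists_poly_lift (N + 1) f
  have hu := (IsLocalization.Away.algebraMap_isUnit (S := P.R (N + 1)) (P.poly (N + 1))).pow n
  have h2 : algebraMap _ (P.R N) (F.map (mkW p k N)) = 0 := by
    rw [algebraMap_map_mkW, ← red_eval₂, ← algebraMap_map_mkW, ← hf, map_mul, h, zero_mul]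
  rw [map_eq_zero_iff _ (algebraMap_injective P N)] at h2
  have h3 : C ((p : WittVector p k) ^ N) ∣ F := by
    rw [C_dvd_iff_dvd_coeff]
    intro i
    have h4 := congrArg (fun g => coeff g i) h2
    simp only [coeff_map, coeff_zero] at h4
    rwa [Ideal.Quotient.eq_zero_iff_mem, Ideal.mem_span_singleton] at h4
  obtain ⟨G, rfl⟩ := h3
  rw [algebraMap_map_mkW, eval₂_mul, eval₂_C, map_pow, map_natCast] at hf
  refine ⟨eval₂ (P.const (N + 1)) (P.t (N + 1)) G *
    Ring.inverse (algebraMap _ (P.R (N + 1)) (P.poly (N + 1)) ^ n), ?_⟩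
  rw [← mul_assoc, ← hf, mul_assoc, Ring.mul_inverse_cancel _ hu, mul_one]

theorem red_lift (x : P.R N) : P.red N (P.lift N x) = x :=
  Function.surjInv_eq (red_surjective P N) x

theorem p_mul_eq_of_red_eq {x y : P.R (N + 1)} (h : P.red N x = P.red N y) :
    (p : P.R (N + 1)) * x = p * y := by
  obtain ⟨e, he⟩ := exists_eq_p_pow_mul_of_red_eq_zero P N
    (x := x - y) (by rw [map_sub, h, sub_self])
  have h2 := natCast_p_nilpotent P (N + 1)
  rw [pow_succ] at h2
  linear_combination (p : P.R (N + 1)) * he + e * h2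

theorem p_mul_lift (x : P.R (N + 1)) : (p : P.R (N + 1)) * P.lift N (P.red N x) = p * x :=
  p_mul_eq_of_red_eq P N (red_lift P N _)

theorem p_mul_lift_mem_chart1 {x : P.R N} (hx : x ∈ P.chart1 N) :
    (p : P.R (N + 1)) * P.lift N x ∈ P.chart1 (N + 1) := by
  obtain ⟨y, hy, rfl⟩ := exists_mem_chart1_red_eq P N hx
  rw [p_mul_lift]
  exact mul_mem (natCast_mem _ _) hy

theorem p_mul_lift_mem_chart2 {x : P.R N} (hx : x ∈ P.chart2 N) :
    (p : P.R (N + 1)) * P.lift N x ∈ P.chart2 (N + 1) := by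
  obtain ⟨y, hy, rfl⟩ := exists_mem_chart2_red_eq P N hx
  rw [p_mul_lift]
  exact mul_mem (natCast_mem _ _) hy

theorem isUnit_natCast {w : ℕ} (h : ¬ p ∣ w) : IsUnit (w : P.R N) := by
  have h : IsUnit (w : WittVector p k) := by
    apply WittVector.isUnit_of_coeff_zero_ne_zero
    intro h0
    have h2 : WittVector.constantCoeff (w : WittVector p k) = 0 := h0
    rw [map_natCast, CharP.cast_eq_zero_iff k p] at h2
    exact h h2
  simpa using h.map (P.const N)

theorem not_dvd_factorial_div (J : ℕ) :
    ¬ p ∣ J.factorial / p ^ padicValNat p J.factorial := by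
  rintro ⟨c, hc⟩
  apply pow_succ_padicValNat_not_dvd (p := p) (Nat.factorial_ne_zero J)
  have hd : p ^ padicValNat p J.factorial * (J.factorial / p ^ padicValNat p J.factorial)
    = J.factorial := Nat.mul_div_cancel' pow_padicValNat_dvd
  exact ⟨c, by rw [hc, ← mul_assoc, ← pow_succ] at hd; exact hd.symm⟩

theorem red_divPow (J : ℕ) : P.red N (P.divPow (N + 1) J) = P.divPow N J := by
  rw [Puncture.divPow, map_mul, map_pow, map_natCast,
    ringHom_ringInverse _ (isUnit_natCast P _ (not_dvd_factorial_div J)), map_natCast]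
  rfl

end Reduction

section ReductionFrobenius

variable {p : ℕ} [Fact p.Prime] {k : Type u} [Field k] [CharP k p] [PerfectRing k p]
  (P : Puncture p k) (N : ℕ) (hp : Odd p)

include hp in
theorem red_frobT1 : P.red N (P.frobT1 (N + 1)) = P.frobT1 N := by
  rw [Puncture.frobT1, map_mul, map_sub, map_pow, red_s, red_const,
    ringHom_ringInverse _ (isUnit_sp1 P _ hp), map_sub, map_pow, red_s, map_one]
  rfl

theorem red_Phi1 (f : P.R (N + 1)) :
    P.red N (P.Phi1 (N + 1) hp f) = P.Phi1 N hp (P.red N f) := by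
  have h : (P.red N).comp (P.Phi1 (N + 1) hp) = (P.Phi1 N hp).comp (P.red N) := by
    refine R_ringHom_ext (fun x => ?_) ?_
    · simp only [RingHom.comp_apply, Phi1_const, red_const]
    · simp only [RingHom.comp_apply, Phi1_t, red_t, red_frobT1 P N hp]
  exact congrArg (fun g => g f) h

theorem red_Phi2 (f : P.R (N + 1)) :
    P.red N (P.Phi2 (N + 1) hp f) = P.Phi2 N hp (P.red N f) := by
  have h : (P.red N).comp (P.Phi2 (N + 1) hp) = (P.Phi2 N hp).comp (P.red N) := by
    refine R_ringHom_ext (fun x => ?_) ?_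
    · simp only [RingHom.comp_apply, Phi2_const, red_const]
    · simp only [RingHom.comp_apply, Phi2_t, red_t, map_pow]
  exact congrArg (fun g => g f) h

theorem red_z : P.red N (P.z (N + 1) hp) = P.z N hp := by
  rw [Puncture.z, ← eval₂_den, map_mul, red_eval₂, ringHom_ringInverse _ (isUnit_den P _ hp),
    red_eval₂, eval₂_den]
  rfl

theorem Phi1_algebraMap (a : WN p k N) :
    ∃ b, P.Phi1 N hp (algebraMap (WN p k N) (P.R N) a) = algebraMap (WN p k N) (P.R N) b := by
  obtain ⟨x, rfl⟩ := mkW_surjective N a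
  exact ⟨_, Phi1_const P N hp x⟩

theorem Phi2_algebraMap (a : WN p k N) :
    ∃ b, P.Phi2 N hp (algebraMap (WN p k N) (P.R N) a) = algebraMap (WN p k N) (P.R N) b := by
  obtain ⟨x, rfl⟩ := mkW_surjective N a
  exact ⟨_, Phi2_const P N hp x⟩

/-- The Frobenius lift `Φ₁` extends to `U₁`: modulo `p` the numerator of `Φ₁(t)` is a constant multiple
of `t ^ p` and the denominator is constant, so that both are invertible up to multiples of `p`. -/
theorem Phi1_mem_chart1 {x : P.R N} (hx : x ∈ P.chart1 N) : P.Phi1 N hp x ∈ P.chart1 N := by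
  obtain ⟨r1, h1⟩ := exists_sub_pow hp (P.t N) (P.const N P.lam)
  obtain ⟨r2, h2⟩ := exists_sub_pow hp (P.t N) 1
  obtain ⟨d, hd⟩ := exists_frobenius_eq P.lam
  obtain ⟨c, hc⟩ := (one_sub_frobenius_isUnit P N).exists_left_inv
  have hd2 := congrArg (P.const N) hd
  simp only [map_add, map_mul, map_pow, map_natCast, map_sub, map_one] at hd2 hc
  have hcm : c ∈ P.chart1 N := by
    obtain ⟨e, he⟩ := ((one_sub_isUnit P).map
      (WittVector.frobenius : WittVector p k →+* WittVector p k)).exists_left_inv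
    have he2 := congrArg (P.const N) he
    simp only [map_mul, map_sub, map_one] at he2
    have : c = P.const N e := by linear_combination c * he2 * (-1) + P.const N e * hc
    rw [this]; exact const_mem_chart1 P N e
  have htm := t_mem_chart1 P N
  have him := invT_mem_chart1 P N
  have hti := Ring.mul_inverse_cancel _ (isUnit_t P N)
  have hT := Phi1_t_mul_den P N hp
  set D := eval₂ (P.const N) (P.t N) P.den with hD
  set T := eval₂ (P.const N) (P.t N) P.numT with hT0
  have hDe : D = (P.t N - P.const N P.lam) ^ p - (P.t N - 1) ^ p := eval₂_den P N
  have hTe : T = (P.t N - P.const N P.lam) ^ p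
      - P.const N (WittVector.frobenius P.lam) * (P.t N - 1) ^ p := by
    simp only [hT0, Puncture.numT, eval₂_sub, eval₂_mul, eval₂_pow, eval₂_X, eval₂_C, eval₂_one]
  have hDm : D ∈ P.chart1 N := by rw [hD, ← algebraMap_map_mkW]; exact algebraMap_mem_chart1 _ _ _
  have hTm : T ∈ P.chart1 N := by rw [hT0, ← algebraMap_map_mkW]; exact algebraMap_mem_chart1 _ _ _
  have hDi : Ring.inverse D ∈ P.chart1 N := by
    refine ringInverse_mem P N hDm hcm (r := (r1 - r2 + P.const N d) * c) ?_
    rw [hDe, h1, h2, one_pow]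
    linear_combination hc + c * hd2
  have htp : P.t N ^ p * Ring.inverse (P.t N) ^ p = 1 := by rw [← mul_pow, hti, one_pow]
  have hTi : Ring.inverse T ∈ P.chart1 N := by
    refine ringInverse_mem P N hTm (mul_mem hcm (pow_mem him p))
      (r := (r1 - P.const N (WittVector.frobenius P.lam) * r2 + P.const N d) *
        (c * Ring.inverse (P.t N) ^ p)) ?_
    rw [hTe, h1, h2, one_pow]
    linear_combination htp + P.t N ^ p * Ring.inverse (P.t N) ^ p * hc
      + c * Ring.inverse (P.t N) ^ p * hd2
  have hDu : IsUnit D := isUnit_den P N hp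
  have hPt : P.Phi1 N hp (P.t N) = T * Ring.inverse D := by
    rw [← hT, mul_assoc, Ring.mul_inverse_cancel _ hDu, mul_one]
  have hPu : IsUnit (P.Phi1 N hp (P.t N)) := (isUnit_t P N).map _
  have hTu : IsUnit T := by rw [← hT]; exact hPu.mul hDu
  induction hx using Algebra.adjoin_induction with
  | mem x hx =>
    rcases hx with rfl | rfl
    · rw [hPt]; exact mul_mem hTm hDi
    · rw [ringHom_ringInverse _ (isUnit_t P N)]
      have : Ring.inverse (P.Phi1 N hp (P.t N)) = D * Ring.inverse T := by
        apply hPu.mul_left_cancel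
        rw [Ring.mul_inverse_cancel _ hPu, ← mul_assoc, hT, Ring.mul_inverse_cancel _ hTu]
      rw [this]; exact mul_mem hDm hTi
  | algebraMap r =>
    obtain ⟨b, hb⟩ := Phi1_algebraMap P N hp r
    rw [hb]; exact Subalgebra.algebraMap_mem _ _
  | add x y _ _ hx hy => rw [map_add]; exact add_mem hx hy
  | mul x y _ _ hx hy => rw [map_mul]; exact mul_mem hx hy

/-- The Frobenius lift `Φ₂` extends to `U₂`. -/
theorem Phi2_mem_chart2 {x : P.R N} (hx : x ∈ P.chart2 N) : P.Phi2 N hp x ∈ P.chart2 N := by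
  obtain ⟨r1, h1⟩ := exists_sub_pow hp (P.t N) (P.const N P.lam)
  obtain ⟨r2, h2⟩ := exists_sub_pow hp (P.t N) 1
  obtain ⟨d, hd⟩ := exists_frobenius_eq P.lam
  have hd2 := congrArg (P.const N) hd
  simp only [map_add, map_mul, map_pow, map_natCast] at hd2
  have hv := t1_mul_invT1 P N
  have htau := tau_mem_chart2 P N
  have hvm := invT1_mem_chart2 P N
  have hsm := s_mem_chart2 P N
  have hsim := invS_mem_chart2 P N
  have hsi := Ring.mul_inverse_cancel _ (isUnit_s P N)
  have hvp : (P.t N - 1) ^ p * P.invT1 N ^ p = 1 := by rw [← mul_pow, hv, one_pow]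
  have hsp : P.s N ^ p * Ring.inverse (P.s N) ^ p = 1 := by rw [← mul_pow, hsi, one_pow]
  have hs : P.s N ^ p = (P.t N - P.const N P.lam) ^ p * P.invT1 N ^ p := by
    rw [← mul_pow]; rfl
  -- numerator and denominator of `Φ₂(s)`, divided by `(t - 1) ^ p`
  set A := (P.t N ^ p - P.const N (WittVector.frobenius P.lam)) * P.invT1 N ^ p with hA
  set B := (P.t N ^ p - 1) * P.invT1 N ^ p with hB
  have hAm : A ∈ P.chart2 N := by
    have : A = P.tau N ^ p - P.const N (WittVector.frobenius P.lam) * P.invT1 N ^ p := by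
      rw [hA, Puncture.tau, mul_pow]; ring
    rw [this]
    exact sub_mem (pow_mem htau p) (mul_mem (const_mem_chart2 P N _) (pow_mem hvm p))
  have hBm : B ∈ P.chart2 N := by
    have : B = P.tau N ^ p - P.invT1 N ^ p := by rw [hB, Puncture.tau, mul_pow]; ring
    rw [this]
    exact sub_mem (pow_mem htau p) (pow_mem hvm p)
  have hBi : Ring.inverse B ∈ P.chart2 N := by
    refine ringInverse_mem P N hBm (one_mem _) (r := -r2 * P.invT1 N ^ p) ?_
    rw [one_pow] at h2
    rw [hB]; linear_combination hvp - P.invT1 N ^ p * h2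
  have hAi : Ring.inverse A ∈ P.chart2 N := by
    refine ringInverse_mem P N hAm (pow_mem hsim p)
      (r := (-r1 - P.const N d) * P.invT1 N ^ p * Ring.inverse (P.s N) ^ p) ?_
    rw [hA]
    linear_combination hsp - Ring.inverse (P.s N) ^ p * hs
      - P.invT1 N ^ p * Ring.inverse (P.s N) ^ p * (h1 + hd2)
  have u1 : IsUnit (P.Phi2 N hp (P.t N - 1)) := (isUnit_t1 P N).map _
  have ul : IsUnit (P.Phi2 N hp (P.t N - P.const N P.lam)) := (isUnit_tlam P N).map _
  have uv : IsUnit (P.invT1 N ^ p) := (isUnit_t1 P N).ringInverse.pow p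
  have e1 : P.Phi2 N hp (P.t N - 1) = P.t N ^ p - 1 := by rw [map_sub, Phi2_t, map_one]
  have el : P.Phi2 N hp (P.t N - P.const N P.lam)
      = P.t N ^ p - P.const N (WittVector.frobenius P.lam) := by
    rw [map_sub, Phi2_t, Phi2_const]
  have uB : IsUnit B := by rw [hB, ← e1]; exact u1.mul uv
  have uA : IsUnit A := by rw [hA, ← el]; exact ul.mul uv
  have hsB : P.Phi2 N hp (P.s N) * B = A := by
    have h := congrArg (P.Phi2 N hp) (s_mul P N _ rfl)
    rw [map_mul, e1, el] at h
    rw [hA, hB, ← h]; ring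
  have hPu : IsUnit (P.Phi2 N hp (P.s N)) := (isUnit_s P N).map _
  induction hx using Algebra.adjoin_induction with
  | mem x hx =>
    rcases hx with rfl | rfl
    · have : P.Phi2 N hp (P.s N) = A * Ring.inverse B := by
        rw [← hsB, mul_assoc, Ring.mul_inverse_cancel _ uB, mul_one]
      rw [this]; exact mul_mem hAm hBi
    · rw [ringHom_ringInverse _ (isUnit_s P N)]
      have : Ring.inverse (P.Phi2 N hp (P.s N)) = B * Ring.inverse A := by
        apply hPu.mul_left_cancel
        rw [Ring.mul_inverse_cancel _ hPu, ← mul_assoc, hsB, Ring.mul_inverse_cancel _ uA]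
      rw [this]; exact mul_mem hBm hAi
  | algebraMap r =>
    obtain ⟨b, hb⟩ := Phi2_algebraMap P N hp r
    rw [hb]; exact Subalgebra.algebraMap_mem _ _
  | add x y _ _ hx hy => rw [map_add]; exact add_mem hx hy
  | mul x y _ _ hx hy => rw [map_mul]; exact mul_mem hx hy

end ReductionFrobenius

/-! ### The divided powers of `p` -/

section DividedPowers

variable {p : ℕ} [Fact p.Prime] {k : Type u} [Field k] [CharP k p]

variable (p k) in
/-- The Witt vector `p ^ (J-1) / J!` for `J ≥ 1`. -/
def divW (J : ℕ) : WittVector p k :=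
  (p : WittVector p k) ^ (J - 1 - padicValNat p J.factorial)
    * Ring.inverse ((J.factorial / p ^ padicValNat p J.factorial : ℕ) : WittVector p k)

variable (p k) in
/-- The Witt vector `p ^ J / J!`. -/
def powW (J : ℕ) : WittVector p k := if J = 0 then 1 else p * divW p k J

theorem isUnit_natCast_W {w : ℕ} (h : ¬ p ∣ w) : IsUnit (w : WittVector p k) := by
  apply WittVector.isUnit_of_coeff_zero_ne_zero
  intro h0
  have h2 : WittVector.constantCoeff (w : WittVector p k) = 0 := h0
  rw [map_natCast, CharP.cast_eq_zero_iff k p] at h2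
  exact h h2

theorem factorial_mul_divW (J : ℕ) (hJ : J ≠ 0) :
    (J.factorial : WittVector p k) * divW p k J = (p : WittVector p k) ^ (J - 1) := by
  have hu : IsUnit ((J.factorial / p ^ padicValNat p J.factorial : ℕ) : WittVector p k) :=
    isUnit_natCast_W (not_dvd_factorial_div J)
  have hd : p ^ padicValNat p J.factorial * (J.factorial / p ^ padicValNat p J.factorial)
    = J.factorial := Nat.mul_div_cancel' pow_padicValNat_dvd
  have hd2 := congrArg (Nat.cast (R := WittVector p k)) hd
  push_cast at hd2
  have hle : padicValNat p J.factorial + (J - 1 - padicValNat p J.factorial) = J - 1 := by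
    have := padicValNat_factorial_le (p := p) J hJ
    omega
  rw [← hd2, divW, mul_mul_mul_comm, ← pow_add, hle, Ring.mul_inverse_cancel _ hu, mul_one]

theorem factorial_mul_powW (J : ℕ) :
    (J.factorial : WittVector p k) * powW p k J = (p : WittVector p k) ^ J := by
  rw [powW]
  split_ifs with h
  · simp [h]
  · rw [mul_left_comm, factorial_mul_divW J h, ← pow_succ', Nat.sub_add_cancel (by omega)]

theorem factorial_ne_zero_W (J : ℕ) : (J.factorial : WittVector p k) ≠ 0 := by
  intro h
  have h2 := factorial_mul_powW (p := p) (k := k) J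
  rw [h, zero_mul] at h2
  exact pow_ne_zero J (WittVector.p_nonzero p k) h2.symm

theorem powW_mul_choose (i j : ℕ) :
    powW p k (i + j) * ((i + j).choose i : ℕ) = powW p k i * powW p k j := by
  apply mul_left_cancel₀ (factorial_ne_zero_W i)
  apply mul_left_cancel₀ (factorial_ne_zero_W j)
  have h := congrArg (Nat.cast (R := WittVector p k))
    (Nat.add_choose_mul_factorial_mul_factorial i j)
  rw [← Nat.choose_symm_add] at h
  push_cast at h
  linear_combination powW p k (i + j) * h + factorial_mul_powW (p := p) (k := k) (i + j)
    - (j.factorial : WittVector p k) * powW p k j * factorial_mul_powW (p := p) (k := k) i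
    - (p : WittVector p k) ^ i * factorial_mul_powW (p := p) (k := k) j

theorem divW_mul_choose (i j : ℕ) (hi : i ≠ 0) :
    divW p k (i + j) * ((i + j).choose i : ℕ) = divW p k i * powW p k j := by
  apply mul_left_cancel₀ (factorial_ne_zero_W i)
  apply mul_left_cancel₀ (factorial_ne_zero_W j)
  have h := congrArg (Nat.cast (R := WittVector p k))
    (Nat.add_choose_mul_factorial_mul_factorial i j)
  rw [← Nat.choose_symm_add] at h
  push_cast at h
  have h1 := factorial_mul_divW (p := p) (k := k) (i + j) (by omega)
  have h2 := factorial_mul_divW (p := p) (k := k) i hi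
  have h3 := factorial_mul_powW (p := p) (k := k) j
  have e : i + j - 1 = i - 1 + j := by omega
  rw [e, pow_add] at h1
  linear_combination divW p k (i + j) * h + h1
    - (j.factorial : WittVector p k) * powW p k j * h2 - (p : WittVector p k) ^ (i - 1) * h3

theorem succ_mul_divW (J : ℕ) : ((J : WittVector p k) + 1) * divW p k (J + 1) = powW p k J := by
  apply mul_left_cancel₀ (factorial_ne_zero_W J)
  have h := factorial_mul_divW (p := p) (k := k) (J + 1) (by omega)
  rw [Nat.factorial_succ, Nat.add_sub_cancel] at h
  push_cast at h
  linear_combination h - factorial_mul_powW (p := p) (k := k) J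

omit [CharP k p] in
/-- For odd `p` and `J ≥ 2` the valuation of `J!` is less than `J - 1`. -/
theorem exists_divW_eq (hp : Odd p) {J : ℕ} (hJ : 2 ≤ J) : ∃ d, divW p k J = p * d := by
  have h := sub_one_mul_padicValNat_factorial_lt_of_ne_zero (p := p) (n := J) (by omega)
  have h2 : 2 ≤ p - 1 := by
    have h2 := (Fact.out : p.Prime).two_le
    obtain ⟨m, hm⟩ := hp
    omega
  have h3 := Nat.mul_le_mul_right (padicValNat p J.factorial) h2
  obtain ⟨c, hc⟩ : ∃ c, J - 1 - padicValNat p J.factorial = c + 1 :=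
    ⟨J - 1 - padicValNat p J.factorial - 1, by omega⟩
  rw [divW, hc, pow_succ']
  exact ⟨_, mul_assoc _ _ _⟩

variable (P : Puncture p k) (N : ℕ)

theorem divPow_eq_const (J : ℕ) : P.divPow N J = P.const N (divW p k J) := by
  rw [divW, map_mul, map_pow, map_natCast,
    ringHom_ringInverse _ (isUnit_natCast_W (not_dvd_factorial_div J)), map_natCast]
  rfl

/-- The element `p ^ J / J!` of `R₁₂`. -/
def Puncture.powDiv (J : ℕ) : P.R N := P.const N (powW p k J)

theorem powDiv_zero : P.powDiv N 0 = 1 := by simp [Puncture.powDiv, powW]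

theorem powDiv_eq {J : ℕ} (hJ : J ≠ 0) : P.powDiv N J = p * P.divPow N J := by
  rw [Puncture.powDiv, powW, if_neg hJ, map_mul, map_natCast, divPow_eq_const]

theorem powDiv_mul_choose (i j : ℕ) :
    P.powDiv N (i + j) * ((i + j).choose i : ℕ) = P.powDiv N i * P.powDiv N j := by
  simpa [Puncture.powDiv] using congrArg (P.const N) (powW_mul_choose (p := p) (k := k) i j)

theorem divPow_mul_choose (i j : ℕ) (hi : i ≠ 0) :
    P.divPow N (i + j) * ((i + j).choose i : ℕ) = P.divPow N i * P.powDiv N j := by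
  simpa [Puncture.powDiv, divPow_eq_const] using
    congrArg (P.const N) (divW_mul_choose (p := p) (k := k) i j hi)

theorem succ_mul_divPow (J : ℕ) :
    ((J : P.R N) + 1) * P.divPow N (J + 1) = P.powDiv N J := by
  simpa [Puncture.powDiv, divPow_eq_const] using
    congrArg (P.const N) (succ_mul_divW (p := p) (k := k) J)

theorem divPow_one : P.divPow N 1 = 1 := by
  have h := succ_mul_divPow P N 0
  rwa [Nat.cast_zero, zero_add, zero_add, one_mul, powDiv_zero] at h

theorem powDiv_eq_zero (hp : Odd p) {J : ℕ} (hJ : 2 * N < J) : P.powDiv N J = 0 := by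
  rw [powDiv_eq P N (by omega), divPow_eq_zero P N hp J hJ, mul_zero]

end DividedPowers

/-! ### The Taylor formula -/

/-- The product of two polynomials in a central element `z`, if the coefficients of the factors and
of the product vanish from degree `K` on. -/
theorem sum_pow_smul_mul_sum {R A : Type*} [CommRing R] [Ring A] [Algebra R A] (z : R)
    (a b : ℕ → A) (K : ℕ) (ha : ∀ i, K ≤ i → a i = 0) (hb : ∀ i, K ≤ i → b i = 0)
    (hab : ∀ J, K ≤ J → ∑ x ∈ antidiagonal J, a x.1 * b x.2 = 0) :
    (∑ i ∈ Finset.range K, z ^ i • a i) * (∑ i ∈ Finset.range K, z ^ i • b i)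
      = ∑ J ∈ Finset.range K, z ^ J • ∑ x ∈ antidiagonal J, a x.1 * b x.2 := by
  have key : ∀ c : ℕ → A, (∀ i, K ≤ i → c i = 0) → ∃ f : A[X], (∀ i, f.coeff i = c i) ∧
      f.eval (algebraMap R A z) = ∑ i ∈ Finset.range K, z ^ i • c i := by
    intro c hc
    refine ⟨∑ i ∈ Finset.range K, monomial i (c i), fun i => ?_, ?_⟩
    · rw [finsetSum_coeff]
      simp only [coeff_monomial]
      rw [Finset.sum_ite_eq']
      split_ifs with h
      · rfl
      · rw [hc i (by simpa using h)]
    · rw [eval_finsetSum]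
      refine Finset.sum_congr rfl fun i _ => ?_
      rw [eval_monomial, ← map_pow, Algebra.smul_def, Algebra.commutes]
  obtain ⟨f, hf, hf2⟩ := key a ha
  obtain ⟨g, hg, hg2⟩ := key b hb
  obtain ⟨h, hh, hh2⟩ := key _ hab
  rw [← hf2, ← hg2, ← hh2]
  have e : h = f * g := by
    ext J
    rw [hh, coeff_mul]
    simp only [hf, hg]
  rw [e]
  exact (eval₂_mul_noncomm (RingHom.id A) _ fun i => (Algebra.commutes (A := A) z _).symm).symm

section Taylor

variable {p : ℕ} [Fact p.Prime] {k : Type u} [Field k] [CharP k p] [PerfectRing k p]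
  (P : Puncture p k) (N : ℕ) (hp : Odd p)

omit [PerfectRing k p] in
theorem iterate_D_mul (J : ℕ) (f g : P.R N) :
    (P.D N)^[J] (f * g) = ∑ x ∈ antidiagonal J,
      J.choose x.1 • ((P.D N)^[x.1] f * (P.D N)^[x.2] g) := by
  induction J with
  | zero => simp
  | succ J ih =>
    rw [Function.iterate_succ_apply', ih, map_sum,
      Finset.sum_antidiagonal_choose_succ_nsmul
        (fun i j => (P.D N)^[i] f * (P.D N)^[j] g), ← Finset.sum_add_distrib]
    refine Finset.sum_congr rfl fun x hx => ?_
    rw [map_nsmul, Derivation.leibniz, nsmul_add, ← Function.iterate_succ_apply' (P.D N),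
      ← Function.iterate_succ_apply' (P.D N), smul_eq_mul, smul_eq_mul, mul_comm ((P.D N)^[x.2] g)]
    congr 2
    rw [← Finset.HasAntidiagonal.mem_antidiagonal.1 hx]
    exact Nat.choose_symm_add

/-- The right hand side of the Taylor formula is multiplicative because
`p ^ J / J! * J.choose i = p ^ i / i! * (p ^ j / j!)`. -/
def Puncture.taylorHom : P.R N →+* P.R N where
  toFun f := ∑ J ∈ Finset.range (2 * N + 1),
    P.z N hp ^ J • P.Phi2 N hp (P.powDiv N J * (P.D N)^[J] f)
  map_zero' := by
    refine Finset.sum_eq_zero fun J _ => ?_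
    rw [iterate_map_zero, mul_zero, map_zero, smul_zero]
  map_add' f g := by
    rw [← Finset.sum_add_distrib]
    refine Finset.sum_congr rfl fun J _ => ?_
    rw [iterate_map_add, mul_add, map_add, smul_add]
  map_one' := by
    have h0 : ∀ J, (P.D N)^[J + 1] 1 = 0 := fun J => by
      rw [Function.iterate_succ_apply, Derivation.map_one_eq_zero, iterate_map_zero]
    rw [Finset.sum_range_succ', Finset.sum_eq_zero fun J _ => by
      rw [h0, mul_zero, map_zero, smul_zero]]
    simp [powDiv_zero]
  map_mul' f g := by
    have h0 : ∀ (h : P.R N) (J : ℕ), 2 * N + 1 ≤ J →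
        P.Phi2 N hp (P.powDiv N J * (P.D N)^[J] h) = 0 := fun h J hJ => by
      rw [powDiv_eq_zero P N hp (by omega), zero_mul, map_zero]
    have h1 : ∀ J, ∑ x ∈ antidiagonal J,
        P.Phi2 N hp (P.powDiv N x.1 * (P.D N)^[x.1] f) *
          P.Phi2 N hp (P.powDiv N x.2 * (P.D N)^[x.2] g)
        = P.Phi2 N hp (P.powDiv N J * (P.D N)^[J] (f * g)) := fun J => by
      rw [iterate_D_mul, Finset.mul_sum, map_sum]
      refine Finset.sum_congr rfl fun x hx => ?_
      rw [← map_mul, ← Finset.HasAntidiagonal.mem_antidiagonal.1 hx]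
      congr 1
      rw [nsmul_eq_mul]
      linear_combination (-(P.D N)^[x.1] f * (P.D N)^[x.2] g) * powDiv_mul_choose P N x.1 x.2
    rw [sum_pow_smul_mul_sum (P.z N hp) (fun i => P.Phi2 N hp (P.powDiv N i * (P.D N)^[i] f))
      (fun i => P.Phi2 N hp (P.powDiv N i * (P.D N)^[i] g)) (2 * N + 1) (h0 f) (h0 g)
      (fun J hJ => by rw [h1, h0 _ J hJ])]
    simp only [h1]

/-- Both sides agree on the constants and on `t`, where the Taylor series has two terms. -/
theorem taylorHom_eq : P.taylorHom N hp = P.Phi1 N hp := by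
  refine R_ringHom_ext (fun x => ?_) ?_
  · change ∑ J ∈ Finset.range (2 * N + 1), _ = _
    have h0 : ∀ J, (P.D N)^[J + 1] (P.const N x) = 0 := fun J => by
      rw [Function.iterate_succ_apply, D_const, iterate_map_zero]
    rw [Finset.sum_range_succ', Finset.sum_eq_zero fun J _ => by
      rw [h0, mul_zero, map_zero, smul_zero]]
    simp [powDiv_zero, Phi1_const, Phi2_const]
  · change ∑ J ∈ Finset.range (2 * N + 1), _ = _
    have h0 : ∀ J, (P.D N)^[J + 2] (P.t N) = 0 := fun J => by
      rw [Function.iterate_add_apply, Function.iterate_succ_apply, Function.iterate_one, D_t,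
        Derivation.map_one_eq_zero, iterate_map_zero]
    rcases Nat.eq_zero_or_pos N with hN | hN
    · subst hN
      have : (1 : P.R 0) = 0 := by simpa using natCast_p_nilpotent P 0
      exact eq_of_zero_eq_one this.symm _ _
    obtain ⟨K, hK⟩ : ∃ K, 2 * N + 1 = K + 2 := ⟨2 * N - 1, by omega⟩
    rw [hK, Finset.sum_range_succ', Finset.sum_range_succ', Finset.sum_eq_zero fun J _ => by
      rw [h0, mul_zero, map_zero, smul_zero]]
    have := p_mul_z P N hp
    rw [zero_add, zero_add, pow_one, Function.iterate_one, D_t, powDiv_eq P N one_ne_zero,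
      divPow_one, powDiv_zero]
    simp only [map_mul, map_natCast, map_one, pow_zero, Function.iterate_zero, id, smul_eq_mul]
    linear_combination this

/-- The Taylor formula `Φ₁(f) = ∑ ((Φ₁(t) - Φ₂(t)) / p) ^ J Φ₂(p ^ J / J! ∂ ^ J f)`. -/
theorem Phi1_eq_sum (f : P.R N) :
    P.Phi1 N hp f = ∑ J ∈ Finset.range (2 * N + 1),
      P.z N hp ^ J • P.Phi2 N hp (P.powDiv N J * (P.D N)^[J] f) := by
  rw [← taylorHom_eq]; rfl

end Taylor

/-! ### Iterated connections and the Taylor gluing -/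

section Iterates

variable {p : ℕ} [Fact p.Prime] {k : Type u} [Field k] [CharP k p] (P : Puncture p k) (N : ℕ)

/-- The derivation `∂` on the entries of a matrix, as an additive map. -/
def Puncture.DM : Matrix (Fin 2) (Fin 2) (P.R N) →+ Matrix (Fin 2) (Fin 2) (P.R N) :=
  AddMonoidHom.mapMatrix (P.D N : P.R N →+ P.R N)

theorem DM_apply (M : Matrix (Fin 2) (Fin 2) (P.R N)) (i j : Fin 2) :
    P.DM N M i j = P.D N (M i j) := rfl

theorem DM_mul (A B : Matrix (Fin 2) (Fin 2) (P.R N)) :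
    P.DM N (A * B) = P.DM N A * B + A * P.DM N B := map_del_mul P N A B

theorem DM_smul (a : P.R N) (M : Matrix (Fin 2) (Fin 2) (P.R N)) :
    P.DM N (a • M) = P.D N a • M + a • P.DM N M := by
  ext i j
  simp only [DM_apply, Matrix.smul_apply, Matrix.add_apply, smul_eq_mul, Derivation.leibniz]
  ring

theorem DM_one : P.DM N 1 = 0 := map_del_one P N

theorem iterate_DM_apply (J : ℕ) (M : Matrix (Fin 2) (Fin 2) (P.R N)) (i j : Fin 2) :
    (P.DM N)^[J] M i j = (P.D N)^[J] (M i j) := by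
  induction J generalizing M with
  | zero => rfl
  | succ J ih => rw [Function.iterate_succ_apply, ih, DM_apply, Function.iterate_succ_apply]

variable {P N}

/-- The covariant derivative `v ↦ ∂ v + B v`. -/
def nab (B v : Matrix (Fin 2) (Fin 2) (P.R N)) : Matrix (Fin 2) (Fin 2) (P.R N) :=
  P.DM N v + B * v

theorem iterConn_succ (B : Matrix (Fin 2) (Fin 2) (P.R N)) (J : ℕ) :
    iterConn B (J + 1) = nab B (iterConn B J) := rfl

theorem iterConn_eq (B : Matrix (Fin 2) (Fin 2) (P.R N)) (J : ℕ) :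
    iterConn B J = (nab B)^[J] 1 := by
  induction J with
  | zero => rfl
  | succ J ih => rw [iterConn_succ, ih, Function.iterate_succ_apply']

theorem nab_one (B : Matrix (Fin 2) (Fin 2) (P.R N)) : nab B 1 = B := by
  rw [nab, DM_one, zero_add, mul_one]

theorem nab_mul (B v w : Matrix (Fin 2) (Fin 2) (P.R N)) :
    nab B (v * w) = nab B v * w + v * P.DM N w := by
  rw [nab, DM_mul, nab, add_mul, mul_assoc]; abel

theorem nab_sum (B : Matrix (Fin 2) (Fin 2) (P.R N)) {ι : Type*} (s : Finset ι)
    (f : ι → Matrix (Fin 2) (Fin 2) (P.R N)) : nab B (∑ i ∈ s, f i) = ∑ i ∈ s, nab B (f i) := by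
  simp only [nab, map_sum, Finset.mul_sum, Finset.sum_add_distrib]

theorem nab_nsmul (B v : Matrix (Fin 2) (Fin 2) (P.R N)) (n : ℕ) :
    nab B (n • v) = n • nab B v := by
  simp only [nab, map_nsmul, mul_smul_comm, smul_add]

/-- The Leibniz rule for iterated covariant derivatives. -/
theorem iterate_nab_eq_sum (B v : Matrix (Fin 2) (Fin 2) (P.R N)) (J : ℕ) :
    (nab B)^[J] v = ∑ x ∈ antidiagonal J, J.choose x.1 • (iterConn B x.1 * (P.DM N)^[x.2] v) := by
  induction J with
  | zero => simp [iterConn]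
  | succ J ih =>
    rw [Function.iterate_succ_apply', ih, nab_sum,
      Finset.sum_antidiagonal_choose_succ_nsmul
        (fun i j => iterConn B i * (P.DM N)^[j] v), ← Finset.sum_add_distrib]
    refine Finset.sum_congr rfl fun x hx => ?_
    rw [nab_nsmul, nab_mul, nsmul_add, ← Function.iterate_succ_apply' (P.DM N), ← iterConn_succ,
      add_comm]
    congr 2
    rw [← Finset.HasAntidiagonal.mem_antidiagonal.1 hx]
    exact Nat.choose_symm_add

theorem iterConn_succ_eq_iterate (B : Matrix (Fin 2) (Fin 2) (P.R N)) (J : ℕ) :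
    iterConn B (J + 1) = (nab B)^[J] B := by
  rw [iterConn_eq, Function.iterate_succ_apply, nab_one]

/-- A gauge transformation intertwines the iterated covariant derivatives. -/
theorem iterate_nab_gauge {B B' g : Matrix (Fin 2) (Fin 2) (P.R N)} (h : nab B g = g * B')
    (J : ℕ) : (nab B)^[J] g = g * iterConn B' J := by
  induction J with
  | zero => simp [iterConn]
  | succ J ih =>
    rw [Function.iterate_succ_apply', ih, nab_mul, h, iterConn_succ, nab, mul_add, mul_assoc,
      add_comm]

/-- The matrix, in the bases `[v₁]₀`, `[v₂]₁` used for the functor `𝒯`, of `p` times an operator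
with matrix `M` in the basis `v₁`, `v₂`. -/
def wt (M : Matrix (Fin 2) (Fin 2) (P.R N)) : Matrix (Fin 2) (Fin 2) (P.R N) :=
  !![(p : P.R N) * M 0 0, M 0 1; (p : P.R N) ^ 2 * M 1 0, (p : P.R N) * M 1 1]

/-- The matrix, in the bases `[v₁]₀`, `[v₂]₁`, of an operator which preserves the filtration. -/
def hat (M : Matrix (Fin 2) (Fin 2) (P.R N)) : Matrix (Fin 2) (Fin 2) (P.R N) :=
  !![M 0 0, 0; (p : P.R N) * M 1 0, M 1 1]

theorem wt_add (A B : Matrix (Fin 2) (Fin 2) (P.R N)) : wt (A + B) = wt A + wt B := by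
  ext i j; fin_cases i <;> fin_cases j <;> simp [wt, mul_add]

theorem wt_zero : wt (0 : Matrix (Fin 2) (Fin 2) (P.R N)) = 0 := by
  ext i j; fin_cases i <;> fin_cases j <;> simp [wt]

theorem wt_smul (a : P.R N) (A : Matrix (Fin 2) (Fin 2) (P.R N)) : wt (a • A) = a • wt A := by
  ext i j; fin_cases i <;> fin_cases j <;> simp [wt, mul_left_comm]

theorem wt_sum {ι : Type*} (s : Finset ι) (f : ι → Matrix (Fin 2) (Fin 2) (P.R N)) :
    wt (∑ i ∈ s, f i) = ∑ i ∈ s, wt (f i) := by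
  classical
  induction s using Finset.induction_on with
  | empty => simp [wt_zero]
  | insert a s ha ih => rw [Finset.sum_insert ha, Finset.sum_insert ha, wt_add, ih]

theorem wt_mul_wt (A B : Matrix (Fin 2) (Fin 2) (P.R N)) : wt A * wt B = (p : P.R N) • wt (A * B) := by
  ext i j
  fin_cases i <;> fin_cases j <;> simp [wt, Matrix.mul_apply, Fin.sum_univ_two] <;> ring

theorem wt_mul_hat (A : Matrix (Fin 2) (Fin 2) (P.R N)) {g : Matrix (Fin 2) (Fin 2) (P.R N)}
    (hg : g 0 1 = 0) : wt A * hat g = wt (A * g) := by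
  ext i j
  fin_cases i <;> fin_cases j <;> simp [wt, hat, Matrix.mul_apply, Fin.sum_univ_two, hg] <;> ring

theorem hat_mul_wt (A : Matrix (Fin 2) (Fin 2) (P.R N)) {g : Matrix (Fin 2) (Fin 2) (P.R N)}
    (hg : g 0 1 = 0) : hat g * wt A = wt (g * A) := by
  ext i j
  fin_cases i <;> fin_cases j <;> simp [wt, hat, Matrix.mul_apply, Fin.sum_univ_two, hg] <;> ring

theorem wt_eq_p_smul_hat {g : Matrix (Fin 2) (Fin 2) (P.R N)} (hg : g 0 1 = 0) :
    wt g = (p : P.R N) • hat g := by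
  ext i j
  fin_cases i <;> fin_cases j <;> simp [wt, hat, hg] ; ring

theorem DM_wt (A : Matrix (Fin 2) (Fin 2) (P.R N)) : P.DM N (wt A) = wt (P.DM N A) := by
  have hp0 : P.D N (p : P.R N) = 0 := Derivation.map_natCast _ _
  ext i j
  fin_cases i <;> fin_cases j <;>
    simp [wt, DM_apply, Derivation.leibniz, Derivation.leibniz_pow, hp0]

theorem DM_hat (A : Matrix (Fin 2) (Fin 2) (P.R N)) : P.DM N (hat A) = hat (P.DM N A) := by
  have hp0 : P.D N (p : P.R N) = 0 := Derivation.map_natCast _ _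
  ext i j
  fin_cases i <;> fin_cases j <;> simp [hat, DM_apply, Derivation.leibniz, hp0]

theorem iterate_DM_wt (J : ℕ) (A : Matrix (Fin 2) (Fin 2) (P.R N)) :
    (P.DM N)^[J] (wt A) = wt ((P.DM N)^[J] A) := by
  induction J generalizing A with
  | zero => rfl
  | succ J ih => rw [Function.iterate_succ_apply, DM_wt, ih, Function.iterate_succ_apply]

theorem iterate_DM_hat (J : ℕ) (A : Matrix (Fin 2) (Fin 2) (P.R N)) :
    (P.DM N)^[J] (hat A) = hat ((P.DM N)^[J] A) := by
  induction J generalizing A with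
  | zero => rfl
  | succ J ih => rw [Function.iterate_succ_apply, DM_hat, ih, Function.iterate_succ_apply]

theorem iterate_DM_zero_one {g : Matrix (Fin 2) (Fin 2) (P.R N)} (hg : g 0 1 = 0) (J : ℕ) :
    (P.DM N)^[J] g 0 1 = 0 := by
  rw [iterate_DM_apply, hg, iterate_map_zero]

variable (B : Matrix (Fin 2) (Fin 2) (P.R N))

/-- The matrices of `∇̃(∂) ^ J / J!`, including `J = 0`. -/
def divConn (J : ℕ) : Matrix (Fin 2) (Fin 2) (P.R N) :=
  if J = 0 then 1 else P.divPow N J • wt (iterConn B J)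

theorem sum_divConn_mul_wt (v : Matrix (Fin 2) (Fin 2) (P.R N)) (J : ℕ) :
    ∑ x ∈ antidiagonal J, divConn B x.1 * (P.powDiv N x.2 • (P.DM N)^[x.2] (wt v))
      = P.powDiv N J • wt ((nab B)^[J] v) := by
  rw [iterate_nab_eq_sum, wt_sum, Finset.smul_sum]
  refine Finset.sum_congr rfl fun x hx => ?_
  have hJ := Finset.HasAntidiagonal.mem_antidiagonal.1 hx
  have h1 : divConn B x.1 * wt ((P.DM N)^[x.2] v)
      = P.powDiv N x.1 • wt (iterConn B x.1 * (P.DM N)^[x.2] v) := by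
    rw [divConn]
    split_ifs with h
    · rw [h, powDiv_zero, one_smul, one_mul]; simp [iterConn]
    · rw [smul_mul_assoc, wt_mul_wt, smul_smul, mul_comm, ← powDiv_eq P N h]
  rw [iterate_DM_wt, mul_smul_comm, h1, smul_smul, ← Nat.cast_smul_eq_nsmul (P.R N), wt_smul,
    smul_smul, ← hJ, powDiv_mul_choose, mul_comm]

theorem sum_divConn_mul_hat {g : Matrix (Fin 2) (Fin 2) (P.R N)} (hg : g 0 1 = 0) {J : ℕ}
    (hJ0 : J ≠ 0) :
    ∑ x ∈ antidiagonal J, divConn B x.1 * (P.powDiv N x.2 • (P.DM N)^[x.2] (hat g))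
      = P.divPow N J • wt ((nab B)^[J] g) := by
  rw [iterate_nab_eq_sum, wt_sum, Finset.smul_sum]
  refine Finset.sum_congr rfl fun x hx => ?_
  have hJ := Finset.HasAntidiagonal.mem_antidiagonal.1 hx
  have hg2 := iterate_DM_zero_one hg x.2
  rw [iterate_DM_hat, mul_smul_comm, divConn, ← Nat.cast_smul_eq_nsmul (P.R N), wt_smul, smul_smul]
  split_ifs with h
  · have hx2 : x.2 = J := by omega
    rw [h, hx2, powDiv_eq P N hJ0, Nat.choose_zero_right, one_mul, iterConn, one_mul,
      wt_eq_p_smul_hat (hx2 ▸ hg2), Nat.cast_one, mul_one, smul_smul, mul_comm]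
  · rw [smul_mul_assoc, wt_mul_hat _ hg2, smul_smul, ← hJ, divPow_mul_choose P N _ _ h, mul_comm]

/-- `p ∂ + wt B` maps `∇̃(∂) ^ J / J!` to `(J + 1)` times its successor. -/
theorem p_DM_divConn_add (J : ℕ) :
    (p : P.R N) • P.DM N (divConn B J) + wt B * divConn B J
      = P.powDiv N J • wt (iterConn B (J + 1)) := by
  rw [divConn]
  split_ifs with h
  · rw [h, DM_one, smul_zero, zero_add, mul_one, powDiv_zero, one_smul, iterConn_succ, iterConn,
      nab_one]
  · have hd : P.D N (P.divPow N J) = 0 := by rw [divPow_eq_const, D_const]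
    rw [DM_smul, hd, zero_smul, zero_add, DM_wt, mul_smul_comm, wt_mul_wt, powDiv_eq P N h,
      iterConn_succ, nab, wt_add, smul_add, smul_smul, smul_smul, mul_comm (P.divPow N J)]

end Iterates

section Gluing

variable {p : ℕ} [Fact p.Prime] {k : Type u} [Field k] [CharP k p] [PerfectRing k p]
  {P : Puncture p k} {N : ℕ} (hp : Odd p) (B : Matrix (Fin 2) (Fin 2) (P.R N))

/-- The Taylor gluing matrix `∑ ((Φ₁(t) - Φ₂(t)) / p) ^ J Φ₂(∇̃(∂) ^ J / J!)`. -/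
def taylorMat : Matrix (Fin 2) (Fin 2) (P.R N) :=
  ∑ J ∈ Finset.range (2 * N + 1), P.z N hp ^ J • (divConn B J).map (P.Phi2 N hp)

omit [PerfectRing k p] in
theorem divConn_eq_zero {J : ℕ} (hp : Odd p) (hJ : 2 * N + 1 ≤ J) : divConn B J = 0 := by
  rw [divConn, if_neg (by omega), divPow_eq_zero P N hp J (by omega), zero_smul]

theorem map_Phi1_eq_sum (M : Matrix (Fin 2) (Fin 2) (P.R N)) :
    M.map (P.Phi1 N hp) = ∑ J ∈ Finset.range (2 * N + 1),
      P.z N hp ^ J • (P.powDiv N J • (P.DM N)^[J] M).map (P.Phi2 N hp) := by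
  ext i j
  rw [Matrix.map_apply, Phi1_eq_sum, Matrix.sum_apply]
  refine Finset.sum_congr rfl fun J _ => ?_
  rw [Matrix.smul_apply, Matrix.map_apply, Matrix.smul_apply, iterate_DM_apply, smul_eq_mul,
    smul_eq_mul, smul_eq_mul]

/-- The product of the Taylor matrix with `Φ₁(M)`, expanded by the Taylor formula for `M`. -/
theorem taylorMat_mul_map_Phi1 (M : Matrix (Fin 2) (Fin 2) (P.R N))
    (c : ℕ → Matrix (Fin 2) (Fin 2) (P.R N))
    (hc : ∀ J, ∑ x ∈ antidiagonal J, divConn B x.1 * (P.powDiv N x.2 • (P.DM N)^[x.2] M) = c J)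
    (hc0 : ∀ J, 2 * N + 1 ≤ J → c J = 0) :
    taylorMat hp B * M.map (P.Phi1 N hp)
      = ∑ J ∈ Finset.range (2 * N + 1), P.z N hp ^ J • (c J).map (P.Phi2 N hp) := by
  have hm : ∀ J, ∑ x ∈ antidiagonal J, (divConn B x.1).map (P.Phi2 N hp) *
      (P.powDiv N x.2 • (P.DM N)^[x.2] M).map (P.Phi2 N hp) = (c J).map (P.Phi2 N hp) := by
    intro J
    rw [← hc]
    simp only [← RingHom.mapMatrix_apply, map_sum, map_mul]
  rw [taylorMat, map_Phi1_eq_sum, sum_pow_smul_mul_sum]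
  · simp only [hm]
  · intro i hi
    rw [divConn_eq_zero B hp hi]
    exact Matrix.map_zero _ (map_zero _)
  · intro i hi
    rw [powDiv_eq_zero P N hp (by omega), zero_smul]
    exact Matrix.map_zero _ (map_zero _)
  · intro J hJ
    rw [hm, hc0 J hJ]
    exact Matrix.map_zero _ (map_zero _)

/-- The derivative series of the Taylor matrix. -/
theorem taylorMat_mul_wt :
    taylorMat hp B * (wt B).map (P.Phi1 N hp) = ∑ J ∈ Finset.range (2 * N + 1),
      P.z N hp ^ J • (P.powDiv N J • wt (iterConn B (J + 1))).map (P.Phi2 N hp) := by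
  refine taylorMat_mul_map_Phi1 hp B _ _ (fun J => ?_) fun J hJ => ?_
  · rw [sum_divConn_mul_wt, iterConn_succ_eq_iterate]
  · rw [powDiv_eq_zero P N hp (by omega), zero_smul]

/-- Gauge transformations preserving the filtration commute with the Taylor gluing. -/
theorem taylorMat_mul_hat {B' g : Matrix (Fin 2) (Fin 2) (P.R N)} (hg : g 0 1 = 0)
    (h : nab B g = g * B') :
    taylorMat hp B * (hat g).map (P.Phi1 N hp) = (hat g).map (P.Phi2 N hp) * taylorMat hp B' := by
  rw [taylorMat_mul_map_Phi1 hp B (hat g) (fun J => hat g * divConn B' J), taylorMat,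
    Finset.mul_sum]
  · refine Finset.sum_congr rfl fun J _ => ?_
    rw [mul_smul_comm, Matrix.map_mul]
  · intro J
    by_cases hJ : J = 0
    · subst hJ; simp [divConn, powDiv_zero]
    · rw [sum_divConn_mul_hat B hg hJ, iterate_nab_gauge h, divConn, if_neg hJ, mul_smul_comm,
        hat_mul_wt _ hg]
  · intro J hJ
    rw [divConn_eq_zero B' hp hJ, mul_zero]

theorem DM_map_Phi2 (M : Matrix (Fin 2) (Fin 2) (P.R N)) :
    P.DM N (M.map (P.Phi2 N hp))
      = ((p : P.R N) * P.t N ^ (p - 1)) • (P.DM N M).map (P.Phi2 N hp) := by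
  ext i j
  rw [DM_apply, Matrix.map_apply, D_Phi2, Matrix.smul_apply, Matrix.map_apply, DM_apply,
    smul_eq_mul, mul_comm]

omit [PerfectRing k p] in
theorem map_smul_ringHom (Φ : P.R N →+* P.R N) (a : P.R N) (M : Matrix (Fin 2) (Fin 2) (P.R N)) :
    (a • M).map Φ = Φ a • M.map Φ := by
  ext i j; simp

/-- The Taylor matrix intertwines the Frobenius pullbacks of `d + B̃` along `Φ₁` and `Φ₂`. -/
theorem DM_taylorMat_add :
    P.DM N (taylorMat hp B) + P.t N ^ (p - 1) • ((wt B).map (P.Phi2 N hp) * taylorMat hp B)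
      = (P.D N (P.z N hp) + P.t N ^ (p - 1)) • (taylorMat hp B * (wt B).map (P.Phi1 N hp)) := by
  -- the Leibniz rule for the terms of the Taylor matrix: the derivatives of the powers of `z` make up
  -- the derivative series
  have h1 : P.DM N (taylorMat hp B) = P.D N (P.z N hp) • (taylorMat hp B *
      (wt B).map (P.Phi1 N hp)) + P.t N ^ (p - 1) • ∑ J ∈ Finset.range (2 * N + 1),
        P.z N hp ^ J • ((p : P.R N) • P.DM N (divConn B J)).map (P.Phi2 N hp) := by
    have e : ∀ J, P.DM N (P.z N hp ^ J • (divConn B J).map (P.Phi2 N hp))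
        = ((J : P.R N) * P.z N hp ^ (J - 1) * P.D N (P.z N hp)) • (divConn B J).map (P.Phi2 N hp)
          + P.t N ^ (p - 1) • P.z N hp ^ J •
            ((p : P.R N) • P.DM N (divConn B J)).map (P.Phi2 N hp) := by
      intro J
      rw [DM_smul, DM_map_Phi2, map_smul_ringHom, map_natCast, Derivation.leibniz_pow]
      simp only [smul_smul, smul_eq_mul, nsmul_eq_mul]
      congr 2 <;> ring
    rw [taylorMat, map_sum, Finset.sum_congr rfl fun J _ => e J, Finset.sum_add_distrib,
      ← Finset.smul_sum, ← taylorMat, taylorMat_mul_wt]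
    congr 1
    rw [Finset.sum_range_succ', Nat.cast_zero, zero_mul, zero_mul, zero_smul, add_zero,
      Finset.sum_range_succ]
    have hlast : P.powDiv N (2 * N) = 0 := by
      rw [← succ_mul_divPow, divPow_eq_zero P N hp _ (Nat.lt_succ_self _), mul_zero]
    rw [hlast, zero_smul, Matrix.map_zero _ (map_zero _), smul_zero, add_zero, Finset.smul_sum]
    refine Finset.sum_congr rfl fun J _ => ?_
    rw [divConn, if_neg J.succ_ne_zero, ← succ_mul_divPow, map_smul_ringHom, map_smul_ringHom,
      map_mul, map_add, map_natCast, map_one, smul_smul, smul_smul, smul_smul,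
      Nat.add_sub_cancel]
    congr 1
    push_cast
    ring
  rw [h1, add_smul, add_assoc, ← smul_add]
  congr 2
  rw [taylorMat_mul_wt, taylorMat, Finset.mul_sum, ← Finset.sum_add_distrib]
  refine Finset.sum_congr rfl fun J _ => ?_
  rw [← p_DM_divConn_add, mul_smul_comm, ← smul_add]
  simp only [← RingHom.mapMatrix_apply, map_add, map_mul]

end Gluing

/-! ### Gauge transformations -/

section Gauge

variable {p : ℕ} [Fact p.Prime] {k : Type u} [Field k] [CharP k p] {P : Puncture p k} {N : ℕ}

/-- Two by two matrices over `R₁₂`. -/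
abbrev Puncture.Mat (P : Puncture p k) (N : ℕ) : Type u := Matrix (Fin 2) (Fin 2) (P.R N)

/-- Isomorphisms of bundles with connection, with the matrices `a` over `R₁`, `b` over `R₂` and
their inverses given as matrices over `R₁₂`. -/
structure Conn.Gauge (c c' : Conn P N) (a a' b b' : P.Mat N) : Prop where
  mem1 : ∀ i j, a i j ∈ P.chart1 N
  mem1' : ∀ i j, a' i j ∈ P.chart1 N
  mem2 : ∀ i j, b i j ∈ P.chart2 N
  mem2' : ∀ i j, b' i j ∈ P.chart2 N
  mul1 : a * a' = 1
  mul2 : b * b' = 1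
  glue : c.G * a = b * c'.G
  conn1 : a * (P.omega1 N • c'.A1) = (P.omega1 N • c.A1) * a + P.DM N a
  conn2 : b * (P.omega2 N • c'.A2) = (P.omega2 N • c.A2) * b + P.DM N b

theorem mul_apply_mem {S : Subalgebra (WN p k N) (P.R N)} {A B : P.Mat N}
    (hA : ∀ i j, A i j ∈ S) (hB : ∀ i j, B i j ∈ S) (i j : Fin 2) : (A * B) i j ∈ S := by
  rw [Matrix.mul_apply]
  exact sum_mem fun x _ => mul_mem (hA i x) (hB x j)

theorem det_mem {S : Subalgebra (WN p k N) (P.R N)} {M : P.Mat N} (hM : ∀ i j, M i j ∈ S) :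
    M.det ∈ S := by
  rw [Matrix.det_fin_two]
  exact sub_mem (mul_mem (hM 0 0) (hM 1 1)) (mul_mem (hM 0 1) (hM 1 0))

theorem Conn.Gauge.symm {c c' : Conn P N} {a a' b b' : P.Mat N} (h : c.Gauge c' a a' b b') :
    c'.Gauge c a' a b' b where
  mem1 := h.mem1'
  mem1' := h.mem1
  mem2 := h.mem2'
  mem2' := h.mem2
  mul1 := mul_eq_one_comm.1 h.mul1
  mul2 := mul_eq_one_comm.1 h.mul2
  glue := by
    have h1 := h.mul1
    have h2 := mul_eq_one_comm.1 h.mul2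
    calc c'.G * a' = b' * b * c'.G * a' := by rw [h2, one_mul]
      _ = b' * (c.G * a) * a' := by rw [h.glue, mul_assoc b']
      _ = b' * c.G := by rw [mul_assoc, mul_assoc, h1, mul_one]
  conn1 := by
    have h1 := h.mul1
    have h2 := mul_eq_one_comm.1 h.mul1
    have hd : P.DM N a' = - (a' * P.DM N a * a') := by
      have e := congrArg (fun x => P.DM N x) h2
      simp only [DM_mul, DM_one] at e
      have e2 : P.DM N a' * a * a' = -(a' * P.DM N a) * a' := by
        rw [eq_neg_of_add_eq_zero_left e]
      rwa [mul_assoc, h1, mul_one, neg_mul] at e2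
    have e := congrArg (fun x => a' * x * a') h.conn1
    simp only [mul_add, add_mul] at e
    rw [← mul_assoc, h2, one_mul] at e
    rw [hd, e, mul_assoc a' _ a', mul_assoc _ a a', h1, mul_one]
    abel
  conn2 := by
    have h1 := h.mul2
    have h2 := mul_eq_one_comm.1 h.mul2
    have hd : P.DM N b' = - (b' * P.DM N b * b') := by
      have e := congrArg (fun x => P.DM N x) h2
      simp only [DM_mul, DM_one] at e
      have e2 : P.DM N b' * b * b' = -(b' * P.DM N b) * b' := by
        rw [eq_neg_of_add_eq_zero_left e]
      rwa [mul_assoc, h1, mul_one, neg_mul] at e2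
    have e := congrArg (fun x => b' * x * b') h.conn2
    simp only [mul_add, add_mul] at e
    rw [← mul_assoc, h2, one_mul] at e
    rw [hd, e, mul_assoc b' _ b', mul_assoc _ b b', h1, mul_one]
    abel

theorem Conn.Gauge.trans {c c' c'' : Conn P N} {a a' b b' d d' e e' : P.Mat N}
    (h : c.Gauge c' a a' b b') (h' : c'.Gauge c'' d d' e e') :
    c.Gauge c'' (a * d) (d' * a') (b * e) (e' * b') where
  mem1 := mul_apply_mem h.mem1 h'.mem1
  mem1' := mul_apply_mem h'.mem1' h.mem1'
  mem2 := mul_apply_mem h.mem2 h'.mem2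
  mem2' := mul_apply_mem h'.mem2' h.mem2'
  mul1 := by rw [mul_assoc, ← mul_assoc d, h'.mul1, one_mul, h.mul1]
  mul2 := by rw [mul_assoc, ← mul_assoc e, h'.mul2, one_mul, h.mul2]
  glue := by rw [← mul_assoc, h.glue, mul_assoc, h'.glue, mul_assoc]
  conn1 := by
    rw [mul_assoc, h'.conn1, mul_add, ← mul_assoc, h.conn1, DM_mul, add_mul, mul_assoc]
    abel
  conn2 := by
    rw [mul_assoc, h'.conn2, mul_add, ← mul_assoc, h.conn2, DM_mul, add_mul, mul_assoc]
    abel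

theorem Conn.Gauge.refl (c : Conn P N) : c.Gauge c 1 1 1 1 := by
  have m1 : ∀ (S : Subalgebra (WN p k N) (P.R N)) i j, (1 : P.Mat N) i j ∈ S := by
    intro S i j
    rw [Matrix.one_apply]
    split_ifs
    · exact one_mem _
    · exact zero_mem _
  constructor <;> simp [m1, DM_one]

theorem Conn.IsIso.gauge {c c' : Conn P N} {g1 : GL (Fin 2) (P.chart1 N)}
    {g2 : GL (Fin 2) (P.chart2 N)} (h : c.IsIso c' g1 g2) :
    c.Gauge c' (g1.val.map Subtype.val) (g1.inv.map Subtype.val) (g2.val.map Subtype.val)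
      (g2.inv.map Subtype.val) where
  mem1 i j := (g1.val i j).2
  mem1' i j := (g1.inv i j).2
  mem2 i j := (g2.val i j).2
  mem2' i j := (g2.inv i j).2
  mul1 := by
    have e := congrArg (fun M => M.map (P.chart1 N).val) g1.val_inv
    rwa [Matrix.map_mul, Matrix.map_one _ (map_zero _) (map_one _)] at e
  mul2 := by
    have e := congrArg (fun M => M.map (P.chart2 N).val) g2.val_inv
    rwa [Matrix.map_mul, Matrix.map_one _ (map_zero _) (map_one _)] at e
  glue := h.glue
  conn1 := h.conn1
  conn2 := h.conn2

theorem exists_GL_of_mem {S : Subalgebra (WN p k N) (P.R N)} {a a' : P.Mat N}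
    (ha : ∀ i j, a i j ∈ S) (ha' : ∀ i j, a' i j ∈ S) (h : a * a' = 1) :
    ∃ g : GL (Fin 2) S, g.val.map Subtype.val = a := by
  let A : Matrix (Fin 2) (Fin 2) S := fun i j => ⟨a i j, ha i j⟩
  let A' : Matrix (Fin 2) (Fin 2) S := fun i j => ⟨a' i j, ha' i j⟩
  have e : A * A' = 1 := by
    have hinj : Function.Injective (fun M : Matrix (Fin 2) (Fin 2) S => M.map S.val) :=
      Matrix.map_injective Subtype.val_injective
    apply hinj
    change (A * A').map S.val = Matrix.map 1 S.val
    rw [Matrix.map_mul, Matrix.map_one _ (map_zero _) (map_one _)]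
    exact h
  exact ⟨⟨A, A', e, mul_eq_one_comm.1 e⟩, rfl⟩

theorem Conn.Gauge.exists_isIso {c c' : Conn P N} {a a' b b' : P.Mat N}
    (h : c.Gauge c' a a' b b') : ∃ (g1 : GL (Fin 2) (P.chart1 N)) (g2 : GL (Fin 2) (P.chart2 N)),
      c.IsIso c' g1 g2 ∧ g1.val.map Subtype.val = a ∧ g2.val.map Subtype.val = b := by
  obtain ⟨g1, h1⟩ := exists_GL_of_mem h.mem1 h.mem1' h.mul1
  obtain ⟨g2, h2⟩ := exists_GL_of_mem h.mem2 h.mem2' h.mul2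
  refine ⟨g1, g2, ⟨?_, ?_, ?_⟩, h1, h2⟩
  · rw [h1, h2]; exact h.glue
  · rw [h1]; exact h.conn1
  · rw [h2]; exact h.conn2

/-- Reduction of a bundle with connection. -/
def Conn.red (c : Conn P (N + 1)) : Conn P N where
  G := c.G.map (P.red N)
  A1 := c.A1.map (P.red N)
  A2 := c.A2.map (P.red N)

theorem DM_map_red (M : P.Mat (N + 1)) : (P.DM (N + 1) M).map (P.red N) = P.DM N (M.map (P.red N)) := by
  ext i j
  simp only [Matrix.map_apply, DM_apply, red_D]

theorem map_smul_red (a : P.R (N + 1)) (M : P.Mat (N + 1)) :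
    (a • M).map (P.red N) = P.red N a • M.map (P.red N) := by
  ext i j; simp

theorem map_add_red (A B : P.Mat (N + 1)) :
    (A + B).map (P.red N) = A.map (P.red N) + B.map (P.red N) :=
  Matrix.map_add _ (map_add _) A B

theorem Conn.Gauge.red {c c' : Conn P (N + 1)} {a a' b b' : P.Mat (N + 1)}
    (h : c.Gauge c' a a' b b') : c.red.Gauge c'.red (a.map (P.red N)) (a'.map (P.red N))
      (b.map (P.red N)) (b'.map (P.red N)) where
  mem1 i j := red_mem_chart1 P N (h.mem1 i j)
  mem1' i j := red_mem_chart1 P N (h.mem1' i j)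
  mem2 i j := red_mem_chart2 P N (h.mem2 i j)
  mem2' i j := red_mem_chart2 P N (h.mem2' i j)
  mul1 := by rw [← Matrix.map_mul, h.mul1, Matrix.map_one _ (map_zero _) (map_one _)]
  mul2 := by rw [← Matrix.map_mul, h.mul2, Matrix.map_one _ (map_zero _) (map_one _)]
  glue := by
    have e := congrArg (fun M => M.map (P.red N)) h.glue
    simp only [Matrix.map_mul] at e
    exact e
  conn1 := by
    have e := congrArg (fun M => M.map (P.red N)) h.conn1
    simp only [Matrix.map_mul, map_add_red, DM_map_red, map_smul_red, red_omega1] at e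
    exact e
  conn2 := by
    have e := congrArg (fun M => M.map (P.red N)) h.conn2
    simp only [Matrix.map_mul, map_add_red, DM_map_red, map_smul_red, red_omega2] at e
    exact e

/-- The conditions on a bundle with log connection, except for the invertibility of the
transition matrix. -/
structure Conn.Glues (c : Conn P N) : Prop where
  mem1 : ∀ i j, c.A1 i j ∈ P.chart1 N
  mem2 : ∀ i j, c.A2 i j ∈ P.chart2 N
  glue : c.G * (P.omega1 N • c.A1) = (P.omega2 N • c.A2) * c.G + P.DM N c.G

theorem invOmega1_mem_chart1 : Ring.inverse (P.omega1 N) ∈ P.chart1 N := by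
  obtain ⟨c, hc⟩ := (one_sub_isUnit P).exists_left_inv
  have hc2 := congrArg (P.const N) hc
  have h := omega1_mul P N
  have hi := Ring.inverse_mul_cancel _ (isUnit_omega1 P N)
  simp only [map_mul, map_sub, map_one] at hc2 h
  have e : Ring.inverse (P.omega1 N)
      = - P.const N c * ((P.t N - P.const N P.lam) * (P.t N - 1)) := by
    linear_combination (-Ring.inverse (P.omega1 N)) * hc2 + Ring.inverse (P.omega1 N) *
      P.const N c * h - P.const N c * ((P.t N - P.const N P.lam) * (P.t N - 1)) * hi
  rw [e]
  exact mul_mem (neg_mem (const_mem_chart1 P N c)) (mul_mem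
    (sub_mem (t_mem_chart1 P N) (const_mem_chart1 P N _)) (sub_mem (t_mem_chart1 P N) (one_mem _)))

/-- Transport of structure along a change of bases. -/
theorem Conn.Glues.exists_gauge {c : Conn P N} (hc : c.Glues) {a a' b b' G' : P.Mat N}
    (mem1 : ∀ i j, a i j ∈ P.chart1 N) (mem1' : ∀ i j, a' i j ∈ P.chart1 N)
    (mem2 : ∀ i j, b i j ∈ P.chart2 N) (mem2' : ∀ i j, b' i j ∈ P.chart2 N)
    (mul1 : a * a' = 1) (mul2 : b * b' = 1) (glue : c.G * a = b * G') :
    ∃ c' : Conn P N, c'.G = G' ∧ c'.Glues ∧ c.Gauge c' a a' b b' := by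
  have i1 := Ring.mul_inverse_cancel _ (isUnit_omega1 P N)
  have i2 := Ring.mul_inverse_cancel _ (isUnit_omega2 P N)
  have e1 : a' * a = 1 := mul_eq_one_comm.1 mul1
  have e2 : b' * b = 1 := mul_eq_one_comm.1 mul2
  let A1 : P.Mat N := a' * (c.A1 * a + Ring.inverse (P.omega1 N) • P.DM N a)
  let A2 : P.Mat N := b' * (c.A2 * b + Ring.inverse (P.omega2 N) • P.DM N b)
  have c1 : a * (P.omega1 N • A1) = (P.omega1 N • c.A1) * a + P.DM N a := by
    rw [mul_smul_comm, ← mul_assoc, mul1, one_mul, smul_add, smul_smul, i1, one_smul,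
      smul_mul_assoc]
  have c2 : b * (P.omega2 N • A2) = (P.omega2 N • c.A2) * b + P.DM N b := by
    rw [mul_smul_comm, ← mul_assoc, mul2, one_mul, smul_add, smul_smul, i2, one_smul,
      smul_mul_assoc]
  refine ⟨⟨G', A1, A2⟩, rfl, ⟨?_, ?_, ?_⟩, ⟨mem1, mem1', mem2, mem2', mul1, mul2, glue, c1, c2⟩⟩
  · refine mul_apply_mem mem1' fun i j => add_mem (mul_apply_mem hc.mem1 mem1 i j) ?_
    exact mul_mem invOmega1_mem_chart1 (D_mem_chart1 P N (mem1 i j))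
  · refine mul_apply_mem mem2' fun i j => add_mem (mul_apply_mem hc.mem2 mem2 i j) ?_
    have : Ring.inverse (P.omega2 N) = P.t N := by
      apply (isUnit_omega2 P N).mul_left_cancel
      rw [i2, omega2_mul]
    rw [this]
    exact t_mul_D_mem_chart2 P N (mem2 i j)
  · have hd := congrArg (fun M => P.DM N M) glue
    simp only [DM_mul] at hd
    have hG : G' = b' * (c.G * a) := by rw [glue, ← mul_assoc, e2, one_mul]
    have key : b * (G' * (P.omega1 N • A1)) = b * ((P.omega2 N • A2) * G' + P.DM N G') := by
      rw [← mul_assoc, ← glue, mul_assoc, c1, mul_add, ← mul_assoc, hc.glue, mul_add, ← mul_assoc,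
        c2, add_mul, add_mul, mul_assoc _ c.G a, glue, ← mul_assoc]
      simp only [add_assoc]
      rw [hd]
    have := congrArg (fun M => b' * M) key
    simpa only [← mul_assoc, e2, one_mul] using this

end Gauge

/-! ### The inverse Cartier transform -/

section Weights

variable {p : ℕ} [Fact p.Prime] {k : Type u} [Field k] [CharP k p] {P : Puncture p k} {n : ℕ}

theorem wt_congr {M M' : P.Mat (n + 1)} (h : M.map (P.red n) = M'.map (P.red n))
    (h01 : M 0 1 = M' 0 1) : wt M = wt M' := by
  have e : ∀ i j, (p : P.R (n + 1)) * M i j = p * M' i j := fun i j =>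
    p_mul_eq_of_red_eq P n (congrFun (congrFun h i) j)
  ext i j
  fin_cases i <;> fin_cases j <;> simp [wt, h01, e, pow_two, mul_assoc]

theorem hat_congr {M M' : P.Mat (n + 1)} (h : M.map (P.red n) = M'.map (P.red n))
    (h00 : M 0 0 = M' 0 0) (h11 : M 1 1 = M' 1 1) : hat M = hat M' := by
  have e : ∀ i j, (p : P.R (n + 1)) * M i j = p * M' i j := fun i j =>
    p_mul_eq_of_red_eq P n (congrFun (congrFun h i) j)
  ext i j
  fin_cases i <;> fin_cases j <;> simp [hat, h00, h11, e]

theorem p_smul_wt_eq {M M' : P.Mat n} (h : ∀ i j, (p : P.R n) * M' i j = p * M i j) :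
    (p : P.R n) • wt M' = (p : P.R n) • wt M := by
  ext i j
  fin_cases i <;> fin_cases j <;> simp [wt, h, pow_two, mul_assoc]

theorem wt_eq_add_of_p_mul_eq {M M' : P.Mat n} (h : ∀ i j, (p : P.R n) * M' i j = p * M i j) :
    wt M' = wt M + (M' 0 1 - M 0 1) • !![0, 1; 0, 0] := by
  ext i j
  fin_cases i <;> fin_cases j <;> simp [wt, h, pow_two, mul_assoc]

theorem map_red_mul (A B : P.Mat (n + 1)) :
    (A * B).map (P.red n) = A.map (P.red n) * B.map (P.red n) := Matrix.map_mul

theorem map_red_nab (B v : P.Mat (n + 1)) :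
    (nab B v).map (P.red n) = nab (B.map (P.red n)) (v.map (P.red n)) := by
  rw [nab, map_add_red, DM_map_red, map_red_mul]; rfl

theorem map_red_iterConn (B : P.Mat (n + 1)) (J : ℕ) :
    (iterConn B J).map (P.red n) = iterConn (B.map (P.red n)) J := by
  induction J with
  | zero => exact Matrix.map_one _ (map_zero _) (map_one _)
  | succ J ih => rw [iterConn_succ, map_red_nab, ih, iterConn_succ]

theorem map_red_wt (M : P.Mat (n + 1)) : (wt M).map (P.red n) = wt (M.map (P.red n)) := by
  ext i j
  fin_cases i <;> fin_cases j <;> simp [wt]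

theorem map_red_divConn (B : P.Mat (n + 1)) (J : ℕ) :
    (divConn B J).map (P.red n) = divConn (B.map (P.red n)) J := by
  rw [divConn, divConn]
  split_ifs with h
  · exact Matrix.map_one _ (map_zero _) (map_one _)
  · rw [map_smul_red, red_divPow, map_red_wt, map_red_iterConn]

end Weights

theorem sum_range_succ_eq_add_sum_Icc {M : Type*} [AddCommMonoid M] (f : ℕ → M) (K : ℕ) :
    ∑ i ∈ Finset.range (K + 1), f i = f 0 + ∑ i ∈ Finset.Icc 1 K, f i := by
  rw [Finset.range_eq_Ico, Finset.sum_eq_sum_Ico_succ_bot (Nat.succ_pos K)]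
  rfl

theorem map_add_ringHom {R S : Type*} [CommRing R] [CommRing S] (Φ : R →+* S)
    (A B : Matrix (Fin 2) (Fin 2) R) : (A + B).map Φ = A.map Φ + B.map Φ :=
  Matrix.map_add _ (map_add Φ) A B

theorem map_zero_ringHom {R S : Type*} [CommRing R] [CommRing S] (Φ : R →+* S) :
    (0 : Matrix (Fin 2) (Fin 2) R).map Φ = 0 :=
  Matrix.map_zero _ (map_zero Φ)

section Taylor

variable {p : ℕ} [Fact p.Prime] {k : Type u} [Field k] [CharP k p] [PerfectRing k p]
  {P : Puncture p k} {n : ℕ} (hp : Odd p)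

/-- The Taylor matrix depends on the connection modulo `p ^ n` and on its Higgs field: the terms
with `J ≥ 2` are multiples of `p`. -/
theorem taylorMat_eq_add {B B' : P.Mat (n + 1)} (h : B.map (P.red n) = B'.map (P.red n)) :
    taylorMat hp B' = taylorMat hp B
      + (P.z (n + 1) hp * P.Phi2 (n + 1) hp (B' 0 1 - B 0 1)) • !![0, 1; 0, 0] := by
  have hC : ∀ J i j, (p : P.R (n + 1)) * iterConn B' J i j = p * iterConn B J i j := by
    intro J i j
    have e : (iterConn B' J).map (P.red n) = (iterConn B J).map (P.red n) := by
      rw [map_red_iterConn, map_red_iterConn, h]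
    exact p_mul_eq_of_red_eq P n (congrFun (congrFun e i) j)
  have hd : ∀ J, divConn B' J = divConn B J
      + if J = 1 then (B' 0 1 - B 0 1) • !![0, 1; 0, 0] else 0 := by
    intro J
    have hJ := hC J
    rcases J with _ | _ | J
    · simp [divConn]
    · have h1 : iterConn B' 1 = B' := by rw [iterConn_succ, iterConn, nab_one]
      have h2 : iterConn B 1 = B := by rw [iterConn_succ, iterConn, nab_one]
      rw [zero_add, h1, h2] at hJ
      rw [zero_add, divConn, divConn, if_neg one_ne_zero, if_neg one_ne_zero, divPow_one, one_smul,
        one_smul, h1, h2, if_pos rfl]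
      exact wt_eq_add_of_p_mul_eq hJ
    · obtain ⟨d, hd⟩ := exists_divW_eq (k := k) hp (J := J + 2) (by omega)
      have hd2 : P.divPow (n + 1) (J + 2) = P.const (n + 1) d * p := by
        rw [divPow_eq_const, hd, map_mul, map_natCast, mul_comm]
      rw [divConn, divConn, if_neg (by omega), if_neg (by omega), if_neg (by omega), add_zero,
        hd2, mul_smul, mul_smul, p_smul_wt_eq hJ]
  have he : ∀ a : P.R (n + 1), (a • !![0, 1; 0, 0] : P.Mat (n + 1)).map (P.Phi2 (n + 1) hp)
      = P.Phi2 (n + 1) hp a • !![0, 1; 0, 0] := by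
    intro a
    ext i j
    fin_cases i <;> fin_cases j <;> simp
  have hs : ∀ J ∈ Finset.range (2 * (n + 1) + 1),
      P.z (n + 1) hp ^ J • (divConn B' J).map (P.Phi2 (n + 1) hp)
      = P.z (n + 1) hp ^ J • (divConn B J).map (P.Phi2 (n + 1) hp) + if J = 1 then
        (P.z (n + 1) hp * P.Phi2 (n + 1) hp (B' 0 1 - B 0 1)) • !![0, 1; 0, 0] else 0 := by
    intro J _
    rw [hd, map_add_ringHom, smul_add, add_right_inj]
    by_cases h1 : J = 1
    · rw [if_pos h1, if_pos h1, h1, pow_one, he, smul_smul]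
    · rw [if_neg h1, if_neg h1, map_zero_ringHom, smul_zero]
  rw [taylorMat, Finset.sum_congr rfl hs, Finset.sum_add_distrib, Finset.sum_ite_eq',
    if_pos (Finset.mem_range.2 (by omega)), taylorMat]

/-- The Taylor matrix depends on the connection only through its reduction and its Higgs field. -/
theorem taylorMat_congr {B B' : P.Mat (n + 1)} (h : B.map (P.red n) = B'.map (P.red n))
    (h01 : B 0 1 = B' 0 1) : taylorMat hp B' = taylorMat hp B := by
  rw [taylorMat_eq_add hp h, h01, sub_self, map_zero, mul_zero, zero_smul, add_zero]

theorem map_red_taylorMat (B : P.Mat (n + 1)) :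
    (taylorMat hp B).map (P.red n) = taylorMat hp (B.map (P.red n)) := by
  have e : (taylorMat hp B).map (P.red n) = ∑ J ∈ Finset.range (2 * n + 1 + 2),
      P.z n hp ^ J • (divConn (B.map (P.red n)) J).map (P.Phi2 n hp) := by
    rw [taylorMat, ← RingHom.mapMatrix_apply, map_sum]
    have hr : 2 * (n + 1) + 1 = 2 * n + 1 + 2 := by ring
    rw [hr]
    refine Finset.sum_congr rfl fun J _ => ?_
    have h2 : ((divConn B J).map (P.Phi2 (n + 1) hp)).map (P.red n)
        = ((divConn B J).map (P.red n)).map (P.Phi2 n hp) := by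
      ext i j
      simp only [Matrix.map_apply, red_Phi2]
    rw [RingHom.mapMatrix_apply, map_smul_red, map_pow, red_z, ← map_red_divConn, h2]
  rw [e]
  rw [Finset.sum_range_succ, Finset.sum_range_succ, divConn_eq_zero _ hp (by omega),
    divConn_eq_zero _ hp (by omega), map_zero_ringHom, smul_zero, smul_zero,
    add_zero, add_zero, taylorMat]

/-- The connection on the second chart corresponding to `liftedConn`. -/
def liftedConn2 (V : FilData P n) (θ : P.R (n + 1)) : P.Mat (n + 1) :=
  P.omega2 (n + 1) • !![P.lift n (V.A2 0 0), P.const (n + 1) (P.lam - 1) * P.invTlam (n + 1) * θ;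
    P.lift n (V.A2 1 0), P.lift n (V.A2 1 1)]

/-- A lift of the transition matrix. -/
def liftedG (V : FilData P n) : P.Mat (n + 1) := !![1, 0; P.lift n V.F, P.tau (n + 1)]

omit [PerfectRing k p] in
theorem wt_liftedConn (V : FilData P n) (θ : P.R (n + 1)) :
    wt (liftedConn V θ) = P.omega1 (n + 1) • (functorT V θ).A1 := by
  rw [liftedConn, wt_smul]; rfl

omit [PerfectRing k p] in
theorem wt_liftedConn2 (V : FilData P n) (θ : P.R (n + 1)) :
    wt (liftedConn2 V θ) = P.omega2 (n + 1) • (functorT V θ).A2 := by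
  rw [liftedConn2, wt_smul]; rfl

omit [PerfectRing k p] in
theorem omega1_eq (N : ℕ) : P.omega1 N
    = P.omega2 N * (P.const N (P.lam - 1) * P.invTlam N) * P.tau N := by
  have h := omega2_mul P N
  rw [Puncture.omega1, Puncture.tau]
  linear_combination (-P.const N (P.lam - 1) * P.invTlam N * P.invT1 N) * h

omit [PerfectRing k p] in
theorem map_red_liftedG (V : FilData P n) : (liftedG V).map (P.red n) = V.toConn.G := by
  ext i j
  fin_cases i <;> fin_cases j <;>
    simp [liftedG, FilData.toConn, red_lift, Puncture.tau, red_t, red_invT1]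

omit [PerfectRing k p] in
theorem map_red_liftedConn {V : FilData P n} {θ : P.R (n + 1)} (hθ : P.red n θ = V.theta) :
    (liftedConn V θ).map (P.red n) = P.omega1 n • V.toConn.A1 := by
  rw [liftedConn, map_smul_red, red_omega1]
  congr 1
  ext i j
  fin_cases i <;> fin_cases j <;> simp [red_lift, hθ, FilData.theta, FilData.toConn]

omit [PerfectRing k p] in
/-- The gluing relation expresses the Higgs field over the second chart by that over the first. -/
theorem theta_eq_of_glues {V : FilData P n} (hV : V.toConn.Glues) :
    V.A2 0 1 = P.const n (P.lam - 1) * P.invTlam n * V.theta := by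
  have h := congrFun (congrFun hV.glue 0) 1
  simp only [FilData.toConn, Matrix.mul_apply, Fin.sum_univ_two, Matrix.add_apply, DM_apply,
    Matrix.smul_apply, smul_eq_mul] at h
  simp at h
  have e : P.t n * P.invT1 n = P.tau n := rfl
  rw [e, omega1_eq] at h
  apply ((isUnit_omega2 P n).mul (isUnit_tau P n)).mul_left_cancel
  rw [FilData.theta]
  linear_combination -h

omit [PerfectRing k p] in
theorem map_red_liftedConn2 {V : FilData P n} (hV : V.toConn.Glues) {θ : P.R (n + 1)}
    (hθ : P.red n θ = V.theta) :
    (liftedConn2 V θ).map (P.red n) = P.omega2 n • V.toConn.A2 := by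
  have h := theta_eq_of_glues hV
  rw [liftedConn2, map_smul_red, red_omega2]
  congr 1
  ext i j
  fin_cases i <;> fin_cases j <;>
    simp [red_lift, hθ, h, red_invTlam, red_const, FilData.toConn]

omit [PerfectRing k p] in
/-- The functor `𝒯` produces a bundle with a `p`-connection. -/
theorem functorT_glue {V : FilData P n} (hV : V.toConn.Glues) {θ : P.R (n + 1)}
    (hθ : P.red n θ = V.theta) :
    hat (liftedG V) * wt (liftedConn V θ)
      = wt (liftedConn2 V θ) * hat (liftedG V) + (p : P.R (n + 1)) • P.DM (n + 1) (hat (liftedG V)) := by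
  have h0 : liftedG V 0 1 = 0 := rfl
  rw [DM_hat, hat_mul_wt _ h0, wt_mul_hat _ h0, ← wt_eq_p_smul_hat (by rw [DM_apply, h0, map_zero]),
    ← wt_add]
  refine wt_congr ?_ ?_
  · rw [map_red_mul, map_add_red, map_red_mul, DM_map_red, map_red_liftedG, map_red_liftedConn hθ,
      map_red_liftedConn2 hV hθ, hV.glue]
  · simp [liftedG, liftedConn, liftedConn2, Matrix.mul_apply, Fin.sum_univ_two, DM_apply]
    rw [omega1_eq, map_sub, map_one]; ring

theorem inverseCartier_G (V : FilData P n) (θ : P.R (n + 1)) :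
    (inverseCartier hp V θ).G = (hat (liftedG V)).map (P.Phi2 (n + 1) hp)
      * taylorMat hp (liftedConn V θ) := by
  have e : ∀ J ∈ Finset.Icc 1 (2 * (n + 1)), P.z (n + 1) hp ^ J •
      (divIter V θ J).map (P.Phi2 (n + 1) hp) = P.z (n + 1) hp ^ J •
      (divConn (liftedConn V θ) J).map (P.Phi2 (n + 1) hp) := by
    intro J hJ
    rw [divConn, if_neg (by have := (Finset.mem_Icc.1 hJ).1; omega)]; rfl
  rw [taylorMat, sum_range_succ_eq_add_sum_Icc, ← Finset.sum_congr rfl e, divConn, if_pos rfl,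
    pow_zero, one_smul, Matrix.map_one _ (map_zero _) (map_one _)]
  rfl

theorem inverseCartier_A1 (V : FilData P n) (θ : P.R (n + 1)) :
    P.Phi1 (n + 1) hp (P.omega1 (n + 1)) • (inverseCartier hp V θ).A1
      = (wt (liftedConn V θ)).map (P.Phi1 (n + 1) hp) := by
  rw [wt_liftedConn, map_smul_ringHom]; rfl

theorem omega2_eq_mul_Phi2 (N : ℕ) :
    P.omega2 N = P.t N ^ (p - 1) * P.Phi2 N hp (P.omega2 N) := by
  have h := omega2_mul P N
  have h2 := congrArg (P.Phi2 N hp) h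
  have hpp : P.t N ^ p = P.t N ^ (p - 1) * P.t N := by
    rw [← pow_succ, Nat.sub_add_cancel (Fact.out : p.Prime).one_le]
  rw [map_mul, Phi2_t, map_one, hpp] at h2
  linear_combination (-P.omega2 N) * h2 + P.Phi2 N hp (P.omega2 N) * P.t N ^ (p - 1) * h

theorem inverseCartier_A2 (V : FilData P n) (θ : P.R (n + 1)) :
    P.omega2 (n + 1) • (inverseCartier hp V θ).A2
      = P.t (n + 1) ^ (p - 1) • (wt (liftedConn2 V θ)).map (P.Phi2 (n + 1) hp) := by
  rw [wt_liftedConn2, map_smul_ringHom, smul_smul, ← omega2_eq_mul_Phi2]; rfl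

omit [PerfectRing k p] in
theorem functorT_mem {V : FilData P n} (hV : V.toConn.Glues) {θ : P.R (n + 1)}
    (hθ1 : θ ∈ P.chart1 (n + 1)) (hθ2 : P.invTlam (n + 1) * θ ∈ P.chart2 (n + 1)) :
    (∀ i j, (functorT V θ).A1 i j ∈ P.chart1 (n + 1)) ∧
      ∀ i j, (functorT V θ).A2 i j ∈ P.chart2 (n + 1) := by
  have h1 : ∀ i j, (p : P.R (n + 1)) * P.lift n (V.A1 i j) ∈ P.chart1 (n + 1) := fun i j =>
    p_mul_lift_mem_chart1 P n (hV.mem1 i j)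
  have h2 : ∀ i j, (p : P.R (n + 1)) * P.lift n (V.A2 i j) ∈ P.chart2 (n + 1) := fun i j =>
    p_mul_lift_mem_chart2 P n (hV.mem2 i j)
  constructor
  · intro i j
    fin_cases i <;> fin_cases j
    · exact h1 0 0
    · exact hθ1
    · change (p : P.R (n + 1)) ^ 2 * _ ∈ _
      rw [pow_two, mul_assoc]
      exact mul_mem (natCast_mem _ _) (h1 1 0)
    · exact h1 1 1
  · intro i j
    fin_cases i <;> fin_cases j
    · exact h2 0 0
    · change _ * _ * θ ∈ _
      rw [mul_assoc]
      exact mul_mem (const_mem_chart2 P _ _) hθ2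
    · change (p : P.R (n + 1)) ^ 2 * _ ∈ _
      rw [pow_two, mul_assoc]
      exact mul_mem (natCast_mem _ _) (h2 1 0)
    · exact h2 1 1

/-- The inverse Cartier transform is a bundle with a logarithmic connection. -/
theorem inverseCartier_glues {V : FilData P n} (hV : V.toConn.Glues) {θ : P.R (n + 1)}
    (hθ : P.red n θ = V.theta)
    (hθ1 : θ ∈ P.chart1 (n + 1)) (hθ2 : P.invTlam (n + 1) * θ ∈ P.chart2 (n + 1)) :
    (inverseCartier hp V θ).Glues where
  mem1 i j := Phi1_mem_chart1 P _ hp ((functorT_mem hV hθ1 hθ2).1 i j)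
  mem2 i j := Phi2_mem_chart2 P _ hp ((functorT_mem hV hθ1 hθ2).2 i j)
  glue := by
    have hu : IsUnit (P.Phi1 (n + 1) hp (P.omega1 (n + 1))) := (isUnit_omega1 P (n + 1)).map _
    have hz := Phi1_omega1_mul_D_z P (n + 1) hp
    have hT := congrArg (fun M => M.map (P.Phi2 (n + 1) hp)) (functorT_glue hV hθ)
    simp only [Matrix.map_mul, Matrix.map_add _ (map_add (P.Phi2 (n + 1) hp)), map_smul_ringHom,
      map_natCast] at hT
    have hS := DM_taylorMat_add hp (liftedConn V θ)
    have h1 : P.omega1 (n + 1) • (inverseCartier hp V θ).A1 = (P.D _ (P.z (n + 1) hp)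
        + P.t (n + 1) ^ (p - 1)) • (wt (liftedConn V θ)).map (P.Phi1 (n + 1) hp) := by
      rw [← inverseCartier_A1, smul_smul, mul_comm, hz]
    rw [h1, inverseCartier_A2, inverseCartier_G, DM_mul, DM_map_Phi2]
    set S := taylorMat hp (liftedConn V θ)
    set G := (hat (liftedG V)).map (P.Phi2 (n + 1) hp)
    rw [mul_assoc, mul_smul_comm, ← hS, mul_add, mul_smul_comm, ← mul_assoc G, hT, add_mul,
      smul_add]
    simp only [smul_mul_assoc, smul_smul, mul_assoc]
    rw [mul_comm (P.t (n + 1) ^ (p - 1))]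
    abel

omit [PerfectRing k p] in
theorem Conn.Glues.twist {N : ℕ} {c : Conn P N} (hc : c.Glues) (m : ℕ) : (c.twist m).Glues where
  mem1 := hc.mem1
  mem2 i j := by
    refine sub_mem (hc.mem2 i j) ?_
    rw [Matrix.smul_apply, Matrix.one_apply, smul_eq_mul]
    refine mul_mem (mul_mem (natCast_mem _ _) (tau_mem_chart2 P N)) ?_
    split_ifs
    · exact one_mem _
    · exact zero_mem _
  glue := by
    have h := hc.glue
    have hv := t1_mul_invT1 P N
    have ho := omega2_mul P N
    have hD : P.D N ((P.t N - 1) ^ m) = (P.t N - 1) ^ m * (m * P.invT1 N) := by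
      rw [Derivation.leibniz_pow, map_sub, D_t, Derivation.map_one_eq_zero, sub_zero]
      rcases m with _ | m
      · simp
      · rw [Nat.add_sub_cancel, pow_succ, nsmul_eq_mul, smul_eq_mul]
        linear_combination (-(P.t N - 1) ^ m * ((m + 1 : ℕ) : P.R N)) * hv
    have e : P.omega2 N * ((m : P.R N) * (P.t N * P.invT1 N)) = m * P.invT1 N := by
      linear_combination (m : P.R N) * P.invT1 N * ho
    simp only [Conn.twist, DM_smul, hD, smul_sub, smul_smul, e, sub_mul, smul_mul_assoc, one_mul,
      mul_smul_comm] at h ⊢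
    have h' := congrArg (fun M => (P.t N - 1) ^ m • M) h
    simp only [smul_add, smul_smul] at h'
    rw [mul_comm (P.omega1 N), h']
    abel

end Taylor

/-! ### Functoriality, deformation and reduction of the inverse Cartier transform -/

section Functoriality

variable {p : ℕ} [Fact p.Prime] {k : Type u} [Field k] [CharP k p] {P : Puncture p k} {n : ℕ}

theorem Conn.Gauge.twist {N : ℕ} {c c' : Conn P N} {a a' b b' : P.Mat N}
    (h : c.Gauge c' a a' b b') (m : ℕ) : (c.twist m).Gauge (c'.twist m) a a' b b' where
  mem1 := h.mem1
  mem1' := h.mem1'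
  mem2 := h.mem2
  mem2' := h.mem2'
  mul1 := h.mul1
  mul2 := h.mul2
  glue := by
    simp only [Conn.twist, smul_mul_assoc, mul_smul_comm, h.glue]
  conn1 := h.conn1
  conn2 := by
    have e := h.conn2
    simp only [Conn.twist, smul_sub, mul_sub, sub_mul, smul_mul_assoc, mul_smul_comm, mul_one,
      one_mul] at e ⊢
    rw [e]; abel

theorem hat_mul_hat {N : ℕ} {A B : P.Mat N} (hA : A 0 1 = 0) (hB : B 0 1 = 0) :
    hat A * hat B = hat (A * B) := by
  ext i j
  fin_cases i <;> fin_cases j <;> simp [hat, Matrix.mul_apply, Fin.sum_univ_two, hA, hB]; ring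

theorem hat_one {N : ℕ} : hat (1 : P.Mat N) = 1 := by
  ext i j
  fin_cases i <;> fin_cases j <;> simp [hat]

/-- A lower triangular matrix with constant diagonal over a subalgebra can be lifted together with
its inverse. -/
theorem exists_lift_lowerTriangular {c0 c1 : WittVector p k} (u0 : IsUnit c0) (u1 : IsUnit c1)
    {S : Subalgebra (WN p k (n + 1)) (P.R (n + 1))} {x : P.R (n + 1)} (hx : x ∈ S) :
    ∃ g' : P.Mat (n + 1), g' 0 1 = 0 ∧
      g' * !![P.const (n + 1) c0, 0; x, P.const (n + 1) c1] = 1 ∧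
      (∀ i j, hat !![P.const (n + 1) c0, 0; x, P.const (n + 1) c1] i j ∈ S) ∧
      ∀ i j, hat g' i j ∈ S := by
  obtain ⟨d0, h0⟩ := u0.exists_left_inv
  obtain ⟨d1, h1⟩ := u1.exists_left_inv
  have e0 := congrArg (P.const (n + 1)) h0
  have e1 := congrArg (P.const (n + 1)) h1
  rw [map_mul, map_one] at e0 e1
  have hc : ∀ c, P.const (n + 1) c ∈ S := fun c => Subalgebra.algebraMap_mem _ _
  refine ⟨!![P.const (n + 1) d0, 0; - (P.const (n + 1) d0 * P.const (n + 1) d1) * x,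
    P.const (n + 1) d1], rfl, ?_, ?_, ?_⟩
  · ext i j
    fin_cases i <;> fin_cases j <;> simp [Matrix.mul_apply, Fin.sum_univ_two, e0, e1]
    linear_combination (-P.const (n + 1) d1 * x) * e0
  · intro i j
    fin_cases i <;> fin_cases j
    · exact hc c0
    · exact zero_mem _
    · exact mul_mem (natCast_mem _ _) hx
    · exact hc c1
  · intro i j
    fin_cases i <;> fin_cases j
    · exact hc d0
    · exact zero_mem _
    · exact mul_mem (natCast_mem _ _) (mul_mem (neg_mem (mul_mem (hc d0) (hc d1))) hx)
    · exact hc d1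

/-- A gauge transformation of connections modulo `p ^ n` which is compatible with the lifted Higgs
fields is a gauge transformation of `p`-connections. -/
theorem hat_mul_wt_eq {g B B' : P.Mat (n + 1)} (hg : g 0 1 = 0)
    (hr : (nab B g).map (P.red n) = (g * B').map (P.red n))
    (h01 : (nab B g) 0 1 = (g * B') 0 1) :
    hat g * wt B' = wt B * hat g + (p : P.R (n + 1)) • P.DM (n + 1) (hat g) := by
  have hD : (P.DM (n + 1) g) 0 1 = 0 := by rw [DM_apply, hg, map_zero]
  have e := wt_congr hr h01
  rw [hat_mul_wt _ hg, wt_mul_hat _ hg, DM_hat, ← wt_eq_p_smul_hat hD, ← wt_add, ← e, nab,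
    add_comm (P.DM (n + 1) g)]

variable [PerfectRing k p] (hp : Odd p)

theorem Phi1_omega1_mul_D_Phi1_t (N : ℕ) :
    P.Phi1 N hp (P.omega1 N) * P.D N (P.Phi1 N hp (P.t N)) = p * P.omega1 N := by
  have h := congrArg (P.D N) (p_mul_z P N hp)
  have h2 := Phi1_omega1_mul_D_z P N hp
  rw [map_sub, D_Phi2, D_t, map_one, one_mul, Derivation.leibniz, Derivation.map_natCast,
    smul_zero, add_zero, smul_eq_mul] at h
  linear_combination (-P.Phi1 N hp (P.omega1 N)) * h + p * h2

theorem DM_map_Phi1 {N : ℕ} (M : P.Mat N) :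
    P.DM N (M.map (P.Phi1 N hp))
      = P.D N (P.Phi1 N hp (P.t N)) • (P.DM N M).map (P.Phi1 N hp) := by
  ext i j
  rw [DM_apply, Matrix.map_apply, D_Phi1, Matrix.smul_apply, Matrix.map_apply, DM_apply,
    smul_eq_mul, mul_comm]

/-- The inverse Cartier transform is functorial for isomorphisms of filtered de Rham bundles which
are compatible with the Higgs bundles. -/
theorem inverseCartier_gauge {V V' : FilData P n} (hV : V.toConn.Glues) (hV' : V'.toConn.Glues)
    {θ θ' : P.R (n + 1)} (hθ : P.red n θ = V.theta) (hθ' : P.red n θ' = V'.theta)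
    {g1 g1' g2 g2' : P.Mat n} (h : V.toConn.Gauge V'.toConn g1 g1' g2 g2')
    (h1 : g1 0 1 = 0) (h2 : g2 0 1 = 0) {c0 c1 : WittVector p k} (u0 : IsUnit c0) (u1 : IsUnit c1)
    (h100 : g1 0 0 = P.const n c0) (h111 : g1 1 1 = P.const n c1)
    (h200 : g2 0 0 = P.const n c0) (h211 : g2 1 1 = P.const n c1)
    (hc : P.const (n + 1) c0 * θ' = θ * P.const (n + 1) c1) :
    ∃ a a' b b', (inverseCartier hp V θ).Gauge (inverseCartier hp V' θ') a a' b b' := by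
  obtain ⟨x1, hx1, rx1⟩ := exists_mem_chart1_red_eq P n (h.mem1 1 0)
  obtain ⟨x2, hx2, rx2⟩ := exists_mem_chart2_red_eq P n (h.mem2 1 0)
  obtain ⟨k1, k101, kg1, mk1, mk1'⟩ := exists_lift_lowerTriangular (n := n) u0 u1 hx1
  obtain ⟨k2, k201, kg2, mk2, mk2'⟩ := exists_lift_lowerTriangular (n := n) u0 u1 hx2
  set G1 : P.Mat (n + 1) := !![P.const (n + 1) c0, 0; x1, P.const (n + 1) c1] with hG1
  set G2 : P.Mat (n + 1) := !![P.const (n + 1) c0, 0; x2, P.const (n + 1) c1] with hG2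
  have G101 : G1 0 1 = 0 := rfl
  have G201 : G2 0 1 = 0 := rfl
  have rG1 : G1.map (P.red n) = g1 := by
    ext i j
    fin_cases i <;> fin_cases j <;> simp [hG1, h1, h100, h111, rx1, red_const]
  have rG2 : G2.map (P.red n) = g2 := by
    ext i j
    fin_cases i <;> fin_cases j <;> simp [hG2, h2, h200, h211, rx2, red_const]
  set B := liftedConn V θ with hB
  set B' := liftedConn V' θ' with hB'
  set C := liftedConn2 V θ with hC
  set C' := liftedConn2 V' θ' with hC'
  have redB : (nab B G1).map (P.red n) = (G1 * B').map (P.red n) := by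
    rw [map_red_nab, map_red_mul, rG1, map_red_liftedConn hθ, map_red_liftedConn hθ', nab,
      h.conn1, add_comm]
  have redC : (nab C G2).map (P.red n) = (G2 * C').map (P.red n) := by
    rw [map_red_nab, map_red_mul, rG2, map_red_liftedConn2 hV hθ, map_red_liftedConn2 hV' hθ', nab,
      h.conn2, add_comm]
  have B01 : (nab B G1) 0 1 = (G1 * B') 0 1 := by
    simp [nab, DM_apply, hG1, hB, hB', liftedConn, Matrix.mul_apply, Fin.sum_univ_two]
    linear_combination (-P.omega1 (n + 1)) * hc
  have C01 : (nab C G2) 0 1 = (G2 * C') 0 1 := by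
    simp [nab, DM_apply, hG2, hC, hC', liftedConn2, Matrix.mul_apply, Fin.sum_univ_two]
    rw [← map_one (P.const (n + 1)), ← map_sub]
    linear_combination (-P.omega2 (n + 1) * P.const (n + 1) (P.lam - 1) * P.invTlam (n + 1)) * hc
  have key1 := hat_mul_wt_eq G101 redB B01
  have key2 := hat_mul_wt_eq G201 redC C01
  have gk1 : G1 * k1 = 1 := mul_eq_one_comm.1 kg1
  have gk2 : G2 * k2 = 1 := mul_eq_one_comm.1 kg2
  -- the gauge transform of `B` by `G1` is not `B'`, but it agrees with `B'` modulo `p ^ n` and in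
  -- its Higgs field, which is what the Taylor matrix depends on
  have hT : taylorMat hp B * (hat G1).map (P.Phi1 (n + 1) hp)
      = (hat G1).map (P.Phi2 (n + 1) hp) * taylorMat hp B' := by
    have hB'' : nab B G1 = G1 * (k1 * nab B G1) := by rw [← mul_assoc, gk1, one_mul]
    rw [taylorMat_mul_hat hp B G101 hB'', taylorMat_congr hp (B := B')]
    · rw [map_red_mul, redB, ← map_red_mul, ← mul_assoc, kg1, one_mul]
    · have e : (k1 * nab B G1) 0 1 = (k1 * (G1 * B')) 0 1 := by
        rw [Matrix.mul_apply, Matrix.mul_apply, Fin.sum_univ_two, Fin.sum_univ_two, k101, zero_mul,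
          zero_mul, B01]
      rw [e, ← mul_assoc, kg1, one_mul]
  have hGG : hat (liftedG V) * hat G1 = hat G2 * hat (liftedG V') := by
    have l0 : ∀ V : FilData P n, liftedG V 0 1 = 0 := fun _ => rfl
    rw [hat_mul_hat (l0 V) G101, hat_mul_hat G201 (l0 V')]
    refine hat_congr ?_ ?_ ?_
    · rw [map_red_mul, map_red_mul, rG1, rG2, map_red_liftedG, map_red_liftedG, h.glue]
    · simp [liftedG, hG1, hG2, Matrix.mul_apply, Fin.sum_univ_two]
    · simp [liftedG, hG1, hG2, Matrix.mul_apply, Fin.sum_univ_two, mul_comm]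
  have hu : IsUnit (P.Phi1 (n + 1) hp (P.omega1 (n + 1))) := (isUnit_omega1 P (n + 1)).map _
  refine ⟨(hat G1).map (P.Phi1 (n + 1) hp), (hat k1).map (P.Phi1 (n + 1) hp),
    (hat G2).map (P.Phi2 (n + 1) hp), (hat k2).map (P.Phi2 (n + 1) hp),
    fun i j => Phi1_mem_chart1 P _ hp (mk1 i j), fun i j => Phi1_mem_chart1 P _ hp (mk1' i j),
    fun i j => Phi2_mem_chart2 P _ hp (mk2 i j), fun i j => Phi2_mem_chart2 P _ hp (mk2' i j),
    ?_, ?_, ?_, ?_, ?_⟩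
  · rw [← Matrix.map_mul, hat_mul_hat G101 k101, gk1, hat_one, Matrix.map_one _ (map_zero _)
      (map_one _)]
  · rw [← Matrix.map_mul, hat_mul_hat G201 k201, gk2, hat_one, Matrix.map_one _ (map_zero _)
      (map_one _)]
  · rw [inverseCartier_G, inverseCartier_G, mul_assoc, ← hB, hT, ← mul_assoc, ← Matrix.map_mul,
      hGG, Matrix.map_mul, mul_assoc]
  · have hk := congrArg (fun M => P.omega1 (n + 1) • M.map (P.Phi1 (n + 1) hp)) key1
    simp only [Matrix.map_mul, map_add_ringHom, map_smul_ringHom, map_natCast, smul_add,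
      smul_smul] at hk
    have hinj : Function.Injective (fun M : P.Mat (n + 1) =>
        P.Phi1 (n + 1) hp (P.omega1 (n + 1)) • M) := fun M M' hM => hu.smul_left_cancel.1 hM
    apply hinj
    have i1 := inverseCartier_A1 hp V θ
    have i2 := inverseCartier_A1 hp V' θ'
    simp only [smul_add]
    rw [DM_map_Phi1, smul_smul, Phi1_omega1_mul_D_Phi1_t, ← mul_smul_comm, smul_comm _
      (P.omega1 (n + 1)), i2, ← smul_mul_assoc, smul_comm _ (P.omega1 (n + 1)), i1, mul_smul_comm,
      smul_mul_assoc, hk, mul_comm (P.omega1 (n + 1))]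
  · have hk := congrArg (fun M => P.t (n + 1) ^ (p - 1) • M.map (P.Phi2 (n + 1) hp)) key2
    simp only [Matrix.map_mul, map_add_ringHom, map_smul_ringHom, map_natCast, smul_add,
      smul_smul] at hk
    rw [inverseCartier_A2, inverseCartier_A2, mul_smul_comm, hk, DM_map_Phi2, smul_mul_assoc,
      mul_comm (P.t (n + 1) ^ (p - 1))]

/-- Changing the lift of the Higgs field by `p ^ n η`. -/
theorem inverseCartier_add (V : FilData P n) (θ η : P.R (n + 1)) :
    (inverseCartier hp V (θ + (p : P.R (n + 1)) ^ n * η)).G = (inverseCartier hp V θ).G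
        + ((p : P.R (n + 1)) ^ n * (P.z (n + 1) hp * P.Phi2 (n + 1) hp (P.omega1 (n + 1) * η)))
          • !![0, 1; 0, 0] ∧
    (inverseCartier hp V (θ + (p : P.R (n + 1)) ^ n * η)).A1 = (inverseCartier hp V θ).A1
        + ((p : P.R (n + 1)) ^ n * P.Phi1 (n + 1) hp η) • !![0, 1; 0, 0] := by
  have hp0 : (p : P.R (n + 1)) ^ n * p = 0 := by rw [← pow_succ, natCast_p_nilpotent]
  have hpn : P.red n ((p : P.R (n + 1)) ^ n) = 0 := by
    rw [map_pow, map_natCast, natCast_p_nilpotent]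
  constructor
  · have h01 : liftedConn V (θ + (p : P.R (n + 1)) ^ n * η) 0 1 - liftedConn V θ 0 1
        = (p : P.R (n + 1)) ^ n * (P.omega1 (n + 1) * η) := by
      simp [liftedConn]; ring
    have hr : (liftedConn V θ).map (P.red n)
        = (liftedConn V (θ + (p : P.R (n + 1)) ^ n * η)).map (P.red n) := by
      ext i j
      fin_cases i <;> fin_cases j <;> simp [liftedConn, hpn]
    rw [inverseCartier_G, inverseCartier_G, taylorMat_eq_add hp hr, h01, mul_add, add_right_inj,
      map_mul, map_pow, map_natCast]
    ext i j
    fin_cases i <;> fin_cases j <;> simp [hat, liftedG, Matrix.mul_apply, Fin.sum_univ_two]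
    · ring
    · linear_combination (P.Phi2 (n + 1) hp (P.lift n V.F) * P.z (n + 1) hp
        * (P.Phi2 (n + 1) hp (P.omega1 (n + 1)) * P.Phi2 (n + 1) hp η)) * hp0
  · ext i j
    fin_cases i <;> fin_cases j <;> simp [inverseCartier, functorT]

omit [PerfectRing k p] in
theorem p_mul_map_red_lift (x : P.R (n + 1)) :
    (p : P.R (n + 1)) * P.red (n + 1) (P.lift (n + 1) x) = p * P.lift n (P.red n x) := by
  rw [red_lift, p_mul_lift]

/-- The inverse Cartier transform is compatible with reduction. -/
theorem inverseCartier_red (V : FilData P (n + 1)) (θ : P.R (n + 2)) :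
    (inverseCartier hp V θ).red = inverseCartier hp V.red (P.red (n + 1) θ) := by
  have hΦ : ∀ M : P.Mat (n + 2), (M.map (P.Phi2 (n + 2) hp)).map (P.red (n + 1))
      = (M.map (P.red (n + 1))).map (P.Phi2 (n + 1) hp) := fun M => by
    ext i j; simp only [Matrix.map_apply, red_Phi2]
  have hΦ1 : ∀ M : P.Mat (n + 2), (M.map (P.Phi1 (n + 2) hp)).map (P.red (n + 1))
      = (M.map (P.red (n + 1))).map (P.Phi1 (n + 1) hp) := fun M => by
    ext i j; simp only [Matrix.map_apply, red_Phi1]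
  have e := p_mul_map_red_lift (P := P) (n := n)
  have hA1 : (functorT V θ).A1.map (P.red (n + 1)) = (functorT V.red (P.red (n + 1) θ)).A1 := by
    ext i j
    fin_cases i <;> fin_cases j <;> simp [functorT, FilData.red, e, pow_two, mul_assoc]
  have hA2 : (functorT V θ).A2.map (P.red (n + 1)) = (functorT V.red (P.red (n + 1) θ)).A2 := by
    ext i j
    fin_cases i <;> fin_cases j <;>
      simp [functorT, FilData.red, e, pow_two, mul_assoc, red_const, red_invTlam]
  have hG : (hat (liftedG V)).map (P.red (n + 1)) = hat (liftedG V.red) := by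
    ext i j
    fin_cases i <;> fin_cases j <;> simp [hat, liftedG, FilData.red, e, red_tau]
  have hB : taylorMat hp ((liftedConn V θ).map (P.red (n + 1)))
      = taylorMat hp (liftedConn V.red (P.red (n + 1) θ)) := by
    refine taylorMat_congr hp ?_ ?_
    · ext i j
      fin_cases i <;> fin_cases j <;> simp [liftedConn, FilData.red, red_omega1, red_lift]
    · simp [liftedConn, red_omega1]
  have h1 : ((inverseCartier hp V θ).G).map (P.red (n + 1))
      = (inverseCartier hp V.red (P.red (n + 1) θ)).G := by
    rw [inverseCartier_G, inverseCartier_G, Matrix.map_mul, hΦ, hG, map_red_taylorMat, hB]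
  have h2 : ((inverseCartier hp V θ).A1).map (P.red (n + 1))
      = (inverseCartier hp V.red (P.red (n + 1) θ)).A1 := by
    change ((functorT V θ).A1.map _).map _ = (functorT V.red (P.red (n + 1) θ)).A1.map _
    rw [hΦ1, hA1]
  have h3 : ((inverseCartier hp V θ).A2).map (P.red (n + 1))
      = (inverseCartier hp V.red (P.red (n + 1) θ)).A2 := by
    change ((functorT V θ).A2.map _).map _ = (functorT V.red (P.red (n + 1) θ)).A2.map _
    rw [hΦ, hA2]
  rw [Conn.red, h1, h2, h3]

omit [PerfectRing k p] in
theorem Conn.twist_red {N : ℕ} (c : Conn P (N + 1)) (m : ℕ) : (c.twist m).red = c.red.twist m := by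
  have e : ∀ M M' : P.Mat (N + 1), (M - M').map (P.red N) = M.map (P.red N) - M'.map (P.red N) :=
    fun M M' => Matrix.map_sub _ (map_sub _) M M'
  simp only [Conn.red, Conn.twist, map_smul_red, e, map_pow, map_sub, red_t, map_one, map_mul,
    map_natCast, red_invT1, Matrix.map_one _ (map_zero (P.red N)) (map_one (P.red N))]

/-- Reduction modulo `p`. -/
def Puncture.redOne (P : Puncture p k) (n : ℕ) : P.R (n + 1) →+* P.R 1 :=
  n.rec (motive := fun n => P.R (n + 1) →+* P.R 1) (RingHom.id _)
    (fun n f => f.comp (P.red (n + 1)))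

omit [PerfectRing k p] in
theorem redOne_zero (x : P.R 1) : P.redOne 0 x = x := rfl

omit [PerfectRing k p] in
theorem redOne_succ (x : P.R (n + 2)) : P.redOne (n + 1) x = P.redOne n (P.red (n + 1) x) := rfl

/-- Reduction modulo `p` of a bundle with connection. -/
def Conn.modP (c : Conn P (n + 1)) : Conn P 1 :=
  ⟨c.G.map (P.redOne n), c.A1.map (P.redOne n), c.A2.map (P.redOne n)⟩

omit [PerfectRing k p] in
theorem map_redOne_zero (M : P.Mat 1) : M.map (P.redOne 0) = M :=
  Matrix.ext fun _ _ => redOne_zero _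

omit [PerfectRing k p] in
theorem map_redOne_succ (M : P.Mat (n + 2)) :
    M.map (P.redOne (n + 1)) = (M.map (P.red (n + 1))).map (P.redOne n) :=
  Matrix.ext fun _ _ => redOne_succ _

omit [PerfectRing k p] in
theorem Conn.modP_zero (c : Conn P 1) : Conn.modP (n := 0) c = c := by
  rw [Conn.modP, map_redOne_zero, map_redOne_zero, map_redOne_zero]

omit [PerfectRing k p] in
theorem Conn.modP_succ (c : Conn P (n + 2)) : Conn.modP (n := n + 1) c = c.red.modP := by
  rw [Conn.modP, Conn.modP, map_redOne_succ, map_redOne_succ, map_redOne_succ, Conn.red]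

omit [PerfectRing k p] in
theorem Conn.Gauge.modP {c c' : Conn P (n + 1)} {a a' b b' : P.Mat (n + 1)}
    (h : c.Gauge c' a a' b b') : c.modP.Gauge c'.modP (a.map (P.redOne n)) (a'.map (P.redOne n))
      (b.map (P.redOne n)) (b'.map (P.redOne n)) := by
  induction n with
  | zero =>
    rw [Conn.modP_zero, Conn.modP_zero, map_redOne_zero, map_redOne_zero, map_redOne_zero,
      map_redOne_zero]
    exact h
  | succ n ih =>
    rw [Conn.modP_succ, Conn.modP_succ, map_redOne_succ, map_redOne_succ, map_redOne_succ,
      map_redOne_succ]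
    exact ih h.red

/-- The inverse Cartier transform modulo `p` of the Higgs bundle with Higgs field `θ`. -/
def Puncture.cartier1 (P : Puncture p k) (θ : P.R 1) : Conn P 1 :=
  inverseCartier hp (⟨0, 0, 0⟩ : FilData P 0) θ

omit [PerfectRing k p] in
theorem subsingleton_R_zero : Subsingleton (P.R 0) := by
  have : (1 : P.R 0) = 0 := by simpa using natCast_p_nilpotent P 0
  exact ⟨fun a b => eq_of_zero_eq_one this.symm _ _⟩

omit [PerfectRing k p] in
theorem filData_zero_eq (V V' : FilData P 0) : V = V' := by
  have := subsingleton_R_zero (P := P)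
  cases V; cases V'
  congr
  · exact Subsingleton.elim _ _
  · exact Subsingleton.elim _ _
  · exact Subsingleton.elim _ _

theorem inverseCartier_modP (V : FilData P n) (θ : P.R (n + 1)) :
    (inverseCartier hp V θ).modP = P.cartier1 hp (P.redOne n θ) := by
  induction n with
  | zero => rw [filData_zero_eq V ⟨0, 0, 0⟩, redOne_zero, Conn.modP_zero, Puncture.cartier1]
  | succ n ih => rw [Conn.modP_succ, inverseCartier_red, ih, redOne_succ]

omit [PerfectRing k p] in
theorem Conn.twist_modP (c : Conn P (n + 1)) (m : ℕ) : (c.twist m).modP = c.modP.twist m := by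
  induction n with
  | zero => rw [Conn.modP_zero, Conn.modP_zero]
  | succ n ih => rw [Conn.modP_succ, Conn.modP_succ, Conn.twist_red, ih]

omit [PerfectRing k p] in
theorem natCast_p_eq_zero : (p : P.R 1) = 0 := by simpa using natCast_p_nilpotent P 1

theorem cartier1_G (θ : P.R 1) : (P.cartier1 hp θ).G
    = !![1, P.z 1 hp * P.Phi2 1 hp (P.omega1 1 * θ); 0, P.Phi2 1 hp (P.tau 1)] := by
  have hT : taylorMat hp (0 : P.Mat (0 + 1)) = 1 := by
    have h0 : ∀ J, iterConn (0 : P.Mat (0 + 1)) (J + 1) = 0 := fun J => by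
      induction J with
      | zero => rw [iterConn_succ, iterConn, nab_one]
      | succ J ih => rw [iterConn_succ, ih, nab, map_zero, mul_zero, add_zero]
    have h1 : ∀ J ∈ Finset.Icc 1 (2 * (0 + 1)), P.z (0 + 1) hp ^ J •
        (divConn (0 : P.Mat (0 + 1)) J).map (P.Phi2 (0 + 1) hp) = 0 := fun J hJ => by
      obtain ⟨J, rfl⟩ : ∃ i, J = i + 1 := ⟨J - 1, by have := (Finset.mem_Icc.1 hJ).1; omega⟩
      rw [divConn, if_neg J.succ_ne_zero, h0, wt_zero, smul_zero, map_zero_ringHom, smul_zero]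
    rw [taylorMat, sum_range_succ_eq_add_sum_Icc, Finset.sum_eq_zero h1, divConn, if_pos rfl,
      pow_zero, one_smul, Matrix.map_one _ (map_zero _) (map_one _), add_zero]
  have hs := subsingleton_R_zero (P := P)
  have h2 : taylorMat hp (liftedConn (⟨0, 0, 0⟩ : FilData P 0) θ)
      = 1 + (P.z 1 hp * P.Phi2 1 hp (P.omega1 1 * θ)) • !![0, 1; 0, 0] := by
    rw [taylorMat_eq_add hp (B := 0) (Matrix.ext fun i j => Subsingleton.elim _ _), hT]
    simp [liftedConn]
  have h3 := natCast_p_eq_zero (P := P)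
  rw [Puncture.cartier1, inverseCartier_G, h2]
  ext i j
  fin_cases i <;> fin_cases j <;>
    simp [hat, liftedG, Matrix.mul_apply, Fin.sum_univ_two, h3]

theorem cartier1_A1 (θ : P.R 1) : (P.cartier1 hp θ).A1 = !![0, P.Phi1 1 hp θ; 0, 0] := by
  have h3 := natCast_p_eq_zero (P := P)
  ext i j
  fin_cases i <;> fin_cases j <;> simp [Puncture.cartier1, inverseCartier, functorT, h3]

theorem cartier1_A2 (θ : P.R 1) : (P.cartier1 hp θ).A2
    = !![0, P.Phi2 1 hp (P.const 1 (P.lam - 1) * P.invTlam 1 * θ); 0, 0] := by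
  have h3 := natCast_p_eq_zero (P := P)
  ext i j
  fin_cases i <;> fin_cases j <;> simp [Puncture.cartier1, inverseCartier, functorT, h3]

end Functoriality

/-! ### The Hodge line subbundle -/

section Hodge

variable {p : ℕ} [Fact p.Prime] {k : Type u} [Field k] [CharP k p] {P : Puncture p k} {N : ℕ}

/-- Compatible maps from `𝒪(1)` to a bundle which is isomorphic to an extension of `𝒪` by `𝒪(1)`
are constant multiples of the inclusion of the Hodge line subbundle. -/
theorem Conn.Gauge.exists_const_mul {c : Conn P N} {V : FilData P N} {a a' b b' : P.Mat N}
    (h : c.Gauge V.toConn a a' b b') {x y : Fin 2 → P.R N} (hx : ∀ i, x i ∈ P.chart1 N)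
    (hy : ∀ i, y i ∈ P.chart2 N) (hxy : c.G.mulVec x = P.tau N • y) :
    ∃ C, ∀ i, x i = P.const N C * a i 1 ∧ y i = P.const N C * b i 1 := by
  have ea : a * a' = 1 := h.mul1
  have eb : b * b' = 1 := h.mul2
  set v := a'.mulVec x with hv
  set w := b'.mulVec y with hw
  have hx' : x = a.mulVec v := by rw [hv, Matrix.mulVec_mulVec, ea, Matrix.one_mulVec]
  have hy' : y = b.mulVec w := by rw [hw, Matrix.mulVec_mulVec, eb, Matrix.one_mulVec]
  have hvm : ∀ i, v i ∈ P.chart1 N := fun i => by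
    simp only [hv, Matrix.mulVec, dotProduct]
    exact sum_mem fun j _ => mul_mem (h.mem1' i j) (hx j)
  have hwm : ∀ i, w i ∈ P.chart2 N := fun i => by
    simp only [hw, Matrix.mulVec, dotProduct]
    exact sum_mem fun j _ => mul_mem (h.mem2' i j) (hy j)
  have key : V.toConn.G.mulVec v = P.tau N • w := by
    have e := h.symm.glue
    rw [hv, Matrix.mulVec_mulVec, e, ← Matrix.mulVec_mulVec, hxy, Matrix.mulVec_smul]
  have k0 := congrFun key 0
  have k1 := congrFun key 1
  simp only [FilData.toConn, Matrix.mulVec, dotProduct, Fin.sum_univ_two, Matrix.of_apply,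
    Matrix.cons_val_zero, Matrix.cons_val_one, Matrix.cons_val_fin_one, one_mul, zero_mul,
    add_zero, Pi.smul_apply, smul_eq_mul] at k0 k1
  -- the component in the quotient `𝒪` of the extension is a section of `𝒪(-1)`
  have v0 : v 0 = 0 := eq_zero_of_eq_tau_mul P N (hvm 0) (hwm 0) k0
  have hu := isUnit_tau P N
  have w0 : w 0 = 0 := by
    apply hu.mul_left_cancel
    rw [← k0, v0, mul_zero]
  have vw : v 1 = w 1 := by
    apply hu.mul_left_cancel
    rw [← k1, v0, mul_zero, zero_add]; rfl
  obtain ⟨C, hC⟩ := exists_const_of_mem_charts P N (hvm 1) (vw ▸ hwm 1)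
  refine ⟨C, fun i => ⟨?_, ?_⟩⟩
  · rw [hx', Matrix.mulVec, dotProduct, Fin.sum_univ_two, v0, hC]; ring
  · rw [hy', Matrix.mulVec, dotProduct, Fin.sum_univ_two, w0, ← vw, hC]; ring

/-- The determinant of `∇(∂) x` and `x`. -/
def Conn.wronskian (c : Conn P N) (x : Fin 2 → P.R N) : P.R N :=
  (P.D N (x 0) + P.omega1 N * (c.A1.mulVec x) 0) * x 1
    - (P.D N (x 1) + P.omega1 N * (c.A1.mulVec x) 1) * x 0

theorem Conn.wronskian_const_mul (c : Conn P N) (C : WittVector p k) (x : Fin 2 → P.R N) :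
    c.wronskian (fun i => P.const N C * x i) = P.const N C ^ 2 * c.wronskian x := by
  simp only [Conn.wronskian, Matrix.mulVec, dotProduct, Fin.sum_univ_two, Derivation.leibniz,
    D_const, smul_eq_mul]
  ring

/-- The Higgs field is the Wronskian of the Hodge line subbundle. -/
theorem Conn.Gauge.wronskian_eq {c : Conn P N} {V : FilData P N} {a a' b b' : P.Mat N}
    (h : c.Gauge V.toConn a a' b b') :
    c.wronskian (fun i => a i 1) = P.omega1 N * V.theta * a.det := by
  have e0 := congrFun (congrFun h.conn1 0) 1
  have e1 := congrFun (congrFun h.conn1 1) 1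
  simp only [FilData.toConn, Matrix.mul_apply, Fin.sum_univ_two, Matrix.add_apply, DM_apply,
    Matrix.smul_apply, smul_eq_mul] at e0 e1
  simp only [Conn.wronskian, Matrix.mulVec, dotProduct, Fin.sum_univ_two, FilData.theta,
    Matrix.det_fin_two]
  linear_combination (-a 1 1) * e0 + a 0 1 * e1

variable [PerfectRing k p]

theorem isUnit_of_isUnit_const {x : WittVector p k} (h : IsUnit (P.const (N + 1) x)) :
    IsUnit x := by
  apply WittVector.isUnit_of_coeff_zero_ne_zero
  intro h0
  obtain ⟨y, hy⟩ := h.exists_left_inv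
  obtain ⟨d, rfl⟩ : (p : WittVector p k) ∣ x := by
    rw [← Ideal.mem_span_singleton]
    exact (WittVector.mem_span_p_iff_coeff_zero_eq_zero _).2 h0
  have h1 : P.const (N + 1) ((p : WittVector p k) ^ N) = 0 := by
    have e : P.const (N + 1) ((p : WittVector p k) ^ (N + 1)) = 0 :=
      (const_eq_zero_iff P (N + 1)).2 dvd_rfl
    have e2 : P.const (N + 1) ((p : WittVector p k) ^ N)
        = y * P.const (N + 1) d * P.const (N + 1) ((p : WittVector p k) ^ (N + 1)) := by
      rw [map_mul] at hy
      rw [map_pow, map_pow, pow_succ]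
      linear_combination (-P.const (N + 1) (p : WittVector p k) ^ N) * hy
    rw [e2, e, mul_zero]
  rw [const_eq_zero_iff] at h1
  have hp0 : (p : WittVector p k) ≠ 0 := WittVector.p_nonzero p k
  have hpu : IsUnit (p : WittVector p k) := by
    obtain ⟨e, he⟩ := h1
    refine IsUnit.of_mul_eq_one e ?_
    apply mul_left_cancel₀ (pow_ne_zero N hp0)
    rw [mul_one, ← mul_assoc, ← pow_succ]; exact he.symm
  have h2 := hpu.map (WittVector.constantCoeff : WittVector p k →+* k)
  rw [map_natCast, CharP.cast_eq_zero] at h2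
  exact not_isUnit_zero h2

/-- Every isomorphism of de Rham bundles preserves the Hodge filtrations. -/
theorem Conn.Gauge.exists_const {V V' : FilData P (N + 1)} {a a' b b' : P.Mat (N + 1)}
    (h : V.toConn.Gauge V'.toConn a a' b b') :
    a 0 1 = 0 ∧ b 0 1 = 0 ∧ ∃ c0 c1, IsUnit c0 ∧ IsUnit c1 ∧
      a 0 0 = P.const (N + 1) c0 ∧ a 1 1 = P.const (N + 1) c1 ∧
      b 0 0 = P.const (N + 1) c0 ∧ b 1 1 = P.const (N + 1) c1 ∧
      P.const (N + 1) c0 * V'.theta = V.theta * P.const (N + 1) c1 := by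
  have hG : V.toConn.G.mulVec ![0, 1] = P.tau (N + 1) • ![0, 1] := by
    ext i
    fin_cases i <;> simp [FilData.toConn, Puncture.tau, Matrix.mulVec, dotProduct, Fin.sum_univ_two]
  have h01 : ∀ (S : Subalgebra (WN p k (N + 1)) (P.R (N + 1))) i,
      (![0, 1] : Fin 2 → P.R (N + 1)) i ∈ S := by
    intro S i
    fin_cases i
    · exact zero_mem _
    · exact one_mem _
  obtain ⟨C, hC⟩ := h.exists_const_mul (h01 _) (h01 _) hG
  have e1 : P.const (N + 1) C * a 1 1 = 1 := (hC 1).1.symm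
  have e2 : P.const (N + 1) C * b 1 1 = 1 := (hC 1).2.symm
  have e3 : P.const (N + 1) C * a 0 1 = 0 := (hC 0).1.symm
  have e4 : P.const (N + 1) C * b 0 1 = 0 := (hC 0).2.symm
  have hu : IsUnit (P.const (N + 1) C) := IsUnit.of_mul_eq_one _ e1
  have a01 : a 0 1 = 0 := hu.mul_left_cancel (by rw [e3, mul_zero])
  have b01 : b 0 1 = 0 := hu.mul_left_cancel (by rw [e4, mul_zero])
  have a11 : a 1 1 = b 1 1 := hu.mul_left_cancel (by rw [e1, e2])
  have a00 : a 0 0 = b 0 0 := by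
    have e := congrFun (congrFun h.glue 0) 0
    simpa [FilData.toConn, Matrix.mul_apply, Fin.sum_univ_two, b01] using e
  obtain ⟨c0, h0⟩ := exists_const_of_mem_charts P _ (h.mem1 0 0) (a00 ▸ h.mem2 0 0)
  obtain ⟨c1, h1⟩ := exists_const_of_mem_charts P _ (h.mem1 1 1) (a11 ▸ h.mem2 1 1)
  have u0 : IsUnit (P.const (N + 1) c0) := by
    have e := congrFun (congrFun h.mul1 0) 0
    rw [Matrix.mul_apply, Fin.sum_univ_two, a01, zero_mul, add_zero, h0, Matrix.one_apply_eq] at e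
    exact IsUnit.of_mul_eq_one _ e
  have u1 : IsUnit (P.const (N + 1) c1) := by
    rw [h1, mul_comm] at e1
    exact IsUnit.of_mul_eq_one _ e1
  refine ⟨a01, b01, c0, c1, isUnit_of_isUnit_const u0, isUnit_of_isUnit_const u1, h0, h1,
    a00 ▸ h0, a11 ▸ h1, ?_⟩
  have e := congrFun (congrFun h.conn1 0) 1
  simp only [FilData.toConn, Matrix.mul_apply, Fin.sum_univ_two, Matrix.add_apply, DM_apply,
    Matrix.smul_apply, smul_eq_mul, a01, map_zero, h0, h1] at e
  apply (isUnit_omega1 P (N + 1)).mul_left_cancel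
  rw [FilData.theta, FilData.theta]
  linear_combination e

end Hodge

section ModP

/-! ### Reduction modulo `p` -/

variable {p : ℕ} [Fact p.Prime] {k : Type u} [Field k] [CharP k p] [PerfectRing k p]
  (P : Puncture p k) {N : ℕ}

theorem exists_eq_add_p_mul {x y : WittVector p k} (h : x.coeff 0 = y.coeff 0) :
    ∃ d, x = y + (p : WittVector p k) * d := by
  have h1 : x - y ∈ Ideal.span {(p : WittVector p k)} := by
    rw [WittVector.mem_span_p_iff_coeff_zero_eq_zero]
    change WittVector.constantCoeff (x - y) = 0
    rw [map_sub, sub_eq_zero]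
    exact h
  obtain ⟨d, hd⟩ := Ideal.mem_span_singleton.1 h1
  exact ⟨d, by rw [← hd]; ring⟩

theorem const_one_eq {x y : WittVector p k} (h : x.coeff 0 = y.coeff 0) :
    P.const 1 x = P.const 1 y := by
  obtain ⟨d, rfl⟩ := exists_eq_add_p_mul h
  rw [map_add, map_mul, map_natCast, natCast_p_eq_zero, zero_mul, add_zero]

variable (p k) in
/-- The residue field as a subring of `W₁(k)`. -/
def resW : k →+* WN p k 1 where
  toFun x := mkW p k 1 (WittVector.teichmuller p x)
  map_zero' := by rw [WittVector.teichmuller_zero, map_zero]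
  map_one' := by rw [map_one, map_one]
  map_mul' x y := by rw [map_mul, map_mul]
  map_add' x y := by
    have h : (WittVector.teichmuller p (x + y)).coeff 0
        = (WittVector.teichmuller p x + WittVector.teichmuller p y).coeff 0 := by
      rw [WittVector.add_coeff_zero]
      simp only [WittVector.teichmuller_coeff_zero]
    obtain ⟨d, hd⟩ := exists_eq_add_p_mul h
    rw [← map_add, hd, map_add, map_mul, Ideal.Quotient.eq_zero_iff_mem.2
      (Ideal.mem_span_singleton.2 (pow_one (p : WittVector p k)).dvd), zero_mul, add_zero]

/-- The residue field as constants of `R₁₂ / p`. -/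
def Puncture.res : k →+* P.R 1 := (algebraMap (WN p k 1) (P.R 1)).comp (resW p k)

theorem res_apply (x : k) : P.res x = P.const 1 (WittVector.teichmuller p x) := rfl

theorem const_one (x : WittVector p k) : P.const 1 x = P.res (x.coeff 0) :=
  const_one_eq P (by simp)

/-- Polynomials over the residue field as functions modulo `p`. -/
def Puncture.ev : k[X] →+* P.R 1 := eval₂RingHom P.res (P.t 1)

theorem ev_X : P.ev X = P.t 1 := eval₂_X _ _

theorem ev_C (x : k) : P.ev (C x) = P.res x := eval₂_C _ _

theorem ev_map_constantCoeff (f : (WittVector p k)[X]) :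
    P.ev (f.map WittVector.constantCoeff) = eval₂ (P.const 1) (P.t 1) f := by
  rw [Puncture.ev, coe_eval₂RingHom, eval₂_map]
  congr 1
  exact RingHom.ext fun x => (const_one P x).symm

theorem ev_eq_algebraMap (f : k[X]) : P.ev f = algebraMap _ (P.R 1) (f.map (resW p k)) := by
  induction f using Polynomial.induction_on' with
  | add f g hf hg => rw [map_add, hf, hg, Polynomial.map_add, map_add]
  | monomial n a =>
    rw [← C_mul_X_pow_eq_monomial, map_mul, map_pow, ev_C, ev_X, Polynomial.map_mul,
      Polynomial.map_pow, map_X, map_C, map_mul, map_pow]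
    exact congrArg₂ _ (algebraMap_C_mkW P 1 _).symm rfl

theorem D_res (x : k) : P.D 1 (P.res x) = 0 := D_const P 1 _

theorem D_ev (f : k[X]) : P.D 1 (P.ev f) = P.ev (derivative f) := by
  induction f using Polynomial.induction_on' with
  | add f g hf hg => simp [hf, hg]
  | monomial n a =>
    rw [← C_mul_X_pow_eq_monomial, map_mul, map_pow, ev_C, ev_X, Derivation.leibniz, D_res,
      smul_zero, add_zero, Derivation.leibniz_pow, D_t, derivative_C_mul_X_pow]
    simp [ev_C, ev_X]
    ring

instance : Nontrivial (P.R 1) := by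
  refine ⟨1, 0, fun h => ?_⟩
  have h1 : IsUnit (P.const (0 + 1) 0) := by
    rw [map_zero]; exact IsUnit.of_mul_eq_one 1 (by rw [zero_mul, h])
  have h2 := isUnit_of_isUnit_const h1
  exact not_isUnit_zero h2

theorem ev_injective : Function.Injective P.ev := by
  have : Nontrivial (WN p k 1) := (algebraMap (WN p k 1) (P.R 1)).domain_nontrivial
  have h : (P.ev : k[X] → P.R 1) = algebraMap _ (P.R 1) ∘ Polynomial.map (resW p k) :=
    funext (ev_eq_algebraMap P)
  rw [h]
  exact (algebraMap_injective P 1).comp (map_injective _ (resW p k).injective)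

instance : CharP (P.R 1) p :=
  (CharP.charP_iff_prime_eq_zero (Fact.out : p.Prime)).2 natCast_p_eq_zero

theorem const_one_frobenius (x : WittVector p k) :
    P.const 1 (WittVector.frobenius x) = P.const 1 x ^ p := by
  obtain ⟨d, hd⟩ := exists_frobenius_eq x
  rw [hd, map_add, map_mul, map_natCast, natCast_p_eq_zero, zero_mul, add_zero, map_pow]

variable (hp : Odd p)

theorem Phi2_one (x : P.R 1) : P.Phi2 1 hp x = x ^ p := by
  have h : P.Phi2 1 hp = frobenius (P.R 1) p := by
    refine R_ringHom_ext (fun x => ?_) ?_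
    · rw [Phi2_const, const_one_frobenius, frobenius_def]
    · rw [Phi2_t, frobenius_def]
  rw [h, frobenius_def]

/-- Modulo `p` both Frobenius lifts are the Frobenius endomorphism. -/
theorem Phi1_one (x : P.R 1) : P.Phi1 1 hp x = x ^ p := by
  have h : P.Phi1 1 hp = frobenius (P.R 1) p := by
    refine R_ringHom_ext (fun x => ?_) ?_
    · rw [Phi1_const, const_one_frobenius, frobenius_def]
    · have e := p_mul_z P 1 hp
      rw [natCast_p_eq_zero, zero_mul, Phi2_t] at e
      rw [frobenius_def]
      linear_combination -e
  rw [h, frobenius_def]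

/-- The reduction of `lam`. -/
def Puncture.l (P : Puncture p k) : k := P.lam.coeff 0

/-- The reduction of the polynomial `Q`. -/
def Puncture.Z : k[X] := (P.Q hp).map WittVector.constantCoeff

omit [PerfectRing k p] in
theorem map_den : P.den.map WittVector.constantCoeff = C (1 - P.l ^ p) := by
  simp only [Puncture.den, Polynomial.map_sub, Polynomial.map_pow, map_X, map_C,
    Polynomial.map_one]
  rw [sub_pow_char, sub_pow_char]
  simp [Puncture.l, WittVector.constantCoeff]

theorem z_mul : P.z 1 hp * P.res (1 - P.l ^ p) = P.ev (P.Z hp) := by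
  have h := z_mul_den P 1 hp
  rwa [← ev_map_constantCoeff, ← ev_map_constantCoeff, map_den, ev_C] at h

omit [PerfectRing k p] in
theorem one_sub_l_pow : (1 - P.l ^ p) = (1 - P.l) ^ p := by
  rw [sub_pow_char, one_pow]

/-- The derivative of `(Φ₁(t) - Φ₂(t)) / p` modulo `p`. -/
theorem derivative_Z : derivative (P.Z hp)
    = C (1 - P.l) * ((X - C P.l) * (X - 1)) ^ (p - 1) - C (1 - P.l) ^ p * X ^ (p - 1) := by
  have h := congrArg (Polynomial.map WittVector.constantCoeff) (derivative_Q_mul_den P hp)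
  have hl : (1 - P.l) ≠ 0 := sub_ne_zero.2 (fun h => P.ne_one h.symm)
  have hf : WittVector.constantCoeff (WittVector.frobenius P.lam) = P.l ^ p :=
    WittVector.coeff_frobenius_charP p P.lam 0
  have hl0 : WittVector.constantCoeff P.lam = P.l := rfl
  rw [Polynomial.map_sub, Polynomial.map_mul, Polynomial.map_mul, ← derivative_map,
    ← derivative_map, map_den, derivative_C, mul_zero, sub_zero] at h
  simp only [Polynomial.map_sub, Polynomial.map_mul, Polynomial.map_pow, map_X, map_C,
    map_den, map_mul, map_sub, map_one, Polynomial.map_one, hf, hl0] at h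
  have hd : (C (1 - P.l) : k[X]) ^ p ≠ 0 := pow_ne_zero _ (C_ne_zero.2 hl)
  have hd2 : (1 - C P.l ^ p : k[X]) = C (1 - P.l) ^ p := by
    rw [← C_pow, ← C_1, ← C_sub, one_sub_l_pow, C_pow]
  apply mul_right_cancel₀ hd
  simp only [map_pow, hd2] at h
  rw [Puncture.Z, h, C_sub, C_1]
  ring

theorem natDegree_Z_le : (P.Z hp).natDegree ≤ 2 * p - 1 := by
  refine natDegree_map_le.trans (natDegree_le_iff_coeff_eq_zero.2 fun i hi => ?_)
  have hp0 : (p : WittVector p k) ≠ 0 := WittVector.p_nonzero p k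
  apply mul_left_cancel₀ hp0
  have h1 : (p : WittVector p k) * (P.Q hp).coeff i = P.num.coeff i := by
    rw [num_eq_Q P hp, ← map_natCast C, coeff_C_mul]
  rw [h1, mul_zero]
  have hpos := (Fact.out : p.Prime).pos
  have m1 : (X - C P.lam : (WittVector p k)[X]).Monic := monic_X_sub_C _
  have m2 : (X - 1 : (WittVector p k)[X]).Monic := by simpa using monic_X_sub_C (1 : WittVector p k)
  have n2 : (X - 1 : (WittVector p k)[X]).natDegree = 1 := by
    simpa using natDegree_X_sub_C (1 : WittVector p k)
  have d1 : ((X - C P.lam : (WittVector p k)[X]) ^ p).natDegree = p := by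
    rw [m1.natDegree_pow, natDegree_X_sub_C, mul_one]
  have d2 : ((X - 1 : (WittVector p k)[X]) ^ p).natDegree = p := by
    rw [m2.natDegree_pow, n2, mul_one]
  have c1 : ∀ j, p < j → ((X - C P.lam : (WittVector p k)[X]) ^ p).coeff j = 0 := fun j hj =>
    coeff_eq_zero_of_natDegree_lt (by rw [d1]; exact hj)
  have c2 : ∀ j, p < j → ((X - 1 : (WittVector p k)[X]) ^ p).coeff j = 0 := fun j hj =>
    coeff_eq_zero_of_natDegree_lt (by rw [d2]; exact hj)
  have c3 : ((X - C P.lam : (WittVector p k)[X]) ^ p).coeff p = 1 := by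
    have := (m1.pow p).coeff_natDegree
    rwa [d1] at this
  have c4 : ((X - 1 : (WittVector p k)[X]) ^ p).coeff p = 1 := by
    have := (m2.pow p).coeff_natDegree
    rwa [d2] at this
  obtain ⟨j, rfl⟩ : ∃ j, i = j + p := ⟨i - p, by omega⟩
  rw [Puncture.num, coeff_sub, coeff_sub, coeff_C_mul, c1 _ (by omega), c2 _ (by omega), mul_comm (X ^ p),
    coeff_mul_X_pow, coeff_sub]
  rcases (show p ≤ j by omega).eq_or_lt with rfl | hj
  · rw [c3, c4]; ring
  · rw [c1 _ hj, c2 _ hj]; ring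

end ModP

/-! ### The Hodge line subbundle modulo `p`, by polynomials -/

section Polynomials

/-- The polynomial with given coefficients. -/
def ofCoeffs {A : Type*} [CommRing A] {n : ℕ} (v : Fin n → A) : A[X] :=
  ∑ i, C (v i) * X ^ (i : ℕ)

section Coeffs

variable {A : Type*} [CommRing A] {n : ℕ}

theorem ofCoeffs_add (v w : Fin n → A) : ofCoeffs (v + w) = ofCoeffs v + ofCoeffs w := by
  simp [ofCoeffs, add_mul, Finset.sum_add_distrib]

theorem ofCoeffs_smul (c : A) (v : Fin n → A) : ofCoeffs (c • v) = C c * ofCoeffs v := by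
  simp [ofCoeffs, mul_assoc, Finset.mul_sum]

theorem coeff_ofCoeffs (v : Fin n → A) (i : Fin n) : (ofCoeffs v).coeff i = v i := by
  rw [ofCoeffs, finsetSum_coeff, Finset.sum_eq_single i]
  · simp
  · intro j _ hj
    rw [coeff_C_mul, coeff_X_pow, if_neg (fun h => hj (Fin.ext h.symm)), mul_zero]
  · simp

theorem natDegree_ofCoeffs_le (v : Fin (n + 1) → A) : (ofCoeffs v).natDegree ≤ n :=
  natDegree_sum_le_of_forall_le _ _ fun i _ =>
    (natDegree_C_mul_X_pow_le _ _).trans (Nat.le_of_lt_succ i.2)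

theorem map_ofCoeffs {B : Type*} [CommRing B] (f : A →+* B) (v : Fin n → A) :
    (ofCoeffs v).map f = ofCoeffs (fun i => f (v i)) := by
  simp [ofCoeffs, Polynomial.map_sum]

end Coeffs

/-- The polynomial `(X - l) (X - 1)`. -/
def kapP {A : Type*} [CommRing A] (l : A) : A[X] := (X - C l) * (X - 1)

theorem monic_kapP {A : Type*} [CommRing A] (l : A) : (kapP l).Monic :=
  (monic_X_sub_C l).mul (by simpa using monic_X_sub_C (1 : A))

theorem map_kapP {A B : Type*} [CommRing A] [CommRing B] (f : A →+* B) (l : A) :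
    (kapP l).map f = kapP (f l) := by
  simp [kapP]

theorem natDegree_kapP {A : Type*} [CommRing A] [Nontrivial A] (l : A) :
    (kapP l).natDegree = 2 := by
  have h : (X - 1 : A[X]).Monic := by simpa using monic_X_sub_C (1 : A)
  have h2 : (X - 1 : A[X]).natDegree = 1 := by simpa using natDegree_X_sub_C (1 : A)
  rw [kapP, (monic_X_sub_C l).natDegree_mul h, natDegree_X_sub_C, h2]

/-- The numerators `U`, `Q` over `U₁` and `M` over `U₂` of the inclusion of the Hodge line
subbundle in the inverse Cartier transform modulo `p` of the Higgs bundle with zero `Y ^ (1/p)`: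
the coordinates over `U₁` are `U / X ^ (p-1)` and `Q / X ^ (p-1)`. The polynomial `Z` stands for
`(Φ₁(t) - Φ₂(t)) / p` modulo `p`. -/
structure IsSol {A : Type*} [CommRing A] (p m : ℕ) (l Y : A) (Z U Q M : A[X]) : Prop where
  eq : U * kapP l ^ p = Z * (X ^ p - C Y) * Q + X ^ p * M
  natDegree_U : U.natDegree ≤ 3 * m
  natDegree_Q : Q.natDegree ≤ m
  natDegree_M : M.natDegree ≤ 3 * m + 1

theorem IsSol.map {A B : Type*} [CommRing A] [CommRing B] (f : A →+* B) {p m : ℕ} {l Y : A}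
    {Z U Q M : A[X]} (h : IsSol p m l Y Z U Q M) :
    IsSol p m (f l) (f Y) (Z.map f) (U.map f) (Q.map f) (M.map f) where
  eq := by
    have e := congrArg (Polynomial.map f) h.eq
    simpa [map_kapP] using e
  natDegree_U := natDegree_map_le.trans h.natDegree_U
  natDegree_Q := natDegree_map_le.trans h.natDegree_Q
  natDegree_M := natDegree_map_le.trans h.natDegree_M

/-- Count of unknowns and equations: there is a nonzero solution. -/
theorem exists_coeffs_ne_zero {A : Type*} [CommRing A] [Nontrivial A] {p m : ℕ}
    (hm : p = 2 * m + 1) (l Y : A) (Z : A[X]) (hZ : Z.natDegree ≤ 2 * p - 1) :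
    ∃ v : (Fin (3 * m + 1) → A) × (Fin (m + 1) → A) × (Fin (3 * m + 2) → A), v ≠ 0 ∧
      ofCoeffs v.1 * kapP l ^ p = Z * (X ^ p - C Y) * ofCoeffs v.2.1
        + X ^ p * ofCoeffs v.2.2 := by
  let E : (Fin (3 * m + 1) → A) × (Fin (m + 1) → A) × (Fin (3 * m + 2) → A) → A[X] := fun v =>
    ofCoeffs v.1 * kapP l ^ p - Z * (X ^ p - C Y) * ofCoeffs v.2.1 - X ^ p * ofCoeffs v.2.2
  let F : ((Fin (3 * m + 1) → A) × (Fin (m + 1) → A) × (Fin (3 * m + 2) → A))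
      →ₗ[A] (Fin (7 * m + 3) → A) :=
    { toFun := fun v i => (E v).coeff i
      map_add' := fun v w => by
        ext i
        simp only [E, Prod.fst_add, Prod.snd_add, ofCoeffs_add, Pi.add_apply, ← coeff_add]
        ring_nf
      map_smul' := fun c v => by
        ext i
        simp only [E, Prod.smul_fst, Prod.smul_snd, ofCoeffs_smul, Pi.smul_apply, smul_eq_mul,
          RingHom.id_apply, ← coeff_C_mul]
        ring_nf }
  have hdeg : ∀ v, (E v).natDegree ≤ 7 * m + 2 := by
    intro v
    have h1 := natDegree_ofCoeffs_le v.1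
    have h2 := natDegree_ofCoeffs_le v.2.1
    have h3 := natDegree_ofCoeffs_le v.2.2
    have hk : (kapP l ^ p).natDegree ≤ 2 * p := by
      refine natDegree_pow_le.trans ?_
      rw [natDegree_kapP, mul_comm]
    have hy : (X ^ p - C Y).natDegree ≤ p := natDegree_X_pow_sub_C.le
    refine (natDegree_sub_le_of_le (natDegree_sub_le_of_le
      (natDegree_mul_le_of_le h1 hk) (natDegree_mul_le_of_le (natDegree_mul_le_of_le hZ hy) h2))
      (natDegree_mul_le_of_le (natDegree_X_pow_le p) h3)).trans ?_
    simp only [max_le_iff]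
    omega
  have hnot : ¬ Function.Injective F := by
    intro hinj
    have h := LinearMap.finrank_le_finrank_of_injective hinj
    simp at h
    omega
  rw [← LinearMap.ker_eq_bot, Submodule.eq_bot_iff] at hnot
  push Not at hnot
  obtain ⟨v, hv, hv0⟩ := hnot
  refine ⟨v, hv0, ?_⟩
  have hE : E v = 0 := by
    ext i
    rw [coeff_zero]
    by_cases hi : i < 7 * m + 3
    · exact congrFun (LinearMap.mem_ker.1 hv) ⟨i, hi⟩
    · exact coeff_eq_zero_of_natDegree_lt (lt_of_le_of_lt (hdeg v) (by omega))
  simp only [E] at hE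
  linear_combination hE

/-- Over a principal ideal domain a nonzero vector is a multiple of a unimodular one. -/
theorem exists_unimodular {A : Type*} [CommRing A] [IsDomain A] [IsPrincipalIdealRing A]
    {ι : Type*} [Fintype ι] {v : ι → A} (hv : v ≠ 0) :
    ∃ (d : A) (g c : ι → A), d ≠ 0 ∧ v = d • g ∧ ∑ i, c i * g i = 1 := by
  obtain ⟨d, hd⟩ := (IsPrincipalIdealRing.principal (Ideal.span (Set.range v))).principal
  have h1 : ∀ i, ∃ g, v i = d * g := fun i => by
    have : v i ∈ Ideal.span (Set.range v) := Ideal.subset_span ⟨i, rfl⟩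
    rw [hd] at this
    exact Ideal.mem_span_singleton.1 this
  choose g hg using h1
  have hd0 : d ≠ 0 := by
    rintro rfl
    apply hv
    ext i
    rw [hg, zero_mul]; rfl
  have h2 : d ∈ Ideal.span (Set.range v) := by
    rw [hd]; exact Ideal.mem_span_singleton_self d
  obtain ⟨c, hc⟩ := (Ideal.mem_span_range_iff_exists_fun).1 h2
  refine ⟨d, g, c, hd0, funext hg, ?_⟩
  apply mul_left_cancel₀ hd0
  rw [mul_one, Finset.mul_sum]
  conv_rhs => rw [← hc]
  exact Finset.sum_congr rfl fun i _ => by rw [hg i]; ring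

/-- A family of solutions parametrised by `Y` none of whose members vanishes. -/
theorem exists_primitive_sol {k : Type u} [Field k] {p m : ℕ} (hm : p = 2 * m + 1) (l : k)
    (Z : k[X]) (hZ : Z.natDegree ≤ 2 * p - 1) :
    ∃ U Q M : k[X][X], IsSol p m (C l) X (Z.map C) U Q M ∧
      ∀ {K : Type u} [Field K] (f : k[X] →+* K),
        ¬ (U.map f = 0 ∧ Q.map f = 0 ∧ M.map f = 0) := by
  obtain ⟨v, hv0, hv⟩ := exists_coeffs_ne_zero hm (C l : k[X]) X (Z.map C)
    (natDegree_map_le.trans hZ)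
  let w : Fin (3 * m + 1) ⊕ Fin (m + 1) ⊕ Fin (3 * m + 2) → k[X] :=
    Sum.elim v.1 (Sum.elim v.2.1 v.2.2)
  have hw : w ≠ 0 := by
    intro h
    apply hv0
    refine Prod.ext (funext fun i => ?_) (Prod.ext (funext fun i => ?_) (funext fun i => ?_))
    · exact congrFun h (Sum.inl i)
    · exact congrFun h (Sum.inr (Sum.inl i))
    · exact congrFun h (Sum.inr (Sum.inr i))
  obtain ⟨d, g, c, hd, hg, hc⟩ := exists_unimodular hw
  have e1 : v.1 = d • fun i => g (Sum.inl i) := funext fun i => congrFun hg (Sum.inl i)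
  have e2 : v.2.1 = d • fun i => g (Sum.inr (Sum.inl i)) :=
    funext fun i => congrFun hg (Sum.inr (Sum.inl i))
  have e3 : v.2.2 = d • fun i => g (Sum.inr (Sum.inr i)) :=
    funext fun i => congrFun hg (Sum.inr (Sum.inr i))
  rw [e1, e2, e3, ofCoeffs_smul, ofCoeffs_smul, ofCoeffs_smul] at hv
  refine ⟨ofCoeffs fun i => g (Sum.inl i), ofCoeffs fun i => g (Sum.inr (Sum.inl i)),
    ofCoeffs fun i => g (Sum.inr (Sum.inr i)), ⟨?_, natDegree_ofCoeffs_le _,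
      natDegree_ofCoeffs_le _, natDegree_ofCoeffs_le _⟩, ?_⟩
  · apply mul_left_cancel₀ (C_ne_zero.2 hd)
    linear_combination hv
  · rintro K _ f ⟨h1, h2, h3⟩
    have z1 : ∀ i, f (g (Sum.inl i)) = 0 := fun i => by
      rw [map_ofCoeffs] at h1
      rw [← coeff_ofCoeffs (fun i => f (g (Sum.inl i))), h1, coeff_zero]
    have z2 : ∀ i, f (g (Sum.inr (Sum.inl i))) = 0 := fun i => by
      rw [map_ofCoeffs] at h2
      rw [← coeff_ofCoeffs (fun i => f (g (Sum.inr (Sum.inl i)))), h2, coeff_zero]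
    have z3 : ∀ i, f (g (Sum.inr (Sum.inr i))) = 0 := fun i => by
      rw [map_ofCoeffs] at h3
      rw [← coeff_ofCoeffs (fun i => f (g (Sum.inr (Sum.inr i)))), h3, coeff_zero]
    have e := congrArg f hc
    rw [map_sum, map_one, Fintype.sum_sum_type, Fintype.sum_sum_type] at e
    simp [z1, z2, z3] at e

/-- The Wronskian of a solution, that is `Conn.wronskian` up to units. -/
def wronP {A : Type*} [CommRing A] (p : ℕ) (l Y : A) (U Q : A[X]) : A[X] :=
  kapP l * (derivative U * Q - U * derivative Q) + C (l - 1) * (X ^ p - C Y) * Q ^ 2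

/-- The Wronskian of a solution, computed over `U₂` in terms of `Q` and `M`. -/
def wronM {A : Type*} [CommRing A] (p : ℕ) (l Y : A) (Q M : A[X]) : A[X] :=
  C (l - 1) ^ p * (X ^ p - C Y) * Q ^ 2 + X * (derivative M * Q - M * derivative Q)

section Wronskian

variable {A : Type*} [CommRing A] [IsDomain A] {p m : ℕ} [Fact p.Prime] [CharP A p] {l Y : A}
  {Z U Q M : A[X]}

/-- Differentiating the equation of a solution compares the Wronskian over both charts. -/
theorem IsSol.wronP_mul (h : IsSol p m l Y Z U Q M) (hp : Odd p)
    (hZ : derivative Z = C (1 - l) * kapP l ^ (p - 1) - C (1 - l) ^ p * X ^ (p - 1)) :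
    wronP p l Y U Q * kapP l ^ (p - 1) = X ^ (p - 1) * wronM p l Y Q M := by
  have e := h.eq
  have hk : (kapP l) ≠ 0 := (monic_kapP l).ne_zero
  have hp1 : 1 ≤ p := (Fact.out : p.Prime).one_le
  have hkp : kapP l ^ p = kapP l ^ (p - 1) * kapP l := by rw [← pow_succ, Nat.sub_add_cancel hp1]
  have hXp : (X : A[X]) ^ p = X ^ (p - 1) * X := by rw [← pow_succ, Nat.sub_add_cancel hp1]
  have hc : (p : A[X]) = 0 := CharP.cast_eq_zero _ _
  have de := congrArg derivative e
  simp only [derivative_mul, derivative_add, derivative_sub, derivative_pow,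
    derivative_C, hZ, map_natCast, hc, zero_mul, mul_zero, sub_zero, add_zero, zero_add] at de
  have hl : (C (l - 1) : A[X]) ^ p = - C (1 - l) ^ p := by
    rw [← neg_sub, C_neg, hp.neg_pow]
  have hl1 : (C (l - 1) : A[X]) = - C (1 - l) := by rw [← neg_sub, C_neg]
  apply mul_right_cancel₀ hk
  rw [wronP, wronM, hl, hl1]
  rw [hkp] at e de
  rw [hXp] at e de ⊢
  linear_combination (kapP l * Q) * de - kapP l * derivative Q * e

variable (hl : IsUnit l)

include hl in
/-- The Wronskian of a solution is a linear polynomial up to `X ^ (p-1)`: it is divisible by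
`X ^ (p-1)`, and its degree is bounded by the description over `U₂`. -/
theorem IsSol.exists_wronP_eq (h : IsSol p m l Y Z U Q M) (hm : p = 2 * m + 1)
    (hZ : derivative Z = C (1 - l) * kapP l ^ (p - 1) - C (1 - l) ^ p * X ^ (p - 1)) :
    ∃ D N, wronP p l Y U Q = X ^ (p - 1) * (C D * X - C N) ∧
      (C D * X - C N) * kapP l ^ (p - 1) = wronM p l Y Q M := by
  have e := h.wronP_mul ⟨m, hm⟩ hZ
  have hcop : IsCoprime (X : A[X]) (kapP l) := by
    obtain ⟨c, hc⟩ := hl.exists_left_inv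
    refine ⟨- C c * (X - 1 - C l), C c, ?_⟩
    have h : C c * C l = (1 : A[X]) := by rw [← C_mul, hc, C_1]
    rw [kapP]
    linear_combination h
  obtain ⟨L, hL⟩ : (X : A[X]) ^ (p - 1) ∣ wronP p l Y U Q :=
    (hcop.pow (m := p - 1) (n := p - 1)).dvd_of_dvd_mul_right ⟨_, e⟩
  have hX : (X : A[X]) ^ (p - 1) ≠ 0 := pow_ne_zero _ X_ne_zero
  have hLB : L * kapP l ^ (p - 1) = wronM p l Y Q M := by
    apply mul_left_cancel₀ hX
    rw [← e, hL]; ring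
  have hB : (wronM p l Y Q M).natDegree ≤ 4 * m + 1 := by
    have h2 := h.natDegree_Q
    have h3 := h.natDegree_M
    have hy : (X ^ p - C Y).natDegree ≤ p := natDegree_X_pow_sub_C.le
    have d2 := natDegree_derivative_le Q
    have d3 := natDegree_derivative_le M
    have hMQ : (derivative M * Q - M * derivative Q).natDegree ≤ 4 * m := by
      rcases Nat.eq_zero_or_pos m with rfl | hmp
      · have hQ : derivative Q = 0 := by
          rw [eq_C_of_natDegree_le_zero h2, derivative_C]
        rw [hQ, mul_zero, sub_zero]
        refine (natDegree_mul_le_of_le d3 h2).trans (by omega)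
      · refine (natDegree_sub_le_of_le (natDegree_mul_le_of_le d3 h2)
          (natDegree_mul_le_of_le h3 d2)).trans ?_
        simp only [max_le_iff]; omega
    have hc : (C (l - 1) ^ p : A[X]).natDegree ≤ 0 := by rw [← C_pow, natDegree_C]
    refine (natDegree_add_le_of_le (natDegree_mul_le_of_le (natDegree_mul_le_of_le hc hy)
      (natDegree_pow_le_of_le 2 h2)) (natDegree_mul_le_of_le natDegree_X_le hMQ)).trans ?_
    simp only [max_le_iff]; omega
  have hL1 : L.natDegree ≤ 1 := by
    by_cases hL0 : L = 0
    · simp [hL0]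
    · have hd : (L * kapP l ^ (p - 1)).natDegree = L.natDegree + 4 * m := by
        rw [natDegree_mul hL0 (pow_ne_zero _ (monic_kapP l).ne_zero),
          (monic_kapP l).natDegree_pow, natDegree_kapP]
        omega
      rw [← hLB, hd] at hB
      omega
  refine ⟨L.coeff 1, -L.coeff 0, ?_, ?_⟩
  · rw [hL, C_neg, sub_neg_eq_add, ← eq_X_add_C_of_natDegree_le_one hL1]
  · rw [C_neg, sub_neg_eq_add, ← eq_X_add_C_of_natDegree_le_one hL1, hLB]

end Wronskian

section Field

variable {K : Type*} [Field K] {p m : ℕ} [Fact p.Prime] [CharP K p] {l Y : K}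
  {Z U Q M : K[X]}

omit [Fact p.Prime] [CharP K p] in
theorem IsSol.Q_ne_zero (h : IsSol p m l Y Z U Q M) (hm : p = 2 * m + 1) (hl : l ≠ 0)
    (h0 : ¬ (U = 0 ∧ Q = 0 ∧ M = 0)) : Q ≠ 0 := by
  rintro rfl
  have e := h.eq
  rw [mul_zero, zero_add] at e
  have hcop : IsCoprime (X : K[X]) (kapP l) := by
    refine ⟨- C l⁻¹ * (X - 1 - C l), C l⁻¹, ?_⟩
    have h : C l⁻¹ * C l = (1 : K[X]) := by rw [← C_mul, inv_mul_cancel₀ hl, C_1]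
    rw [kapP]
    linear_combination h
  have hX : (X : K[X]) ^ p ≠ 0 := pow_ne_zero _ X_ne_zero
  have hU : U = 0 := by
    obtain ⟨U1, hU1⟩ : (X : K[X]) ^ p ∣ U :=
      (hcop.pow (m := p) (n := p)).dvd_of_dvd_mul_right ⟨_, e⟩
    by_contra hU
    have hM : M = U1 * kapP l ^ p := by
      apply mul_left_cancel₀ hX
      rw [← e, hU1]; ring
    have hU10 : U1 ≠ 0 := by rintro rfl; exact hU (by rw [hU1, mul_zero])
    have hd := h.natDegree_M
    rw [hM, natDegree_mul hU10 (pow_ne_zero _ (monic_kapP l).ne_zero),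
      (monic_kapP l).natDegree_pow, natDegree_kapP] at hd
    omega
  rw [hU, zero_mul] at e
  exact h0 ⟨hU, rfl, (mul_eq_zero.1 e.symm).resolve_left hX⟩

theorem iterate_derivative_char_eq_zero (f : K[X]) : derivative^[p] f = 0 := by
  rw [← factorial_smul_hasseDeriv, LinearMap.smul_apply, nsmul_eq_mul]
  have : ((p.factorial : ℕ) : K[X]) = 0 := by
    rw [CharP.cast_eq_zero_iff K[X] p]
    exact Nat.dvd_factorial (Fact.out : p.Prime).pos le_rfl
  rw [this, zero_mul]

theorem iterate_derivative_mul_of_derivative_eq_zero {g : K[X]} (hg : derivative g = 0) (f : K[X])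
    (i : ℕ) : derivative^[i] (g * f) = g * derivative^[i] f := by
  induction i with
  | zero => rfl
  | succ i ih =>
    rw [Function.iterate_succ_apply', ih, derivative_mul, hg, zero_mul, zero_add,
      Function.iterate_succ_apply']

/-- The Wronskian of a nonzero solution does not vanish: otherwise `((X - l) (X - 1)) ^ (p-1)`,
up to factors with vanishing derivative, would be the derivative of `U * Q ^ (p-1)`, so that its
derivative of order `p - 1` would vanish. But up to a constant it differs from the derivative of `Z`
by a nonzero multiple of `X ^ (p-1)`, whose derivative of order `p - 1` is `(p - 1)! ≠ 0`. -/
theorem wronP_ne_zero (hl1 : l ≠ 1) (hQ : Q ≠ 0)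
    (hZ : derivative Z = C (1 - l) * kapP l ^ (p - 1) - C (1 - l) ^ p * X ^ (p - 1)) :
    wronP p l Y U Q ≠ 0 := by
  intro h0
  have hp2 := (Fact.out : p.Prime).two_le
  have hc : (p : K[X]) = 0 := CharP.cast_eq_zero _ _
  have hk : kapP l ≠ 0 := (monic_kapP l).ne_zero
  have hkp : kapP l ^ p = kapP l ^ (p - 1) * kapP l := by
    rw [← pow_succ, Nat.sub_add_cancel (by omega)]
  set R : K[X] := C (l - 1) * (X ^ p - C Y) * Q ^ p with hR
  have hRd : derivative R = 0 := by
    rw [hR]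
    simp [derivative_pow]
  have hR0 : R ≠ 0 := by
    refine mul_ne_zero (mul_ne_zero (C_ne_zero.2 (sub_ne_zero.2 hl1))
      (X_pow_sub_C_ne_zero (by omega) Y)) (pow_ne_zero _ hQ)
  have hUQ : kapP l * derivative (U * Q ^ (p - 1)) = - R := by
    have hQ1 : Q ^ (p - 1) = Q ^ (p - 2) * Q := by
      rw [← pow_succ]; congr 1; omega
    have hQ2 : Q ^ p = Q ^ (p - 2) * Q ^ 2 := by
      rw [← pow_add]; congr 1; omega
    have hcast : ((p - 1 : ℕ) : K[X]) = -1 := by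
      rw [Nat.cast_sub (by omega), hc, Nat.cast_one, zero_sub]
    rw [derivative_mul, derivative_pow, map_natCast, hcast, hR, hQ1, hQ2, show p - 1 - 1 = p - 2 by
      omega]
    rw [wronP] at h0
    linear_combination Q ^ (p - 2) * h0
  have h1 : derivative^[p - 1] (R * kapP l ^ (p - 1)) = 0 := by
    have e : R * kapP l ^ (p - 1) = (- kapP l ^ p) * derivative (U * Q ^ (p - 1)) := by
      rw [hkp]; linear_combination kapP l ^ (p - 1) * hUQ
    rw [e, iterate_derivative_mul_of_derivative_eq_zero (by simp [derivative_pow]),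
      ← Function.iterate_succ_apply, show (p - 1).succ = p by omega,
      iterate_derivative_char_eq_zero, mul_zero]
  rw [iterate_derivative_mul_of_derivative_eq_zero hRd] at h1
  have h2 := (mul_eq_zero.1 h1).resolve_left hR0
  have h3 := congrArg (derivative^[p - 1]) hZ
  rw [← Function.iterate_succ_apply, show (p - 1).succ = p by omega,
    iterate_derivative_char_eq_zero, iterate_derivative_sub, iterate_derivative_C_mul, h2, mul_zero,
    zero_sub, ← C_pow, iterate_derivative_C_mul, iterate_derivative_X_pow_eq_natCast_mul,
    Nat.descFactorial_self, Nat.sub_self, pow_zero, mul_one, eq_comm, neg_eq_zero, mul_eq_zero] at h3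
  rcases h3 with h3 | h3
  · exact pow_ne_zero p (sub_ne_zero.2 (Ne.symm hl1)) (C_eq_zero.1 h3)
  · rw [CharP.cast_eq_zero_iff K[X] p, (Fact.out : p.Prime).dvd_factorial] at h3
    omega

/-- A polynomial whose square divides a nonzero linear polynomial up to powers of `r` divides a
power of `r`. -/
theorem dvd_pow_of_sq_dvd {g r c : K[X]} {j : ℕ} (hc0 : c ≠ 0) (hc : c.natDegree ≤ 1)
    (hr : r ≠ 0) (h : g ^ 2 ∣ r ^ j * c) : ∃ i, g ∣ r ^ i := by
  have hg0 : g ≠ 0 := by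
    rintro rfl
    rw [zero_pow two_ne_zero, zero_dvd_iff] at h
    exact mul_ne_zero (pow_ne_zero j hr) hc0 h
  have hq : ∀ q, Prime q → q ∣ g → q ∣ r := by
    intro q hq hqg
    by_contra hqr
    have hcop : IsCoprime (q ^ 2) (r ^ j) :=
      ((Irreducible.coprime_iff_not_dvd hq.irreducible).2 hqr).pow
    have h2 := hcop.dvd_of_dvd_mul_left ((pow_dvd_pow_of_dvd hqg 2).trans h)
    have h3 := natDegree_le_of_dvd h2 hc0
    rw [natDegree_pow] at h3
    have h4 := hq.irreducible.natDegree_pos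
    omega
  clear h
  induction g using UniqueFactorizationMonoid.induction_on_prime with
  | h₁ => exact absurd rfl hg0
  | h₂ x hx => exact ⟨0, hx.dvd⟩
  | h₃ a q ha hq' ih =>
    obtain ⟨i, hi⟩ := ih ha fun q' h1 h2 => hq q' h1 (h2.mul_left _)
    exact ⟨i + 1, by rw [pow_succ']; exact mul_dvd_mul (hq q hq' (dvd_mul_right _ _)) hi⟩

/-- The pair `(U, Q)` is unimodular away from `0`: the square of a common divisor divides the
Wronskian. -/
theorem IsSol.exists_comb_eq_X_pow (h : IsSol p m l Y Z U Q M) (hm : p = 2 * m + 1) (hl : l ≠ 0)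
    (hl1 : l ≠ 1) (h0 : ¬ (U = 0 ∧ Q = 0 ∧ M = 0))
    (hZ : derivative Z = C (1 - l) * kapP l ^ (p - 1) - C (1 - l) ^ p * X ^ (p - 1)) :
    ∃ α β i, α * U + β * Q = X ^ i := by
  classical
  have hQ := h.Q_ne_zero hm hl h0
  have hL := wronP_ne_zero (U := U) (Y := Y) hl1 hQ hZ
  obtain ⟨D, N, h1, -⟩ := h.exists_wronP_eq hl.isUnit hm hZ
  have hc0 : C D * X - C N ≠ 0 := by
    intro e; rw [e, mul_zero] at h1; exact hL h1
  have hc : (C D * X - C N).natDegree ≤ 1 := by compute_degree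
  set g := EuclideanDomain.gcd U Q with hg
  obtain ⟨U1, hU⟩ := EuclideanDomain.gcd_dvd_left U Q
  obtain ⟨Q1, hQ1⟩ := EuclideanDomain.gcd_dvd_right U Q
  rw [← hg] at hU hQ1
  have hd : g ^ 2 ∣ X ^ (p - 1) * (C D * X - C N) := by
    rw [← h1, wronP, hU, hQ1, derivative_mul, derivative_mul]
    exact ⟨kapP l * (derivative U1 * Q1 - U1 * derivative Q1) + C (l - 1) * (X ^ p - C Y) * Q1 ^ 2,
      by ring⟩
  obtain ⟨i, e, he⟩ := dvd_pow_of_sq_dvd hc0 hc X_ne_zero hd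
  have hb := EuclideanDomain.gcd_eq_gcd_ab U Q
  rw [← hg] at hb
  exact ⟨e * EuclideanDomain.gcdA U Q, e * EuclideanDomain.gcdB U Q, i, by
    rw [he, hb]; ring⟩

/-- Division with remainder bounds the degrees in a Bézout relation. -/
theorem exists_degree_le_of_comb {f g c : K[X]} (hf : f ≠ 0) {α β : K[X]} {i : ℕ}
    (h : α * f + β * g = c ^ i) : ∃ α' β', α' * f + β' * g = c ^ i ∧ β'.natDegree ≤ f.natDegree ∧
      α'.natDegree + f.natDegree ≤ max (f.natDegree + g.natDegree) (i * c.natDegree) := by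
  have hdm := EuclideanDomain.div_add_mod β f
  have e : (α + (β / f) * g) * f + (β % f) * g = c ^ i := by
    rw [← h]; linear_combination g * hdm
  have hb : (β % f).natDegree ≤ f.natDegree := by
    rcases eq_or_ne (β % f) 0 with h0 | h0
    · simp [h0]
    · exact natDegree_le_natDegree (degree_mod_lt β hf).le
  refine ⟨α + (β / f) * g, β % f, e, hb, ?_⟩
  by_cases h0 : α + (β / f) * g = 0
  · rw [h0, natDegree_zero, zero_add]
    exact le_max_of_le_left (Nat.le_add_right _ _)
  · rw [← natDegree_mul h0 hf, show (α + (β / f) * g) * f = c ^ i - (β % f) * g by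
      linear_combination e]
    refine (natDegree_sub_le _ _).trans (max_le ?_ ?_)
    · exact le_max_of_le_right natDegree_pow_le
    · exact le_max_of_le_left (natDegree_mul_le.trans (Nat.add_le_add_right hb _))

/-- The pair `(M, Q)` is unimodular away from the zeros of `kapP l`, including the point at
infinity. -/
theorem IsSol.exists_comb_eq_kapP_pow (h : IsSol p m l Y Z U Q M) (hm : p = 2 * m + 1) (hl : l ≠ 0)
    (hl1 : l ≠ 1) (h0 : ¬ (U = 0 ∧ Q = 0 ∧ M = 0))
    (hZ : derivative Z = C (1 - l) * kapP l ^ (p - 1) - C (1 - l) ^ p * X ^ (p - 1)) :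
    ∃ α β i, α * M + β * Q = kapP l ^ i ∧ α.natDegree + (3 * m + 1) ≤ 2 * i ∧
      β.natDegree + m ≤ 2 * i := by
  classical
  have hQ := h.Q_ne_zero hm hl h0
  have hL := wronP_ne_zero (U := U) (Y := Y) hl1 hQ hZ
  obtain ⟨D, N, h1, h2⟩ := h.exists_wronP_eq hl.isUnit hm hZ
  have hc0 : C D * X - C N ≠ 0 := by
    intro e; rw [e, mul_zero] at h1; exact hL h1
  have hc : (C D * X - C N).natDegree ≤ 1 := by compute_degree
  have hk := monic_kapP l
  set g := EuclideanDomain.gcd M Q with hg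
  obtain ⟨M1, hM⟩ := EuclideanDomain.gcd_dvd_left M Q
  obtain ⟨Q1, hQ1⟩ := EuclideanDomain.gcd_dvd_right M Q
  rw [← hg] at hM hQ1
  have hd : g ^ 2 ∣ kapP l ^ (p - 1) * (C D * X - C N) := by
    rw [mul_comm, h2, wronM, hM, hQ1, derivative_mul, derivative_mul]
    exact ⟨C (l - 1) ^ p * (X ^ p - C Y) * Q1 ^ 2 + X * (derivative M1 * Q1 - M1 * derivative Q1),
      by ring⟩
  obtain ⟨i, e, he⟩ := dvd_pow_of_sq_dvd hc0 hc hk.ne_zero hd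
  have hb := EuclideanDomain.gcd_eq_gcd_ab M Q
  rw [← hg] at hb
  have hcomb : ∀ j, (kapP l ^ j * e * EuclideanDomain.gcdA M Q) * M
      + (kapP l ^ j * e * EuclideanDomain.gcdB M Q) * Q = kapP l ^ (i + j) := fun j => by
    rw [pow_add, he, hb]; ring
  -- the exponent is chosen large enough for the degree bounds
  have hcomb := hcomb (4 * m + 4)
  -- unimodularity at infinity: otherwise the degree of the Wronskian would be too small
  have hinf : Q.natDegree = m ∨ M.natDegree = 3 * m + 1 := by
    by_contra hcon
    push Not at hcon
    have q1 := lt_of_le_of_ne h.natDegree_Q hcon.1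
    have q2 := lt_of_le_of_ne h.natDegree_M hcon.2
    have hB : (wronM p l Y Q M).natDegree < 4 * m := by
      have hy : (X ^ p - C Y).natDegree ≤ p := natDegree_X_pow_sub_C.le
      have d2 := natDegree_derivative_le Q
      have d3 := natDegree_derivative_le M
      have hcc : (C (l - 1) ^ p : K[X]).natDegree ≤ 0 := by rw [← C_pow, natDegree_C]
      have hMQ : (derivative M * Q - M * derivative Q).natDegree ≤ 4 * m - 2 := by
        rcases Nat.eq_zero_or_pos Q.natDegree with hz | hz
        · rw [eq_C_of_natDegree_eq_zero hz, derivative_C, mul_zero, sub_zero, mul_comm]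
          refine (natDegree_C_mul_le _ _).trans ?_
          omega
        · refine (natDegree_sub_le_of_le natDegree_mul_le natDegree_mul_le).trans ?_
          simp only [max_le_iff]; omega
      refine lt_of_le_of_lt (natDegree_add_le_of_le (natDegree_mul_le_of_le
        (natDegree_mul_le_of_le hcc hy) (natDegree_pow_le_of_le 2 (Nat.le_sub_one_of_lt q1)))
        (natDegree_mul_le_of_le natDegree_X_le hMQ)) ?_
      simp only [max_lt_iff]; omega
    rw [← h2, natDegree_mul hc0 (pow_ne_zero _ hk.ne_zero), hk.natDegree_pow, natDegree_kapP] at hB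
    omega
  rcases hinf with hdQ | hdM
  · rw [add_comm] at hcomb
    obtain ⟨β, α, e1, e2, e3⟩ := exists_degree_le_of_comb hQ hcomb
    refine ⟨α, β, i + (4 * m + 4), by rw [add_comm]; exact e1, ?_, ?_⟩
    · have := h.natDegree_M; omega
    · rw [natDegree_kapP, hdQ] at e3
      have := h.natDegree_M
      rcases le_max_iff.1 e3 with e3 | e3 <;> omega
  · have hM0 : M ≠ 0 := by rintro rfl; simp at hdM
    obtain ⟨α, β, e1, e2, e3⟩ := exists_degree_le_of_comb hM0 hcomb
    refine ⟨α, β, i + (4 * m + 4), e1, ?_, ?_⟩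
    · rw [natDegree_kapP, hdM] at e3
      have := h.natDegree_Q
      rcases le_max_iff.1 e3 with e3 | e3 <;> omega
    · have := h.natDegree_Q; omega

end Field

end Polynomials

/-! ### The flow modulo `p` -/

section Bundles

variable {p : ℕ} [Fact p.Prime] {k : Type u} [Field k] [CharP k p] {P : Puncture p k} {N : ℕ}

theorem exists_inverse_of_det {S : Subalgebra (WN p k N) (P.R N)} {a : P.Mat N}
    (ha : ∀ i j, a i j ∈ S) {d : P.R N} (hd : d ∈ S) (h : a.det * d = 1) :
    ∃ a' : P.Mat N, (∀ i j, a' i j ∈ S) ∧ a * a' = 1 := by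
  refine ⟨d • a.adjugate, fun i j => ?_, ?_⟩
  · rw [Matrix.smul_apply, smul_eq_mul, Matrix.adjugate_fin_two]
    refine mul_mem hd ?_
    fin_cases i <;> fin_cases j
    · exact ha 1 1
    · exact neg_mem (ha 0 1)
    · exact neg_mem (ha 1 0)
    · exact ha 0 0
  · rw [mul_smul_comm, Matrix.mul_adjugate, smul_smul, mul_comm, h, one_smul]

/-- Bases adapted to a line subbundle `𝒪(1)` with quotient `𝒪` give a filtered bundle. -/
theorem Conn.Glues.exists_filData {c : Conn P N} (hc : c.Glues) {a a' b b' : P.Mat N}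
    (mem1 : ∀ i j, a i j ∈ P.chart1 N) (mem1' : ∀ i j, a' i j ∈ P.chart1 N)
    (mem2 : ∀ i j, b i j ∈ P.chart2 N) (mem2' : ∀ i j, b' i j ∈ P.chart2 N)
    (mul1 : a * a' = 1) (mul2 : b * b' = 1)
    (hline : c.G.mulVec (fun i => a i 1) = P.tau N • fun i => b i 1)
    (hdet : c.G.det * a.det = P.tau N * b.det) :
    ∃ V : FilData P N, V.toConn.Glues ∧ c.Gauge V.toConn a a' b b' := by
  have e2 : b' * b = 1 := mul_eq_one_comm.1 mul2
  have d2 : b'.det * b.det = 1 := by rw [← Matrix.det_mul, e2, Matrix.det_one]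
  set G' := b' * (c.G * a) with hG'
  have hcol : ∀ i, G' i 1 = P.tau N * (1 : P.Mat N) i 1 := by
    intro i
    have h1 : G' i 1 = (b'.mulVec (c.G.mulVec fun i => a i 1)) i := rfl
    rw [h1, hline, Matrix.mulVec_smul, ← e2]
    rfl
  have h01 : G' 0 1 = 0 := by rw [hcol]; simp
  have h11 : G' 1 1 = P.tau N := by rw [hcol]; simp
  have h00 : G' 0 0 = 1 := by
    have hd : G'.det = P.tau N := by
      rw [hG', Matrix.det_mul, Matrix.det_mul, hdet]
      linear_combination P.tau N * d2
    rw [Matrix.det_fin_two, h01, h11, zero_mul, sub_zero] at hd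
    apply (isUnit_tau P N).mul_right_cancel
    rw [hd, one_mul]
  have hG : G' = !![1, 0; G' 1 0, P.t N * P.invT1 N] := by
    ext i j
    fin_cases i <;> fin_cases j
    · exact h00
    · exact h01
    · rfl
    · exact h11
  have glue : c.G * a = b * !![1, 0; G' 1 0, P.t N * P.invT1 N] := by
    rw [← hG, hG', ← mul_assoc b, mul2, one_mul]
  obtain ⟨c', hc', h1, h2⟩ := hc.exists_gauge mem1 mem1' mem2 mem2' mul1 mul2 glue
  have hV : (⟨G' 1 0, c'.A1, c'.A2⟩ : FilData P N).toConn = c' := by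
    rw [FilData.toConn, ← hc']
  exact ⟨⟨G' 1 0, c'.A1, c'.A2⟩, by rw [hV]; exact h1, by rw [hV]; exact h2⟩

theorem FilData.isUnit_G (V : FilData P N) : IsUnit V.toConn.G := by
  rw [Matrix.isUnit_iff_isUnit_det, Matrix.det_fin_two]
  have h : V.toConn.G 0 0 * V.toConn.G 1 1 - V.toConn.G 0 1 * V.toConn.G 1 0 = P.tau N := by
    simp [FilData.toConn, Puncture.tau]
  rw [h]
  exact isUnit_tau P N

theorem FilData.det_G (V : FilData P N) : V.toConn.G.det = P.tau N := by
  rw [Matrix.det_fin_two]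
  simp [FilData.toConn, Puncture.tau]

/-- The de Rham bundle with given data. -/
def FilData.toFilDR (V : FilData P N) (h : V.toConn.Glues)
    (h0 : ∃ x0 x1, IsZeroOf P N V.theta x0 x1) : FilDR P N where
  toFilData := V
  isLogConnection := ⟨V.isUnit_G, h.mem1, h.mem2, h.glue⟩
  exists_zero := h0

theorem FilDR.glues (V : FilDR P N) : V.toConn.Glues :=
  ⟨V.isLogConnection.mem1, V.isLogConnection.mem2, V.isLogConnection.glue⟩

end Bundles

section ModP

variable {p : ℕ} [Fact p.Prime] {k : Type u} [Field k] [CharP k p] [PerfectRing k p]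
  {P : Puncture p k}

theorem ev_kapP : P.ev (kapP P.l) = algebraMap _ (P.R 1) (P.kap 1) := by
  rw [algebraMap_kap, kapP, map_mul, map_sub, map_sub, map_one, ev_X, ev_C, const_one, mul_comm]
  rfl

theorem ev_mem_chart1 (f : k[X]) : P.ev f ∈ P.chart1 1 := by
  rw [ev_eq_algebraMap]; exact algebraMap_mem_chart1 P 1 _

theorem mem_chart2_of_mul_ev {x : P.R 1} {f : k[X]} {i : ℕ} (hf : f.natDegree ≤ 2 * i)
    (h : x * P.ev (kapP P.l) ^ i = P.ev f) : x ∈ P.chart2 1 := by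
  rw [ev_kapP, ev_eq_algebraMap] at h
  exact mem_chart2_of_mul_kap_pow P 1 (natDegree_map_le.trans hf) h

theorem isZeroOf_res {θ : P.R 1} {u x0 x1 : k} (hu : u ≠ 0) (h0 : ¬ (x0 = 0 ∧ x1 = 0))
    (h : θ = P.res u * (P.res x1 * P.t 1 - P.res x0)) :
    IsZeroOf P 1 θ (WittVector.teichmuller p x0) (WittVector.teichmuller p x1) := by
  have hd : ∀ x : k, (p : WittVector p k) ∣ WittVector.teichmuller p x → x = 0 := fun x hx => by
    rw [← Ideal.mem_span_singleton, WittVector.mem_span_p_iff_coeff_zero_eq_zero,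
      WittVector.teichmuller_coeff_zero] at hx
    exact hx
  refine ⟨fun hh => h0 ⟨hd _ hh.1, hd _ hh.2⟩, WittVector.teichmuller p u, ?_, h⟩
  apply WittVector.isUnit_of_coeff_zero_ne_zero
  rwa [WittVector.teichmuller_coeff_zero]

variable (hp : Odd p) {m : ℕ}

section Line

variable {U Q M : k[X]} {w x : k}

/-- The generator over `U₁` of the Hodge line subbundle modulo `p`, for the Higgs field
`w (t - x)`. -/
def Puncture.line1 (P : Puncture p k) (w : k) (U Q : k[X]) : Fin 2 → P.R 1 :=
  ![P.res w ^ p * (Ring.inverse (P.t 1) ^ (p - 1) * P.ev U),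
    Ring.inverse (P.t 1) ^ (p - 1) * P.ev Q]

/-- The generator over `U₂` of the Hodge line subbundle modulo `p`. -/
def Puncture.line2 (P : Puncture p k) (m : ℕ) (w : k) (M Q : k[X]) : Fin 2 → P.R 1 :=
  ![P.res w ^ p * ((P.t 1 - 1) ^ (m + 1) * (P.invT1 1 * P.invTlam 1) ^ p * P.ev M),
    P.invT1 1 ^ m * P.ev Q]

theorem line1_mem (w : k) (U Q : k[X]) (i : Fin 2) : P.line1 w U Q i ∈ P.chart1 1 := by
  have h1 := invT_mem_chart1 P 1
  have h2 : P.res w ∈ P.chart1 1 := Subalgebra.algebraMap_mem _ _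
  fin_cases i
  · exact mul_mem (pow_mem h2 _) (mul_mem (pow_mem h1 _) (ev_mem_chart1 U))
  · exact mul_mem (pow_mem h1 _) (ev_mem_chart1 Q)

omit [PerfectRing k p] in
theorem t1_mul_tlam_mul (N : ℕ) :
    (P.invT1 N * P.invTlam N) * ((P.t N - P.const N P.lam) * (P.t N - 1)) = 1 := by
  have h1 := t1_mul_invT1 P N
  have h2 := tlam_mul_invTlam P N
  linear_combination (P.t N - P.const N P.lam) * P.invTlam N * h1 + h2

theorem ev_kapP_eq : P.ev (kapP P.l) = (P.t 1 - P.const 1 P.lam) * (P.t 1 - 1) := by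
  rw [ev_kapP, algebraMap_kap, mul_comm]

theorem line2_mem (hm : p = 2 * m + 1) (w : k) (hQ : Q.natDegree ≤ m)
    (hM : M.natDegree ≤ 3 * m + 1) (i : Fin 2) : P.line2 m w M Q i ∈ P.chart2 1 := by
  have h2 : P.res w ∈ P.chart2 1 := Subalgebra.algebraMap_mem _ _
  have n1 : (X - 1 : k[X]).natDegree ≤ 1 := by compute_degree
  have n2 : (X - C P.l : k[X]).natDegree ≤ 1 := by compute_degree
  fin_cases i
  · refine mul_mem (pow_mem h2 _) (mem_chart2_of_mul_ev (f := (X - 1) ^ (m + 1) * M) (i := p) ?_ ?_)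
    · refine (natDegree_mul_le_of_le (natDegree_pow_le_of_le _ n1) hM).trans ?_
      omega
    · rw [ev_kapP_eq, map_mul, map_pow, map_sub, ev_X, map_one]
      have e : (P.invT1 1 * P.invTlam 1) ^ p * ((P.t 1 - P.const 1 P.lam) * (P.t 1 - 1)) ^ p = 1 := by
        rw [← mul_pow, t1_mul_tlam_mul, one_pow]
      linear_combination (P.t 1 - 1) ^ (m + 1) * P.ev M * e
  · refine mem_chart2_of_mul_ev (f := (X - C P.l) ^ m * Q) (i := m) ?_ ?_
    · refine (natDegree_mul_le_of_le (natDegree_pow_le_of_le _ n2) hQ).trans ?_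
      omega
    · rw [ev_kapP_eq, map_mul, map_pow, map_sub, ev_X, ev_C, const_one]
      change P.invT1 1 ^ m * P.ev Q * _ = _
      have e : P.invT1 1 ^ m * (P.t 1 - 1) ^ m = 1 := by
        rw [← mul_pow, mul_comm, t1_mul_invT1, one_pow]
      rw [mul_pow]
      change _ = (P.t 1 - P.res (P.lam.coeff 0)) ^ m * P.ev Q
      linear_combination (P.t 1 - P.res (P.lam.coeff 0)) ^ m * P.ev Q * e

omit [PerfectRing k p] in
theorem lam_sub_one_coeff : (P.lam - 1).coeff 0 = P.l - 1 := by
  change (WittVector.constantCoeff : WittVector p k →+* k) (P.lam - 1) = _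
  rw [map_sub, map_one]; rfl

theorem z_mul_omega1_pow : P.z 1 hp * P.omega1 1 ^ p * P.ev (kapP P.l) ^ p = - P.ev (P.Z hp) := by
  have h1 := omega1_mul P 1
  have h2 := z_mul P hp
  rw [ev_kapP_eq, mul_assoc, ← mul_pow, h1, ← h2, const_one, ← map_pow, ← mul_neg, ← map_neg]
  congr 2
  rw [lam_sub_one_coeff, sub_pow_char, one_pow, neg_sub]

/-- The gluing of sections of the form of `Puncture.line1` and `Puncture.line2`. For `Q0 = 0` this is
the equation for the Hodge line subbundle, for `Q0 = Q` with the remaining polynomials replaced by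
derivatives with respect to `Y` it is the linearisation of that equation. -/
theorem twist_cartier1_mulVec_sub (hm : p = 2 * m + 1) {Q0 : k[X]}
    (h : U * kapP P.l ^ p = P.Z hp * ((X ^ p - C (x ^ p)) * Q - Q0) + X ^ p * M) {θ : P.R 1}
    (hθ : θ = P.res w * (P.t 1 - P.res x)) :
    ((P.cartier1 hp θ).twist m).G.mulVec (P.line1 w U Q)
        - ![(P.t 1 - 1) ^ m * (P.z 1 hp * P.Phi2 1 hp (P.omega1 1 * P.res w))
            * (Ring.inverse (P.t 1) ^ (p - 1) * P.ev Q0), 0]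
      = P.tau 1 • P.line2 m w M Q := by
  have i1 := t1_mul_invT1 P 1
  have i0 := Ring.inverse_mul_cancel _ (isUnit_t P 1)
  have htau : P.tau 1 = P.t 1 * P.invT1 1 := rfl
  have hpp : ∀ y : P.R 1, y ^ p = y ^ (p - 1) * y := fun y => by
    rw [← pow_succ, Nat.sub_add_cancel (Fact.out : p.Prime).one_le]
  have i0p : Ring.inverse (P.t 1) ^ (p - 1) * P.t 1 ^ (p - 1) = 1 := by
    rw [← mul_pow, i0, one_pow]
  have hE : (P.cartier1 hp θ).twist m = ⟨(P.t 1 - 1) ^ m • (P.cartier1 hp θ).G, _, _⟩ := rfl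
  rw [hE, cartier1_G, Phi2_one, Phi2_one, Phi2_one]
  ext i
  fin_cases i
  · simp only [Puncture.line1, Puncture.line2, Matrix.mulVec, dotProduct, Fin.sum_univ_two,
      Matrix.smul_apply, smul_eq_mul, Pi.smul_apply, Fin.zero_eta, Matrix.of_apply,
      Matrix.cons_val_zero, Matrix.cons_val_one, Matrix.cons_val_fin_one, Pi.sub_apply]
    have e := congrArg P.ev h
    have hz := z_mul_omega1_pow (P := P) hp
    have hk : (P.invT1 1 * P.invTlam 1) ^ p * P.ev (kapP P.l) ^ p = 1 := by
      rw [← mul_pow, ev_kapP_eq, t1_mul_tlam_mul, one_pow]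
    have hu : IsUnit (P.ev (kapP P.l) ^ p) := IsUnit.of_mul_eq_one _ (by rw [mul_comm]; exact hk)
    have hθp : θ ^ p = P.res w ^ p * (P.t 1 ^ p - P.res (x ^ p)) := by
      rw [hθ, mul_pow, sub_pow_char, map_pow]
    simp only [map_mul, map_add, map_sub, map_pow, ev_X, ev_C] at e
    apply hu.mul_right_cancel
    rw [mul_pow, mul_pow, hθp, htau, map_pow]
    rw [hpp (P.t 1)] at e ⊢
    generalize (P.invT1 1 * P.invTlam 1) ^ p = iP at *
    generalize P.ev (kapP P.l) ^ p = kp at *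
    generalize P.omega1 1 ^ p = om at *
    generalize P.res w ^ p = W at *
    generalize P.res x ^ p = Y at *
    generalize Ring.inverse (P.t 1) ^ (p - 1) = f at *
    generalize P.t 1 ^ (p - 1) = tp at *
    linear_combination (P.t 1 - 1) ^ m * W * f * e
      + (P.t 1 - 1) ^ m * W * f * ((tp * P.t 1 - Y) * P.ev Q - P.ev Q0) * hz
      + (P.t 1 - 1) ^ m * W * P.t 1 * P.ev M * i0p
      - W * P.t 1 * P.invT1 1 * (P.t 1 - 1) ^ (m + 1) * P.ev M * hk
      - W * P.t 1 * (P.t 1 - 1) ^ m * P.ev M * i1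
  · simp only [Puncture.line1, Puncture.line2, Matrix.mulVec, dotProduct, Fin.sum_univ_two,
      Matrix.smul_apply, smul_eq_mul, Pi.smul_apply, Fin.mk_one, Matrix.of_apply,
      Matrix.cons_val_zero, Matrix.cons_val_one, Matrix.cons_val_fin_one, mul_zero, zero_mul,
      zero_add, Pi.sub_apply, sub_zero]
    have im : (P.t 1 - 1) ^ m * P.invT1 1 ^ m = 1 := by rw [← mul_pow, i1, one_pow]
    have hT : P.invT1 1 ^ p = P.invT1 1 ^ m * P.invT1 1 ^ m * P.invT1 1 := by
      rw [← pow_add, ← pow_succ]; congr 1; omega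
    rw [htau, mul_pow, hT, hpp]
    linear_combination (P.t 1 - 1) ^ m * P.t 1 * P.invT1 1 ^ m * P.invT1 1 ^ m * P.invT1 1
      * P.ev Q * i0p + P.t 1 * P.invT1 1 ^ m * P.invT1 1 * P.ev Q * im

theorem twist_cartier1_mulVec (hm : p = 2 * m + 1)
    (h : IsSol p m P.l (x ^ p) (P.Z hp) U Q M) {θ : P.R 1}
    (hθ : θ = P.res w * (P.t 1 - P.res x)) :
    ((P.cartier1 hp θ).twist m).G.mulVec (P.line1 w U Q) = P.tau 1 • P.line2 m w M Q := by
  rw [← twist_cartier1_mulVec_sub hp hm (Q0 := 0) (by rw [h.eq, sub_zero, mul_assoc]) hθ, map_zero,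
    mul_zero, mul_zero]
  ext i
  fin_cases i <;> simp

omit [PerfectRing k p] in
theorem D_invT_pow : P.D 1 (Ring.inverse (P.t 1) ^ (p - 1)) = Ring.inverse (P.t 1) ^ p := by
  have hp1 := (Fact.out : p.Prime).two_le
  have hi : Ring.inverse (P.t 1) ^ p = Ring.inverse (P.t 1) ^ (p - 1 - 1)
      * Ring.inverse (P.t 1) ^ 2 := by
    rw [← pow_add]; congr 1; omega
  rw [Derivation.leibniz_pow, D_ringInverse _ _ (isUnit_t P 1), D_t, hi,
    smul_eq_mul, nsmul_eq_mul, Nat.cast_sub (by omega), natCast_p_eq_zero, Nat.cast_one]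
  ring

/-- The Wronskian of the Hodge line subbundle, and with it the next Higgs field, has the zero `N / D`. -/
theorem wronskian_line1 {θ : P.R 1} (hθ : θ = P.res w * (P.t 1 - P.res x)) {D N : k}
    (h : wronP p P.l (x ^ p) U Q = X ^ (p - 1) * (C D * X - C N)) :
    ((P.cartier1 hp θ).twist m).wronskian (P.line1 w U Q) * P.ev (kapP P.l)
      = P.res w ^ p * Ring.inverse (P.t 1) ^ (p - 1) * (P.res D * P.t 1 - P.res N) := by
  have hE : ((P.cartier1 hp θ).twist m).A1 = !![0, θ ^ p; 0, 0] := by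
    rw [← Phi1_one P hp, ← cartier1_A1]; rfl
  have e := congrArg P.ev h
  have ho := omega1_mul P 1
  rw [← ev_kapP_eq, const_one, lam_sub_one_coeff] at ho
  have i0p : Ring.inverse (P.t 1) ^ (p - 1) * P.t 1 ^ (p - 1) = 1 := by
    rw [← mul_pow, Ring.inverse_mul_cancel _ (isUnit_t P 1), one_pow]
  have hθp : θ ^ p = P.res w ^ p * (P.t 1 ^ p - P.res x ^ p) := by
    rw [hθ, mul_pow, sub_pow_char]
  simp only [wronP, map_mul, map_add, map_sub, map_pow, ev_X, ev_C, ← D_ev, map_one] at e ho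
  rw [Conn.wronskian, hE, hθp]
  simp only [Puncture.line1, Matrix.mulVec, dotProduct, Fin.sum_univ_two, Matrix.of_apply,
    Matrix.cons_val_zero, Matrix.cons_val_one, Matrix.cons_val_fin_one, zero_mul, zero_add,
    add_zero, mul_zero, Derivation.leibniz, D_invT_pow, smul_eq_mul, ← map_pow P.res, D_res]
  simp only [map_pow]
  generalize Ring.inverse (P.t 1) ^ (p - 1) = f at *
  generalize P.t 1 ^ (p - 1) = tp at *
  generalize P.res w ^ p = W at *
  linear_combination W * f ^ 2 * e + W * f * (P.res D * P.t 1 - P.res N) * i0p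
    + W * f ^ 2 * (P.t 1 ^ p - P.res x ^ p) * P.ev Q ^ 2 * ho

end Line

/-- A basis over `U₁` which contains the generator of the Hodge line subbundle. -/
theorem exists_frame1 {U Q : k[X]} {w : k} (hw : w ≠ 0)
    (h : ∃ α β i, α * U + β * Q = X ^ i) :
    ∃ a a' : P.Mat 1, (∀ i j, a i j ∈ P.chart1 1) ∧ (∀ i j, a' i j ∈ P.chart1 1) ∧ a * a' = 1 ∧
      (∀ i, a i 1 = P.line1 w U Q i) ∧ a.det = Ring.inverse (P.t 1) ^ (p - 1) := by
  obtain ⟨α, β, i, h⟩ := h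
  have e := congrArg P.ev h
  simp only [map_add, map_mul, map_pow, ev_X] at e
  have i0 := Ring.inverse_mul_cancel _ (isUnit_t P 1)
  have ii : ∀ i, Ring.inverse (P.t 1) ^ i * P.t 1 ^ i = 1 := fun i => by
    rw [← mul_pow, i0, one_pow]
  have hww : P.res w⁻¹ ^ p * P.res w ^ p = 1 := by
    rw [← mul_pow, ← map_mul, inv_mul_cancel₀ hw, map_one, one_pow]
  have hT := invT_mem_chart1 P 1
  have hres : P.res w⁻¹ ∈ P.chart1 1 := Subalgebra.algebraMap_mem _ _
  let a : P.Mat 1 := !![P.ev β * Ring.inverse (P.t 1) ^ i, P.line1 w U Q 0;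
    -(P.res w⁻¹ ^ p * P.ev α * Ring.inverse (P.t 1) ^ i), P.line1 w U Q 1]
  have ha : ∀ i j, a i j ∈ P.chart1 1 := by
    intro i' j
    fin_cases i' <;> fin_cases j
    · exact mul_mem (ev_mem_chart1 β) (pow_mem hT _)
    · exact line1_mem w U Q 0
    · exact neg_mem (mul_mem (mul_mem (pow_mem hres _) (ev_mem_chart1 α)) (pow_mem hT _))
    · exact line1_mem w U Q 1
  have hdet : a.det = Ring.inverse (P.t 1) ^ (p - 1) := by
    rw [Matrix.det_fin_two]
    simp only [a, Puncture.line1, Matrix.of_apply, Matrix.cons_val_zero, Matrix.cons_val_one,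
      Matrix.cons_val_fin_one]
    have := ii i
    generalize Ring.inverse (P.t 1) ^ i = T at *
    generalize Ring.inverse (P.t 1) ^ (p - 1) = f at *
    linear_combination f * T * e + f * this + f * T * P.ev α * P.ev U * hww
  obtain ⟨a', ha', haa⟩ := exists_inverse_of_det ha (pow_mem (t_mem_chart1 P 1) (p - 1))
    (by rw [hdet, ii])
  refine ⟨a, a', ha, ha', haa, fun i => ?_, hdet⟩
  fin_cases i <;> rfl

/-- A basis over `U₂` which contains the generator of the Hodge line subbundle. -/
theorem exists_frame2 (hm : p = 2 * m + 1) {M Q : k[X]} {w : k} (hw : w ≠ 0)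
    (hQ : Q.natDegree ≤ m) (hM : M.natDegree ≤ 3 * m + 1)
    (h : ∃ α β i, α * M + β * Q = kapP P.l ^ i ∧ α.natDegree + (3 * m + 1) ≤ 2 * i ∧
      β.natDegree + m ≤ 2 * i) :
    ∃ b b' : P.Mat 1, (∀ i j, b i j ∈ P.chart2 1) ∧ (∀ i j, b' i j ∈ P.chart2 1) ∧ b * b' = 1 ∧
      (∀ i, b i 1 = P.line2 m w M Q i) ∧ b.det = 1 := by
  obtain ⟨α, β, i, h, hα, hβ⟩ := h
  have e := congrArg P.ev h
  simp only [map_add, map_mul, map_pow] at e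
  have i1 := t1_mul_invT1 P 1
  have hk := t1_mul_tlam_mul (P := P) 1
  have n1 : (X - 1 : k[X]).natDegree ≤ 1 := by compute_degree
  have n2 : (X - C P.l : k[X]).natDegree ≤ 1 := by compute_degree
  set K := P.invT1 1 * P.invTlam 1 with hK
  have hKi : ∀ i, K ^ i * P.ev (kapP P.l) ^ i = 1 := fun i => by
    rw [← mul_pow, ev_kapP_eq, hk, one_pow]
  have hww : P.res w⁻¹ ^ p * P.res w ^ p = 1 := by
    rw [← mul_pow, ← map_mul, inv_mul_cancel₀ hw, map_one, one_pow]
  have hres : P.res w⁻¹ ∈ P.chart2 1 := Subalgebra.algebraMap_mem _ _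
  have hev1 : P.ev (X - 1) = P.t 1 - 1 := by rw [map_sub, ev_X, map_one]
  have him : ∀ j, P.invT1 1 ^ j * (P.t 1 - 1) ^ j = 1 := fun j => by
    rw [← mul_pow, mul_comm, i1, one_pow]
  let b : P.Mat 1 := !![P.ev β * (P.t 1 - 1) ^ m * K ^ i, P.line2 m w M Q 0;
    -(P.res w⁻¹ ^ p * (P.ev α * P.ev (kapP P.l) ^ p * P.invT1 1 ^ (m + 1) * K ^ i)),
      P.line2 m w M Q 1]
  have hb : ∀ i j, b i j ∈ P.chart2 1 := by
    intro i' j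
    fin_cases i' <;> fin_cases j
    · refine mem_chart2_of_mul_ev (f := β * (X - 1) ^ m) (i := i) ?_ ?_
      · exact (natDegree_mul_le_of_le le_rfl (natDegree_pow_le_of_le m n1)).trans (by omega)
      · change P.ev β * (P.t 1 - 1) ^ m * K ^ i * _ = _
        rw [map_mul, map_pow, hev1]
        linear_combination (P.ev β * (P.t 1 - 1) ^ m) * hKi i
    · exact line2_mem hm w hQ hM 0
    · refine neg_mem (mul_mem (pow_mem hres _) (mem_chart2_of_mul_ev
        (f := α * ((X - C P.l) ^ p * (X - 1) ^ m)) (i := i) ?_ ?_))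
      · exact (natDegree_mul_le_of_le le_rfl (natDegree_mul_le_of_le (natDegree_pow_le_of_le p n2)
          (natDegree_pow_le_of_le m n1))).trans (by omega)
      · have hp1 : P.ev (X - 1) ^ p = (P.t 1 - 1) ^ (m + 1) * (P.t 1 - 1) ^ m := by
          rw [hev1, ← pow_add]; congr 1; omega
        rw [map_mul, map_mul, map_pow, map_pow, hev1]
        have hkp : P.ev (kapP P.l) ^ p = P.ev (X - C P.l) ^ p
            * ((P.t 1 - 1) ^ (m + 1) * (P.t 1 - 1) ^ m) := by
          rw [← hp1, ← mul_pow, ← map_mul]; rfl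
        rw [hkp]
        linear_combination (P.ev α * P.ev (X - C P.l) ^ p
          * ((P.t 1 - 1) ^ (m + 1) * (P.t 1 - 1) ^ m) * P.invT1 1 ^ (m + 1)) * hKi i
          + P.ev α * P.ev (X - C P.l) ^ p * (P.t 1 - 1) ^ m * him (m + 1)
    · exact line2_mem hm w hQ hM 1
  have hdet : b.det = 1 := by
    rw [Matrix.det_fin_two]
    simp only [b, Puncture.line2, Matrix.of_apply, Matrix.cons_val_zero, Matrix.cons_val_one,
      Matrix.cons_val_fin_one, ← hK]
    have k1 := hKi i
    have k2 := hKi p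
    have k3 := him m
    have k4 := him (m + 1)
    generalize K ^ i = Ki at *
    generalize K ^ p = Kp at *
    generalize P.ev (kapP P.l) ^ p = kp at *
    generalize P.ev (kapP P.l) ^ i = ki at *
    generalize P.invT1 1 ^ (m + 1) = T1 at *
    generalize P.invT1 1 ^ m = T0 at *
    generalize (P.t 1 - 1) ^ (m + 1) = t1 at *
    generalize (P.t 1 - 1) ^ m = t0 at *
    linear_combination (P.ev β * Ki * P.ev Q) * k3
      + (kp * T1 * t1 * Kp * P.ev M * P.ev α * Ki) * hww
      + (T1 * t1 * P.ev M * P.ev α * Ki) * k2 + (P.ev M * P.ev α * Ki) * k4 + Ki * e + k1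
  obtain ⟨b', hb', hbb⟩ := exists_inverse_of_det hb (one_mem _) (by rw [hdet, mul_one])
  refine ⟨b, b', hb, hb', hbb, fun i => ?_, hdet⟩
  fin_cases i <;> rfl

theorem cartier1_glues {w x : k} {θ : P.R 1} (hθ : θ = P.res w * (P.t 1 - P.res x)) :
    (P.cartier1 hp θ).Glues := by
  have hs := subsingleton_R_zero (P := P)
  have hx1 : ∀ x, P.res x ∈ P.chart1 1 := fun x => Subalgebra.algebraMap_mem _ _
  have hx2 : ∀ x, P.res x ∈ P.chart2 1 := fun x => Subalgebra.algebraMap_mem _ _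
  have h0 : ∀ (S : Subalgebra (WN p k 0) (P.R 0)) (x : P.R 0), x ∈ S := fun S x =>
    Subsingleton.elim 0 x ▸ zero_mem S
  refine inverseCartier_glues hp ⟨fun i j => h0 _ _, fun i j => h0 _ _, ?_⟩
    (Subsingleton.elim _ _) ?_ ?_
  · exact Matrix.ext fun _ _ => Subsingleton.elim _ _
  · rw [hθ]
    exact mul_mem (hx1 w) (sub_mem (t_mem_chart1 P 1) (hx1 x))
  · have e : P.invTlam 1 * θ = P.res w * (P.t 1 * P.invTlam 1 - P.res x * P.invTlam 1) := by
      rw [hθ]; ring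
    exact e ▸ mul_mem (hx2 w) (sub_mem (t_mul_invTlam_mem_chart2 P 1)
      (mul_mem (hx2 x) (invTlam_mem_chart2 P 1)))

/-- The Hodge filtration on the inverse Cartier transform modulo `p`, and its Higgs field. -/
theorem exists_gauge_cartier1 (hm : p = 2 * m + 1) {U Q M : k[X]} {w x : k} (hw : w ≠ 0)
    (h : IsSol p m P.l (x ^ p) (P.Z hp) U Q M) (h0 : ¬ (U = 0 ∧ Q = 0 ∧ M = 0)) {θ : P.R 1}
    (hθ : θ = P.res w * (P.t 1 - P.res x)) {D N : k}
    (hDN : wronP p P.l (x ^ p) U Q = X ^ (p - 1) * (C D * X - C N)) :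
    ¬ (N = 0 ∧ D = 0) ∧ ∃ (V : FilData P 1) (a a' b b' : P.Mat 1), V.toConn.Glues ∧
      ((P.cartier1 hp θ).twist m).Gauge V.toConn a a' b b' ∧
      (∀ i, a i 1 = P.line1 w U Q i) ∧ (∀ i, b i 1 = P.line2 m w M Q i) ∧
      a.det = Ring.inverse (P.t 1) ^ (p - 1) ∧
      V.theta = P.res (w ^ p / (P.l - 1)) * (P.res D * P.t 1 - P.res N) := by
  have hl : P.l ≠ 0 := P.ne_zero
  have hl1 : P.l ≠ 1 := P.ne_one
  have hZ := derivative_Z P hp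
  have hQ := h.Q_ne_zero hm hl h0
  have hL := wronP_ne_zero (U := U) (Y := x ^ p) hl1 hQ hZ
  refine ⟨?_, ?_⟩
  · rintro ⟨rfl, rfl⟩
    apply hL
    rw [hDN]; simp
  obtain ⟨a, a', ma, ma', haa, ha, da⟩ := exists_frame1 (P := P) hw
    (h.exists_comb_eq_X_pow hm hl hl1 h0 hZ)
  obtain ⟨b, b', mb, mb', hbb, hb, db⟩ := exists_frame2 (P := P) hm hw h.natDegree_Q h.natDegree_M
    (h.exists_comb_eq_kapP_pow hm hl hl1 h0 hZ)
  have hline := twist_cartier1_mulVec hp hm h hθ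
  rw [← funext ha, ← funext hb] at hline
  have hc := (cartier1_glues hp hθ).twist m
  have hdet : ((P.cartier1 hp θ).twist m).G.det * a.det = P.tau 1 * b.det := by
    have e : ((P.cartier1 hp θ).twist m).G = (P.t 1 - 1) ^ m • (P.cartier1 hp θ).G := rfl
    rw [e, cartier1_G, Phi2_one, Phi2_one, Matrix.det_smul, Matrix.det_fin_two_of, da, db,
      Fintype.card_fin, Puncture.tau]
    have hpp : ∀ y : P.R 1, y ^ p = y ^ (p - 1) * y := fun y => by
      rw [← pow_succ, Nat.sub_add_cancel (Fact.out : p.Prime).one_le]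
    have i0 : Ring.inverse (P.t 1) ^ (p - 1) * P.t 1 ^ (p - 1) = 1 := by
      rw [← mul_pow, Ring.inverse_mul_cancel _ (isUnit_t P 1), one_pow]
    have i1 : (P.t 1 - 1) ^ (p - 1) * P.invT1 1 ^ (p - 1) = 1 := by
      rw [← mul_pow, t1_mul_invT1, one_pow]
    have hm2 : ((P.t 1 - 1) ^ m) ^ 2 = (P.t 1 - 1) ^ (p - 1) := by
      rw [← pow_mul]; congr 1; omega
    rw [hm2, mul_pow, hpp, hpp (P.invT1 1)]
    linear_combination (P.t 1 * P.invT1 1 * (P.t 1 - 1) ^ (p - 1) * P.invT1 1 ^ (p - 1)) * i0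
      + P.t 1 * P.invT1 1 * i1
  obtain ⟨V, hV, hg⟩ := hc.exists_filData ma ma' mb mb' haa hbb hline hdet
  refine ⟨V, a, a', b, b', hV, hg, ha, hb, da, ?_⟩
  have hw1 := hg.wronskian_eq
  have hw2 := wronskian_line1 hp (m := m) hθ hDN
  rw [← funext ha, hw1, da] at hw2
  have ho := omega1_mul P 1
  rw [← ev_kapP_eq, const_one, lam_sub_one_coeff] at ho
  have hl2 : P.l - 1 ≠ 0 := sub_ne_zero.2 hl1
  have hu : IsUnit (Ring.inverse (P.t 1) ^ (p - 1)) := (isUnit_t P 1).ringInverse.pow _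
  have hv : P.res (P.l - 1) * P.res (w ^ p / (P.l - 1)) = P.res w ^ p := by
    rw [← map_mul, mul_div_cancel₀ _ hl2, map_pow]
  apply (hu.mul ((hl2.isUnit).map P.res)).mul_left_cancel
  linear_combination hw2 - Ring.inverse (P.t 1) ^ (p - 1) * V.theta * ho
    - Ring.inverse (P.t 1) ^ (p - 1) * (P.res D * P.t 1 - P.res N) * hv

end ModP

/-! ### The rational function of the flow modulo `p` -/

section Family

variable {p : ℕ} [Fact p.Prime] {k : Type u} [Field k] [CharP k p] [PerfectRing k p]

/-- A family of solutions of `IsSol`, parametrised by `Y = x ^ p`, where `x` is the zero of the Higgs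
field, none of whose members vanishes. Up to units `D X - N` is the Higgs field of the next term of
the flow, with zero `N / D`. -/
structure IsFamily (hp : Odd p) (P : Puncture p k) (m : ℕ) (U Q M : k[X][X]) (D N : k[X]) :
    Prop where
  hm : p = 2 * m + 1
  sol : IsSol p m (C P.l) X ((P.Z hp).map C) U Q M
  prim : ∀ {K : Type u} [Field K] (f : k[X] →+* K), ¬ (U.map f = 0 ∧ Q.map f = 0 ∧ M.map f = 0)
  wron : wronP p (C P.l) X U Q = X ^ (p - 1) * (C D * X - C N)
  N_zero : N.eval 0 = 0

theorem exists_isFamily (hp : Odd p) (P : Puncture p k) :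
    ∃ m U Q M D N, IsFamily hp P m U Q M D N := by
  obtain ⟨m, hm⟩ := id hp
  obtain ⟨U, Q, M, hs, hprim⟩ := exists_primitive_sol hm P.l (P.Z hp) (natDegree_Z_le P hp)
  have hZ : derivative ((P.Z hp).map C) = C (1 - C P.l) * kapP (C P.l) ^ (p - 1)
      - C (1 - C P.l) ^ p * X ^ (p - 1) := by
    rw [derivative_map, derivative_Z]
    simp [kapP]
  have hl : IsUnit (C P.l) := isUnit_C.2 (IsUnit.mk0 _ P.ne_zero)
  obtain ⟨D, N, h1, h2⟩ := hs.exists_wronP_eq hl hm hZ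
  refine ⟨m, U, Q, M, D, N, hm, hs, hprim, h1, ?_⟩
  have e := congrArg (fun f => (f.eval 0).eval 0) h2
  have hp0 : p ≠ 0 := (Fact.out : p.Prime).ne_zero
  simp [wronM, kapP, hp0] at e
  exact e.resolve_right fun h => P.ne_zero h.1

variable {hp : Odd p} {P : Puncture p k} {m : ℕ} {U Q M : k[X][X]} {D N : k[X]}

section BaseChange

variable (K : Type u) [Field K] [CharP K p] [PerfectRing K p] [Algebra k K]

omit [PerfectRing k p] [PerfectRing K p] in
theorem baseChange_l : (P.baseChange K).l = algebraMap k K P.l := WittVector.map_coeff _ _ _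

theorem baseChange_Z : (P.baseChange K).Z hp = (P.Z hp).map (algebraMap k K) := by
  have hfr : WittVector.frobenius (WittVector.map (algebraMap k K) P.lam)
      = WittVector.map (algebraMap k K) (WittVector.frobenius P.lam) := by
    ext i
    simp [WittVector.coeff_frobenius_charP, WittVector.map_coeff]
  have hQ : (P.baseChange K).Q hp = (P.Q hp).map (WittVector.map (algebraMap k K)) := by
    apply p_mul_cancel
    have h1 := num_eq_Q (P.baseChange K) hp
    have h2 := congrArg (Polynomial.map (WittVector.map (algebraMap k K))) (num_eq_Q P hp)
    rw [Polynomial.map_mul, Polynomial.map_natCast] at h2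
    rw [← h1, ← h2]
    simp [Puncture.num, Puncture.baseChange, hfr]
  rw [Puncture.Z, Puncture.Z, hQ, Polynomial.map_map, Polynomial.map_map]
  congr 1

end BaseChange

section Specialise

variable {K : Type u} [Field K] [CharP K p] [PerfectRing K p] [Algebra k K]

/-- The specialisation of a polynomial over `k[Y]` at `Y = y`. -/
abbrev spec (y : K) (f : k[X][X]) : K[X] :=
  f.map ((aeval y : k[X] →ₐ[k] K) : k[X] →+* K)

theorem map_C_spec (y : K) (f : k[X]) : spec y (f.map C) = f.map (algebraMap k K) := by
  rw [spec, Polynomial.map_map]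
  congr 1
  ext x
  simp

omit [Fact p.Prime] [CharP k p] [PerfectRing k p] [CharP K p] [PerfectRing K p] in
theorem map_wronP {A B : Type*} [CommRing A] [CommRing B] (f : A →+* B) (l Y : A) (U Q : A[X]) :
    (wronP p l Y U Q).map f = wronP p (f l) (f Y) (U.map f) (Q.map f) := by
  simp [wronP, map_kapP, derivative_map]

theorem IsFamily.spec_sol (h : IsFamily hp P m U Q M D N) (y : K) :
    IsSol p m (P.baseChange K).l y ((P.baseChange K).Z hp) (spec y U) (spec y Q) (spec y M) := by
  have e := h.sol.map ((aeval y : k[X] →ₐ[k] K) : k[X] →+* K)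
  rw [baseChange_l, baseChange_Z, ← map_C_spec y]
  simpa using e

omit [PerfectRing K p] in
theorem IsFamily.spec_wron (h : IsFamily hp P m U Q M D N) (y : K) :
    wronP p (P.baseChange K).l y (spec y U) (spec y Q)
      = X ^ (p - 1) * (C (aeval y D) * X - C (aeval y N)) := by
  have e := congrArg (spec y) h.wron
  rw [spec, map_wronP] at e
  rw [baseChange_l]
  simpa using e

end Specialise

/-- The Hodge line subbundle of an arbitrary representative of the first term of the flow. -/
theorem exists_const_of_gauge_cartier1 (hm : p = 2 * m + 1) {U Q M : k[X]} {w x : k}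
    (h : IsSol p m P.l (x ^ p) (P.Z hp) U Q M) (h0 : ¬ (U = 0 ∧ Q = 0 ∧ M = 0)) {θ : P.R 1}
    (hθ : θ = P.res w * (P.t 1 - P.res x)) {D N : k}
    (hDN : wronP p P.l (x ^ p) U Q = X ^ (p - 1) * (C D * X - C N))
    {V : FilData P 1} {a a' b b' : P.Mat 1}
    (hg : ((P.cartier1 hp θ).twist m).Gauge V.toConn a a' b b') :
    ∃ κ d : k, κ ≠ 0 ∧ d ≠ 0 ∧ (∀ i, P.line1 w U Q i = P.res κ * a i 1) ∧
      (∀ i, P.line2 m w M Q i = P.res κ * b i 1) ∧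
      a.det = P.res d * Ring.inverse (P.t 1) ^ (p - 1) ∧
      V.theta = P.res (w ^ p / ((P.l - 1) * κ ^ 2 * d)) * (P.res D * P.t 1 - P.res N) := by
  obtain ⟨C, hC⟩ := hg.exists_const_mul (line1_mem w U Q)
    (line2_mem hm w h.natDegree_Q h.natDegree_M) (twist_cartier1_mulVec hp hm h hθ)
  rw [const_one] at hC
  have i0 : Ring.inverse (P.t 1) ^ (p - 1) * P.t 1 ^ (p - 1) = 1 := by
    rw [← mul_pow, Ring.inverse_mul_cancel _ (isUnit_t P 1), one_pow]
  have hκ : C.coeff 0 ≠ 0 := by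
    intro hz
    apply h.Q_ne_zero hm P.ne_zero h0
    apply ev_injective P
    have e := (hC 1).1
    rw [hz, map_zero, zero_mul] at e
    have e' : Ring.inverse (P.t 1) ^ (p - 1) * P.ev Q = 0 := e
    rw [map_zero]
    linear_combination P.t 1 ^ (p - 1) * e' - P.ev Q * i0
  have hdet : a.det * P.t 1 ^ (p - 1) = b.det := by
    have e := congrArg Matrix.det hg.glue
    rw [Matrix.det_mul, Matrix.det_mul, FilData.det_G] at e
    have e1 : ((P.cartier1 hp θ).twist m).G = (P.t 1 - 1) ^ m • (P.cartier1 hp θ).G := rfl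
    rw [e1, cartier1_G, Phi2_one, Phi2_one, Matrix.det_smul, Matrix.det_fin_two_of,
      Fintype.card_fin, mul_zero, sub_zero, one_mul] at e
    apply (isUnit_tau P 1).mul_right_cancel
    rw [← e, Puncture.tau]
    have hpp : ∀ y : P.R 1, y ^ p = y ^ (p - 1) * y := fun y => by
      rw [← pow_succ, Nat.sub_add_cancel (Fact.out : p.Prime).one_le]
    have i1 : (P.t 1 - 1) ^ (p - 1) * P.invT1 1 ^ (p - 1) = 1 := by
      rw [← mul_pow, t1_mul_invT1, one_pow]
    have hm2 : ((P.t 1 - 1) ^ m) ^ 2 = (P.t 1 - 1) ^ (p - 1) := by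
      rw [← pow_mul]; congr 1; omega
    rw [hm2, mul_pow, hpp, hpp (P.invT1 1)]
    linear_combination (-a.det * P.t 1 ^ (p - 1) * P.t 1 * P.invT1 1) * i1
  obtain ⟨d, hd⟩ := exists_const_of_mem_charts P 1 (x := b.det)
    (hdet ▸ mul_mem (det_mem hg.mem1) (pow_mem (t_mem_chart1 P 1) _)) (det_mem hg.mem2)
  rw [const_one] at hd
  have hd0 : d.coeff 0 ≠ 0 := by
    intro hz
    rw [hz, map_zero] at hd
    have e := congrArg Matrix.det hg.mul2
    rw [Matrix.det_mul, hd, zero_mul, Matrix.det_one] at e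
    exact zero_ne_one e
  have hda : a.det = P.res (d.coeff 0) * Ring.inverse (P.t 1) ^ (p - 1) := by
    rw [← hd, ← hdet, mul_assoc, mul_comm (P.t 1 ^ (p - 1)), i0, mul_one]
  refine ⟨C.coeff 0, d.coeff 0, hκ, hd0, fun i => (hC i).1, fun i => (hC i).2, hda, ?_⟩
  have hw1 := hg.wronskian_eq
  have hw2 := wronskian_line1 hp (m := m) hθ hDN
  have hw3 := ((P.cartier1 hp θ).twist m).wronskian_const_mul C (fun i => a i 1)
  rw [const_one, ← funext fun i => (hC i).1, hw1] at hw3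
  rw [hw3, hda] at hw2
  have ho := omega1_mul P 1
  rw [← ev_kapP_eq, const_one, lam_sub_one_coeff] at ho
  have hl2 : P.l - 1 ≠ 0 := sub_ne_zero.2 P.ne_one
  have hu : IsUnit (Ring.inverse (P.t 1) ^ (p - 1)) := (isUnit_t P 1).ringInverse.pow _
  have hne : (P.l - 1) * C.coeff 0 ^ 2 * d.coeff 0 ≠ 0 :=
    mul_ne_zero (mul_ne_zero hl2 (pow_ne_zero _ hκ)) hd0
  have hv : P.res (P.l - 1) * P.res (C.coeff 0) ^ 2 * P.res (d.coeff 0)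
      * P.res (w ^ p / ((P.l - 1) * C.coeff 0 ^ 2 * d.coeff 0)) = P.res w ^ p := by
    rw [← map_pow, ← map_mul, ← map_mul, ← map_mul, mul_div_cancel₀ _ hne, map_pow]
  apply (hu.mul ((hne.isUnit).map P.res)).mul_left_cancel
  rw [map_mul, map_mul, map_pow]
  linear_combination hw2 - Ring.inverse (P.t 1) ^ (p - 1) * V.theta * P.res (C.coeff 0) ^ 2
    * P.res (d.coeff 0) * ho
    - Ring.inverse (P.t 1) ^ (p - 1) * (P.res D * P.t 1 - P.res N) * hv

/-- The rational function `N / D` describes the flow modulo `p`. -/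
theorem IsFamily.isFlowFunction (h : IsFamily hp P m U Q M D N) {φ : RatFunc k} {e : k[X]}
    (hN : N = φ.num * e) (hD : D = φ.denom * e) : IsFlowFunction hp P φ := by
  intro K _ _ _ _ x
  have hs := h.spec_sol (x ^ p)
  have hp0 := h.prim ((aeval (x ^ p) : k[X] →ₐ[k] K) : k[X] →+* K)
  have hw := h.spec_wron (x ^ p)
  have hm2 : (p - 1) / 2 = m := by have := h.hm; omega
  have hex : ∀ {w : K} {θ : (P.baseChange K).R 1}, w ≠ 0 →
      θ = (P.baseChange K).res w * ((P.baseChange K).t 1 - (P.baseChange K).res x) → _ :=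
    fun hw0 hθ => exists_gauge_cartier1 hp h.hm hw0 hs hp0 hθ hw
  have hne := (hex one_ne_zero rfl).1
  rw [hN, hD, map_mul, map_mul] at hne
  have he : aeval (x ^ p) e ≠ 0 := fun h0 => hne (by simp [h0])
  have hne2 : ¬ (aeval (x ^ p) φ.num = 0 ∧ aeval (x ^ p) φ.denom = 0) := fun h0 =>
    hne (by simp [h0.1, h0.2])
  have hzero : ∀ {θ : (P.baseChange K).R 1} {u : K}, u ≠ 0 →
      θ = (P.baseChange K).res u * ((P.baseChange K).res (aeval (x ^ p) D) * (P.baseChange K).t 1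
        - (P.baseChange K).res (aeval (x ^ p) N)) →
      IsZeroOf (P.baseChange K) 1 θ (WittVector.teichmuller p (aeval (x ^ p) φ.num))
        (WittVector.teichmuller p (aeval (x ^ p) φ.denom)) := by
    intro θ u hu hθ
    refine isZeroOf_res (u := u * aeval (x ^ p) e) (mul_ne_zero hu he) hne2 ?_
    rw [hθ, hN, hD]
    simp only [map_mul]
    ring
  have hl1 : (P.baseChange K).l - 1 ≠ 0 := sub_ne_zero.2 (P.baseChange K).ne_one
  refine ⟨?_, ?_⟩
  · obtain ⟨-, V, a, a', b, b', hV, hg, -, -, -, hth⟩ :=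
      hex (w := 1) (θ := (P.baseChange K).res 1 * ((P.baseChange K).t 1 - (P.baseChange K).res x))
        one_ne_zero rfl
    have hz := hzero (div_ne_zero (pow_ne_zero p one_ne_zero) hl1) hth
    refine ⟨V.toFilDR hV ⟨_, _, hz⟩,
      (P.baseChange K).res 1 * ((P.baseChange K).t 1 - (P.baseChange K).res x),
      ⟨?_, 1, isUnit_one, ?_⟩, ?_⟩
    · exact fun h => WittVector.irreducible p |>.not_isUnit (isUnit_of_dvd_one h.2)
    · simp only [map_one, one_mul, const_one, WittVector.teichmuller_coeff_zero]
    · obtain ⟨g1, g2, hi, -⟩ := hg.exists_isIso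
      refine ⟨g1, g2, ?_⟩
      rw [hm2]
      exact hi
  · rintro V' ⟨θ, ⟨-, w, hwu, hθ⟩, g1, g2, hi⟩
    rw [hm2] at hi
    have hw0 : w.coeff 0 ≠ 0 := by
      have := hwu.map (WittVector.constantCoeff : WittVector p K →+* K)
      exact this.ne_zero
    have hθ2 : θ = (P.baseChange K).res (w.coeff 0)
        * ((P.baseChange K).t 1 - (P.baseChange K).res x) := by
      rw [hθ, map_one, one_mul, const_one, const_one, WittVector.teichmuller_coeff_zero]
    obtain ⟨κ, d, hκ, hd, -, -, -, hth⟩ :=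
      exists_const_of_gauge_cartier1 h.hm hs hp0 hθ2 hw (hp := hp) hi.gauge
    exact hzero (div_ne_zero (pow_ne_zero p hw0)
      (mul_ne_zero (mul_ne_zero hl1 (pow_ne_zero _ hκ)) hd)) hth

/-- The value of a polynomial over `k[Y]` at `Y = y`. -/
abbrev evalCoeff (y : k) (f : k[X][X]) : k[X] := f.map (evalRingHom y)

theorem evalCoeff_map_C (y : k) (f : k[X]) : evalCoeff y (f.map C) = f := by
  rw [evalCoeff, Polynomial.map_map, show (evalRingHom y).comp C = RingHom.id k from
    RingHom.ext fun a => by simp, Polynomial.map_id]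

theorem IsFamily.eval_sol (h : IsFamily hp P m U Q M D N) (y : k) :
    IsSol p m P.l y (P.Z hp) (evalCoeff y U) (evalCoeff y Q) (evalCoeff y M) := by
  have e := h.sol.map (evalRingHom y)
  have hz : ((P.Z hp).map C).map (evalRingHom y) = P.Z hp := evalCoeff_map_C y _
  rw [hz] at e
  simpa using e

theorem IsFamily.eval_wron (h : IsFamily hp P m U Q M D N) (y : k) :
    wronP p P.l y (evalCoeff y U) (evalCoeff y Q) = X ^ (p - 1) * (C (D.eval y) * X - C (N.eval y)) := by
  have hw := congrArg (Polynomial.map (evalRingHom y)) h.wron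
  rw [map_wronP] at hw
  simpa using hw

theorem IsFamily.N_D_ne_zero (h : IsFamily hp P m U Q M D N) (x : k) :
    ¬ (N.eval (x ^ p) = 0 ∧ D.eval (x ^ p) = 0) :=
  (exists_gauge_cartier1 hp h.hm one_ne_zero (h.eval_sol _) (h.prim _) rfl (h.eval_wron _)).1

theorem IsFamily.exists_ratFunc (h : IsFamily hp P m U Q M D N) :
    ∃ (φ : RatFunc k) (e : k[X]), N = φ.num * e ∧ D = φ.denom * e := by
  have hD : D ≠ 0 := by
    intro hD
    have hp0 : p ≠ 0 := (Fact.out : p.Prime).ne_zero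
    apply h.N_D_ne_zero 0
    rw [zero_pow hp0, h.N_zero, hD, eval_zero]
    exact ⟨rfl, rfl⟩
  have hq : RatFunc.num (algebraMap k[X] (RatFunc k) N / algebraMap k[X] (RatFunc k) D) * D
      = N * RatFunc.denom (algebraMap k[X] (RatFunc k) N / algebraMap k[X] (RatFunc k) D) :=
    (RatFunc.num_mul_eq_mul_denom_iff hD).2 rfl
  set φ := algebraMap k[X] (RatFunc k) N / algebraMap k[X] (RatFunc k) D
  have hc := RatFunc.isCoprime_num_denom φ
  obtain ⟨e, he⟩ : φ.denom ∣ D := hc.symm.dvd_of_dvd_mul_left ⟨N, by rw [hq, mul_comm]⟩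
  refine ⟨φ, e, ?_, he⟩
  apply mul_right_cancel₀ (RatFunc.denom_ne_zero φ)
  rw [← hq]
  nth_rewrite 1 [he]
  ring

theorem coeff_mul_eq_of_isZeroOf {θ : P.R 1} {x0 x1 y0 y1 : WittVector p k}
    (hx : IsZeroOf P 1 θ x0 x1) (hy : IsZeroOf P 1 θ y0 y1) :
    x0.coeff 0 * y1.coeff 0 = y0.coeff 0 * x1.coeff 0 := by
  obtain ⟨-, v, hv, e⟩ := hx
  obtain ⟨-, w, hw, f⟩ := hy
  have hv0 : v.coeff 0 ≠ 0 :=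
    (hv.map (WittVector.constantCoeff : WittVector p k →+* k)).ne_zero
  have hw0 : w.coeff 0 ≠ 0 :=
    (hw.map (WittVector.constantCoeff : WittVector p k →+* k)).ne_zero
  rw [e] at f
  simp only [const_one, ← ev_C, ← ev_X, ← map_mul, ← map_sub] at f
  have f' := ev_injective P f
  have f0 := congrArg (fun q => q.coeff 0) f'
  have f1 := congrArg (fun q => q.coeff 1) f'
  simp at f0 f1
  apply mul_left_cancel₀ (mul_ne_zero hv0 hw0)
  linear_combination w.coeff 0 * y1.coeff 0 * f0 - w.coeff 0 * y0.coeff 0 * f1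

omit [PerfectRing k p] in
/-- Two flow functions agree at all points of an algebraic closure. -/
theorem isFlowFunction_unique {φ ψ : RatFunc k} (hφ : IsFlowFunction hp P φ)
    (hψ : IsFlowFunction hp P ψ) : φ = ψ := by
  have : CharP (AlgebraicClosure k) p := charP_of_injective_algebraMap
    (algebraMap k (AlgebraicClosure k)).injective p
  have : ExpChar (AlgebraicClosure k) p := ExpChar.prime (Fact.out : p.Prime)
  have : PerfectRing (AlgebraicClosure k) p := PerfectField.toPerfectRing p
  have key : ∀ y : AlgebraicClosure k, aeval y (φ.num * ψ.denom) = aeval y (ψ.num * φ.denom) := by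
    intro y
    obtain ⟨x, rfl⟩ : ∃ x, x ^ p = y := surjective_frobenius (AlgebraicClosure k) p y
    obtain ⟨⟨V', h⟩, h1⟩ := hφ (AlgebraicClosure k) x
    have e := coeff_mul_eq_of_isZeroOf (h1 V' h) ((hψ (AlgebraicClosure k) x).2 V' h)
    simp only [WittVector.teichmuller_coeff_zero] at e
    rw [map_mul, map_mul, e]
  have h := Polynomial.funext (p := (φ.num * ψ.denom).map (algebraMap k (AlgebraicClosure k)))
    (q := (ψ.num * φ.denom).map (algebraMap k (AlgebraicClosure k)))
    (fun y => by simpa only [eval_map_algebraMap] using key y)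
  have h2 := Polynomial.map_injective _ (algebraMap k (AlgebraicClosure k)).injective h
  rw [← RatFunc.num_div_denom φ, ← RatFunc.num_div_denom ψ,
    div_eq_div_iff (by simpa using RatFunc.denom_ne_zero φ) (by simpa using RatFunc.denom_ne_zero ψ),
    ← map_mul, ← map_mul, h2]

/-- The flow function is represented by `N / D`. -/
theorem IsFamily.exists_eq_of_isFlowFunction (h : IsFamily hp P m U Q M D N) {φ : RatFunc k}
    (hφ : IsFlowFunction hp P φ) : ∃ e, N = φ.num * e ∧ D = φ.denom * e := by
  obtain ⟨ψ, e, hN, hD⟩ := h.exists_ratFunc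
  rw [isFlowFunction_unique hφ (h.isFlowFunction hN hD)]
  exact ⟨e, hN, hD⟩

theorem existsUnique_isFlowFunction (hp : Odd p) (P : Puncture p k) :
    ∃! φ : RatFunc k, IsFlowFunction hp P φ := by
  obtain ⟨m, U, Q, M, D, N, h⟩ := exists_isFamily hp P
  obtain ⟨φ, e, hN, hD⟩ := h.exists_ratFunc
  exact ⟨φ, h.isFlowFunction hN hD, fun ψ hψ => isFlowFunction_unique hψ (h.isFlowFunction hN hD)⟩

end Family

/-! ### Differentiation with respect to the parameter -/

section DerivCoeff

variable {k : Type u} [Field k]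

/-- Differentiation with respect to `Y` on `k[Y][X]`. -/
def derivCoeff : Derivation k k[X][X] k[X][X] :=
  PolynomialModule.equivPolynomialSelf.compDer (derivative' (R := k)).mapCoeffs

theorem coeff_derivCoeff (f : k[X][X]) (i : ℕ) :
    (derivCoeff f).coeff i = derivative (f.coeff i) := rfl

theorem derivCoeff_C (a : k[X]) : derivCoeff (C a) = C (derivative a) := by
  ext1 i
  rw [coeff_derivCoeff, coeff_C, coeff_C]
  split_ifs <;> simp

theorem derivCoeff_X : derivCoeff (X : k[X][X]) = 0 := by
  ext1 i
  rw [coeff_derivCoeff, coeff_X]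
  split_ifs <;> simp

theorem derivCoeff_map_C (f : k[X]) : derivCoeff (f.map C) = 0 := by
  ext1 i
  rw [coeff_derivCoeff, coeff_map, derivative_C, coeff_zero]

theorem derivCoeff_derivative (f : k[X][X]) :
    derivCoeff (derivative f) = derivative (derivCoeff f) := by
  ext1 i
  rw [coeff_derivCoeff, coeff_derivative, coeff_derivative, coeff_derivCoeff]
  simp

theorem natDegree_derivCoeff_le (f : k[X][X]) : (derivCoeff f).natDegree ≤ f.natDegree := by
  rw [natDegree_le_iff_coeff_eq_zero]
  intro i hi
  rw [coeff_derivCoeff, coeff_eq_zero_of_natDegree_lt hi, derivative_zero]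

theorem derivCoeff_kapP (l : k) : derivCoeff (kapP (C l)) = 0 := by
  rw [← map_kapP, derivCoeff_map_C]

end DerivCoeff

section FamilyDeriv

variable {p : ℕ} [Fact p.Prime] {k : Type u} [Field k] [CharP k p] [PerfectRing k p]
  {hp : Odd p} {P : Puncture p k} {m : ℕ} {U Q M : k[X][X]} {D N : k[X]}

/-- The equation of `IsSol`, differentiated with respect to `Y`. -/
theorem IsFamily.deriv_sol (h : IsFamily hp P m U Q M D N) (y : k) :
    evalCoeff y (derivCoeff U) * kapP P.l ^ p
      = P.Z hp * ((X ^ p - C y) * evalCoeff y (derivCoeff Q) - evalCoeff y Q)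
        + X ^ p * evalCoeff y (derivCoeff M) := by
  have e := congrArg derivCoeff h.sol.eq
  simp only [Derivation.leibniz, map_add, map_sub, Derivation.leibniz_pow, derivCoeff_kapP,
    derivCoeff_map_C, derivCoeff_X, derivCoeff_C, derivative_X, smul_eq_mul, smul_zero,
    mul_zero, zero_add, add_zero] at e
  have e2 := congrArg (evalCoeff y) e
  have hz : ((P.Z hp).map C).map (evalRingHom y) = P.Z hp := evalCoeff_map_C y _
  simp only [evalCoeff, Polynomial.map_add, Polynomial.map_mul, Polynomial.map_sub, Polynomial.map_pow,
    hz, map_kapP, map_X, map_C, coe_evalRingHom, eval_C, eval_X,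
    Polynomial.map_one, map_one, Polynomial.map_zero] at e2 ⊢
  linear_combination e2

/-- The formula for the Wronskian, differentiated with respect to `Y`. -/
theorem IsFamily.deriv_wron (h : IsFamily hp P m U Q M D N) (y : k) :
    kapP P.l * (derivative (evalCoeff y (derivCoeff U)) * evalCoeff y Q
          + derivative (evalCoeff y U) * evalCoeff y (derivCoeff Q)
          - evalCoeff y (derivCoeff U) * derivative (evalCoeff y Q)
          - evalCoeff y U * derivative (evalCoeff y (derivCoeff Q)))
        + C (P.l - 1) * (2 * (X ^ p - C y) * evalCoeff y Q * evalCoeff y (derivCoeff Q) - evalCoeff y Q ^ 2)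
      = X ^ (p - 1) * (C ((derivative D).eval y) * X - C ((derivative N).eval y)) := by
  have e := congrArg derivCoeff h.wron
  simp only [wronP, Derivation.leibniz, map_add, map_sub, Derivation.leibniz_pow, derivCoeff_kapP,
    derivCoeff_X, derivCoeff_C, derivative_X, smul_eq_mul, smul_zero,
    mul_zero, zero_add, add_zero, zero_sub, derivCoeff_derivative, derivative_C, derivative_one,
    sub_self, map_zero] at e
  have e2 := congrArg (evalCoeff y) e
  simp only [evalCoeff, Polynomial.map_add, Polynomial.map_mul, Polynomial.map_sub, Polynomial.map_pow,
    map_kapP, map_X, map_C, coe_evalRingHom, eval_C, eval_X, Polynomial.map_neg,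
    Polynomial.map_one, map_one, derivative_map, nsmul_eq_mul, map_sub, Nat.cast_ofNat, pow_one,
    Polynomial.map_ofNat, Nat.add_one_sub_one] at e2 ⊢
  linear_combination e2

/-- The polarisation of `Conn.wronskian`. -/
def Conn.polar {N : ℕ} (c : Conn P N) (x y : Fin 2 → P.R N) : P.R N :=
  (P.D N (y 0) + P.omega1 N * (c.A1.mulVec y) 0) * x 1
    + (P.D N (x 0) + P.omega1 N * (c.A1.mulVec x) 0) * y 1
    - (P.D N (y 1) + P.omega1 N * (c.A1.mulVec y) 1) * x 0
    - (P.D N (x 1) + P.omega1 N * (c.A1.mulVec x) 1) * y 0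

omit [PerfectRing k p] in
theorem Conn.polar_const_mul {N : ℕ} (c : Conn P N) (r s : WittVector p k) (x y : Fin 2 → P.R N) :
    c.polar (fun i => P.const N r * x i) (fun i => P.const N s * y i)
      = P.const N r * P.const N s * c.polar x y := by
  simp only [Conn.polar, Matrix.mulVec, dotProduct, Fin.sum_univ_two, Derivation.leibniz,
    D_const, smul_eq_mul]
  ring

omit [PerfectRing k p] in
/-- The first order variation of the Wronskian, under changes of the section and of the Higgs field. -/
theorem Conn.wronskian_add_mul {N : ℕ} {c c' : Conn P N} {q α : P.R N} (hq : q * q = 0)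
    (hD : P.D N q = 0) (h : c'.A1 = c.A1 + (q * α) • !![0, 1; 0, 0]) (x y : Fin 2 → P.R N) :
    c'.wronskian (fun i => x i + q * y i)
      = c.wronskian x + q * (c.polar x y + P.omega1 N * α * x 1 ^ 2) := by
  simp only [Conn.wronskian, Conn.polar, h, Matrix.mulVec, dotProduct, Fin.sum_univ_two,
    Derivation.leibniz, map_add, hD, smul_eq_mul, Matrix.add_apply, Matrix.smul_apply,
    Matrix.of_apply, Matrix.cons_val_zero, Matrix.cons_val_one, Matrix.cons_val_fin_one, mul_zero,
    add_zero, mul_one]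
  generalize P.D N (x 0) = dx0
  generalize P.D N (x 1) = dx1
  generalize P.D N (y 0) = dy0
  generalize P.D N (y 1) = dy1
  generalize c.A1 0 0 = a00
  generalize c.A1 0 1 = a01
  generalize c.A1 1 0 = a10
  generalize c.A1 1 1 = a11
  generalize x 0 = x0
  generalize x 1 = x1
  generalize y 0 = y0
  generalize y 1 = y1
  linear_combination (P.omega1 N * α * y1 * (x1 + x1 + q * y1) + (dy0 + P.omega1 N * (a00 * y0 + a01 * y1)) * y1
    - (dy1 + P.omega1 N * (a10 * y0 + a11 * y1)) * y0) * hq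

/-- The linearisation of the formula for the Wronskian. -/
theorem polar_line1 {U Q U' Q' : k[X]} {w x : k} {θ : P.R 1}
    (hθ : θ = P.res w * (P.t 1 - P.res x)) {D N : k}
    (h : kapP P.l * (derivative U' * Q + derivative U * Q' - U' * derivative Q - U * derivative Q')
        + C (P.l - 1) * (2 * (X ^ p - C (x ^ p)) * Q * Q' - Q ^ 2)
      = X ^ (p - 1) * (C D * X - C N)) :
    (((P.cartier1 hp θ).twist m).polar (P.line1 w U Q) (P.line1 w U' Q')
        - P.omega1 1 * P.Phi1 1 hp (P.res w) * P.line1 w U Q 1 ^ 2) * P.ev (kapP P.l)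
      = P.res w ^ p * Ring.inverse (P.t 1) ^ (p - 1) * (P.res D * P.t 1 - P.res N) := by
  have hE : ((P.cartier1 hp θ).twist m).A1 = !![0, θ ^ p; 0, 0] := by
    rw [← Phi1_one P hp, ← cartier1_A1]; rfl
  have e := congrArg P.ev h
  have ho := omega1_mul P 1
  rw [← ev_kapP_eq, const_one, lam_sub_one_coeff] at ho
  have i0p : Ring.inverse (P.t 1) ^ (p - 1) * P.t 1 ^ (p - 1) = 1 := by
    rw [← mul_pow, Ring.inverse_mul_cancel _ (isUnit_t P 1), one_pow]
  have hθp : θ ^ p = P.res w ^ p * (P.t 1 ^ p - P.res x ^ p) := by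
    rw [hθ, mul_pow, sub_pow_char]
  simp only [map_mul, map_add, map_sub, map_pow, ev_X, ev_C, ← D_ev, map_one, map_ofNat] at e ho
  rw [Conn.polar, hE, hθp, Phi1_one]
  simp only [Puncture.line1, Matrix.mulVec, dotProduct, Fin.sum_univ_two, Matrix.of_apply,
    Matrix.cons_val_zero, Matrix.cons_val_one, Matrix.cons_val_fin_one, zero_mul, zero_add,
    add_zero, mul_zero, Derivation.leibniz, D_invT_pow, smul_eq_mul, ← map_pow P.res, D_res]
  simp only [map_pow]
  generalize Ring.inverse (P.t 1) ^ (p - 1) = f at *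
  generalize P.t 1 ^ (p - 1) = tp at *
  generalize P.res w ^ p = W at *
  linear_combination W * f ^ 2 * e + W * f * (P.res D * P.t 1 - P.res N) * i0p
    + W * f ^ 2 * (2 * (P.t 1 ^ p - P.res x ^ p) * P.ev Q * P.ev Q' - P.ev Q ^ 2) * ho

end FamilyDeriv

/-! ### Variation of the flow under a change of the lift of the Higgs field -/

section RedOne

variable {p : ℕ} [Fact p.Prime] {k : Type u} [Field k] [CharP k p] {P : Puncture p k} (n : ℕ)

variable {n} in
theorem p_pow_mul_p_pow_eq_zero (hN : n ≠ 0) :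
    (p : P.R (n + 1)) ^ n * (p : P.R (n + 1)) ^ n = 0 := by
  rw [← pow_add]
  obtain ⟨j, hj⟩ : ∃ j, n + n = n + 1 + j := ⟨n - 1, by omega⟩
  rw [hj, pow_add, natCast_p_nilpotent, zero_mul]

theorem redOne_const (x : WittVector p k) :
    P.redOne n (P.const (n + 1) x) = P.const 1 x := by
  induction n with
  | zero => rfl
  | succ n ih => rw [redOne_succ, red_const, ih]

theorem redOne_t : P.redOne n (P.t (n + 1)) = P.t 1 := by
  induction n with
  | zero => rfl
  | succ n ih => rw [redOne_succ, red_t, ih]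

theorem redOne_tau : P.redOne n (P.tau (n + 1)) = P.tau 1 := by
  induction n with
  | zero => rfl
  | succ n ih => rw [redOne_succ, red_tau, ih]

theorem redOne_omega1 : P.redOne n (P.omega1 (n + 1)) = P.omega1 1 := by
  induction n with
  | zero => rfl
  | succ n ih => rw [redOne_succ, red_omega1, ih]

theorem redOne_D (x : P.R (n + 1)) :
    P.redOne n (P.D (n + 1) x) = P.D 1 (P.redOne n x) := by
  induction n with
  | zero => rfl
  | succ n ih => rw [redOne_succ, red_D, ih, redOne_succ]

theorem exists_mem_chart1_redOne_eq {x : P.R 1} (hx : x ∈ P.chart1 1) :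
    ∃ y ∈ P.chart1 (n + 1), P.redOne n y = x := by
  induction n with
  | zero => exact ⟨x, hx, rfl⟩
  | succ n ih =>
    obtain ⟨y, hy, rfl⟩ := ih
    obtain ⟨z, hz, rfl⟩ := exists_mem_chart1_red_eq P _ hy
    exact ⟨z, hz, redOne_succ z⟩

theorem exists_mem_chart2_redOne_eq {x : P.R 1} (hx : x ∈ P.chart2 1) :
    ∃ y ∈ P.chart2 (n + 1), P.redOne n y = x := by
  induction n with
  | zero => exact ⟨x, hx, rfl⟩
  | succ n ih =>
    obtain ⟨y, hy, rfl⟩ := ih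
    obtain ⟨z, hz, rfl⟩ := exists_mem_chart2_red_eq P _ hy
    exact ⟨z, hz, redOne_succ z⟩

variable {n}

theorem redOne_polar (c : Conn P (n + 1)) (x y : Fin 2 → P.R (n + 1)) :
    P.redOne n (c.polar x y)
      = c.modP.polar (fun i => P.redOne n (x i)) (fun i => P.redOne n (y i)) := by
  simp only [Conn.polar, Conn.modP, Matrix.mulVec, dotProduct, Fin.sum_univ_two, map_add, map_sub,
    map_mul, redOne_D, redOne_omega1, Matrix.map_apply]

/-- Reduction modulo `p` of a filtered de Rham bundle. -/
def FilData.modP (V : FilData P (n + 1)) : FilData P 1 :=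
  ⟨P.redOne n V.F, V.A1.map (P.redOne n), V.A2.map (P.redOne n)⟩

theorem FilData.modP_toConn (V : FilData P (n + 1)) : V.toConn.modP = V.modP.toConn := by
  have e : V.toConn.G.map (P.redOne n) = V.modP.toConn.G := by
    ext i j
    fin_cases i <;> fin_cases j <;> simp [FilData.toConn, FilData.modP]
    exact (map_mul _ _ _).symm.trans (redOne_tau (P := P) n)
  rw [Conn.modP, e]
  rfl

theorem p_pow_mul_eq_of_redOne_eq {x y : P.R (n + 1)} (h : P.redOne n x = P.redOne n y) :
    (p : P.R (n + 1)) ^ n * x = (p : P.R (n + 1)) ^ n * y := by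
  induction n with
  | zero => rw [show x = y from h]
  | succ n ih =>
    have e := ih (x := P.red (n + 1) x) (y := P.red (n + 1) y) (by rwa [← redOne_succ, ← redOne_succ])
    have e2 := p_mul_eq_of_red_eq P (n + 1) (x := (p : P.R (n + 2)) ^ n * x)
      (y := (p : P.R (n + 2)) ^ n * y) (by rw [map_mul, map_mul, map_pow, map_natCast, e])
    rw [pow_succ', mul_assoc, mul_assoc, e2]

variable [PerfectRing k p] (hp : Odd p)

theorem redOne_Phi1 (x : P.R (n + 1)) :
    P.redOne n (P.Phi1 (n + 1) hp x) = P.Phi1 1 hp (P.redOne n x) := by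
  induction n with
  | zero => rfl
  | succ n ih => rw [redOne_succ, red_Phi1, ih, redOne_succ]

theorem redOne_Phi2 (x : P.R (n + 1)) :
    P.redOne n (P.Phi2 (n + 1) hp x) = P.Phi2 1 hp (P.redOne n x) := by
  induction n with
  | zero => rfl
  | succ n ih => rw [redOne_succ, red_Phi2, ih, redOne_succ]

theorem redOne_z : P.redOne n (P.z (n + 1) hp) = P.z 1 hp := by
  induction n with
  | zero => rfl
  | succ n ih => rw [redOne_succ, red_z, ih]

end RedOne

section Compare

variable {p : ℕ} [Fact p.Prime] {k : Type u} [Field k] [CharP k p] [PerfectRing k p]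
  {hp : Odd p} {P : Puncture p k} {m n : ℕ} {U Q M : k[X][X]} {D N : k[X]}

/-- Gauge transformations to extensions of `𝒪` by `𝒪(1)` of two bundles with the same determinant
have determinants which differ by a constant. -/
theorem exists_det_eq_const_mul {c c' : Conn P (n + 1)}
    (hd : c'.G.det = c.G.det) {V V' : FilData P (n + 1)} {a a' b b' e e' f f' : P.Mat (n + 1)}
    (h : c.Gauge V.toConn a a' b b') (h' : c'.Gauge V'.toConn e e' f f') :
    ∃ u, IsUnit u ∧ e.det = P.const (n + 1) u * a.det := by
  have h1 := congrArg Matrix.det h.glue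
  have h2 := congrArg Matrix.det h'.glue
  have ha := congrArg Matrix.det h.mul1
  have hb := congrArg Matrix.det h.mul2
  have he := congrArg Matrix.det h'.mul1
  rw [Matrix.det_mul, Matrix.det_mul, FilData.det_G] at h1 h2
  rw [Matrix.det_mul, Matrix.det_one] at ha hb he
  rw [hd] at h2
  have hc : IsUnit c.G.det := by
    refine isUnit_of_mul_isUnit_left (y := a.det) ?_
    rw [h1]
    exact (IsUnit.of_mul_eq_one _ hb).mul (isUnit_tau P (n + 1))
  have key : e.det * a'.det = f.det * b'.det := by
    apply (hc.mul (isUnit_tau P (n + 1))).mul_left_cancel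
    have hbu : IsUnit b'.det := IsUnit.of_mul_eq_one b.det (by rw [mul_comm]; exact hb)
    linear_combination a'.det * P.tau (n + 1) * h2 - a'.det * P.tau (n + 1) * f.det * b'.det * h1
      - f.det * P.tau (n + 1) ^ 2 * a'.det * hb + c.G.det * P.tau (n + 1) * f.det * b'.det * ha
  obtain ⟨u, hu⟩ := exists_const_of_mem_charts P (n + 1)
    (mul_mem (det_mem h'.mem1) (det_mem h.mem1')) (key ▸ mul_mem (det_mem h'.mem2) (det_mem h.mem2'))
  refine ⟨u, isUnit_of_isUnit_const (P := P) (N := n) ?_, ?_⟩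
  · rw [← hu]
    exact (IsUnit.of_mul_eq_one _ he).mul (IsUnit.of_mul_eq_one a.det (by rw [mul_comm]; exact ha))
  · rw [← hu]
    linear_combination (-e.det) * ha

omit [PerfectRing k p] in
/-- A first order perturbation of a solution of `G x = y`. -/
theorem mulVec_add_mul {A : Type*} [CommRing A] {G : Matrix (Fin 2) (Fin 2) A} {q r τ : A}
    (hq : q * q = 0) {x y X Y : Fin 2 → A} (h : G.mulVec x = τ • y)
    (h1 : q * (G.mulVec X 0 + r * x 1) = q * (τ * Y 0)) (h2 : q * G.mulVec X 1 = q * (τ * Y 1)) :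
    (G + (q * r) • !![0, 1; 0, 0]).mulVec (fun i => x i + q * X i)
      = τ • (fun i => y i + q * Y i) := by
  have e0 := congrFun h 0
  have e1 := congrFun h 1
  simp only [Matrix.mulVec, dotProduct, Fin.sum_univ_two, Pi.smul_apply, smul_eq_mul] at e0 e1 h1 h2
  ext i
  fin_cases i
  · simp only [Fin.zero_eta, Matrix.mulVec, dotProduct, Fin.sum_univ_two, Pi.smul_apply,
      smul_eq_mul, Matrix.add_apply, Matrix.smul_apply, Matrix.of_apply, Matrix.cons_val_zero,
      Matrix.cons_val_one, Matrix.cons_val_fin_one, mul_zero, add_zero, mul_one]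
    linear_combination e0 + h1 + r * X 1 * hq
  · simp only [Fin.mk_one, Matrix.mulVec, dotProduct, Fin.sum_univ_two, Pi.smul_apply,
      smul_eq_mul, Matrix.add_apply, Matrix.smul_apply, Matrix.of_apply, Matrix.cons_val_zero,
      Matrix.cons_val_one, Matrix.cons_val_fin_one, mul_zero, add_zero]
    linear_combination e1 + h2

theorem twist_cartier1_mulVec_smul (hm : p = 2 * m + 1) {U Q M Q0 : k[X]} {w x κ δ : k}
    (h : U * kapP P.l ^ p = P.Z hp * ((X ^ p - C (x ^ p)) * Q - Q0) + X ^ p * M) {θ : P.R 1}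
    (hθ : θ = P.res w * (P.t 1 - P.res x)) :
    ((P.cartier1 hp θ).twist m).G.mulVec (fun i => P.res (κ⁻¹ * δ ^ p) * P.line1 w U Q i) 0
        + (P.t 1 - 1) ^ m * (P.z 1 hp * P.Phi2 1 hp (P.omega1 1 * (- P.res (w * δ))))
          * (P.res κ⁻¹ * (Ring.inverse (P.t 1) ^ (p - 1) * P.ev Q0))
      = P.tau 1 * (P.res (κ⁻¹ * δ ^ p) * P.line2 m w M Q 0) ∧
    ((P.cartier1 hp θ).twist m).G.mulVec (fun i => P.res (κ⁻¹ * δ ^ p) * P.line1 w U Q i) 1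
      = P.tau 1 * (P.res (κ⁻¹ * δ ^ p) * P.line2 m w M Q 1) := by
  have hlin := twist_cartier1_mulVec_sub (hp := hp) hm h hθ
  have e0 := congrFun hlin 0
  have e1 := congrFun hlin 1
  simp only [Matrix.mulVec, dotProduct, Fin.sum_univ_two, Pi.smul_apply, smul_eq_mul,
    Pi.sub_apply, Matrix.cons_val_zero, Matrix.cons_val_one, Matrix.cons_val_fin_one,
    sub_zero] at e0 e1 ⊢
  have hPhi : P.Phi2 1 hp (P.omega1 1 * (- P.res (w * δ)))
      = - (P.Phi2 1 hp (P.omega1 1 * P.res w) * P.res (δ ^ p)) := by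
    rw [map_mul P.res, map_pow P.res, ← Phi2_one P hp (P.res δ), ← map_mul (P.Phi2 1 hp), mul_neg,
      map_neg, mul_assoc]
  rw [hPhi, map_mul P.res]
  constructor
  · linear_combination P.res κ⁻¹ * P.res (δ ^ p) * e0
  · linear_combination P.res κ⁻¹ * P.res (δ ^ p) * e1

theorem polar_line1_mul {U Q U' Q' : k[X]} {w x κ d δ : k} (hκ : κ ≠ 0) (hd : d ≠ 0) {θ : P.R 1}
    (hθ : θ = P.res w * (P.t 1 - P.res x)) {D N : k}
    (h : kapP P.l * (derivative U' * Q + derivative U * Q' - U' * derivative Q - U * derivative Q')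
        + C (P.l - 1) * (2 * (X ^ p - C (x ^ p)) * Q * Q' - Q ^ 2)
      = X ^ (p - 1) * (C D * X - C N)) :
    ((P.cartier1 hp θ).twist m).polar (fun i => P.res κ⁻¹ * P.line1 w U Q i)
        (fun i => P.res (κ⁻¹ * δ ^ p) * P.line1 w U' Q' i)
        + P.omega1 1 * P.Phi1 1 hp (- P.res (w * δ)) * (P.res κ⁻¹ * P.line1 w U Q 1) ^ 2
      = P.omega1 1 * (P.res d * Ring.inverse (P.t 1) ^ (p - 1)) *
        (P.res (w ^ p / ((P.l - 1) * κ ^ 2 * d) * δ ^ p) * (P.res D * P.t 1 - P.res N)) := by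
  have hl := polar_line1 (hp := hp) (m := m) hθ h
  have hs := ((P.cartier1 hp θ).twist m).polar_const_mul
    (WittVector.teichmuller p κ⁻¹) (WittVector.teichmuller p (κ⁻¹ * δ ^ p))
    (P.line1 w U Q) (P.line1 w U' Q')
  rw [← res_apply, ← res_apply] at hs
  have ho := omega1_mul P 1
  rw [← ev_kapP_eq, const_one, lam_sub_one_coeff] at ho
  have hl1 : P.l - 1 ≠ 0 := sub_ne_zero.2 P.ne_one
  have hu : IsUnit (P.ev (kapP P.l)) := by
    refine isUnit_of_mul_isUnit_right (x := P.omega1 1) ?_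
    rw [ho]
    exact hl1.isUnit.map P.res
  have hk : P.res (P.l - 1) * P.res d * P.res (w ^ p / ((P.l - 1) * κ ^ 2 * d) * δ ^ p)
      = P.res κ⁻¹ ^ 2 * P.res (δ ^ p) * P.res w ^ p := by
    simp only [← map_mul, ← map_pow]
    congr 1
    field_simp
  have hPhi : P.Phi1 1 hp (- P.res (w * δ)) = - (P.Phi1 1 hp (P.res w) * P.res (δ ^ p)) := by
    rw [map_mul P.res, map_pow P.res, ← Phi1_one P hp (P.res δ), ← map_mul (P.Phi1 1 hp), map_neg]
  apply hu.mul_right_cancel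
  rw [hs, hPhi, map_mul P.res κ⁻¹]
  linear_combination P.res κ⁻¹ ^ 2 * P.res (δ ^ p) * hl
    - P.res d * Ring.inverse (P.t 1) ^ (p - 1)
      * P.res (w ^ p / ((P.l - 1) * κ ^ 2 * d) * δ ^ p) * (P.res D * P.t 1 - P.res N) * ho
    - Ring.inverse (P.t 1) ^ (p - 1) * (P.res D * P.t 1 - P.res N) * hk

/-- The variation of the next Higgs field if the Higgs field changes by `p ^ n η`. The derivative of
the family of solutions with respect to `Y`, taken at `Y = x ^ p` and scaled by `δ ^ p`, is a first
order variation of the Hodge line subbundle, so that the Higgs field `D(Y) t - N(Y)` varies by the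
same multiple of `D'(Y) t - N'(Y)`. -/
theorem IsFamily.exists_compare (h : IsFamily hp P m U Q M D N) (hn : n ≠ 0) {V : FilData P n}
    {θ η : P.R (n + 1)} {w x δ : k} (hw : w ≠ 0)
    (hθ : P.redOne n θ = P.res w * (P.t 1 - P.res x)) (hη : P.redOne n η = - P.res (w * δ))
    {V0 V1 : FilData P (n + 1)} {a a' b b' e e' f f' : P.Mat (n + 1)}
    (h0 : ((inverseCartier hp V θ).twist m).Gauge V0.toConn a a' b b')
    (h1 : ((inverseCartier hp V (θ + (p : P.R (n + 1)) ^ n * η)).twist m).Gauge V1.toConn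
      e e' f f') :
    ∃ (μ : k) (u : WittVector p k), μ ≠ 0 ∧ IsUnit u ∧
      P.redOne n V0.theta
        = P.res μ * (P.res (D.eval (x ^ p)) * P.t 1 - P.res (N.eval (x ^ p))) ∧
      P.const (n + 1) u * V1.theta = V0.theta + (p : P.R (n + 1)) ^ n *
        (P.const (n + 1) (WittVector.teichmuller p (μ * δ ^ p)) *
          (P.const (n + 1) (WittVector.teichmuller p ((derivative D).eval (x ^ p))) * P.t (n + 1)
            - P.const (n + 1) (WittVector.teichmuller p ((derivative N).eval (x ^ p))))) := by
  set q : P.R (n + 1) := (p : P.R (n + 1)) ^ n with hqdef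
  have hqq : q * q = 0 := p_pow_mul_p_pow_eq_zero hn
  have hqD : P.D (n + 1) q = 0 := by
    have e1 : q = P.const (n + 1) ((p : WittVector p k) ^ n) := by rw [map_pow, map_natCast]
    rw [e1, D_const]
  have hqp : ∀ {x y : P.R (n + 1)}, P.redOne n x = P.redOne n y → q * x = q * y :=
    fun hxy => p_pow_mul_eq_of_redOne_eq hxy
  -- the Hodge line subbundle modulo `p`
  have h0p := h0.modP
  rw [Conn.twist_modP, inverseCartier_modP, FilData.modP_toConn] at h0p
  obtain ⟨κ, d, hκ, hd, hl1, hl2, hdet, hth⟩ :=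
    exists_const_of_gauge_cartier1 h.hm (h.eval_sol (x ^ p)) (h.prim _) hθ (h.eval_wron (x ^ p)) h0p
  have hr : P.res κ⁻¹ * P.res κ = 1 := by rw [← map_mul, inv_mul_cancel₀ hκ, map_one]
  have hl1' : ∀ i, P.redOne n (a i 1) = P.res κ⁻¹ * P.line1 w (evalCoeff (x ^ p) U)
      (evalCoeff (x ^ p) Q) i := fun i => by
    rw [hl1, ← mul_assoc, hr, one_mul]; rfl
  -- the first order variation of the line subbundle
  have hU' : ∀ i, P.res (κ⁻¹ * δ ^ p) * P.line1 w (evalCoeff (x ^ p) (derivCoeff U))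
      (evalCoeff (x ^ p) (derivCoeff Q)) i ∈ P.chart1 1 := fun i =>
    mul_mem (Subalgebra.algebraMap_mem _ _) (line1_mem _ _ _ i)
  have hM' : ∀ i, P.res (κ⁻¹ * δ ^ p) * P.line2 m w (evalCoeff (x ^ p) (derivCoeff M))
      (evalCoeff (x ^ p) (derivCoeff Q)) i ∈ P.chart2 1 := fun i =>
    mul_mem (Subalgebra.algebraMap_mem _ _) (line2_mem h.hm _
      ((natDegree_map_le.trans (natDegree_derivCoeff_le _)).trans h.sol.natDegree_Q)
      ((natDegree_map_le.trans (natDegree_derivCoeff_le _)).trans h.sol.natDegree_M) i)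
  choose X1 hX1 hX1r using fun i => exists_mem_chart1_redOne_eq n (hU' i)
  choose X2 hX2 hX2r using fun i => exists_mem_chart2_redOne_eq n (hM' i)
  have hqm : ∀ S : Subalgebra (WN p k (n + 1)) (P.R (n + 1)), q ∈ S := fun S =>
    pow_mem (natCast_mem S p) n
  obtain ⟨hG, hA⟩ := inverseCartier_add (hp := hp) V θ η
  have hq1 : P.redOne n q = 0 := by
    rw [hqdef, map_pow, map_natCast, natCast_p_eq_zero, zero_pow hn]
  have hcG : ∀ i j, P.redOne n (((inverseCartier hp V θ).twist m).G i j)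
      = ((P.cartier1 hp (P.redOne n θ)).twist m).G i j := fun i j => by
    rw [← inverseCartier_modP, ← Conn.twist_modP]
    rfl
  have hG' : ((inverseCartier hp V (θ + q * η)).twist m).G = ((inverseCartier hp V θ).twist m).G
      + (q * ((P.t (n + 1) - 1) ^ m * (P.z (n + 1) hp * P.Phi2 (n + 1) hp (P.omega1 (n + 1) * η))))
        • !![0, 1; 0, 0] := by
    have e1 : ∀ c : Conn P (n + 1), (c.twist m).G = (P.t (n + 1) - 1) ^ m • c.G := fun _ => rfl
    rw [e1, e1, hG, smul_add, smul_smul, mul_left_comm]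
  have hmul : ((inverseCartier hp V (θ + q * η)).twist m).G.mulVec (fun i => a i 1 + q * X1 i)
      = P.tau (n + 1) • (fun i => b i 1 + q * X2 i) := by
    obtain ⟨m0, m1⟩ := twist_cartier1_mulVec_smul (hp := hp) (κ := κ) (δ := δ) h.hm
      (h.deriv_sol (x ^ p)) hθ
    have hgl : ((inverseCartier hp V θ).twist m).G.mulVec (fun i => a i 1)
        = P.tau (n + 1) • fun i => b i 1 := by
      ext i
      have e1 := congrFun (congrFun h0.glue i) 1
      simp only [FilData.toConn, Matrix.mul_apply, Fin.sum_univ_two, Matrix.of_apply,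
        Matrix.cons_val_zero, Matrix.cons_val_one, Matrix.cons_val_fin_one, mul_zero, zero_add] at e1
      simp only [Matrix.mulVec, dotProduct, Fin.sum_univ_two, Pi.smul_apply, smul_eq_mul]
      rw [e1, mul_comm]
      rfl
    have hGX : ∀ i, P.redOne n (((inverseCartier hp V θ).twist m).G.mulVec X1 i)
        = ((P.cartier1 hp (P.redOne n θ)).twist m).G.mulVec
          (fun i => P.res (κ⁻¹ * δ ^ p) * P.line1 w (evalCoeff (x ^ p) (derivCoeff U))
            (evalCoeff (x ^ p) (derivCoeff Q)) i) i := fun i => by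
      simp only [Matrix.mulVec, dotProduct, Fin.sum_univ_two, map_add, map_mul, hcG, hX1r]
    rw [hG']
    refine mulVec_add_mul hqq hgl (hqp ?_) (hqp ?_)
    · have hr2 : P.redOne n
          ((P.t (n + 1) - 1) ^ m * (P.z (n + 1) hp * P.Phi2 (n + 1) hp (P.omega1 (n + 1) * η)))
          = (P.t 1 - 1) ^ m * (P.z 1 hp * P.Phi2 1 hp (P.omega1 1 * (- P.res (w * δ)))) := by
        rw [← hη, map_mul (P.redOne n), map_mul (P.redOne n), map_pow, map_sub, map_one, redOne_t,
          redOne_z, redOne_Phi2, map_mul (P.redOne n), redOne_omega1]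
      rw [map_add (P.redOne n), hGX, map_mul (P.redOne n), hr2, hl1',
        map_mul (P.redOne n), redOne_tau, hX2r]
      exact m0
    · rw [hGX, map_mul (P.redOne n), redOne_tau, hX2r]
      exact m1
  -- by uniqueness the varied section generates the Hodge line subbundle of `V1`
  obtain ⟨C, hC⟩ := h1.exists_const_mul
    (fun i => add_mem (h0.mem1 i 1) (mul_mem (hqm _) (hX1 i)))
    (fun i => add_mem (h0.mem2 i 1) (mul_mem (hqm _) (hX2 i))) hmul
  have hCu : IsUnit C := by
    apply WittVector.isUnit_of_coeff_zero_ne_zero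
    intro hC0
    have hz : ∀ i, P.redOne n (a i 1) = 0 := fun i => by
      have e1 := congrArg (P.redOne n) (hC i).1
      rwa [map_add, map_mul, hq1, zero_mul, add_zero, map_mul, redOne_const, const_one, hC0,
        map_zero, zero_mul] at e1
    have e2 : (a.map (P.redOne n)).det = 0 := by
      rw [Matrix.det_fin_two, Matrix.map_apply, Matrix.map_apply, Matrix.map_apply,
        Matrix.map_apply, hz, hz, mul_zero, zero_mul, sub_zero]
    rw [hdet] at e2
    exact (((hd.isUnit).map P.res).mul ((isUnit_t P 1).ringInverse.pow (p - 1))).ne_zero e2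
  obtain ⟨u, hu, hdu⟩ : ∃ u, IsUnit u ∧ e.det = P.const (n + 1) u * a.det := by
    refine exists_det_eq_const_mul ?_ h0 h1
    have e1 : q * ((inverseCartier hp V θ).twist m).G 1 0 = 0 := by
      rw [← mul_zero q]
      apply hqp
      rw [hcG, map_zero]
      change (P.t 1 - 1) ^ m * (P.cartier1 hp (P.redOne n θ)).G 1 0 = 0
      rw [cartier1_G]
      simp
    rw [hG', Matrix.det_fin_two, Matrix.det_fin_two]
    simp only [Matrix.add_apply, Matrix.smul_apply, Matrix.of_apply, Matrix.cons_val_zero,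
      Matrix.cons_val_one, Matrix.cons_val_fin_one, smul_eq_mul, mul_one, mul_zero, add_zero]
    linear_combination (-((P.t (n + 1) - 1) ^ m *
      (P.z (n + 1) hp * P.Phi2 (n + 1) hp (P.omega1 (n + 1) * η)))) * e1
  have hpol : q * (((inverseCartier hp V θ).twist m).polar (fun i => a i 1) X1
        + P.omega1 (n + 1) * P.Phi1 (n + 1) hp η * a 1 1 ^ 2)
      = q * (P.omega1 (n + 1) * a.det *
        (P.const (n + 1) (WittVector.teichmuller p (w ^ p / ((P.l - 1) * κ ^ 2 * d) * δ ^ p)) *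
          (P.const (n + 1) (WittVector.teichmuller p ((derivative D).eval (x ^ p))) * P.t (n + 1)
            - P.const (n + 1) (WittVector.teichmuller p ((derivative N).eval (x ^ p)))))) := by
    apply hqp
    have hda : P.redOne n a.det = P.res d * Ring.inverse (P.t 1) ^ (p - 1) := by
      rw [← hdet, Matrix.det_fin_two, Matrix.det_fin_two]
      simp
    have hpl := polar_line1_mul (hp := hp) (m := m) (δ := δ) hκ hd hθ (h.deriv_wron (x ^ p))
    rw [map_add (P.redOne n), redOne_polar, Conn.twist_modP, inverseCartier_modP, funext hl1',
      funext hX1r, map_mul (P.redOne n), map_mul (P.redOne n), map_pow (P.redOne n), redOne_omega1, redOne_Phi1, hη, hl1']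
    refine hpl.trans ?_
    simp only [map_mul, map_sub, redOne_omega1, redOne_const, redOne_t, hda, res_apply]
  have hwr := Conn.wronskian_add_mul (c := (inverseCartier hp V θ).twist m)
    (c' := (inverseCartier hp V (θ + q * η)).twist m) hqq hqD hA (fun i => a i 1) X1
  have hne : (P.l - 1) * κ ^ 2 * d ≠ 0 :=
    mul_ne_zero (mul_ne_zero (sub_ne_zero.2 P.ne_one) (pow_ne_zero _ hκ)) hd
  refine ⟨w ^ p / ((P.l - 1) * κ ^ 2 * d), C ^ 2 * u, div_ne_zero (pow_ne_zero p hw) hne,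
    (hCu.pow 2).mul hu, hth, ?_⟩
  rw [hpol, h0.wronskian_eq, funext fun i => (hC i).1, Conn.wronskian_const_mul, h1.wronskian_eq,
    hdu] at hwr
  have hau : IsUnit a.det := IsUnit.of_mul_eq_one _ (by rw [← Matrix.det_mul, h0.mul1, Matrix.det_one])
  apply ((isUnit_omega1 P (n + 1)).mul hau).mul_left_cancel
  rw [map_mul, map_pow]
  linear_combination hwr

end Compare

/-! ### Lifting the Hodge filtration -/

section Lifting

variable {p : ℕ} [Fact p.Prime] {k : Type u} [Field k] [CharP k p] {P : Puncture p k} {N : ℕ}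

/-- Invertible matrices over a chart can be lifted together with their inverses. -/
theorem exists_lift_of_mul_eq_one (hN : N ≠ 0) {S : Subalgebra (WN p k N) (P.R N)}
    {T : Subalgebra (WN p k (N + 1)) (P.R (N + 1))}
    (hST : ∀ x ∈ S, ∃ y ∈ T, P.red N y = x) {a a' : P.Mat N} (ha : ∀ i j, a i j ∈ S)
    (ha' : ∀ i j, a' i j ∈ S) (h : a * a' = 1) :
    ∃ b b' : P.Mat (N + 1), (∀ i j, b i j ∈ T) ∧ (∀ i j, b' i j ∈ T) ∧ b * b' = 1 ∧
      b.map (P.red N) = a := by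
  choose b hb hba using fun i j => hST _ (ha i j)
  choose e he hea using fun i j => hST _ (ha' i j)
  have hba' : (Matrix.of b).map (P.red N) = a := Matrix.ext hba
  have hea' : (Matrix.of e).map (P.red N) = a' := Matrix.ext hea
  have hb' : ∀ i j, (Matrix.of b) i j ∈ T := hb
  have he' : ∀ i j, (Matrix.of e) i j ∈ T := he
  have hu : P.red N ((Matrix.of b).det * (Matrix.of e).det - 1) = 0 := by
    rw [← Matrix.det_mul, map_sub, map_one, RingHom.map_det, RingHom.mapMatrix_apply,
      Matrix.map_mul, hba', hea', h, Matrix.det_one, sub_self]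
  obtain ⟨y, hy⟩ := exists_eq_p_pow_mul_of_red_eq_zero P N hu
  have hq := p_pow_mul_p_pow_eq_zero (P := P) hN
  obtain ⟨b', hb1, hb2⟩ := exists_inverse_of_det hb'
    (d := (Matrix.of e).det * (2 - (Matrix.of b).det * (Matrix.of e).det))
    (mul_mem (det_mem he') (sub_mem (ofNat_mem T 2) (mul_mem (det_mem hb') (det_mem he'))))
    (by linear_combination (-((Matrix.of b).det * (Matrix.of e).det - 1)
        - (p : P.R (N + 1)) ^ N * y) * hy - y ^ 2 * hq)
  exact ⟨_, b', hb', hb1, hb2, hba'⟩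

/-- A bundle with connection whose reduction has a Hodge filtration has a Hodge filtration itself:
the obstructions lie in `H¹(ℙ¹, 𝒪)` and `H¹(ℙ¹, 𝒪(-1))`, which vanish. -/
theorem Conn.Glues.exists_filData_of_red (hN : N ≠ 0) {c : Conn P (N + 1)} (hc : c.Glues)
    {V : FilData P N} {a a' b b' : P.Mat N} (h : c.red.Gauge V.toConn a a' b b') :
    ∃ (V' : FilData P (N + 1)) (e e' f f' : P.Mat (N + 1)), V'.toConn.Glues ∧
      c.Gauge V'.toConn e e' f f' := by
  obtain ⟨a1, a2, ha1, ha2, haa, hra⟩ := exists_lift_of_mul_eq_one hN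
    (fun x hx => exists_mem_chart1_red_eq P N hx) h.mem1 h.mem1' h.mul1
  obtain ⟨b1, b2, hb1, hb2, hbb, hrb⟩ := exists_lift_of_mul_eq_one hN
    (fun x hx => exists_mem_chart2_red_eq P N hx) h.mem2 h.mem2' h.mul2
  have hq := p_pow_mul_p_pow_eq_zero (P := P) hN
  set q := (p : P.R (N + 1)) ^ N
  set B := b2 * (c.G * a1) with hB
  have hbB : b1 * B = c.G * a1 := by rw [hB, ← mul_assoc, hbb, one_mul]
  have hrB : B.map (P.red N) = V.toConn.G := by
    have e1 : b2 * b1 = 1 := mul_eq_one_comm.1 hbb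
    have e2 : b2.map (P.red N) * b = 1 := by
      rw [← hrb, ← Matrix.map_mul, e1, Matrix.map_one _ (map_zero _) (map_one _)]
    rw [hB, Matrix.map_mul, Matrix.map_mul, hra]
    change b2.map (P.red N) * (c.red.G * a) = _
    rw [h.glue, ← mul_assoc, e2, one_mul]
  have hr : ∀ i j (y : P.R (N + 1)), P.red N y = V.toConn.G i j → ∃ z, B i j = y + q * z := by
    intro i j y hy
    obtain ⟨z, hz⟩ := exists_eq_p_pow_mul_of_red_eq_zero P N (x := B i j - y) (by
      rw [map_sub, hy, ← hrB, Matrix.map_apply, sub_self])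
    exact ⟨z, by linear_combination hz⟩
  obtain ⟨e00, h00⟩ := hr 0 0 1 (by simp [FilData.toConn])
  obtain ⟨e01, h01⟩ := hr 0 1 0 (by simp [FilData.toConn])
  obtain ⟨e11, h11⟩ := hr 1 1 (P.tau (N + 1)) (by rw [red_tau]; rfl)
  -- the deviation of the transition matrix from the form of `FilData.toConn` is a cocycle, which is
  -- the coboundary of upper triangular matrices `x` over `U₁` and `y` over `U₂`
  obtain ⟨x01, hx01, y01, hy01, hxy01⟩ := exists_eq_add_tau_mul P (N + 1) e01
  obtain ⟨x11, hx11, y11, hy11, hxy11⟩ := exists_eq_add P (N + 1)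
    (Ring.inverse (P.tau (N + 1)) * (e11 - B 1 0 * x01))
  obtain ⟨x00, hx00, y00, hy00, hxy00⟩ := exists_eq_add P (N + 1) (e00 - y01 * B 1 0)
  have hti := Ring.mul_inverse_cancel _ (isUnit_tau P (N + 1))
  have hqS : ∀ S : Subalgebra (WN p k (N + 1)) (P.R (N + 1)), q ∈ S := fun S =>
    pow_mem (natCast_mem S p) N
  have hmem : ∀ {S : Subalgebra (WN p k (N + 1)) (P.R (N + 1))} {x y z : P.R (N + 1)}, x ∈ S →
      y ∈ S → z ∈ S → ∀ i j, (!![1 + q * x, q * y; 0, 1 + q * z] : P.Mat (N + 1)) i j ∈ S := by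
    intro S x y z hx hy hz i j
    fin_cases i <;> fin_cases j
    · exact add_mem (one_mem _) (mul_mem (hqS S) hx)
    · exact mul_mem (hqS S) hy
    · exact zero_mem S
    · exact add_mem (one_mem _) (mul_mem (hqS S) hz)
  have hinv : ∀ x y z : P.R (N + 1), (!![1 + q * x, q * y; 0, 1 + q * z] : P.Mat (N + 1))
      * !![1 + q * (-x), q * (-y); 0, 1 + q * (-z)] = 1 := by
    intro x y z
    ext i j
    fin_cases i <;> fin_cases j <;> simp [Matrix.mul_apply, Fin.sum_univ_two]
    · linear_combination (-x ^ 2) * hq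
    · linear_combination (-x * y - y * z) * hq
    · linear_combination (-z ^ 2) * hq
  have hcomp : ∀ u u' v v' : P.Mat (N + 1), u * u' = 1 → v * v' = 1 →
      (u * v) * (v' * u') = 1 := fun u u' v v' h1 h2 => by
    rw [mul_assoc, ← mul_assoc v, h2, one_mul, h1]
  have hglue : B * !![1 + q * (-x00), q * (-x01); 0, 1 + q * (-x11)]
      = !![1 + q * y00, q * y01; 0, 1 + q * y11]
        * !![1, 0; B 1 0 - q * (B 1 0 * x00 + B 1 0 * y11), P.t (N + 1) * P.invT1 (N + 1)] := by
    have htau : P.t (N + 1) * P.invT1 (N + 1) = P.tau (N + 1) := rfl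
    rw [htau]
    ext i j
    fin_cases i <;> fin_cases j <;> simp [Matrix.mul_apply, Fin.sum_univ_two]
    · rw [h00]
      linear_combination q * hxy00 + (-e00 * x00 + y01 * (B 1 0 * x00 + B 1 0 * y11)) * hq
    · rw [h00, h01]
      linear_combination q * hxy01 + (-e00 * x01 - e01 * x11) * hq
    · linear_combination y11 * (B 1 0 * x00 + B 1 0 * y11) * hq
    · rw [h11]
      linear_combination q * P.tau (N + 1) * hxy11 - q * (e11 - B 1 0 * x01) * hti
        - e11 * x11 * hq
  obtain ⟨c', hc', h1, h2⟩ := hc.exists_gauge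
    (mul_apply_mem ha1 (hmem (neg_mem hx00) (neg_mem hx01) (neg_mem hx11)))
    (mul_apply_mem (hmem (neg_mem (neg_mem hx00)) (neg_mem (neg_mem hx01)) (neg_mem (neg_mem hx11)))
      ha2)
    (mul_apply_mem hb1 (hmem hy00 hy01 hy11))
    (mul_apply_mem (hmem (neg_mem hy00) (neg_mem hy01) (neg_mem hy11)) hb2)
    (hcomp _ _ _ _ haa (hinv _ _ _)) (hcomp _ _ _ _ hbb (hinv _ _ _))
    (by rw [← mul_assoc c.G, ← hbB, mul_assoc, hglue, ← mul_assoc])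
  have hV : (⟨B 1 0 - q * (B 1 0 * x00 + B 1 0 * y11), c'.A1, c'.A2⟩ : FilData P (N + 1)).toConn
      = c' := by
    rw [FilData.toConn, ← hc']
  exact ⟨_, _, _, _, _, by rw [hV]; exact h1, by rw [hV]; exact h2⟩

end Lifting

/-! ### The point at infinity -/

section Infinity

variable {p : ℕ} [Fact p.Prime] {k : Type u} [Field k] [CharP k p] [PerfectRing k p]
  {hp : Odd p} {P : Puncture p k} {m : ℕ}

/-- The point at infinity is fixed by the flow modulo `p`: where the Higgs field vanishes, the
residue of the connection is scalar. -/
theorem exists_theta_eq_res_of_gauge {u : k} {V : FilData P 1} (hV : V.toConn.Glues)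
    {a a' b b' : P.Mat 1}
    (h : ((P.cartier1 hp (P.res u)).twist m).Gauge V.toConn a a' b b') :
    ∃ v, V.theta = P.res v := by
  have i1 := t1_mul_invT1 P 1
  have il := tlam_mul_invTlam P 1
  have e2 : b' * b = 1 := mul_eq_one_comm.1 h.mul2
  -- `(t - 1) (A₂ + m)` is regular over `U₂`
  have hA : ∀ i j, ((P.t 1 - 1) • (((P.cartier1 hp (P.res u)).twist m).A2
      + (m : P.R 1) • (1 : P.Mat 1))) i j ∈ P.chart2 1 := by
    have hE : ((P.cartier1 hp (P.res u)).twist m).A2 = (P.cartier1 hp (P.res u)).A2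
      - ((m : P.R 1) * (P.t 1 * P.invT1 1)) • (1 : P.Mat 1) := rfl
    have hm : (m : P.R 1) ∈ P.chart2 1 := natCast_mem _ _
    have hd : (P.t 1 - 1) * (-((m : P.R 1) * (P.t 1 * P.invT1 1)) + m) ∈ P.chart2 1 := by
      have e : (P.t 1 - 1) * (-((m : P.R 1) * (P.t 1 * P.invT1 1)) + m) = - (m : P.R 1) := by
        linear_combination (-(m : P.R 1) * P.t 1) * i1
      rw [e]
      exact neg_mem hm
    rw [hE, cartier1_A2, Phi2_one]
    intro i j
    fin_cases i <;> fin_cases j <;> simp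
    · simpa using hd
    · have hpp : ∀ y : P.R 1, y ^ p = y ^ (p - 1) * y := fun y => by
        rw [← pow_succ, Nat.sub_add_cancel (Fact.out : p.Prime).one_le]
      have hx : P.const 1 (P.lam - 1) * P.invTlam 1 * P.res u ∈ P.chart2 1 :=
        mul_mem (mul_mem (const_mem_chart2 P 1 _) (invTlam_mem_chart2 P 1))
          (const_mem_chart2 P 1 _)
      have hy : (P.t 1 - 1) * (P.const 1 (P.lam - 1) * P.invTlam 1 * P.res u) ∈ P.chart2 1 := by
        have e : (P.t 1 - 1) * (P.const 1 (P.lam - 1) * P.invTlam 1 * P.res u)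
            = P.const 1 (P.lam - 1) * P.res u
              + P.const 1 (P.lam - 1) * (P.const 1 (P.lam - 1) * P.invTlam 1 * P.res u) := by
          rw [map_sub, map_one]
          linear_combination (P.const 1 P.lam - 1) * P.res u * il
        rw [e]
        exact add_mem (mul_mem (const_mem_chart2 P 1 _) (const_mem_chart2 P 1 _))
          (mul_mem (const_mem_chart2 P 1 _) hx)
      have hz := mul_mem (pow_mem hx (p - 1)) hy
      rw [mul_left_comm, ← hpp] at hz
      simpa using hz
    · simpa using hd
  have hcon : b * (V.A2 + (m : P.R 1) • (1 : P.Mat 1))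
      = (((P.cartier1 hp (P.res u)).twist m).A2 + (m : P.R 1) • (1 : P.Mat 1)) * b
        + P.t 1 • P.DM 1 b := by
    have e := congrArg (fun M => P.t 1 • M) h.conn2
    have ho : P.t 1 * P.omega2 1 = 1 := by rw [mul_comm]; exact omega2_mul P 1
    simp only [smul_add, smul_mul_assoc, mul_smul_comm, smul_smul, ho, one_smul] at e
    rw [mul_add, add_mul, mul_smul_comm, smul_mul_assoc, mul_one, one_mul]
    change b * V.toConn.A2 + _ = _
    rw [e]
    abel
  have hmem : (P.t 1 - 1) * V.A2 0 1 ∈ P.chart2 1 := by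
    have e : (P.t 1 - 1) • (V.A2 + (m : P.R 1) • (1 : P.Mat 1))
        = b' * (((P.t 1 - 1) • (((P.cartier1 hp (P.res u)).twist m).A2
          + (m : P.R 1) • (1 : P.Mat 1))) * b + (P.t 1 - 1) • (P.t 1 • P.DM 1 b)) := by
      rw [smul_mul_assoc, ← smul_add, ← hcon, mul_smul_comm, ← mul_assoc, e2, one_mul]
    have e1 := congrFun (congrFun e 0) 1
    simp only [Matrix.smul_apply, Matrix.add_apply, smul_eq_mul, Matrix.one_apply_ne zero_ne_one,
      mul_zero, add_zero] at e1
    rw [e1]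
    refine mul_apply_mem h.mem2' (fun i j => add_mem (mul_apply_mem hA h.mem2 i j) ?_) 0 1
    exact t_mul_D_mul_mem_chart2 P 1 (h.mem2 i j)
  have hθ : V.theta ∈ P.chart2 1 := by
    obtain ⟨d, hd⟩ := (one_sub_isUnit P).exists_left_inv
    have hd' := congrArg (P.const 1) hd
    rw [map_mul, map_one, map_sub, map_one] at hd'
    have e : V.theta = - P.const 1 d * (P.s 1 * ((P.t 1 - 1) * V.A2 0 1)) := by
      rw [theta_eq_of_glues hV, Puncture.s, map_sub, map_one]
      linear_combination (-P.const 1 d * (1 - P.const 1 P.lam) * V.theta) * i1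
        - V.theta * hd'
        - P.const 1 d * (1 - P.const 1 P.lam) * V.theta * ((P.t 1 - 1) * P.invT1 1) * il
    rw [e]
    exact mul_mem (neg_mem (const_mem_chart2 P 1 d)) (mul_mem (s_mem_chart2 P 1) hmem)
  obtain ⟨v, hv⟩ := exists_const_of_mem_charts P 1 (hV.mem1 0 1) hθ
  exact ⟨v.coeff 0, by rw [← const_one]; exact hv⟩

end Infinity

/-! ### Zeros of Higgs fields -/

section Zeros

variable {p : ℕ} [Fact p.Prime] {k : Type u} [Field k] [CharP k p] {P : Puncture p k} {N : ℕ}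

theorem const_mul_t_sub_inj {a b a' b' : WittVector p k}
    (h : P.const N a * P.t N - P.const N b = P.const N a' * P.t N - P.const N b') :
    (p : WittVector p k) ^ N ∣ a - a' ∧ (p : WittVector p k) ^ N ∣ b - b' := by
  have hX : algebraMap (WN p k N)[X] (P.R N) X = P.t N := rfl
  simp only [← algebraMap_C_mkW, ← hX, ← map_mul, ← map_sub] at h
  have h' := algebraMap_injective P N h
  have h0 := congrArg (fun f => f.coeff 0) h'
  have h1 := congrArg (fun f => f.coeff 1) h'
  simp only [coeff_sub, coeff_C_mul, coeff_X_zero, coeff_X_one, mul_zero, mul_one, coeff_C_zero,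
    zero_sub, neg_inj, coeff_C_succ, sub_zero] at h0 h1
  rw [Ideal.Quotient.eq, Ideal.mem_span_singleton] at h0 h1
  exact ⟨h1, h0⟩

theorem const_eq_const_iff {a b : WittVector p k} :
    P.const N a = P.const N b ↔ (p : WittVector p k) ^ N ∣ a - b := by
  rw [← sub_eq_zero, ← map_sub, const_eq_zero_iff]

theorem not_p_dvd_one : ¬ (p : WittVector p k) ∣ 1 := by
  rintro ⟨c, hc⟩
  have h := congrArg (WittVector.constantCoeff : WittVector p k →+* k) hc
  rw [map_one, map_mul, map_natCast, CharP.cast_eq_zero, zero_mul] at h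
  exact one_ne_zero h

theorem isZeroOf_one_iff {θ : P.R N} {x : WittVector p k} :
    IsZeroOf P N θ x 1 ↔ ∃ w, IsUnit w ∧ θ = P.const N w * (P.t N - P.const N x) := by
  constructor
  · rintro ⟨-, w, hw, h⟩
    exact ⟨w, hw, by rw [h, map_one, one_mul]⟩
  · rintro ⟨w, hw, h⟩
    exact ⟨fun h => not_p_dvd_one h.2, w, hw, by rw [h, map_one, one_mul]⟩

theorem IsZeroOf.of_dvd {θ : P.R N} {x y : WittVector p k} (h : IsZeroOf P N θ x 1)
    (hxy : (p : WittVector p k) ^ N ∣ x - y) : IsZeroOf P N θ y 1 := by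
  rw [isZeroOf_one_iff] at h ⊢
  obtain ⟨w, hw, h⟩ := h
  exact ⟨w, hw, by rw [h, const_eq_const_iff.2 hxy]⟩

theorem IsZeroOf.dvd_sub {θ : P.R N} {x y : WittVector p k} (h : IsZeroOf P N θ x 1)
    (h' : IsZeroOf P N θ y 1) : (p : WittVector p k) ^ N ∣ x - y := by
  rw [isZeroOf_one_iff] at h h'
  obtain ⟨w, hw, h⟩ := h
  obtain ⟨v, -, h'⟩ := h'
  obtain ⟨h1, h2⟩ := const_mul_t_sub_inj (P := P) (N := N) (a := w) (b := w * x) (a' := v)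
    (b' := v * y) (by rw [map_mul, map_mul]; linear_combination h' - h)
  rw [← hw.dvd_mul_left]
  have e : w * (x - y) = (w * x - v * y) - (w - v) * y := by ring
  rw [e]
  exact _root_.dvd_sub h2 (dvd_mul_of_dvd_left h1 y)

theorem IsZeroOf.mul {θ θ' : P.R N} {x : WittVector p k} (h : IsZeroOf P N θ x 1)
    {u v : WittVector p k} (hu : IsUnit u) (hv : IsUnit v)
    (e : P.const N u * θ' = θ * P.const N v) : IsZeroOf P N θ' x 1 := by
  rw [isZeroOf_one_iff] at h ⊢
  obtain ⟨w, hw, h⟩ := h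
  obtain ⟨u', hu'⟩ := hu.exists_left_inv
  have hu2 := congrArg (P.const N) hu'
  rw [map_mul, map_one] at hu2
  refine ⟨u' * (w * v), (IsUnit.of_mul_eq_one u hu').mul (hw.mul hv), ?_⟩
  rw [map_mul, map_mul]
  linear_combination P.const N u' * e - θ' * hu2 + P.const N u' * P.const N v * h

theorem IsZeroOf.red {θ : P.R (N + 1)} {x : WittVector p k} (h : IsZeroOf P (N + 1) θ x 1) :
    IsZeroOf P N (P.red N θ) x 1 := by
  rw [isZeroOf_one_iff] at h ⊢
  obtain ⟨w, hw, rfl⟩ := h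
  exact ⟨w, hw, by rw [map_mul, map_sub, red_const, red_const, red_t]⟩

theorem IsZeroOf.mem_chart1 {θ : P.R N} {x : WittVector p k} (h : IsZeroOf P N θ x 1) :
    θ ∈ P.chart1 N := by
  obtain ⟨w, -, rfl⟩ := isZeroOf_one_iff.1 h
  exact mul_mem (const_mem_chart1 P N w) (sub_mem (t_mem_chart1 P N) (const_mem_chart1 P N x))

theorem IsZeroOf.mem_chart2 {θ : P.R N} {x : WittVector p k} (h : IsZeroOf P N θ x 1) :
    P.invTlam N * θ ∈ P.chart2 N := by
  obtain ⟨w, -, rfl⟩ := isZeroOf_one_iff.1 h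
  have e : P.invTlam N * (P.const N w * (P.t N - P.const N x))
      = P.const N w * (P.t N * P.invTlam N - P.const N x * P.invTlam N) := by ring
  rw [e]
  exact mul_mem (const_mem_chart2 P N w) (sub_mem (t_mul_invTlam_mem_chart2 P N)
    (mul_mem (const_mem_chart2 P N x) (invTlam_mem_chart2 P N)))

/-- The Higgs field of a filtered bundle is a section of `𝒪(1)`. -/
theorem Conn.Glues.exists_theta_eq [PerfectRing k p] {V : FilData P N} (hV : V.toConn.Glues) :
    ∃ a b, V.theta = P.const N a * P.t N - P.const N b := by
  obtain ⟨d, hd⟩ := (one_sub_isUnit P).exists_left_inv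
  have hd' := congrArg (P.const N) hd
  rw [map_mul, map_one, map_sub, map_one] at hd'
  have e : P.invTlam N * V.theta = - P.const N d * V.A2 0 1 := by
    rw [theta_eq_of_glues hV, map_sub, map_one]
    linear_combination (-P.invTlam N * V.theta) * hd'
  refine exists_linear_of_mem_charts P N (hV.mem1 0 1) (y := P.invTlam N * V.theta) ?_ ?_
  · rw [e]
    exact mul_mem (neg_mem (const_mem_chart2 P N d)) (hV.mem2 0 1)
  · have il := tlam_mul_invTlam P N
    change V.theta = _
    linear_combination (-V.theta) * il

theorem coeff_zero_eq_of_dvd {x y : WittVector p k} (h : (p : WittVector p k) ∣ x - y) :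
    x.coeff 0 = y.coeff 0 := by
  obtain ⟨c, hc⟩ := h
  have e := congrArg (WittVector.constantCoeff : WittVector p k →+* k) hc
  rw [map_sub, map_mul, map_natCast, CharP.cast_eq_zero, zero_mul, sub_eq_zero] at e
  exact e

theorem p_pow_dvd_p_pow_mul_sub [PerfectRing k p] {x y : WittVector p k}
    (h : x.coeff 0 = y.coeff 0) (n : ℕ) :
    (p : WittVector p k) ^ (n + 1) ∣ (p : WittVector p k) ^ n * (x - y) := by
  obtain ⟨c, hc⟩ := exists_eq_add_p_mul h
  exact ⟨c, by rw [hc, pow_succ]; ring⟩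

/-- The zero of the Higgs field of a lift lifts the zero of the Higgs field. -/
theorem Conn.Glues.exists_isZeroOf [PerfectRing k p] {V : FilData P (N + 2)}
    (hV : V.toConn.Glues) {x : WittVector p k} (h : IsZeroOf P (N + 1) V.red.theta x 1) :
    ∃ y, IsZeroOf P (N + 2) V.theta (x + (p : WittVector p k) ^ (N + 1) * y) 1 := by
  obtain ⟨a, b, hab⟩ := hV.exists_theta_eq
  have e : V.red.theta = P.red (N + 1) V.theta := rfl
  obtain ⟨w, hw, hwx⟩ := isZeroOf_one_iff.1 h
  rw [e, hab, map_sub, map_mul, red_const, red_const, red_t] at hwx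
  obtain ⟨⟨d, hd⟩, ⟨f, hf⟩⟩ := const_mul_t_sub_inj (P := P) (N := N + 1) (a := a) (b := b) (a' := w)
    (b' := w * x) (by rw [hwx, map_mul]; ring)
  have ha : IsUnit a := by
    apply WittVector.isUnit_of_coeff_zero_ne_zero
    rw [coeff_zero_eq_of_dvd (y := w) ⟨(p : WittVector p k) ^ N * d, by rw [hd, pow_succ']; ring⟩]
    exact (hw.map (WittVector.constantCoeff : WittVector p k →+* k)).ne_zero
  obtain ⟨a', ha'⟩ := ha.exists_left_inv
  refine ⟨a' * (f - d * x), isZeroOf_one_iff.2 ⟨a, ha, ?_⟩⟩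
  rw [hab, mul_sub, ← map_mul, sub_right_inj]
  congr 1
  linear_combination hf - hd * x - (p : WittVector p k) ^ (N + 1) * (f - d * x) * ha'

end Zeros

/-! ### One step of the flow on lifts -/

section Step

variable {p : ℕ} [Fact p.Prime] {k : Type u} [Field k] [CharP k p] {P : Puncture p k}

/-- Isomorphism of bundles with connection. -/
def Conn.Isomorphic {N : ℕ} (c c' : Conn P N) : Prop := ∃ a a' b b', c.Gauge c' a a' b b'

theorem Conn.Isomorphic.symm {N : ℕ} {c c' : Conn P N} (h : c.Isomorphic c') : c'.Isomorphic c := by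
  obtain ⟨_, _, _, _, h⟩ := h
  exact ⟨_, _, _, _, h.symm⟩

theorem Conn.Isomorphic.trans {N : ℕ} {c c' c'' : Conn P N} (h : c.Isomorphic c')
    (h' : c'.Isomorphic c'') : c.Isomorphic c'' := by
  obtain ⟨_, _, _, _, h⟩ := h
  obtain ⟨_, _, _, _, h'⟩ := h'
  exact ⟨_, _, _, _, h.trans h'⟩

theorem Conn.Isomorphic.refl {N : ℕ} (c : Conn P N) : c.Isomorphic c := ⟨_, _, _, _, .refl c⟩

theorem Conn.Isomorphic.red {N : ℕ} {c c' : Conn P (N + 1)} (h : c.Isomorphic c') :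
    c.red.Isomorphic c'.red := by
  obtain ⟨_, _, _, _, h⟩ := h
  exact ⟨_, _, _, _, h.red⟩

theorem Conn.Isomorphic.twist {N : ℕ} {c c' : Conn P N} (h : c.Isomorphic c') (m : ℕ) :
    (c.twist m).Isomorphic (c'.twist m) := by
  obtain ⟨_, _, _, _, h⟩ := h
  exact ⟨_, _, _, _, h.twist m⟩

theorem FilDR.Iso.isomorphic {N : ℕ} {V V' : FilDR P N} (h : V.Iso V') :
    V.toConn.Isomorphic V'.toConn := by
  obtain ⟨_, _, h, -⟩ := h
  exact ⟨_, _, _, _, h.gauge⟩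

theorem FilData.red_toConn {N : ℕ} (V : FilData P (N + 1)) : V.red.toConn = V.toConn.red := by
  have e : V.red.toConn.G = V.toConn.G.map (P.red N) := by
    ext i j
    fin_cases i <;> fin_cases j <;> simp [FilData.toConn, FilData.red]
    exact (map_mul _ _ _).symm.trans (red_tau P N) |>.symm
  rw [Conn.red, ← e]
  rfl

variable [PerfectRing k p] {n : ℕ}

theorem IsZeroOf.of_isomorphic {V V' : FilData P (n + 1)} (h : V.toConn.Isomorphic V'.toConn)
    {x : WittVector p k} (hx : IsZeroOf P (n + 1) V.theta x 1) :
    IsZeroOf P (n + 1) V'.theta x 1 := by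
  obtain ⟨_, _, _, _, h⟩ := h
  obtain ⟨-, -, c0, c1, u0, u1, -, -, -, -, e⟩ := h.exists_const
  exact hx.mul u0 u1 e

variable {hp : Odd p}

theorem isFlowStep_iff {V : FilData P n} {θ : P.R (n + 1)} {V' : FilDR P (n + 1)} :
    IsFlowStep hp V θ V' ↔ ((inverseCartier hp V θ).twist ((p - 1) / 2)).Isomorphic V'.toConn := by
  constructor
  · rintro ⟨_, _, h⟩
    exact ⟨_, _, _, _, h.gauge⟩
  · rintro ⟨_, _, _, _, h⟩
    obtain ⟨g1, g2, h, -⟩ := h.exists_isIso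
    exact ⟨g1, g2, h⟩

/-- The inverse Cartier transform depends only on the filtered bundle and the zero of the Higgs
field. -/
theorem inverseCartier_isomorphic {V V' : FilData P (n + 1)} (hV : V.toConn.Glues)
    (hV' : V'.toConn.Glues) (h : V.toConn.Isomorphic V'.toConn) {θ θ' : P.R (n + 2)}
    (hθ : P.red (n + 1) θ = V.theta) (hθ' : P.red (n + 1) θ' = V'.theta) {x : WittVector p k}
    (hx : IsZeroOf P (n + 2) θ x 1) (hx' : IsZeroOf P (n + 2) θ' x 1) :
    (inverseCartier hp V θ).Isomorphic (inverseCartier hp V' θ') := by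
  obtain ⟨_, _, _, _, h⟩ := h
  obtain ⟨h1, h2, c0, c1, u0, u1, h100, h111, h200, h211, e⟩ := h.exists_const
  obtain ⟨w, hw, rfl⟩ := isZeroOf_one_iff.1 hx
  obtain ⟨w', hw', rfl⟩ := isZeroOf_one_iff.1 hx'
  obtain ⟨v, hv⟩ := hw.exists_left_inv
  rw [← hθ, ← hθ'] at e
  simp only [map_mul, map_sub, red_const, red_t] at e
  have hcc : P.const (n + 1) (c0 * w') = P.const (n + 1) (w * c1) := by
    rw [const_eq_const_iff]
    refine (const_mul_t_sub_inj (P := P) (N := n + 1) (b := c0 * w' * x) (b' := w * c1 * x) ?_).1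
    simp only [map_mul]
    linear_combination e
  have hc1 : P.const (n + 1) (v * (c0 * w')) = P.const (n + 1) c1 := by
    rw [map_mul, hcc, ← map_mul, ← mul_assoc, hv, one_mul]
  have hvu : IsUnit v := IsUnit.of_mul_eq_one w hv
  refine inverseCartier_gauge hp hV hV' hθ hθ' h h1 h2 u0 (hvu.mul (u0.mul hw')) h100
    (by rw [h111, hc1]) h200 (by rw [h211, hc1]) ?_
  have hv2 := congrArg (P.const (n + 2)) hv
  rw [map_mul, map_one] at hv2
  simp only [map_mul]
  linear_combination (-P.const (n + 2) c0 * P.const (n + 2) w'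
    * (P.t (n + 2) - P.const (n + 2) x)) * hv2

/-- The flow over `W_{n+2}` lifts the flow over `W_{n+1}`. -/
theorem exists_filData_of_flowStep {V : FilData P (n + 1)} (hV : V.toConn.Glues)
    {V' : FilDR P (n + 1)} (hs : IsFlowStep hp V.red V.theta V') {θ : P.R (n + 2)}
    (hθ : P.red (n + 1) θ = V.theta) {x : WittVector p k} (hx : IsZeroOf P (n + 2) θ x 1) :
    ((inverseCartier hp V θ).twist ((p - 1) / 2)).red.Isomorphic V'.toConn ∧
    ∃ U : FilData P (n + 2), U.toConn.Glues ∧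
      ((inverseCartier hp V θ).twist ((p - 1) / 2)).Isomorphic U.toConn := by
  have h1 : ((inverseCartier hp V θ).twist ((p - 1) / 2)).red.Isomorphic V'.toConn := by
    rw [Conn.twist_red, inverseCartier_red, hθ]
    exact isFlowStep_iff.1 hs
  refine ⟨h1, ?_⟩
  obtain ⟨_, _, _, _, h⟩ := h1
  have hg : (inverseCartier hp V θ).Glues := inverseCartier_glues hp hV hθ hx.mem_chart1 hx.mem_chart2
  obtain ⟨U, _, _, _, _, hU, hc⟩ := (hg.twist ((p - 1) / 2)).exists_filData_of_red n.succ_ne_zero h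
  exact ⟨U, hU, _, _, _, _, hc⟩

/-- The first order variation of a section of `𝒪(1)` moves its zero by the derivative of `N / D`. -/
theorem isZeroOf_of_variation {θ0 θ : P.R (n + 2)} {b0 u : WittVector p k} (hu : IsUnit u)
    (h0 : IsZeroOf P (n + 2) θ0 b0 1) {μ D N D' N' ε : k} (hμ : μ ≠ 0)
    (hr : P.redOne (n + 1) θ0 = P.res μ * (P.res D * P.t 1 - P.res N))
    (h : P.const (n + 2) u * θ = θ0 + (p : P.R (n + 2)) ^ (n + 1) *
      (P.const (n + 2) (WittVector.teichmuller p (μ * ε)) *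
        (P.const (n + 2) (WittVector.teichmuller p D') * P.t (n + 2)
          - P.const (n + 2) (WittVector.teichmuller p N')))) :
    D ≠ 0 ∧ b0.coeff 0 = N / D ∧ IsZeroOf P (n + 2) θ (b0 + (p : WittVector p k) ^ (n + 1) *
      WittVector.teichmuller p ((N' * D - N * D') / D ^ 2 * ε)) 1 := by
  obtain ⟨w, hw, rfl⟩ := isZeroOf_one_iff.1 h0
  have hcc : ∀ x : WittVector p k, (WittVector.constantCoeff : WittVector p k →+* k) x = x.coeff 0 :=
    fun x => rfl
  rw [map_mul (P.redOne (n + 1)), map_sub (P.redOne (n + 1)), redOne_const, redOne_const, redOne_t,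
    res_apply, res_apply, res_apply] at hr
  obtain ⟨e1, e2⟩ := const_mul_t_sub_inj (P := P) (N := 1) (a := w) (b := w * b0)
    (a' := WittVector.teichmuller p μ * WittVector.teichmuller p D)
    (b' := WittVector.teichmuller p μ * WittVector.teichmuller p N)
    (by simp only [map_mul]; linear_combination hr)
  rw [pow_one] at e1 e2
  have f1 := coeff_zero_eq_of_dvd e1
  have f2 := coeff_zero_eq_of_dvd e2
  rw [← hcc, ← hcc, map_mul, hcc, hcc, hcc, WittVector.teichmuller_coeff_zero,
    WittVector.teichmuller_coeff_zero] at f1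
  rw [← hcc, ← hcc, map_mul, map_mul, hcc, hcc, hcc, hcc, WittVector.teichmuller_coeff_zero,
    WittVector.teichmuller_coeff_zero] at f2
  have hw0 : w.coeff 0 ≠ 0 :=
    (hw.map (WittVector.constantCoeff : WittVector p k →+* k)).ne_zero
  have hD : D ≠ 0 := by
    rintro rfl
    exact hw0 (by rw [f1, mul_zero])
  have hb : b0.coeff 0 = N / D := by
    rw [eq_div_iff hD]
    apply mul_left_cancel₀ hμ
    linear_combination f2 - b0.coeff 0 * f1
  refine ⟨hD, hb, ?_⟩
  have hA := WittVector.teichmuller_coeff_zero p (μ * ε)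
  have hB := WittVector.teichmuller_coeff_zero p D'
  have hC := WittVector.teichmuller_coeff_zero p N'
  have hE := WittVector.teichmuller_coeff_zero p ((N' * D - N * D') / D ^ 2 * ε)
  generalize WittVector.teichmuller p (μ * ε) = A at h hA ⊢
  generalize WittVector.teichmuller p D' = B at h hB ⊢
  generalize WittVector.teichmuller p N' = C at h hC ⊢
  generalize WittVector.teichmuller p ((N' * D - N * D') / D ^ 2 * ε) = E at hE ⊢
  have hw1u : IsUnit (w + (p : WittVector p k) ^ (n + 1) * (A * B)) := by
    apply WittVector.isUnit_of_coeff_zero_ne_zero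
    rw [coeff_zero_eq_of_dvd (y := w) ⟨(p : WittVector p k) ^ n * (A * B), by ring⟩]
    exact hw0
  have key : P.const (n + 2) ((w + (p : WittVector p k) ^ (n + 1) * (A * B))
        * (b0 + (p : WittVector p k) ^ (n + 1) * E))
      = P.const (n + 2) (w * b0 + (p : WittVector p k) ^ (n + 1) * (A * C)) := by
    rw [const_eq_const_iff]
    have hdvd := p_pow_dvd_p_pow_mul_sub (p := p)
      (x := A * B * (b0 + (p : WittVector p k) ^ (n + 1) * E) + w * E) (y := A * C) (by
        rw [← hcc, ← hcc]
        simp only [map_add, map_mul, map_pow, map_natCast, CharP.cast_eq_zero]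
        rw [zero_pow n.succ_ne_zero]
        simp only [hcc, hA, hB, hC, hE, hb, f1]
        field_simp
        ring) (n + 1)
    convert hdvd using 1
    ring
  obtain ⟨v, hv⟩ := hu.exists_left_inv
  have hv2 := congrArg (P.const (n + 2)) hv
  rw [map_mul, map_one] at hv2
  refine isZeroOf_one_iff.2 ⟨v * (w + (p : WittVector p k) ^ (n + 1) * (A * B)),
    (IsUnit.of_mul_eq_one u hv).mul hw1u, ?_⟩
  rw [map_mul, mul_sub, mul_assoc (P.const (n + 2) v) _ (P.const (n + 2) (b0 + _)), ← map_mul _ _ (b0 + _),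
    key]
  simp only [map_add, map_mul, map_pow, map_natCast]
  linear_combination (-θ) * hv2 + P.const (n + 2) v * h

/-- One step of the flow on lifts: in the coordinates of the torsors of lifts it is
`δ ↦ (N / D)' (a ^ p) δ ^ p + γ`. -/
theorem IsFamily.exists_step {m : ℕ} {U Q M : k[X][X]} {D N : k[X]}
    (h : IsFamily hp P m U Q M D N) {V V' : FilDR P (n + 1)} (hs : FlowStep hp V V')
    {a b : WittVector p k} (ha : IsZeroOf P (n + 1) V.theta a 1)
    (hb : IsZeroOf P (n + 1) V'.theta b 1) :
    D.eval (a.coeff 0 ^ p) ≠ 0 ∧ b.coeff 0 = N.eval (a.coeff 0 ^ p) / D.eval (a.coeff 0 ^ p) ∧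
    ∃ γ : k, ∀ (V1 : FilDR P (n + 1)) (θ : P.R (n + 2)) (δ : k),
      V1.toConn.Isomorphic V.toConn → P.red (n + 1) θ = V1.theta →
      IsZeroOf P (n + 2) θ (a + (p : WittVector p k) ^ (n + 1) * WittVector.teichmuller p δ) 1 →
      (∃ U, IsFlowStep hp V1.toFilData θ U) ∧
      ∀ U, IsFlowStep hp V1.toFilData θ U → U.toConn.red.Isomorphic V'.toConn ∧
        IsZeroOf P (n + 2) U.theta (b + (p : WittVector p k) ^ (n + 1) * WittVector.teichmuller p
          (((derivative N).eval (a.coeff 0 ^ p) * D.eval (a.coeff 0 ^ p)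
            - N.eval (a.coeff 0 ^ p) * (derivative D).eval (a.coeff 0 ^ p))
            / D.eval (a.coeff 0 ^ p) ^ 2 * δ ^ p + γ)) 1 := by
  have hm2 : (p - 1) / 2 = m := by have := h.hm; omega
  obtain ⟨w, hw, hθV⟩ := isZeroOf_one_iff.1 ha
  have hw0 : w.coeff 0 ≠ 0 :=
    (hw.map (WittVector.constantCoeff : WittVector p k →+* k)).ne_zero
  set q := (p : WittVector p k) ^ (n + 1) with hq
  set θ0 : P.R (n + 2) := P.const (n + 2) w * (P.t (n + 2) - P.const (n + 2) a) with hθ0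
  set η : k → P.R (n + 2) := fun δ => - P.const (n + 2) (w * WittVector.teichmuller p δ) with hη
  have hz : ∀ δ, IsZeroOf P (n + 2) (θ0 + (p : P.R (n + 2)) ^ (n + 1) * η δ)
      (a + q * WittVector.teichmuller p δ) 1 := fun δ => by
    refine isZeroOf_one_iff.2 ⟨w, hw, ?_⟩
    simp only [hθ0, hη, hq, map_add, map_mul, map_pow, map_natCast]
    ring
  have hz0 : IsZeroOf P (n + 2) θ0 a 1 := isZeroOf_one_iff.2 ⟨w, hw, rfl⟩
  have hpr : P.red (n + 1) ((p : P.R (n + 2)) ^ (n + 1)) = 0 := by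
    rw [map_pow, map_natCast, natCast_p_nilpotent]
  have hr0 : P.red (n + 1) θ0 = V.theta := by
    rw [hθ0, map_mul, map_sub, red_const, red_const, red_t, hθV]
  have hr : ∀ δ, P.red (n + 1) (θ0 + (p : P.R (n + 2)) ^ (n + 1) * η δ) = V.theta := fun δ => by
    rw [map_add (P.red (n + 1)), hr0, map_mul (P.red (n + 1)), hpr, zero_mul, add_zero]
  have hθp : P.redOne (n + 1) θ0 = P.res (w.coeff 0) * (P.t 1 - P.res (a.coeff 0)) := by
    rw [hθ0, map_mul, map_sub, redOne_const, redOne_const, redOne_t, const_one, const_one]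
  have hηp : ∀ δ, P.redOne (n + 1) (η δ) = - P.res (w.coeff 0 * δ) := fun δ => by
    rw [hη, map_neg, redOne_const, map_mul, const_one, const_one,
      WittVector.teichmuller_coeff_zero, map_mul]
  obtain ⟨hi0, U0, hU0, g0⟩ := exists_filData_of_flowStep V.glues hs hr0 hz0
  have hz1 : IsZeroOf P (n + 1) U0.red.theta b 1 := by
    refine hb.of_isomorphic ?_
    rw [FilData.red_toConn]
    exact hi0.symm.trans g0.red
  obtain ⟨y, hy⟩ := hU0.exists_isZeroOf hz1
  have hcomp : ∀ (δ : k) (U1 : FilData P (n + 2)), ((inverseCartier hp V.toFilData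
      (θ0 + (p : P.R (n + 2)) ^ (n + 1) * η δ)).twist ((p - 1) / 2)).Isomorphic U1.toConn →
      D.eval (a.coeff 0 ^ p) ≠ 0 ∧
      (b + q * y).coeff 0 = N.eval (a.coeff 0 ^ p) / D.eval (a.coeff 0 ^ p) ∧
      IsZeroOf P (n + 2) U1.theta (b + q * y + q * WittVector.teichmuller p
          (((derivative N).eval (a.coeff 0 ^ p) * D.eval (a.coeff 0 ^ p)
            - N.eval (a.coeff 0 ^ p) * (derivative D).eval (a.coeff 0 ^ p))
            / D.eval (a.coeff 0 ^ p) ^ 2 * δ ^ p)) 1 := by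
    intro δ U1 g1
    obtain ⟨_, _, _, _, g0'⟩ := g0
    obtain ⟨_, _, _, _, g1'⟩ := g1
    rw [hm2] at g0' g1'
    obtain ⟨μ, u, hμ, hu, e1, e2⟩ :=
      h.exists_compare n.succ_ne_zero hw0 hθp (hηp δ) g0' g1'
    exact isZeroOf_of_variation hu hy hμ e1 e2
  have hby : (b + q * y).coeff 0 = b.coeff 0 :=
    coeff_zero_eq_of_dvd ⟨(p : WittVector p k) ^ n * y, by rw [hq]; ring⟩
  obtain ⟨-, U1, -, g1⟩ := exists_filData_of_flowStep V.glues hs (hr 0) (hz 0)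
  obtain ⟨hD, hbN, -⟩ := hcomp 0 U1 g1
  refine ⟨hD, hby.symm.trans hbN, y.coeff 0, fun V1 θ δ hiso hθ hzθ => ?_⟩
  have gi := inverseCartier_isomorphic (hp := hp) V1.glues V.glues hiso hθ (hr δ) hzθ (hz δ)
  have gt := gi.twist ((p - 1) / 2)
  have hfin : ∀ U1 : FilData P (n + 2), ((inverseCartier hp V.toFilData
      (θ0 + (p : P.R (n + 2)) ^ (n + 1) * η δ)).twist ((p - 1) / 2)).Isomorphic U1.toConn →
      IsZeroOf P (n + 2) U1.theta (b + q * WittVector.teichmuller p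
          (((derivative N).eval (a.coeff 0 ^ p) * D.eval (a.coeff 0 ^ p)
            - N.eval (a.coeff 0 ^ p) * (derivative D).eval (a.coeff 0 ^ p))
            / D.eval (a.coeff 0 ^ p) ^ 2 * δ ^ p + y.coeff 0)) 1 := by
    intro U1 g
    refine (hcomp δ U1 g).2.2.of_dvd ?_
    generalize ((derivative N).eval (a.coeff 0 ^ p) * D.eval (a.coeff 0 ^ p)
            - N.eval (a.coeff 0 ^ p) * (derivative D).eval (a.coeff 0 ^ p))
            / D.eval (a.coeff 0 ^ p) ^ 2 * δ ^ p = ε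
    have hcc : ∀ x : WittVector p k,
        (WittVector.constantCoeff : WittVector p k →+* k) x = x.coeff 0 := fun x => rfl
    have hdvd := p_pow_dvd_p_pow_mul_sub (p := p) (x := y + WittVector.teichmuller p ε)
      (y := WittVector.teichmuller p (ε + y.coeff 0)) (by
        rw [← hcc (y + _), map_add, hcc, hcc, WittVector.teichmuller_coeff_zero,
          WittVector.teichmuller_coeff_zero, add_comm]) (n + 1)
    convert hdvd using 1
    rw [hq]
    ring
  constructor
  · obtain ⟨-, U2, hU2, g2⟩ := exists_filData_of_flowStep V.glues hs (hr δ) (hz δ)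
    exact ⟨U2.toFilDR hU2 ⟨_, _, hfin U2 g2⟩, isFlowStep_iff.2 (gt.trans g2)⟩
  · intro U2 hU2
    have g2 := isFlowStep_iff.1 hU2
    obtain ⟨hi, -⟩ := exists_filData_of_flowStep V.glues hs (hr δ) (hz δ)
    exact ⟨(g2.symm.trans gt).red.trans hi, hfin _ (gt.symm.trans g2)⟩

end Step

/-! ### The iterated flow on lifts -/

section Chain

variable {p : ℕ} [Fact p.Prime] {k : Type u} [Field k] [CharP k p] {P : Puncture p k} {n : ℕ}

theorem Conn.Glues.red {N : ℕ} {c : Conn P (N + 1)} (h : c.Glues) : c.red.Glues where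
  mem1 i j := red_mem_chart1 P N (h.mem1 i j)
  mem2 i j := red_mem_chart2 P N (h.mem2 i j)
  glue := by
    have e := congrArg (fun M => M.map (P.red N)) h.glue
    simp only [map_red_mul, map_add_red, map_smul_red, DM_map_red, red_omega1, red_omega2] at e
    exact e

theorem Conn.Glues.modP {c : Conn P (n + 1)} (h : c.Glues) : c.modP.Glues := by
  induction n with
  | zero => rw [Conn.modP_zero]; exact h
  | succ n ih => rw [Conn.modP_succ]; exact ih h.red

/-- Iterates of the maps `x ↦ g i * x ^ p + γ i`. -/
def affineIter (p : ℕ) (g γ : ℕ → k) (x : k) : ℕ → k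
  | 0 => x
  | j + 1 => g j * affineIter p g γ x j ^ p + γ j

/-- Iterates of the single steps, in closed form. -/
theorem exists_affineIter_eq (g γ : ℕ → k) (j : ℕ) : ∃ Γ, ∀ x, affineIter p g γ x j
    = (∏ i ∈ Finset.range j, g i ^ p ^ (j - 1 - i)) * x ^ p ^ j + Γ := by
  induction j with
  | zero => exact ⟨0, fun x => by simp [affineIter]⟩
  | succ j ih =>
    obtain ⟨Γ, hΓ⟩ := ih
    refine ⟨g j * Γ ^ p + γ j, fun x => ?_⟩
    have e : ∏ i ∈ Finset.range j, g i ^ p ^ (j - i)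
        = (∏ i ∈ Finset.range j, g i ^ p ^ (j - 1 - i)) ^ p := by
      rw [← Finset.prod_pow]
      refine Finset.prod_congr rfl fun i hi => ?_
      rw [← pow_mul, ← pow_succ]
      congr 2
      have := Finset.mem_range.1 hi
      omega
    rw [affineIter, hΓ, add_pow_char, mul_pow, ← pow_mul, ← pow_succ, Finset.prod_range_succ,
      Nat.add_sub_cancel, e, Nat.sub_self, pow_zero, pow_one]
    ring

/-- Reduction of a filtered de Rham bundle whose Higgs field has a finite zero. -/
def FilDR.redOf {N : ℕ} (U : FilDR P (N + 1)) {x : WittVector p k}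
    (hx : IsZeroOf P (N + 1) U.theta x 1) : FilDR P N :=
  U.toFilData.red.toFilDR (by rw [FilData.red_toConn]; exact U.glues.red) ⟨x, 1, hx.red⟩

theorem FilDR.redOf_isomorphic {N : ℕ} (U : FilDR P (N + 1)) {x : WittVector p k}
    (hx : IsZeroOf P (N + 1) U.theta x 1) {c : Conn P N} (h : U.toConn.red.Isomorphic c) :
    (U.redOf hx).toConn.Isomorphic c :=
  (FilData.red_toConn U.toFilData).symm ▸ h

/-- A sequence of related elements with prescribed first term, along which a property is kept. -/
theorem exists_chain {α : Type*} {r : α → α → Prop} {L : ℕ → α → Prop} {f : ℕ}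
    (h : ∀ i < f, ∀ u, L i u → (∃ u', r u u') ∧ ∀ u', r u u' → L (i + 1) u') {u0 : α}
    (h0 : L 0 u0) : ∃ U : ℕ → α, U 0 = u0 ∧ L f (U f) ∧ ∀ i < f, r (U i) (U (i + 1)) := by
  induction f with
  | zero => exact ⟨fun _ => u0, rfl, h0, fun i hi => absurd hi i.not_lt_zero⟩
  | succ f ih =>
    obtain ⟨U, e, hL, hr⟩ := ih fun i hi => h i (by omega)
    obtain ⟨⟨u', hu'⟩, hall⟩ := h f (by omega) _ hL
    refine ⟨Function.update U (f + 1) u', ?_, ?_, fun i hi => ?_⟩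
    · rwa [Function.update_of_ne (by omega)]
    · rw [Function.update_self]
      exact hall _ hu'
    · rcases Nat.lt_succ_iff_lt_or_eq.1 hi with hij | rfl
      · rw [Function.update_of_ne (by omega), Function.update_of_ne (by omega)]
        exact hr i hij
      · rw [Function.update_of_ne (by omega), Function.update_self]
        exact hu'

theorem chain_induction {α : Type*} {r : α → α → Prop} {L : ℕ → α → Prop} {f : ℕ}
    (h : ∀ i < f, ∀ u, L i u → ∀ u', r u u' → L (i + 1) u') {U : ℕ → α}
    (h0 : L 0 (U 0)) (hr : ∀ i < f, r (U i) (U (i + 1))) : L f (U f) := by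
  induction f with
  | zero => exact h0
  | succ f ih =>
    exact h f f.lt_succ_self _ (ih (fun i hi => h i (by omega)) fun i hi => hr i (by omega)) _
      (hr f f.lt_succ_self)

variable [PerfectRing k p] {hp : Odd p}

/-- The preimage of a finite point under the flow is finite, since infinity is fixed. -/
theorem exists_isZeroOf_of_flowStep {V V' : FilDR P (n + 1)} (hs : FlowStep hp V V')
    {b : WittVector p k} (hb : IsZeroOf P (n + 1) V'.theta b 1) :
    ∃ a, IsZeroOf P (n + 1) V.theta a 1 := by
  obtain ⟨x0, x1, -, w, hw, hθ⟩ := V.exists_zero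
  by_cases hx1 : x1.coeff 0 = 0
  · exfalso
    have e1 : P.redOne n V.theta = P.res (-(w.coeff 0 * x0.coeff 0)) := by
      rw [hθ, map_mul, map_sub, map_mul, redOne_const, redOne_const, redOne_const, const_one,
        const_one, const_one, hx1, map_zero, zero_mul, zero_sub, mul_neg, ← map_mul, ← map_neg]
    obtain ⟨_, _, _, _, g⟩ := isFlowStep_iff.1 hs
    have gp := g.modP
    rw [Conn.twist_modP, inverseCartier_modP, FilData.modP_toConn, e1] at gp
    have hV : V'.modP.toConn.Glues := by
      rw [← FilData.modP_toConn]
      exact V'.glues.modP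
    obtain ⟨v, hv⟩ := exists_theta_eq_res_of_gauge hV gp
    obtain ⟨w', hw', hθ'⟩ := isZeroOf_one_iff.1 hb
    have e2 : P.redOne n V'.theta = P.res v := hv
    rw [hθ', map_mul, map_sub, redOne_const, redOne_const, redOne_t, res_apply] at e2
    have h0 := coeff_zero_eq_of_dvd (k := k) (pow_one (p : WittVector p k) ▸
      (const_mul_t_sub_inj (P := P) (N := 1) (a := w') (b := w' * b) (a' := 0)
      (b' := - WittVector.teichmuller p v) (by
        rw [map_mul, map_zero, map_neg]; linear_combination e2)).1)
    exact (hw'.map (WittVector.constantCoeff : WittVector p k →+* k)).ne_zero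
      (h0.trans (WittVector.zero_coeff p k 0))
  · have hu := WittVector.isUnit_of_coeff_zero_ne_zero x1 hx1
    obtain ⟨v, hv⟩ := hu.exists_left_inv
    have hv2 := congrArg (P.const (n + 1)) hv
    rw [map_mul, map_one] at hv2
    refine ⟨v * x0, isZeroOf_one_iff.2 ⟨w * x1, hw.mul hu, ?_⟩⟩
    rw [hθ, map_mul, map_mul]
    linear_combination P.const (n + 1) w * P.const (n + 1) x0 * hv2

/-- The iterated flow on the lift with coordinate `x 0`, if for each `i` the `i`-th step sends every
lift with coordinate `x i` to lifts with coordinate `x (i + 1)`. -/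
theorem flowMap_iff_of_steps {f : ℕ} {V : ℕ → FilDR P (n + 1)} {a : ℕ → WittVector p k}
    (ha : IsZeroOf P (n + 1) (V 0).theta (a 0) 1) {x : ℕ → k}
    (hstep : ∀ i < f + 1, ∀ (V1 : FilDR P (n + 1)) (θ : P.R (n + 2)),
      V1.toConn.Isomorphic (V i).toConn → P.red (n + 1) θ = V1.theta →
      IsZeroOf P (n + 2) θ
        (a i + (p : WittVector p k) ^ (n + 1) * WittVector.teichmuller p (x i)) 1 →
      (∃ U, IsFlowStep hp V1.toFilData θ U) ∧
      ∀ U, IsFlowStep hp V1.toFilData θ U → U.toConn.red.Isomorphic (V (i + 1)).toConn ∧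
        IsZeroOf P (n + 2) U.theta (a (i + 1) + (p : WittVector p k) ^ (n + 1) *
          WittVector.teichmuller p (x (i + 1))) 1) (c : WittVector p k) :
    FlowMap hp (V 0) (f + 1)
        (a 0 + (p : WittVector p k) ^ (n + 1) * WittVector.teichmuller p (x 0)) c ↔
      (p : WittVector p k) ^ (n + 2) ∣ c - (a (f + 1) + (p : WittVector p k) ^ (n + 1) *
        WittVector.teichmuller p (x (f + 1))) := by
  let L : ℕ → FilDR P (n + 2) → Prop := fun i U => U.toConn.red.Isomorphic (V (i + 1)).toConn ∧
    IsZeroOf P (n + 2) U.theta (a (i + 1) + (p : WittVector p k) ^ (n + 1) *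
      WittVector.teichmuller p (x (i + 1))) 1
  have hL : ∀ i < f, ∀ U, L i U → (∃ U', FlowStep hp U U') ∧ ∀ U', FlowStep hp U U' →
      L (i + 1) U' := fun i hi U ⟨h1, h2⟩ =>
    hstep (i + 1) (by omega) (U.redOf h2) U.theta (U.redOf_isomorphic h2 h1) rfl h2
  constructor
  · rintro ⟨θ, U, hθ, hz, h0, hU, hc⟩
    have ht : L f (U f) := chain_induction (fun i hi U hLU => (hL i hi U hLU).2)
      ((hstep 0 f.succ_pos (V 0) θ (.refl _) hθ hz).2 _ h0) fun i hi => hU i (by omega)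
    exact hc.dvd_sub ht.2
  · intro hc
    obtain ⟨w, hw, hw2⟩ := isZeroOf_one_iff.1 ha
    obtain ⟨θ, hθ, hz⟩ : ∃ θ, P.red (n + 1) θ = (V 0).theta ∧ IsZeroOf P (n + 2) θ
        (a 0 + (p : WittVector p k) ^ (n + 1) * WittVector.teichmuller p (x 0)) 1 := by
      refine ⟨_, ?_, isZeroOf_one_iff.2 ⟨w, hw, rfl⟩⟩
      rw [map_mul, map_sub, red_const, red_const, red_t, hw2, const_eq_const_iff.2
        (⟨WittVector.teichmuller p (x 0), by ring⟩ : (p : WittVector p k) ^ (n + 1) ∣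
          (a 0 + (p : WittVector p k) ^ (n + 1) * WittVector.teichmuller p (x 0)) - a 0)]
    obtain ⟨⟨U0, h0⟩, hall⟩ := hstep 0 f.succ_pos (V 0) θ (.refl _) hθ hz
    obtain ⟨U, rfl, ht, hU⟩ := exists_chain hL (hall _ h0)
    exact ⟨θ, U, hθ, hz, h0, fun i hi => hU i (by omega), ht.2.of_dvd (by
      rw [← dvd_neg, neg_sub]; exact hc)⟩

/-- The iterated flow on lifts, along a sequence of steps of the flow through finite points. -/
theorem IsFamily.exists_flowMap_iff {m : ℕ} {U Q M : k[X][X]} {D N : k[X]}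
    (h : IsFamily hp P m U Q M D N) {f : ℕ} (hf : 0 < f) {V : ℕ → FilDR P (n + 1)}
    (hs : ∀ i < f, FlowStep hp (V i) (V (i + 1))) {a : ℕ → WittVector p k}
    (ha : ∀ i ≤ f, IsZeroOf P (n + 1) (V i).theta (a i) 1) :
    ∃ γ : k, ∀ (δ : k) (c : WittVector p k),
      FlowMap hp (V 0) f (a 0 + (p : WittVector p k) ^ (n + 1) * WittVector.teichmuller p δ) c ↔
        (p : WittVector p k) ^ (n + 2) ∣ c - (a f + (p : WittVector p k) ^ (n + 1) *
          WittVector.teichmuller p ((∏ i ∈ Finset.range f,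
            (((derivative N).eval ((a i).coeff 0 ^ p) * D.eval ((a i).coeff 0 ^ p)
            - N.eval ((a i).coeff 0 ^ p) * (derivative D).eval ((a i).coeff 0 ^ p))
            / D.eval ((a i).coeff 0 ^ p) ^ 2) ^ p ^ (f - 1 - i)) * δ ^ p ^ f + γ)) := by
  have hstep : ∀ i, ∃ γ : k, i < f → _ := fun i => by
    by_cases hi : i < f
    · obtain ⟨γ, hγ⟩ := (h.exists_step (hs i hi) (ha i hi.le) (ha (i + 1) hi)).2.2
      exact ⟨γ, fun _ => hγ⟩
    · exact ⟨0, fun h => absurd h hi⟩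
  choose γ hγ using hstep
  obtain ⟨Γ, hΓ⟩ := exists_affineIter_eq (p := p) (fun i =>
    ((derivative N).eval ((a i).coeff 0 ^ p) * D.eval ((a i).coeff 0 ^ p)
      - N.eval ((a i).coeff 0 ^ p) * (derivative D).eval ((a i).coeff 0 ^ p))
      / D.eval ((a i).coeff 0 ^ p) ^ 2) γ f
  refine ⟨Γ, fun δ c => ?_⟩
  rw [← hΓ]
  obtain ⟨f, rfl⟩ := Nat.exists_eq_succ_of_ne_zero hf.ne'
  exact flowMap_iff_of_steps (ha 0 hf.le) (x := affineIter p _ γ δ)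
    (fun i hi V1 θ => hγ i hi V1 θ _) c

end Chain

/-! ### Values of the rational function -/

theorem ratEval_eq_of_eq_mul {k : Type u} [Field k] {φ : RatFunc k} {N D e : k[X]}
    (hN : N = φ.num * e) (hD : D = φ.denom * e) {y : k} (hy : D.eval y ≠ 0) :
    ratEval φ y = N.eval y / D.eval y := by
  subst hN hD
  rw [eval_mul] at hy
  rw [ratEval, eval_mul, eval_mul, mul_div_mul_right _ _ (right_ne_zero_of_mul hy)]

theorem ratDerivEval_eq_of_eq_mul {k : Type u} [Field k] {φ : RatFunc k} {N D e : k[X]}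
    (hN : N = φ.num * e) (hD : D = φ.denom * e) {y : k} (hy : D.eval y ≠ 0) :
    ratDerivEval φ y = ((derivative N).eval y * D.eval y - N.eval y * (derivative D).eval y)
      / D.eval y ^ 2 := by
  subst hN hD
  rw [eval_mul] at hy
  have h1 := left_ne_zero_of_mul hy
  have h2 := right_ne_zero_of_mul hy
  rw [ratDerivEval, derivative_mul, derivative_mul]
  simp only [eval_mul, eval_add]
  field_simp
  ring

end HiggsDeRham

end

theorem mainTheorem12 {p : ℕ} [Fact p.Prime] {k : Type*} [Field k] [CharP k p] [PerfectRing k p]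
    (hp : Odd p) (P : Puncture p k) :
    (∃! φ : RatFunc k, IsFlowFunction hp P φ) ∧
    ∀ φ : RatFunc k, IsFlowFunction hp P φ →
      (∀ (n : ℕ) (V V' : FilDR P (n + 1)), FlowStep hp V V' →
        ∀ a b : WittVector p k,
          IsZeroOf P (n + 1) V.theta a 1 → IsZeroOf P (n + 1) V'.theta b 1 →
          ∃ γ : k, ∀ (δ : k) (c : WittVector p k),
            FlowMap hp V 1 (a + (p : WittVector p k) ^ (n + 1) * WittVector.teichmuller p δ) c ↔
              (p : WittVector p k) ^ (n + 2) ∣ c - (b + (p : WittVector p k) ^ (n + 1) *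
                WittVector.teichmuller p (ratDerivEval φ (a.coeff 0 ^ p) * δ ^ p + γ))) ∧
      (∀ (n f : ℕ), 0 < f → ∀ V : ℕ → FilDR P (n + 1),
        (∀ i < f, FlowStep hp (V i) (V (i + 1))) → (V f).Iso (V 0) →
        ∀ a : WittVector p k, IsZeroOf P (n + 1) (V 0).theta a 1 →
          ∃ γ : k, ∀ (δ : k) (c : WittVector p k),
            FlowMap hp (V 0) f
                (a + (p : WittVector p k) ^ (n + 1) * WittVector.teichmuller p δ) c ↔
              (p : WittVector p k) ^ (n + 2) ∣ c - (a + (p : WittVector p k) ^ (n + 1) *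
                WittVector.teichmuller p
                  ((∏ i ∈ Finset.range f,
                    ratDerivEval φ (((fun x => ratEval φ (x ^ p))^[i] (a.coeff 0)) ^ p)
                      ^ p ^ (f - 1 - i)) * δ ^ p ^ f + γ))) := by
  refine ⟨existsUnique_isFlowFunction hp P, fun φ hφ => ?_⟩
  obtain ⟨m, U, Q, M, D, N, h⟩ := exists_isFamily hp P
  obtain ⟨e, hN, hD⟩ := h.exists_eq_of_isFlowFunction hφ
  refine ⟨fun n V V' hs a b ha hb => ?_, fun n f hf V hs hiso a ha => ?_⟩
  · obtain ⟨γ, hγ⟩ := h.exists_flowMap_iff one_pos (V := fun i => if i = 0 then V else V')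
      (a := fun i => if i = 0 then a else b)
      (fun i hi => by obtain rfl := Nat.lt_one_iff.1 hi; exact hs)
      (fun i hi => by rcases Nat.le_one_iff_eq_zero_or_eq_one.1 hi with rfl | rfl <;> assumption)
    refine ⟨γ, fun δ c => (hγ δ c).trans ?_⟩
    rw [ratDerivEval_eq_of_eq_mul hN hD (h.exists_step hs ha hb).1]
    simp
  · have hlast : IsZeroOf P (n + 1) (V f).theta a 1 := ha.of_isomorphic hiso.isomorphic.symm
    have hex : ∀ i ≤ f, ∃ x, IsZeroOf P (n + 1) (V i).theta x 1 := fun i hi =>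
      Nat.decreasingInduction (motive := fun i _ => ∃ x, IsZeroOf P (n + 1) (V i).theta x 1)
        (fun i hi ⟨_, hx⟩ => exists_isZeroOf_of_flowStep (hs i hi) hx) ⟨a, hlast⟩ hi
    obtain ⟨A, hA, hA0, hAf⟩ : ∃ A : ℕ → WittVector p k,
        (∀ i ≤ f, IsZeroOf P (n + 1) (V i).theta (A i) 1) ∧ A 0 = a ∧ A f = a := by
      choose! A hA using hex
      refine ⟨fun i => if i = 0 ∨ i = f then a else A i, fun i hi => ?_, by simp, by simp⟩
      by_cases h0 : i = 0
      · subst h0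
        simpa using ha
      by_cases h1 : i = f
      · subst h1
        simpa using hlast
      · simpa [h0, h1] using hA i hi
    obtain ⟨γ, hγ⟩ := h.exists_flowMap_iff hf hs hA
    have hst := fun i (hi : i < f) => h.exists_step (hs i hi) (hA i hi.le) (hA (i + 1) hi)
    have hAi : ∀ i < f, (A i).coeff 0 = (fun x => ratEval φ (x ^ p))^[i] (a.coeff 0) := by
      intro i
      induction i with
      | zero => exact fun _ => by rw [hA0]; rfl
      | succ i ih =>
        intro hi
        obtain ⟨h1, h2, -⟩ := hst i (by omega)
        rw [Function.iterate_succ_apply', ← ih (by omega), h2, ratEval_eq_of_eq_mul hN hD h1]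
    rw [hA0, hAf] at hγ
    refine ⟨γ, fun δ c => (hγ δ c).trans ?_⟩
    rw [Finset.prod_congr rfl fun i hi => ?_]
    have hi' := Finset.mem_range.1 hi
    rw [← hAi i hi', ratDerivEval_eq_of_eq_mul hN hD (hst i hi').1]
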